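/- Consider the system $$\dot x=\epsilon\,(y-(\mu+1)z+F),\qquad \dot y=\epsilon\,(\tfrac12\mu+G),\qquad \dot z=x+z^2+zH ,$$ where $F,G,H$ are functions of $(x,y,z,\epsilon,\mu)$ near the origin, analytic in $(x,y,z)$ and smooth in $(\epsilon,\mu)$ (i.e. restrictions of functions that are jointly $C^\infty$, and holomorphic in $(x,y,z)$, on a complex polydisc in $(x,y,z)$ times a real neighbourhood in $(\epsilon,\mu)$), with $$F=\mathcal O(x,\epsilon,(|y|+|z|)^2),\quad G=\mathcal O(x,y,z,\epsilon),\quad H=\mathcal O(xz,xy,z^2,\epsilon),$$ and assume $\lambda:=\partial_yG(\mathbf 0)+\partial_zG(\mathbf 0)\neq0$. Put $x=r_2^2x_2$, $y=r_2y_2$, $z=r_2z_2$, $\epsilon=r_2^2$ and divide by $r_2$. This gives, with $F,G,H$ evaluated at $(r_2^2x_2,r_2y_2,r_2z_2,r_2^2,\mu)$, the scaling-chart system $$\dot x_2=y_2-(\mu+1)z_2+r_2^{-1}F,\qquad \dot y_2=\tfrac12\mu+G,\qquad \dot z_2=x_2+z_2^2+r_2^{-1}z_2H,\qquad(\ast)$$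 which extends smoothly to $r_2=0$. Set $\mu=r_2\mu_2$ and write $\dot y_2=r_2\,q(x_2,y_2,z_2,r_2,\mu_2)$ with $q$ smooth up to $r_2=0$. Then there are $\nu,\delta,R>0$ and a family of locally invariant slow manifolds $(x_2,z_2)=m(y_2,r_2,\mu_2)$ of $(\ast)$, for $|y_2|\le\nu$, $0\le r_2\le R$, $|\mu_2|\le\delta$, given by power series $m=\sum_n m_n(r_2,\mu_2)y_2^n$ that depend smoothly on $(r_2,\mu_2)$ in the norm $\sum_n|m_n|\nu^n$, with $m(y_2,0,\mu_2)=(-y_2^2,y_2)$, such that the following holds. In the coordinates $(x_2,z_2)=m(y_2,r_2,\mu_2)+u$ write $(\ast)$ as $\dot u=V(u,y_2,r_2,\mu_2)$, $\dot y_2=r_2\,Q(u,y_2,r_2,\mu_2)$, where $V(0,\cdot)=0$. For $h>0$ let $\phi_h=(x_{2h},z_{2h})$ be the periodic solution of $\dot x_2=-z_2$, $\dot z_2=x_2+z_2^2$ with $\phi_h(0)=(-h,0)$, and put $A_h(t)=\begin{pmatrix}0&-1\\1&2z_{2h}(t)\end{pmatrix}$. Let $(u,y_2)=(\phi_h+\tilde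 u,\tilde y_2)$ be the solution with $\tilde u(0)=0$, $\tilde y_2(0)=y_2$, let $T=T(h,y_2,r_2,\mu_2)$ be its first return time to $\{u_2=0,\ u_1<0\}$, and let $\psi_h$ solve $\dot\psi=-A_h^T\psi$, $\psi_h(T)=(1,0)$. Define $$\Delta_1=[x_{2h}(T)+h]+\int_0^T\psi_h\cdot\big\{V(\phi_h+\tilde u,\tilde y_2,r_2,\mu_2)-\dot\phi_h-A_h\tilde u\big\}\,dt,\qquad \Delta_2=\int_0^T Q(\phi_h+\tilde u,\tilde y_2,r_2,\mu_2)\,dt .$$ For every $h_1>0$ there are $\eta>0$ and $r_0\in(0,R]$ such that on $0<h\le h_1$, $|y_2|\le\eta$, $0\le r_2\le r_0$, $|\mu_2|\le\delta$ all these objects exist with $|\tilde y_2|<\nu$ on $[0,T]$, and $T$ and $\widehat\Delta:=(h^{-1}\Delta_1,\Delta_2)$ extend to $C^\infty$ functions on the closed box with $0\le h\le h_1$. There are $C^\infty$ functions $\overline y_2(h,r_2)\in[-\eta,\eta]$ and $\overline\mu_2(h,r_2)\in[-\delta,\delta]$ on $[0,h_1]\times[0,r_0]$ with $\overline y_2(h,0)=\overline\mu_2(h,0)=0$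 and $$\widehat\Delta\big(h,\overline y_2(h,r_2),r_2,\overline\mu_2(h,r_2)\big)=0\qquad\text{for all }(h,r_2)\in[0,h_1]\times[0,r_0].$$ Moreover, for all $r_2\in[0,r_0]$ and with $\mu=r_2\overline\mu_2(h,r_2)$: if $0<h\le h_1$, the solution of $(\ast)$ through $u=(-h,0)$, $y_2=\overline y_2(h,r_2)$ is a nonconstant periodic orbit with minimal period $T(h,\overline y_2,r_2,\overline\mu_2)$ contained in $\{|y_2|<\nu\}$; and if $h=0$, the point $u=0$, $y_2=\overline y_2(0,r_2)$ is an equilibrium of $(\ast)$. -/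

import Mathlib

open Set Filter Topology
open scoped ContDiff

noncomputable section

namespace FoldedSaddleNode

/-! ### The slow-fast system -/

/-- `f (x, y, z, ε, μ)` is, near the origin, analytic in the space variables `(x, y, z)` and smooth
in the parameters `(ε, μ)`: on a polydisc it is the restriction to real arguments of a function
that is jointly `C^∞` and holomorphic in the complexified space variables. -/
def AnalyticInSpace (f : ℝ → ℝ → ℝ → ℝ → ℝ → ℝ) : Prop :=
  ∃ ρ : ℝ, 0 < ρ ∧ ∃ fc : (ℂ × ℂ × ℂ) × (ℝ × ℝ) → ℂ,
    ContDiffOn ℝ ∞ fc (Metric.ball 0 ρ) ∧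
    (∀ p ∈ Metric.ball (0 : ℝ × ℝ) ρ,
      DifferentiableOn ℂ (fun w : ℂ × ℂ × ℂ => fc (w, p)) (Metric.ball 0 ρ)) ∧
    ∀ x y z ε μ : ℝ, |x| < ρ → |y| < ρ → |z| < ρ → |ε| < ρ → |μ| < ρ →
      fc (((x : ℂ), (y : ℂ), (z : ℂ)), (ε, μ)) = (f x y z ε μ : ℂ)

/-- `F = O(x, ε, (|y| + |z|)²)`. -/
def OrderF (F : ℝ → ℝ → ℝ → ℝ → ℝ → ℝ) : Prop :=
  (fun p : ℝ × ℝ × ℝ × ℝ × ℝ => F p.1 p.2.1 p.2.2.1 p.2.2.2.1 p.2.2.2.2)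
    =O[𝓝 0] (fun p => |p.1| + |p.2.2.2.1| + (|p.2.1| + |p.2.2.1|) ^ 2)

/-- `G = O(x, y, z, ε)`. -/
def OrderG (G : ℝ → ℝ → ℝ → ℝ → ℝ → ℝ) : Prop :=
  (fun p : ℝ × ℝ × ℝ × ℝ × ℝ => G p.1 p.2.1 p.2.2.1 p.2.2.2.1 p.2.2.2.2)
    =O[𝓝 0] (fun p => |p.1| + |p.2.1| + |p.2.2.1| + |p.2.2.2.1|)

/-- `H = O(xz, xy, z², ε)`. -/
def OrderH (H : ℝ → ℝ → ℝ → ℝ → ℝ → ℝ) : Prop :=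
  (fun p : ℝ × ℝ × ℝ × ℝ × ℝ => H p.1 p.2.1 p.2.2.1 p.2.2.2.1 p.2.2.2.2)
    =O[𝓝 0] (fun p => |p.1 * p.2.2.1| + |p.1 * p.2.1| + p.2.2.1 ^ 2 + |p.2.2.2.1|)

/-- `a₁ = ∂G/∂y (0)`. -/
def a₁ (G : ℝ → ℝ → ℝ → ℝ → ℝ → ℝ) : ℝ := deriv (fun s => G 0 s 0 0 0) 0

/-- `a₂ = ∂G/∂z (0)`. -/
def a₂ (G : ℝ → ℝ → ℝ → ℝ → ℝ → ℝ) : ℝ := deriv (fun s => G 0 0 s 0 0) 0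

/-- The vector field of the slow-fast system, in the variables `(x, y, z)`. -/
def fastField (F G H : ℝ → ℝ → ℝ → ℝ → ℝ → ℝ) (ε μ x y z : ℝ) : ℝ × ℝ × ℝ :=
  (ε * (y - (μ + 1) * z + F x y z ε μ),
   ε * (μ / 2 + G x y z ε μ),
   x + z ^ 2 + z * H x y z ε μ)

/-! ### The scaling chart `x = r² x₂, y = r y₂, z = r z₂, ε = r²` -/

/-- The vector field in the scaling chart, in the variables `(x₂, y₂, z₂)`, after division by `r`.
At `r = 0` the two terms with a quotient are `0`, which is the value of their smooth extension
because `F` and `H` are `O(r²)` along the chart. -/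
def chartField (F G H : ℝ → ℝ → ℝ → ℝ → ℝ → ℝ) (r μ x y z : ℝ) : ℝ × ℝ × ℝ :=
  (y - (μ + 1) * z + r * (F (r ^ 2 * x) (r * y) (r * z) (r ^ 2) μ / r ^ 2),
   μ / 2 + G (r ^ 2 * x) (r * y) (r * z) (r ^ 2) μ,
   x + z ^ 2 + r * z * (H (r ^ 2 * x) (r * y) (r * z) (r ^ 2) μ / r ^ 2))

/-- The chart field is the blown up slow-fast field, divided by `r`. -/
theorem fastField_eq_chartField (F G H : ℝ → ℝ → ℝ → ℝ → ℝ → ℝ) (r μ x y z : ℝ) (hr : r ≠ 0) :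
    fastField F G H (r ^ 2) μ (r ^ 2 * x) (r * y) (r * z) =
      (r ^ 2 * (r * (chartField F G H r μ x y z).1),
       r * (r * (chartField F G H r μ x y z).2.1),
       r * (r * (chartField F G H r μ x y z).2.2)) := by
  simp only [fastField, chartField, Prod.mk.injEq]
  refine ⟨?_, ?_, ?_⟩ <;> field_simp

/-- For `μ = r μ₂` the slow equation is `y₂' = r * slowRate`; this is the function
`μ₂ / 2 + λ y₂ + P₂`. The value at `r = 0` is the limit as `r → 0`. -/
def slowRate (G : ℝ → ℝ → ℝ → ℝ → ℝ → ℝ) (r μ₂ x y z : ℝ) : ℝ :=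
  μ₂ / 2 +
    if r = 0 then a₁ G * y + a₂ G * z
    else G (r ^ 2 * x) (r * y) (r * z) (r ^ 2) (r * μ₂) / r

/-! ### The slow manifold `(x₂, z₂) = m (y₂, r, μ₂)` -/

/-- The graph `(x₂, z₂) = m (y₂, r, μ₂)`, `|y₂| < ν`, `0 ≤ r ≤ R`, `|μ₂| ≤ δ`, is a family of slow
manifolds of the chart system with `μ = r μ₂`: it is a power series in `y₂`, absolutely convergent
on the closed disc of radius `ν` and depending smoothly on `(r, μ₂)` in the norm `∑ |mₙ| νⁿ`
(the `ℓ¹` sequence is `cₙ = mₙ νⁿ`), it is locally invariant, and for `r = 0` it is the critical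
manifold. -/
structure IsSlowManifold (F G H : ℝ → ℝ → ℝ → ℝ → ℝ → ℝ) (ν δ R : ℝ)
    (m : ℝ → ℝ → ℝ → ℝ × ℝ) : Prop where
  analytic : ∃ c : ℝ × ℝ → lp (fun _ : ℕ => ℝ × ℝ) 1,
    ContDiffOn ℝ ∞ c (Icc 0 R ×ˢ Icc (-δ) δ) ∧
    ∀ r ∈ Icc 0 R, ∀ μ₂ ∈ Icc (-δ) δ, ∀ y ∈ Icc (-ν) ν,
      HasSum (fun n => (y / ν) ^ n • (c (r, μ₂) : ℕ → ℝ × ℝ) n) (m y r μ₂)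
  invariant : ∀ r ∈ Icc 0 R, ∀ μ₂ ∈ Icc (-δ) δ, ∀ y ∈ Ioo (-ν) ν,
    let v := chartField F G H r (r * μ₂) (m y r μ₂).1 y (m y r μ₂).2
    (v.1, v.2.2) = v.2.1 • deriv (fun s => m s r μ₂) y
  critical : ∀ μ₂ ∈ Icc (-δ) δ, ∀ y ∈ Icc (-ν) ν, m y 0 μ₂ = (-y ^ 2, y)

/-- The `u`-component of the chart field (with `μ = r μ₂`) in the coordinates `(u, y₂)` where
`(x₂, z₂) = m (y₂, r, μ₂) + u`. -/
def straightField (F G H : ℝ → ℝ → ℝ → ℝ → ℝ → ℝ) (m : ℝ → ℝ → ℝ → ℝ × ℝ) (r μ₂ : ℝ)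
    (u : ℝ × ℝ) (y : ℝ) : ℝ × ℝ :=
  let p := m y r μ₂ + u
  let v := chartField F G H r (r * μ₂) p.1 y p.2
  (v.1, v.2.2) - v.2.1 • deriv (fun s => m s r μ₂) y

/-! ### The Melnikov functions -/

/-- The layer problem `x₂' = -z₂, z₂' = x₂ + z₂²` within `y₂ = 0`. -/
def layerField (u : ℝ × ℝ) : ℝ × ℝ := (-u.2, u.1 + u.2 ^ 2)

/-- `w ↦ A w` with `A = [[0, -1], [1, 2z]]`, the linearization of the layer problem. -/
def linA (z : ℝ) (w : ℝ × ℝ) : ℝ × ℝ := (-w.2, w.1 + 2 * z * w.2)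

/-- `ψ ↦ Aᵀ ψ`. -/
def linAT (z : ℝ) (ψ : ℝ × ℝ) : ℝ × ℝ := (ψ.2, -ψ.1 + 2 * z * ψ.2)

/-- The nonlinear remainder: with `u = φ + w`, where `φ` solves the layer problem, the equation for
`u` becomes `w' = A w + remainder`. -/
def remainder (F G H : ℝ → ℝ → ℝ → ℝ → ℝ → ℝ) (m : ℝ → ℝ → ℝ → ℝ × ℝ) (r μ₂ : ℝ)
    (φ w : ℝ × ℝ) (y : ℝ) : ℝ × ℝ :=
  straightField F G H m r μ₂ (φ + w) y - layerField φ - linA φ.2 w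

/-- The slow rate in the coordinates `(u, y₂)`. -/
def straightRate (G : ℝ → ℝ → ℝ → ℝ → ℝ → ℝ) (m : ℝ → ℝ → ℝ → ℝ × ℝ) (r μ₂ : ℝ)
    (u : ℝ × ℝ) (y : ℝ) : ℝ :=
  slowRate G r μ₂ (m y r μ₂ + u).1 y (m y r μ₂ + u).2

/-- The return orbit from `(u, y₂) = ((-h, 0), y)`, with the objects that enter the Melnikov
functions: `φ` is the layer solution through `(-h, 0)`, `(φ + w, Y)` the solution of the straightened
system, `T` its first return time to the section `{u₂ = 0, u₁ < 0}`, and `ψ` the solution of the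
adjoint system along `φ` with `ψ T = (1, 0)`. -/
structure IsReturnOrbit (F G H : ℝ → ℝ → ℝ → ℝ → ℝ → ℝ) (ν : ℝ) (m : ℝ → ℝ → ℝ → ℝ × ℝ)
    (h y r μ₂ T : ℝ) (φ w ψ : ℝ → ℝ × ℝ) (Y : ℝ → ℝ) : Prop where
  layer_init : φ 0 = (-h, 0)
  layer_ode : ∀ t, HasDerivAt φ (layerField (φ t)) t
  w_init : w 0 = 0
  w_ode : ∀ t ∈ Icc 0 T, HasDerivWithinAt w
    (linA (φ t).2 (w t) + remainder F G H m r μ₂ (φ t) (w t) (Y t)) (Icc 0 T) t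
  Y_init : Y 0 = y
  Y_ode : ∀ t ∈ Icc 0 T,
    HasDerivWithinAt Y (r * straightRate G m r μ₂ (φ t + w t) (Y t)) (Icc 0 T) t
  Y_mem : ∀ t ∈ Icc 0 T, Y t ∈ Ioo (-ν) ν
  T_pos : 0 < T
  return_mem : (φ T + w T).2 = 0 ∧ (φ T + w T).1 < 0
  return_first : ∀ t ∈ Ioo 0 T, ¬ ((φ t + w t).2 = 0 ∧ (φ t + w t).1 < 0)
  ψ_final : ψ T = (1, 0)
  ψ_ode : ∀ t ∈ Icc 0 T, HasDerivWithinAt ψ (-linAT (φ t).2 (ψ t)) (Icc 0 T) t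

/-- `T` is the return time and `(Δ₁, Δ₂)` the value of the Melnikov functions at
`(h, y, r, μ₂)`, `h > 0`. -/
def IsMelnikovValue (F G H : ℝ → ℝ → ℝ → ℝ → ℝ → ℝ) (ν : ℝ) (m : ℝ → ℝ → ℝ → ℝ × ℝ)
    (h y r μ₂ T Δ₁ Δ₂ : ℝ) : Prop :=
  ∃ (φ w ψ : ℝ → ℝ × ℝ) (Y : ℝ → ℝ), IsReturnOrbit F G H ν m h y r μ₂ T φ w ψ Y ∧
    Δ₁ = ((φ T).1 + h) +
      ∫ t in (0 : ℝ)..T,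
        ((ψ t).1 * (remainder F G H m r μ₂ (φ t) (w t) (Y t)).1 +
         (ψ t).2 * (remainder F G H m r μ₂ (φ t) (w t) (Y t)).2) ∧
    Δ₂ = ∫ t in (0 : ℝ)..T, straightRate G m r μ₂ (φ t + w t) (Y t)

/-- The box of `(h, y₂, r, μ₂)` with `0 ≤ h ≤ h₁`, `|y₂| ≤ η`, `0 ≤ r ≤ r₀`, `|μ₂| ≤ δ`. -/
def box (h₁ η r₀ δ : ℝ) : Set (ℝ × ℝ × ℝ × ℝ) :=
  Icc 0 h₁ ×ˢ Icc (-η) η ×ˢ Icc 0 r₀ ×ˢ Icc (-δ) δ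

/-- On the box, `T` is the return time and `D` the rescaled Melnikov function `(h⁻¹ Δ₁, Δ₂)`, both
extended smoothly (hence uniquely) to `h = 0`. -/
structure IsRescaledMelnikov (F G H : ℝ → ℝ → ℝ → ℝ → ℝ → ℝ) (ν : ℝ)
    (m : ℝ → ℝ → ℝ → ℝ × ℝ) (h₁ η r₀ δ : ℝ)
    (T : ℝ × ℝ × ℝ × ℝ → ℝ) (D : ℝ × ℝ × ℝ × ℝ → ℝ × ℝ) : Prop where
  smooth_T : ContDiffOn ℝ ∞ T (box h₁ η r₀ δ)
  smooth_D : ContDiffOn ℝ ∞ D (box h₁ η r₀ δ)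
  value : ∀ h y r μ₂, (h, y, r, μ₂) ∈ box h₁ η r₀ δ → 0 < h →
    ∃ Δ₁ Δ₂, IsMelnikovValue F G H ν m h y r μ₂ (T (h, y, r, μ₂)) Δ₁ Δ₂ ∧
      D (h, y, r, μ₂) = (h⁻¹ * Δ₁, Δ₂)

/-! ### Periodic orbits of the chart system -/

/-- `γ` is a (nonconstant) periodic solution of the chart system, with minimal period `T`. -/
structure IsPeriodicOrbit (F G H : ℝ → ℝ → ℝ → ℝ → ℝ → ℝ) (r μ T : ℝ)
    (γ : ℝ → ℝ × ℝ × ℝ) : Prop where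
  ode : ∀ t, HasDerivAt γ (chartField F G H r μ (γ t).1 (γ t).2.1 (γ t).2.2) t
  T_pos : 0 < T
  periodic : ∀ t, γ (t + T) = γ t
  minimal : ∀ t ∈ Ioo 0 T, γ t ≠ γ 0

end FoldedSaddleNode

end

/-!
The proof has two halves: the construction of the slow manifolds, and the continuation of the layer
orbits.

*Slow manifolds.* The implicit function theorem gives an equilibrium `(x*, y*, z*)` of the chart
system, with the slow equation divided by `r`, smooth in `p = (r, μ₂)`; here `λ ≠ 0` is used. With
`s = y - y*`, an invariant graph `x = x* + s a`, `z = z* + s (1 + b)` through the equilibrium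
satisfies `r s (a, b)' = Θ (s, a, b, p)` (`exists_rescaled_equation`), where `Θ` is holomorphic in the
space variables and smooth in `p`. After centring at a branch of zeros of `Θ (0, ·, p)`, this is a
Briot–Bouquet equation with a small parameter in front of the derivative. Its formal solution is given
by the recursion `(r n - B(p)) vₙ = RHSₙ`. For `p = 0` the linear part `B` is `1/λ` times a rotation,
so `r n - B(p)` is invertible uniformly in `n` for all small `p` including `r = 0`: there are no small
divisors. Each derivative in `p` of the inverse costs a factor `n`, and the norms `seriesNorm`, which
weight derivatives of the `n`-th coefficient by powers of `1 / (n + 1)`, absorb this loss and stay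
submultiplicative. A majorant argument then bounds the coefficients with a radius that is the same for
derivatives of all orders (`exists_bounds_solCoeff`), so that the solution is smooth in `p` as a
convergent series (`exists_singular_solution`, `exists_slowManifold`).

*Continuation.* In the coordinates `u = h v`, `y₂ = y + r q`, the straightened system extends smoothly
to `h = 0`, because `u = 0` is invariant (`exists_scaledField`). The orbits from `v = (-1, 0)`, `q = 0`
to their first return to `v₂ = 0`, `v₁ < 0` depend smoothly on `(h, y, r, μ₂)`: a return orbit, with its
time rescaled to the unit interval, is a zero of a map on a space of continuous functions, whose
linearization is a Volterra operator bordered by the transversality condition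
(`exists_smooth_return`). By variation of constants along the adjoint solution, the integral in `Δ₁`
is the first component of the deviation from the layer orbit, so the rescaled Melnikov function
`(h⁻¹ Δ₁, Δ₂)` is the displacement `(v₁ + 1, q)` at the return
(`IsScaledSystem.isMelnikovValue`).

At `r = 0`, `y = 0` the `v`-system is the scaled layer problem, which has a first integral and is
reversible, so its orbit through `(-1, 0)` is periodic (`exists_layer_orbit`), and the displacement is
`(0, μ₂ T / 2)`. At `r = 0` and general `y` the first integral grows by `4 y ∫ v₂² exp (2 h v₁)`. Hence
the derivative of the displacement with respect to `(y, μ₂)` is triangular and invertible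
(`displacement_derivatives`), and the implicit function theorem, applied along the compact interval
`0 ≤ h ≤ h₁`, gives the curve of zeros (`exists_zero_curve`). A zero with `h > 0` is a periodic orbit.
For `h = 0` the variable `q` satisfies a scalar autonomous equation; as it returns to its initial value
it is constant, and the point is an equilibrium.
-/

noncomputable section

namespace FoldedSaddleNode

set_option linter.unusedSectionVars false

/-! ### Superposition operators on spaces of continuous functions -/

section Superposition

variable {K : Type} [TopologicalSpace K] [CompactSpace K]
variable {A F : Type} [NormedAddCommGroup A] [NormedSpace ℝ A]
  [NormedAddCommGroup F] [NormedSpace ℝ F]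

open Classical in
/-- The superposition (Nemytskii) operator `θ ↦ Γ ∘ θ` on continuous functions, with value `0`
where `Γ ∘ θ` is not continuous. -/
def superpos (Γ : A → F) (θ : C(K, A)) : C(K, F) :=
  if h : Continuous (Γ ∘ θ) then ⟨Γ ∘ θ, h⟩ else 0

/-- The continuous functions with values in `O`. -/
def mapsInto (K : Type) [TopologicalSpace K] (O : Set A) : Set C(K, A) := {θ | ∀ k, θ k ∈ O}

theorem isOpen_mapsInto {O : Set A} (hO : IsOpen O) : IsOpen (mapsInto K O) := by
  have := ContinuousMap.isOpen_setOfPred_mapsTo (X := K) (Y := A) isCompact_univ hO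
  simpa [mapsInto, MapsTo] using this

theorem superpos_apply {Γ : A → F} {O : Set A} (hΓ : ContinuousOn Γ O)
    {θ : C(K, A)} (hθ : θ ∈ mapsInto K O) (k : K) : superpos Γ θ k = Γ (θ k) := by
  have : Continuous (Γ ∘ θ) := hΓ.comp_continuous θ.continuous hθ
  simp [superpos, this]

/-- Pointwise application of a continuous family of operators to a continuous family of
vectors. -/
def applyCLM (K A F : Type) [TopologicalSpace K] [CompactSpace K]
    [NormedAddCommGroup A] [NormedSpace ℝ A] [NormedAddCommGroup F] [NormedSpace ℝ F] :
    C(K, A →L[ℝ] F) →L[ℝ] C(K, A) →L[ℝ] C(K, F) :=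
  LinearMap.mkContinuous₂
    (LinearMap.mk₂ ℝ (fun (L : C(K, A →L[ℝ] F)) (η : C(K, A)) =>
      (⟨fun k => L k (η k), L.continuous.clm_apply η.continuous⟩ : C(K, F)))
      (by intros; ext; simp) (by intros; ext; simp) (by intros; ext; simp) (by intros; ext; simp))
    1 (by
      intro L η
      rw [one_mul, ContinuousMap.norm_le _ (by positivity)]
      intro k
      exact ((L k).le_opNorm _).trans
        (mul_le_mul (L.norm_coe_le_norm k) (η.norm_coe_le_norm k) (by positivity) (by positivity)))

@[simp] theorem applyCLM_apply (L : C(K, A →L[ℝ] F)) (η : C(K, A)) (k : K) :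
    applyCLM K A F L η k = L k (η k) := rfl

theorem continuousOn_superpos {Γ : A → F} {O : Set A} (hΓ : ContinuousOn Γ O) :
    ContinuousOn (superpos Γ) (mapsInto K O) := by
  rw [continuousOn_iff_continuous_domRestrict]
  refine ContinuousMap.continuous_of_continuous_uncurry _ ?_
  have hev : Continuous fun q : mapsInto K O × K => (q.1 : C(K, A)) q.2 :=
    (ContinuousEval.continuous_eval (F := C(K, A))).comp
      ((continuous_subtype_val.comp continuous_fst).prodMk continuous_snd)
  refine (hΓ.comp_continuous hev fun q => q.1.2 q.2).congr fun q => ?_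
  exact (superpos_apply hΓ q.1.2 q.2).symm

/-- The derivative of `θ ↦ Γ ∘ θ` is pointwise multiplication by `Γ' ∘ θ`; the remainder is uniform
because the range of `θ` is compact. -/
theorem hasFDerivAt_superpos {Γ : A → F} {O : Set A} (hO : IsOpen O) (hΓ : ContDiffOn ℝ 1 Γ O)
    {θ : C(K, A)} (hθ : θ ∈ mapsInto K O) :
    HasFDerivAt (superpos Γ) (applyCLM K A F (superpos (fderiv ℝ Γ) θ)) θ := by
  have hd : ContinuousOn (fderiv ℝ Γ) O := hΓ.continuousOn_fderiv_of_isOpen hO le_rfl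
  rw [hasFDerivAt_iff_isLittleO_nhds_zero, Asymptotics.isLittleO_iff]
  intro ε hε
  -- near the compact range of `θ` the derivative of `Γ` oscillates by at most `ε`
  have hcont := (continuousOn_superpos (K := K) hd).continuousAt
    ((isOpen_mapsInto (K := K) hO).mem_nhds hθ)
  obtain ⟨δ₁, hδ₁, h₁⟩ := Metric.continuousAt_iff.1 hcont ε hε
  obtain ⟨δ₂, hδ₂, h₂⟩ := Metric.isOpen_iff.1 (isOpen_mapsInto (K := K) hO) θ hθ
  filter_upwards [Metric.ball_mem_nhds (0 : C(K, A)) (lt_min hδ₁ hδ₂)] with η hη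
  have hη' : ‖η‖ < min δ₁ δ₂ := by simpa using hη
  have hmem : ∀ s ∈ Icc (0 : ℝ) 1, θ + s • η ∈ Metric.ball θ (min δ₁ δ₂) := by
    intro s hs
    rw [mem_ball_iff_norm, add_sub_cancel_left, norm_smul, Real.norm_of_nonneg hs.1]
    nlinarith [norm_nonneg η, hs.1, hs.2]
  have hO' : ∀ s ∈ Icc (0 : ℝ) 1, θ + s • η ∈ mapsInto K O := fun s hs =>
    h₂ (Metric.ball_subset_ball (min_le_right _ _) (hmem s hs))
  have h1mem : θ + η ∈ mapsInto K O := by simpa using hO' 1 (by simp)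
  rw [ContinuousMap.norm_le _ (by positivity)]
  intro k
  rw [ContinuousMap.sub_apply, ContinuousMap.sub_apply, superpos_apply hΓ.continuousOn h1mem,
    superpos_apply hΓ.continuousOn hθ, applyCLM_apply, superpos_apply hd hθ]
  have key := Convex.norm_image_sub_le_of_norm_hasFDerivWithin_le' (𝕜 := ℝ)
    (f := Γ) (f' := fderiv ℝ Γ) (φ := fderiv ℝ Γ (θ k)) (C := ε)
    (s := segment ℝ (θ k) (θ k + η k)) (x := θ k) (y := θ k + η k) ?_ ?_ (convex_segment _ _)
    (left_mem_segment _ _ _) (right_mem_segment _ _ _)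
  · rw [add_sub_cancel_left] at key
    refine key.trans ?_
    gcongr
    exact η.norm_coe_le_norm k
  · intro x hx
    obtain ⟨s, hs, rfl⟩ := (segment_eq_image' ℝ (θ k) (θ k + η k)).subset hx
    rw [add_sub_cancel_left]
    have : θ k + s • η k ∈ O := by simpa using hO' s hs k
    exact ((hΓ.differentiableOn (by simp)).differentiableAt
      (hO.mem_nhds this)).hasFDerivAt.hasFDerivWithinAt
  · intro x hx
    obtain ⟨s, hs, rfl⟩ := (segment_eq_image' ℝ (θ k) (θ k + η k)).subset hx
    rw [add_sub_cancel_left]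
    have h := h₁ (Metric.ball_subset_ball (min_le_left _ _) (hmem s hs))
    rw [ContinuousMap.dist_lt_iff hε] at h
    have h' := h k
    rw [superpos_apply hd hθ, superpos_apply hd (hO' s hs), dist_eq_norm] at h'
    exact h'.le

theorem contDiffOn_superpos_nat {O : Set A} (hO : IsOpen O) (n : ℕ) :
    ∀ {F : Type} [NormedAddCommGroup F] [NormedSpace ℝ F] {Γ : A → F},
    ContDiffOn ℝ n Γ O → ContDiffOn ℝ n (superpos Γ) (mapsInto K O) := by
  induction n with
  | zero =>
    intro F _ _ Γ h
    simp only [CharP.cast_eq_zero, contDiffOn_zero] at h ⊢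
    exact continuousOn_superpos h
  | succ n ih =>
    intro F _ _ Γ h
    have h1 : ContDiffOn ℝ 1 Γ O := h.of_le (by norm_cast; omega)
    have hopen := isOpen_mapsInto (K := K) hO
    rw [Nat.cast_add, Nat.cast_one, contDiffOn_succ_iff_fderiv_of_isOpen hopen]
    refine ⟨fun θ hθ => (hasFDerivAt_superpos hO h1 hθ).differentiableAt.differentiableWithinAt,
      by simp, ?_⟩
    rw [Nat.cast_add, Nat.cast_one, contDiffOn_succ_iff_fderiv_of_isOpen hO] at h
    refine ((applyCLM K A F).contDiff.comp_contDiffOn (ih h.2.2)).congr ?_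
    intro θ hθ
    exact (hasFDerivAt_superpos hO h1 hθ).fderiv

/-- Superposition with a smooth function is smooth. Smooth dependence on parameters of integrals,
Taylor coefficients and solutions of differential equations is derived from this. -/
theorem contDiffOn_superpos {O : Set A} (hO : IsOpen O) {Γ : A → F} (h : ContDiffOn ℝ ∞ Γ O) :
    ContDiffOn ℝ ∞ (superpos Γ) (mapsInto K O) :=
  contDiffOn_infty.2 fun n => contDiffOn_superpos_nat hO n (contDiffOn_infty.1 h n)

variable {E : Type} [NormedAddCommGroup E] [NormedSpace ℝ E]

/-- The affine map sending `x` to the continuous function `k ↦ (θ k, x)`. -/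
def pairConst (θ : C(K, A)) (x : E) : C(K, A × E) := θ.prodMk (ContinuousMap.const K x)

theorem contDiff_pairConst (θ : C(K, A)) : ContDiff ℝ ∞ (pairConst (E := E) θ) := by
  let L : E →L[ℝ] C(K, A × E) := LinearMap.mkContinuous
    { toFun := fun x => pairConst (0 : C(K, A)) x
      map_add' := by intros; ext <;> simp [pairConst]
      map_smul' := by intros; ext <;> simp [pairConst] } 1 (by
      intro x
      rw [one_mul, ContinuousMap.norm_le _ (norm_nonneg _)]
      intro k
      simp [pairConst, Prod.norm_def])
  have : pairConst (E := E) θ = fun x => pairConst θ 0 + L x := by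
    ext x k <;> simp [pairConst, L]
  rw [this]
  exact contDiff_const.add L.contDiff

/-- The continuous function `k ↦ Γ (θ k, x)`, as a function of the parameter `x`. -/
def paramFun (Γ : A × E → F) (θ : C(K, A)) (x : E) : C(K, F) := superpos Γ (pairConst θ x)

variable {O : Set (A × E)} {Γ : A × E → F} {θ : C(K, A)} {U : Set E}

theorem paramFun_apply (hΓ : ContinuousOn Γ O) {x : E} (hx : ∀ k, (θ k, x) ∈ O) (k : K) :
    paramFun Γ θ x k = Γ (θ k, x) :=
  superpos_apply hΓ (θ := pairConst θ x) hx k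

theorem contDiffOn_paramFun (hO : IsOpen O) (hΓ : ContDiffOn ℝ ∞ Γ O)
    (hU : ∀ x ∈ U, ∀ k, (θ k, x) ∈ O) : ContDiffOn ℝ ∞ (paramFun Γ θ) U := by
  have h1 : ContDiffOn ℝ ∞ (superpos (K := K) Γ) (mapsInto K O) := contDiffOn_superpos hO hΓ
  have h2 : ContDiffOn ℝ ∞ (pairConst (E := E) θ) U := (contDiff_pairConst θ).contDiffOn
  exact h1.comp h2 fun x hx k => hU x hx k

theorem fderiv_paramFun_apply (hO : IsOpen O) (hΓ : ContDiffOn ℝ ∞ Γ O) {x : E}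
    (hx : ∀ k, (θ k, x) ∈ O) (e : E) (k : K) :
    fderiv ℝ (paramFun Γ θ) x e k = fderiv ℝ Γ (θ k, x) (0, e) := by
  have hopen : {x : E | ∀ k, (θ k, x) ∈ O} ∈ 𝓝 x := by
    have h1 : ContinuousAt (pairConst (E := E) θ) x := 
      (contDiff_pairConst (E := E) θ).continuous.continuousAt
    exact h1.preimage_mem_nhds ((isOpen_mapsInto (K := K) hO).mem_nhds
      (show pairConst θ x ∈ mapsInto K O from fun k => hx k))
  have hd : DifferentiableAt ℝ (paramFun Γ θ) x :=
    ((contDiffOn_paramFun (U := {x : E | ∀ k, (θ k, x) ∈ O}) hO hΓ fun _ h => h).contDiffAt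
      hopen).differentiableAt (by simp)
  have h1 : HasFDerivAt (fun y => paramFun Γ θ y k)
      ((ContinuousMap.evalCLM ℝ k).comp (fderiv ℝ (paramFun Γ θ) x)) x :=
    ((ContinuousMap.evalCLM ℝ k : C(K, F) →L[ℝ] F).hasFDerivAt (x := paramFun Γ θ x)).comp x
      hd.hasFDerivAt
  have h2 : HasFDerivAt (fun y => Γ (θ k, y))
      ((fderiv ℝ Γ (θ k, x)).comp (ContinuousLinearMap.inr ℝ A E)) x :=
    (((hΓ.contDiffAt (hO.mem_nhds (hx k))).differentiableAt (by simp)).hasFDerivAt).comp x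
      (hasFDerivAt_prodMk_right (θ k) x)
  have h3 : (fun y => paramFun Γ θ y k) =ᶠ[𝓝 x] fun y => Γ (θ k, y) := by
    filter_upwards [hopen] with y hy using paramFun_apply hΓ.continuousOn hy k
  have := (h1.congr_of_eventuallyEq h3.symm).unique h2
  simpa using congrArg (fun L : E →L[ℝ] F => L e) this

end Superposition

/-! ### Parametric integrals and division by a variable -/

section Integrals

variable {E F : Type} [NormedAddCommGroup E] [NormedSpace ℝ E]
  [NormedAddCommGroup F] [NormedSpace ℝ F]

/-- The unit interval. -/
abbrev UI : Type := Icc (0 : ℝ) 1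

/-- The extension of a continuous function on `[0, 1]` to the line, constant on either side. -/
def ext01 (η : C(UI, F)) (σ : ℝ) : F := η (projIcc 0 1 zero_le_one σ)

theorem continuous_ext01 (η : C(UI, F)) : Continuous (ext01 η) :=
  η.continuous.comp continuous_projIcc

theorem ext01_of_mem (η : C(UI, F)) {σ : ℝ} (hσ : σ ∈ Icc (0 : ℝ) 1) : ext01 η σ = η ⟨σ, hσ⟩ := by
  rw [ext01, projIcc_of_mem]

theorem norm_ext01_le (η : C(UI, F)) (σ : ℝ) : ‖ext01 η σ‖ ≤ ‖η‖ := η.norm_coe_le_norm _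

/-- The mean value over the unit interval, as a continuous linear map. -/
def meanCLM (F : Type) [NormedAddCommGroup F] [NormedSpace ℝ F] : C(UI, F) →L[ℝ] F :=
  LinearMap.mkContinuous
    { toFun := fun η => ∫ σ in (0 : ℝ)..1, ext01 η σ
      map_add' := fun η η' => by
        rw [← intervalIntegral.integral_add ((continuous_ext01 η).intervalIntegrable _ _)
          ((continuous_ext01 η').intervalIntegrable _ _)]
        rfl
      map_smul' := fun c η => by
        rw [RingHom.id_apply, ← intervalIntegral.integral_smul]
        rfl } 1 (fun η => by
      have := intervalIntegral.norm_integral_le_of_norm_le_const (a := 0) (b := 1)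
        (f := ext01 η) (C := ‖η‖) fun σ _ => norm_ext01_le η σ
      simpa using this)

theorem meanCLM_apply (η : C(UI, F)) : meanCLM F η = ∫ σ in (0 : ℝ)..1, ext01 η σ := rfl

theorem norm_meanCLM_le : ‖meanCLM F‖ ≤ 1 := LinearMap.mkContinuous_norm_le _ zero_le_one _

theorem meanCLM_eq (η : C(UI, F)) (f : ℝ → F) (h : ∀ k : UI, η k = f k) :
    meanCLM F η = ∫ σ in (0 : ℝ)..1, f σ := by
  rw [meanCLM_apply]
  refine intervalIntegral.integral_congr fun σ hσ => ?_
  rw [uIcc_of_le zero_le_one] at hσ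
  rw [ext01_of_mem η hσ, h]

/-- The inclusion of the unit interval in the line. -/
def inclUI : C(UI, ℝ) := ⟨Subtype.val, continuous_subtype_val⟩

variable {𝕜 : Type} [RCLike 𝕜]

/-- The quotient of `g (s, q) - g (0, q)` by `s`, smooth also at `s = 0`. -/
def hadamardQuot (g : 𝕜 × E → F) (x : 𝕜 × E) : F :=
  meanCLM F (paramFun (fun y : ℝ × 𝕜 × E => fderiv ℝ g (y.1 • y.2.1, y.2.2) (1, 0)) inclUI x)

variable {O : Set (𝕜 × E)} {g : 𝕜 × E → F}

theorem contDiffOn_hadamardQuot_aux (hO : IsOpen O) (hg : ContDiffOn ℝ ∞ g O) :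
    IsOpen {y : ℝ × 𝕜 × E | (y.1 • y.2.1, y.2.2) ∈ O} ∧
    ContDiffOn ℝ ∞ (fun y : ℝ × 𝕜 × E => fderiv ℝ g (y.1 • y.2.1, y.2.2) (1, 0))
      {y : ℝ × 𝕜 × E | (y.1 • y.2.1, y.2.2) ∈ O} := by
  have hs : ContDiff ℝ ∞ (fun y : ℝ × 𝕜 × E => (y.1 • y.2.1, y.2.2)) := by fun_prop
  refine ⟨hO.preimage hs.continuous, ?_⟩
  have h1 : ContDiffOn ℝ ∞ (fderiv ℝ g) O := hg.fderiv_of_isOpen hO (by simp)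
  exact (h1.comp hs.contDiffOn fun y hy => hy).clm_apply contDiffOn_const

/-- The quotient is smooth up to the zero set of the variable, since it is an integral that depends
smoothly on parameters. -/
theorem contDiffOn_hadamardQuot (hO : IsOpen O) (hg : ContDiffOn ℝ ∞ g O)
    (hstar : ∀ x ∈ O, ∀ σ ∈ Icc (0 : ℝ) 1, (σ • x.1, x.2) ∈ O) :
    ContDiffOn ℝ ∞ (hadamardQuot g) O := by
  obtain ⟨h1, h2⟩ := contDiffOn_hadamardQuot_aux hO hg
  exact (meanCLM F).contDiff.comp_contDiffOn
    (contDiffOn_paramFun (θ := inclUI) h1 h2 fun x hx k => hstar x hx k k.2)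

theorem hadamardQuot_eq (hO : IsOpen O) (hg : ContDiffOn ℝ ∞ g O)
    (hstar : ∀ x ∈ O, ∀ σ ∈ Icc (0 : ℝ) 1, (σ • x.1, x.2) ∈ O) {x : 𝕜 × E} (hx : x ∈ O) :
    hadamardQuot g x = ∫ σ in (0 : ℝ)..1, fderiv ℝ g (σ • x.1, x.2) (1, 0) := by
  obtain ⟨h1, h2⟩ := contDiffOn_hadamardQuot_aux hO hg
  exact meanCLM_eq _ (fun σ : ℝ => fderiv ℝ g (σ • x.1, x.2) (1, 0)) fun k =>
    paramFun_apply (θ := inclUI) h2.continuousOn (fun k => hstar x hx k k.2) k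

theorem hadamardQuot_zero (hO : IsOpen O) (hg : ContDiffOn ℝ ∞ g O)
    (hstar : ∀ x ∈ O, ∀ σ ∈ Icc (0 : ℝ) 1, (σ • x.1, x.2) ∈ O) {q : E} (hx : (0, q) ∈ O) 
    [CompleteSpace F] : hadamardQuot g (0, q) = fderiv ℝ g (0, q) (1, 0) := by
  rw [hadamardQuot_eq hO hg hstar hx]
  simp

/-- For a complex variable the hypothesis `hlin` is the Cauchy–Riemann equation. -/
theorem smul_hadamardQuot [NormedSpace 𝕜 F] [CompleteSpace F]
    (hO : IsOpen O) (hg : ContDiffOn ℝ ∞ g O)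
    (hstar : ∀ x ∈ O, ∀ σ ∈ Icc (0 : ℝ) 1, (σ • x.1, x.2) ∈ O)
    (hlin : ∀ x ∈ O, ∀ s : 𝕜, fderiv ℝ g x (s, 0) = s • fderiv ℝ g x (1, 0))
    {x : 𝕜 × E} (hx : x ∈ O) : x.1 • hadamardQuot g x = g x - g (0, x.2) := by
  obtain ⟨h1, h2⟩ := contDiffOn_hadamardQuot_aux hO hg
  rw [hadamardQuot_eq hO hg hstar hx, ← intervalIntegral.integral_smul]
  have hderiv : ∀ σ ∈ uIcc (0 : ℝ) 1, HasDerivAt (fun σ : ℝ => g (σ • x.1, x.2))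
      (x.1 • fderiv ℝ g (σ • x.1, x.2) (1, 0)) σ := by
    intro σ hσ
    rw [uIcc_of_le zero_le_one] at hσ
    have hm := hstar x hx σ hσ
    have hd := ((hg.contDiffAt (hO.mem_nhds hm)).differentiableAt (by simp)).hasFDerivAt
    have hc : HasDerivAt (fun σ : ℝ => (σ • x.1, x.2)) (x.1, 0) σ := by
      simpa using ((hasDerivAt_id σ).smul_const x.1).prodMk (hasDerivAt_const σ x.2)
    rw [← hlin _ hm]
    exact hd.comp_hasDerivAt σ hc
  have hcont : ContinuousOn (fun σ : ℝ => x.1 • fderiv ℝ g (σ • x.1, x.2) (1, 0))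
      (uIcc 0 1) := by
    rw [uIcc_of_le zero_le_one]
    refine ContinuousOn.const_smul ?_ x.1
    refine h2.continuousOn.comp (f := fun σ : ℝ => (σ, x)) (by fun_prop) ?_
    intro σ hσ
    exact hstar x hx σ hσ
  have := intervalIntegral.integral_eq_sub_of_hasDerivAt hderiv hcont.intervalIntegrable
  simpa using this

end Integrals

/-! ### Implicit functions -/

section Implicit

variable {X Y Z : Type} [NormedAddCommGroup X] [NormedSpace ℝ X] [CompleteSpace X]
  [NormedAddCommGroup Y] [NormedSpace ℝ Y] [CompleteSpace Y]
  [NormedAddCommGroup Z] [NormedSpace ℝ Z] [CompleteSpace Z]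

/-- The implicit function theorem in the class `C^∞`: the implicit function is `C^∞` on a
neighborhood (being `C^∞` at the base point only would be weaker), and it captures all solutions
near the base point. -/
theorem exists_smooth_implicitFunction {f : X × Y → Z} {O : Set (X × Y)} (hO : IsOpen O)
    (hf : ContDiffOn ℝ ∞ f O) {x₀ : X} {y₀ : Y} (hu : (x₀, y₀) ∈ O) (h0 : f (x₀, y₀) = 0)
    (hinv : (fderiv ℝ f (x₀, y₀) ∘L .inr ℝ X Y).IsInvertible) :
    ∃ ψ : X → Y, ψ x₀ = y₀ ∧ (∀ᶠ x in 𝓝 x₀, ContDiffAt ℝ ∞ ψ x) ∧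
      (∀ᶠ x in 𝓝 x₀, (x, ψ x) ∈ O ∧ f (x, ψ x) = 0) ∧
      ∀ᶠ v in 𝓝 (x₀, y₀), f v = 0 ↔ ψ v.1 = v.2 := by
  have cd : ∀ u ∈ O, ContDiffAt ℝ ∞ f u := fun u hu => hf.contDiffAt (hO.mem_nhds hu)
  have hne : (∞ : WithTop ℕ∞) ≠ 0 := by simp
  set ψ := (cd _ hu).implicitFunction hne hinv with hψ
  have hψ0 : ψ x₀ = y₀ := (cd _ hu).implicitFunction_apply_self hne hinv
  have hsm : ContDiffAt ℝ ∞ ψ x₀ := (cd _ hu).contDiffAt_implicitFunction hne hinv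
  have hev : ∀ᶠ v in 𝓝 (x₀, y₀), f v = 0 ↔ ψ v.1 = v.2 := by
    have := (cd _ hu).eventually_apply_eq_iff_implicitFunction hne hinv
    rw [h0] at this
    exact this
  have hsol : ∀ᶠ x in 𝓝 x₀, f (x, ψ x) = 0 := by
    have := (cd _ hu).eventually_apply_implicitFunction hne hinv
    rw [h0] at this
    exact this
  have hcont : Tendsto (fun x => (x, ψ x)) (𝓝 x₀) (𝓝 (x₀, y₀)) := by
    have : ContinuousAt (fun x => (x, ψ x)) x₀ := continuousAt_id.prodMk hsm.continuousAt
    rw [ContinuousAt, hψ0] at this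
    exact this
  have hc1 : ∀ᶠ x in 𝓝 x₀, ContinuousAt ψ x := by
    have := (hsm.of_le (m := 1) (by simp)).eventually (by simp)
    exact this.mono fun x hx => hx.continuousAt
  -- invertibility of the partial derivative is an open condition
  have hinv' : ∀ᶠ u in 𝓝 (x₀, y₀), (fderiv ℝ f u ∘L .inr ℝ X Y).IsInvertible := by
    have hdc : ContinuousAt (fun u => fderiv ℝ f u ∘L .inr ℝ X Y) (x₀, y₀) := by
      have : ContinuousAt (fderiv ℝ f) (x₀, y₀) :=
        ((hf.continuousOn_fderiv_of_isOpen hO (by simp)).continuousAt (hO.mem_nhds hu))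
      exact this.clm_comp continuousAt_const
    obtain ⟨e, he⟩ := hinv
    have := hdc.preimage_mem_nhds (he ▸ ContinuousLinearEquiv.nhds e)
    filter_upwards [this] with u hu
    obtain ⟨e', he'⟩ := hu
    exact ⟨e', he'⟩
  refine ⟨ψ, hψ0, ?_, (hcont.eventually (hO.mem_nhds hu)).and hsol, hev⟩
  filter_upwards [hcont.eventually (hev.eventually_nhds.and hinv'),
    hcont.eventually (hO.mem_nhds hu), hsol, hc1] with x hx hxO hx0 hxc
  -- at a nearby solution, the implicit function based there agrees with `ψ`
  obtain ⟨hx1, hx2⟩ := hx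
  have hs := (cd _ hxO).contDiffAt_implicitFunction hne hx2
  refine hs.congr_of_eventuallyEq ?_
  have hself := (cd _ hxO).implicitFunction_apply_self hne hx2
  have hsol' := (cd _ hxO).eventually_apply_implicitFunction hne hx2
  rw [hx0] at hsol'
  have hcont' : Tendsto (fun x' => (x', (cd _ hxO).implicitFunction hne hx2 x')) (𝓝 x)
      (𝓝 (x, ψ x)) := by
    have : ContinuousAt (fun x' => (x', (cd _ hxO).implicitFunction hne hx2 x')) x :=
      continuousAt_id.prodMk hs.continuousAt
    rw [ContinuousAt, hself] at this
    exact this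
  filter_upwards [hsol', hcont'.eventually hx1] with x' h1 h2
  exact (h2.1 h1)

end Implicit

/-! ### Truncated jet norms -/

section JetNorm

open Finset

theorem sum_antidiagonal_range_le (N : ℕ) (w : ℕ → ℕ → ℝ) (hw : ∀ i j, 0 ≤ w i j) :
    ∑ n ∈ range N, ∑ x ∈ antidiagonal n, w x.1 x.2 ≤ ∑ i ∈ range N, ∑ j ∈ range N, w i j := by
  rw [sum_sigma', ← sum_product']
  have hinj : Set.InjOn (fun x : (_ : ℕ) × ℕ × ℕ => x.2)
      ((range N).sigma fun n => antidiagonal n : Finset ((_ : ℕ) × ℕ × ℕ)) := by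
    rintro ⟨n, i, j⟩ h ⟨n', i', j'⟩ h' heq
    simp only [coe_sigma, Set.mem_sigma_iff, mem_coe, HasAntidiagonal.mem_antidiagonal] at h h'
    simp only [Prod.mk.injEq] at heq
    obtain ⟨rfl, rfl⟩ := heq
    obtain ⟨_, rfl⟩ := h
    obtain ⟨_, rfl⟩ := h'
    rfl
  rw [← sum_image (f := fun x : ℕ × ℕ => w x.1 x.2) hinj]
  refine sum_le_sum_of_subset_of_nonneg ?_ fun x _ _ => hw _ _
  intro x hx
  simp only [Finset.mem_image, mem_sigma, Finset.mem_range,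
    HasAntidiagonal.mem_antidiagonal] at hx
  obtain ⟨⟨n, y⟩, ⟨h1, h2⟩, rfl⟩ := hx
  simp only [mem_product, Finset.mem_range] at h1 h2 ⊢
  omega

variable {P : Type} [NormedAddCommGroup P] [NormedSpace ℝ P]
variable {F G H : Type} [NormedAddCommGroup F] [NormedSpace ℝ F]
  [NormedAddCommGroup G] [NormedSpace ℝ G] [NormedAddCommGroup H] [NormedSpace ℝ H]

/-- The norm of the `k`-jet of `f` at `p`, in which derivatives of order `j` have weight
`t ^ j / j!`. It is submultiplicative. -/
def jetNorm (k : ℕ) (t : ℝ) (f : P → F) (p : P) : ℝ :=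
  ∑ j ∈ range (k + 1), t ^ j / j.factorial * ‖iteratedFDeriv ℝ j f p‖

variable {k : ℕ} {t : ℝ} {p : P}

theorem jetNorm_nonneg (ht : 0 ≤ t) (f : P → F) : 0 ≤ jetNorm k t f p :=
  sum_nonneg fun j _ => by positivity

theorem jetNorm_mono {t' : ℝ} (ht : 0 ≤ t) (htt : t ≤ t') (f : P → F) :
    jetNorm k t f p ≤ jetNorm k t' f p :=
  sum_le_sum fun j _ => by gcongr

theorem le_jetNorm (ht : 0 ≤ t) (f : P → F) {j : ℕ} (hj : j ≤ k) :
    t ^ j / j.factorial * ‖iteratedFDeriv ℝ j f p‖ ≤ jetNorm k t f p :=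
  single_le_sum (f := fun j => t ^ j / j.factorial * ‖iteratedFDeriv ℝ j f p‖)
    (fun j _ => by positivity) (Finset.mem_range.2 (by omega))

theorem norm_le_jetNorm (ht : 0 ≤ t) (f : P → F) : ‖f p‖ ≤ jetNorm k t f p := by
  simpa using le_jetNorm (k := k) (p := p) ht f (Nat.zero_le k)

theorem jetNorm_eq_norm_add (f : P → F) : jetNorm k t f p =
    ‖f p‖ + ∑ j ∈ range k, t ^ (j + 1) / (j + 1).factorial * ‖iteratedFDeriv ℝ (j + 1) f p‖ := by
  rw [jetNorm, sum_range_succ']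
  simp [add_comm]

theorem jetNorm_const (c : F) : jetNorm k t (fun _ : P => c) p = ‖c‖ := by
  rw [jetNorm_eq_norm_add]
  simp [iteratedFDeriv_succ_const]

theorem jetNorm_zero : jetNorm k t (fun _ : P => (0 : F)) p = 0 := by
  rw [jetNorm_const, norm_zero]

theorem jetNorm_add (ht : 0 ≤ t) {f g : P → F} (hf : ContDiff ℝ ∞ f) (hg : ContDiff ℝ ∞ g) :
    jetNorm k t (fun x => f x + g x) p ≤ jetNorm k t f p + jetNorm k t g p := by
  rw [jetNorm, jetNorm, jetNorm, ← sum_add_distrib]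
  refine sum_le_sum fun j _ => ?_
  rw [← mul_add]
  have h := iteratedFDeriv_add_apply (x := p)
    ((hf.of_le (m := (j : WithTop ℕ∞)) (by exact_mod_cast le_top)).contDiffAt)
    ((hg.of_le (m := (j : WithTop ℕ∞)) (by exact_mod_cast le_top)).contDiffAt)
  have h' : iteratedFDeriv ℝ j (fun x => f x + g x) p =
    iteratedFDeriv ℝ j f p + iteratedFDeriv ℝ j g p := h
  rw [h']
  gcongr
  exact norm_add_le _ _

theorem jetNorm_sum (ht : 0 ≤ t) {ι : Type} (s : Finset ι) {f : ι → P → F}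
    (hf : ∀ i ∈ s, ContDiff ℝ ∞ (f i)) :
    jetNorm k t (fun x => ∑ i ∈ s, f i x) p ≤ ∑ i ∈ s, jetNorm k t (f i) p := by
  classical
  induction s using Finset.induction_on with
  | empty => simp [jetNorm_zero]
  | insert a s ha ih =>
    simp only [sum_insert ha]
    have h1 := hf a (mem_insert_self _ _)
    have h2 : ∀ i ∈ s, ContDiff ℝ ∞ (f i) := fun i hi => hf i (mem_insert_of_mem hi)
    exact (jetNorm_add ht h1 (ContDiff.sum h2)).trans (by gcongr; exact ih h2)

/-- Submultiplicativity, by the Leibniz rule: the factors `1 / j!` turn the binomial sum into a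
Cauchy product. -/
theorem jetNorm_bilin (ht : 0 ≤ t) (B : F →L[ℝ] G →L[ℝ] H) (hB : ‖B‖ ≤ 1) {f : P → F} {g : P → G}
    (hf : ContDiff ℝ ∞ f) (hg : ContDiff ℝ ∞ g) :
    jetNorm k t (fun x => B (f x) (g x)) p ≤ jetNorm k t f p * jetNorm k t g p := by
  have key : ∀ j, t ^ j / j.factorial * ‖iteratedFDeriv ℝ j (fun x => B (f x) (g x)) p‖ ≤
      ∑ x ∈ antidiagonal j, (t ^ x.1 / x.1.factorial * ‖iteratedFDeriv ℝ x.1 f p‖) *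
        (t ^ x.2 / x.2.factorial * ‖iteratedFDeriv ℝ x.2 g p‖) := by
    intro j
    have h := B.norm_iteratedFDeriv_le_of_bilinear_of_le_one hf hg p (n := j)
      (by exact_mod_cast le_top) hB
    refine (mul_le_mul_of_nonneg_left h (by positivity)).trans (le_of_eq ?_)
    rw [mul_sum, Finset.Nat.sum_antidiagonal_eq_sum_range_succ (fun a b =>
          (t ^ a / a.factorial * ‖iteratedFDeriv ℝ a f p‖) *
            (t ^ b / b.factorial * ‖iteratedFDeriv ℝ b g p‖))]
    refine sum_congr rfl fun i hi => ?_
    have hij : i ≤ j := Nat.lt_succ_iff.1 (Finset.mem_range.1 hi)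
    have hfac : (j.choose i : ℝ) = j.factorial / (i.factorial * (j - i).factorial) := by
      rw [Nat.cast_choose ℝ hij]
    have hpow : t ^ j = t ^ i * t ^ (j - i) := by rw [← pow_add]; congr 1; omega
    rw [hfac, hpow]
    field_simp
  calc jetNorm k t (fun x => B (f x) (g x)) p ≤ _ := sum_le_sum fun j _ => key j
    _ ≤ _ := sum_antidiagonal_range_le (k + 1) (fun a b =>
          (t ^ a / a.factorial * ‖iteratedFDeriv ℝ a f p‖) *
            (t ^ b / b.factorial * ‖iteratedFDeriv ℝ b g p‖)) fun i j => by positivity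
    _ = _ := by rw [jetNorm, jetNorm, sum_mul_sum]

theorem jetNorm_mul (ht : 0 ≤ t) {A : Type} [NormedRing A] [NormedAlgebra ℝ A] {f g : P → A}
    (hf : ContDiff ℝ ∞ f) (hg : ContDiff ℝ ∞ g) :
    jetNorm k t (fun x => f x * g x) p ≤ jetNorm k t f p * jetNorm k t g p :=
  jetNorm_bilin ht (ContinuousLinearMap.mul ℝ A) (ContinuousLinearMap.opNorm_mul_le ℝ A) hf hg

theorem jetNorm_smul (ht : 0 ≤ t) {f : P → ℝ} {g : P → F}
    (hf : ContDiff ℝ ∞ f) (hg : ContDiff ℝ ∞ g) :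
    jetNorm k t (fun x => f x • g x) p ≤ jetNorm k t f p * jetNorm k t g p :=
  jetNorm_bilin ht (ContinuousLinearMap.lsmul ℝ ℝ) ContinuousLinearMap.opNorm_lsmul_le hf hg

theorem jetNorm_clm_apply (ht : 0 ≤ t) {f : P → F →L[ℝ] G} {g : P → F}
    (hf : ContDiff ℝ ∞ f) (hg : ContDiff ℝ ∞ g) :
    jetNorm k t (fun x => f x (g x)) p ≤ jetNorm k t f p * jetNorm k t g p :=
  jetNorm_bilin ht (ContinuousLinearMap.id ℝ (F →L[ℝ] G)) ContinuousLinearMap.norm_id_le hf hg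

theorem jetNorm_clm_comp (ht : 0 ≤ t) (L : F →L[ℝ] G) (hL : ‖L‖ ≤ 1) {f : P → F}
    (hf : ContDiff ℝ ∞ f) : jetNorm k t (fun x => L (f x)) p ≤ jetNorm k t f p := by
  refine (jetNorm_clm_apply ht (f := fun _ => L) contDiff_const hf).trans ?_
  rw [jetNorm_const]
  exact mul_le_of_le_one_left (jetNorm_nonneg ht _) hL

/-- If the derivatives of `f` of positive order have small jet norm compared with the inverse of
`f p`, the jet norm of the inverse function is at most twice its norm bound. -/
theorem jetNorm_inverse_le (ht : 0 ≤ t) {A : Type} [NormedRing A] [NormedAlgebra ℝ A]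
    {f h : P → A} (hf : ContDiff ℝ ∞ f) (hh : ContDiff ℝ ∞ h) (hfh : ∀ x, f x * h x = 1)
    (hhf : ∀ x, h x * f x = 1) {K : ℝ} (hK : 0 < K) (hhK : ‖h p‖ ≤ K)
    (hsmall : ∑ j ∈ range k, t ^ (j + 1) / (j + 1).factorial * ‖iteratedFDeriv ℝ (j + 1) f p‖ ≤
      1 / (2 * K)) : jetNorm k t h p ≤ 2 * K := by
  set f₀ : P → A := fun x => f x + -f p
  have hf₀ : ContDiff ℝ ∞ f₀ := hf.add contDiff_const
  have hJ : jetNorm k t f₀ p ≤ 1 / (2 * K) := by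
    rw [jetNorm_eq_norm_add]
    simp only [f₀, add_neg_cancel, norm_zero, zero_add]
    refine le_of_eq_of_le (sum_congr rfl fun j _ => ?_) hsmall
    have h := iteratedFDeriv_add_apply (x := p) (i := j + 1) (f := f) (g := fun _ => -f p)
      ((hf.of_le (m := ((j + 1 : ℕ) : WithTop ℕ∞)) (by exact_mod_cast le_top)).contDiffAt)
      contDiff_const.contDiffAt
    have h' : iteratedFDeriv ℝ (j + 1) (fun x => f x + -f p) p = iteratedFDeriv ℝ (j + 1) f p := by
      refine Eq.trans h ?_
      simp [iteratedFDeriv_succ_const]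
    rw [h']
  -- `h = h p - h p * (f - f p) * h`
  have heq : h = fun x => h p + (-h p) * (f₀ x * h x) := by
    funext x
    simp only [f₀, add_mul, hfh, mul_add, neg_mul, mul_neg, neg_neg, mul_one]
    rw [← mul_assoc (h p), hhf, one_mul]
    abel
  have hJh := jetNorm_nonneg (k := k) (p := p) ht h
  have h1 : jetNorm k t h p ≤ K + K * (1 / (2 * K) * jetNorm k t h p) := by
    conv_lhs => rw [heq]
    refine (jetNorm_add ht contDiff_const (contDiff_const.mul (hf₀.mul hh))).trans ?_
    rw [jetNorm_const]
    refine add_le_add hhK ((jetNorm_mul ht contDiff_const (hf₀.mul hh)).trans ?_)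
    rw [jetNorm_const, norm_neg]
    refine mul_le_mul hhK ((jetNorm_mul ht hf₀ hh).trans ?_) (jetNorm_nonneg ht _) hK.le
    gcongr
  have h2 : K * (1 / (2 * K) * jetNorm k t h p) = jetNorm k t h p / 2 := by field_simp
  linarith

/-- A finite weighted sum of positive powers is small for small arguments. -/
theorem exists_pos_sum_pow_le (k : ℕ) (C : ℕ → ℝ) (hC : ∀ j, 0 ≤ C j) {ε : ℝ} (hε : 0 < ε) :
    ∃ θ₀ : ℝ, 0 < θ₀ ∧ θ₀ ≤ 1 ∧ ∀ θ, 0 < θ → θ ≤ θ₀ →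
      ∑ j ∈ range k, θ ^ (j + 1) * C (j + 1) ≤ ε := by
  set S := ∑ j ∈ range k, C (j + 1)
  have hS : 0 ≤ S := sum_nonneg fun j _ => hC _
  refine ⟨min 1 (ε / (S + 1)), by positivity, min_le_left _ _, fun θ hθ hle => ?_⟩
  have h1 : θ ≤ 1 := hle.trans (min_le_left _ _)
  have h2 : θ ≤ ε / (S + 1) := hle.trans (min_le_right _ _)
  calc ∑ j ∈ range k, θ ^ (j + 1) * C (j + 1) ≤ ∑ j ∈ range k, θ * C (j + 1) := by
        refine sum_le_sum fun j _ => ?_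
        have : θ ^ (j + 1) ≤ θ := by
          rw [pow_succ]
          exact mul_le_of_le_one_left hθ.le (pow_le_one₀ hθ.le h1)
        exact mul_le_mul_of_nonneg_right this (hC _)
    _ = θ * S := by rw [mul_sum]
    _ ≤ ε / (S + 1) * S := by gcongr
    _ ≤ ε := by
        rw [div_mul_eq_mul_div, div_le_iff₀ (by positivity)]
        nlinarith

end JetNorm

/-! ### Weighted norms of power series with smooth coefficients -/

section SeriesNorm

open Finset PowerSeries

variable {P : Type} [NormedAddCommGroup P] [NormedSpace ℝ P]

/-- The coefficients of the power series are smooth functions of the parameter. -/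
def SmoothCoeffs (φ : PowerSeries (P → ℝ)) : Prop := ∀ n, ContDiff ℝ ∞ (coeff n φ)

theorem SmoothCoeffs.mul {φ ψ : PowerSeries (P → ℝ)} (hφ : SmoothCoeffs φ) (hψ : SmoothCoeffs ψ) :
    SmoothCoeffs (φ * ψ) := by
  intro n
  rw [coeff_mul]
  have : (∑ x ∈ antidiagonal n, coeff x.1 φ * coeff x.2 ψ) =
      fun p => ∑ x ∈ antidiagonal n, coeff x.1 φ p * coeff x.2 ψ p := by
    funext p; simp
  rw [this]
  exact ContDiff.sum fun x _ => (hφ _).mul (hψ _)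

theorem SmoothCoeffs.one : SmoothCoeffs (1 : PowerSeries (P → ℝ)) := by
  intro n
  rw [coeff_one]
  split_ifs
  · exact contDiff_const (c := (1 : ℝ))
  · exact contDiff_const (c := (0 : ℝ))

theorem SmoothCoeffs.pow {φ : PowerSeries (P → ℝ)} (hφ : SmoothCoeffs φ) (n : ℕ) :
    SmoothCoeffs (φ ^ n) := by
  induction n with
  | zero => simpa using SmoothCoeffs.one
  | succ n ih => rw [pow_succ]; exact ih.mul hφ

theorem SmoothCoeffs.X : SmoothCoeffs (PowerSeries.X : PowerSeries (P → ℝ)) := by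
  intro n
  rw [coeff_X]
  split_ifs
  · exact contDiff_const (c := (1 : ℝ))
  · exact contDiff_const (c := (0 : ℝ))

/-- The weighted `ℓ¹`-norm of the first `N` coefficients. Derivatives of the `n`-th coefficient
carry a factor `n + 1` less: this absorbs the loss of one power of `n` per derivative in the
inverses of `ρ n - B`. -/
def seriesNorm (k : ℕ) (θ ν : ℝ) (N : ℕ) (p : P) (φ : PowerSeries (P → ℝ)) : ℝ :=
  ∑ n ∈ range N, ν ^ n * jetNorm k (θ / (n + 1)) (coeff n φ) p

variable {k N : ℕ} {θ ν : ℝ} {p : P}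

theorem seriesNorm_nonneg (hθ : 0 ≤ θ) (hν : 0 ≤ ν) (φ : PowerSeries (P → ℝ)) :
    0 ≤ seriesNorm k θ ν N p φ :=
  sum_nonneg fun n _ => mul_nonneg (by positivity) (jetNorm_nonneg (by positivity) _)

/-- The weight `θ / (n + 1)` decreases with `n`, so that it may be raised to the weights of the two
factors in each term of the Cauchy product. -/
theorem seriesNorm_mul (hθ : 0 ≤ θ) (hν : 0 ≤ ν) {φ ψ : PowerSeries (P → ℝ)}
    (hφ : SmoothCoeffs φ) (hψ : SmoothCoeffs ψ) :
    seriesNorm k θ ν N p (φ * ψ) ≤ seriesNorm k θ ν N p φ * seriesNorm k θ ν N p ψ := by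
  have key : ∀ n : ℕ, ν ^ n * jetNorm k (θ / (n + 1)) (coeff n (φ * ψ)) p ≤
      ∑ x ∈ HasAntidiagonal.antidiagonal n, (ν ^ x.1 * jetNorm k (θ / (x.1 + 1)) (coeff x.1 φ) p) *
        (ν ^ x.2 * jetNorm k (θ / (x.2 + 1)) (coeff x.2 ψ) p) := by
    intro n
    have h0 : coeff n (φ * ψ) =
        fun p => ∑ x ∈ antidiagonal n, coeff x.1 φ p * coeff x.2 ψ p := by
      rw [coeff_mul]; funext p; simp
    rw [h0]
    have ht : 0 ≤ θ / (n + 1) := by positivity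
    refine (mul_le_mul_of_nonneg_left (jetNorm_sum ht _ fun x _ => (hφ _).mul (hψ _))
      (by positivity)).trans ?_
    rw [mul_sum]
    refine sum_le_sum fun x hx => ?_
    have hx' := HasAntidiagonal.mem_antidiagonal.1 hx
    have h1 : (x.1 : ℝ) ≤ n := by exact_mod_cast (by omega : x.1 ≤ n)
    have h2 : (x.2 : ℝ) ≤ n := by exact_mod_cast (by omega : x.2 ≤ n)
    have hp : ν ^ n = ν ^ x.1 * ν ^ x.2 := by rw [← pow_add, hx']
    have hle : jetNorm k (θ / (n + 1)) (fun p => coeff x.1 φ p * coeff x.2 ψ p) p ≤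
        jetNorm k (θ / (x.1 + 1)) (coeff x.1 φ) p * jetNorm k (θ / (x.2 + 1)) (coeff x.2 ψ) p := by
      refine (jetNorm_mul ht (hφ _) (hψ _)).trans ?_
      refine mul_le_mul (jetNorm_mono ht ?_ _) (jetNorm_mono ht ?_ _) (jetNorm_nonneg ht _)
        (jetNorm_nonneg (by positivity) _)
      · gcongr
      · gcongr
    calc _ ≤ ν ^ n * _ := mul_le_mul_of_nonneg_left hle (by positivity)
      _ = _ := by rw [hp]; ring
  calc _ ≤ _ := sum_le_sum fun n _ => key n
    _ ≤ _ := sum_antidiagonal_range_le N (fun a b =>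
        (ν ^ a * jetNorm k (θ / (a + 1)) (coeff a φ) p) *
        (ν ^ b * jetNorm k (θ / (b + 1)) (coeff b ψ) p)) fun i j =>
          mul_nonneg (mul_nonneg (by positivity) (jetNorm_nonneg (by positivity) _))
            (mul_nonneg (by positivity) (jetNorm_nonneg (by positivity) _))
    _ = _ := by rw [seriesNorm, seriesNorm, sum_mul_sum]

theorem seriesNorm_one_le : seriesNorm k θ ν N p (1 : PowerSeries (P → ℝ)) ≤ 1 := by
  have : ∀ n : ℕ, ν ^ n * jetNorm k (θ / (n + 1)) (coeff n (1 : PowerSeries (P → ℝ))) p =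
      if n = 0 then 1 else 0 := by
    intro n
    rw [coeff_one]
    split_ifs with h
    · have := jetNorm_const (k := k) (t := θ / (n + 1)) (p := p) (1 : ℝ)
      rw [show (1 : P → ℝ) = fun _ => 1 from rfl, this]
      simp [h]
    · rw [show (0 : P → ℝ) = fun _ => 0 from rfl, jetNorm_zero, mul_zero]
  rw [seriesNorm, sum_congr rfl fun n _ => this n, sum_ite_eq']
  split_ifs <;> norm_num

theorem seriesNorm_X_le (hν : 0 ≤ ν) :
    seriesNorm k θ ν N p (PowerSeries.X : PowerSeries (P → ℝ)) ≤ ν := by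
  have : ∀ n : ℕ, ν ^ n * jetNorm k (θ / (n + 1)) (coeff n (PowerSeries.X : PowerSeries (P → ℝ))) p =
      if n = 1 then ν else 0 := by
    intro n
    rw [coeff_X]
    split_ifs with h
    · have := jetNorm_const (k := k) (t := θ / (n + 1)) (p := p) (1 : ℝ)
      rw [show (1 : P → ℝ) = fun _ => 1 from rfl, this]
      simp [h]
    · rw [show (0 : P → ℝ) = fun _ => 0 from rfl, jetNorm_zero, mul_zero]
  rw [seriesNorm, sum_congr rfl fun n _ => this n, sum_ite_eq']
  split_ifs
  · exact le_rfl
  · exact hν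

theorem seriesNorm_pow (hθ : 0 ≤ θ) (hν : 0 ≤ ν) {φ : PowerSeries (P → ℝ)}
    (hφ : SmoothCoeffs φ) (n : ℕ) :
    seriesNorm k θ ν N p (φ ^ n) ≤ seriesNorm k θ ν N p φ ^ n := by
  induction n with
  | zero => simpa using seriesNorm_one_le
  | succ n ih =>
    rw [pow_succ, pow_succ]
    refine (seriesNorm_mul hθ hν (hφ.pow n) hφ).trans ?_
    gcongr
    exact seriesNorm_nonneg hθ hν _

end SeriesNorm

/-! ### A singular equation of Briot–Bouquet type with a small parameter -/

section Recursion

open Finset PowerSeries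

/-- The exponents `(a, b, c)`, each at most `n`, of the monomials `s ^ a * v₁ ^ b * v₂ ^ c` other
than the constant and the two that are linear in `v` alone. -/
def higherIdx (n : ℕ) : Finset (ℕ × ℕ × ℕ) :=
  ((range (n + 1)) ×ˢ (range (n + 1)) ×ˢ (range (n + 1))).filter
    fun a => 2 ≤ 2 * a.1 + a.2.1 + a.2.2

/-- The power series `s ^ a * φ ^ b * ψ ^ c`. -/
def monoSeries {R : Type} [CommRing R] (φ ψ : PowerSeries R) (a : ℕ × ℕ × ℕ) : PowerSeries R :=
  PowerSeries.X ^ a.1 * φ ^ a.2.1 * ψ ^ a.2.2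

theorem X_pow_dvd_pow_sub_pow {R : Type} [CommRing R] {φ φ' : PowerSeries R} {N : ℕ}
    (h' : PowerSeries.X ∣ φ') (h : PowerSeries.X ∣ φ)
    (hd : PowerSeries.X ^ N ∣ φ - φ') {b : ℕ} (hb : 2 ≤ b) :
    PowerSeries.X ^ (N + 1) ∣ φ ^ b - φ' ^ b := by
  obtain ⟨b, rfl⟩ := Nat.exists_eq_add_of_le hb
  have h1 : φ ^ (2 + b) - φ' ^ (2 + b) =
      (φ ^ (b + 1) - φ' ^ (b + 1)) * φ + (φ - φ') * φ' * φ' ^ b := by ring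
  rw [h1, pow_succ]
  exact dvd_add (mul_dvd_mul (hd.trans (sub_dvd_pow_sub_pow _ _ _)) h)
    (dvd_mul_of_dvd_left (mul_dvd_mul hd h') _)

/-- A monomial that is not constant or linear in `v` alone depends on `v` modulo `s ^ (N + 1)` only
through `v` modulo `s ^ N`. -/
theorem X_pow_dvd_monoSeries_sub {R : Type} [CommRing R] {φ φ' ψ ψ' : PowerSeries R} {N : ℕ}
    (hφ : PowerSeries.X ∣ φ) (hφ' : PowerSeries.X ∣ φ') (hψ : PowerSeries.X ∣ ψ)
    (hψ' : PowerSeries.X ∣ ψ') (hd : PowerSeries.X ^ N ∣ φ - φ') (he : PowerSeries.X ^ N ∣ ψ - ψ')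
    {a : ℕ × ℕ × ℕ} (ha : 2 ≤ 2 * a.1 + a.2.1 + a.2.2) :
    PowerSeries.X ^ (N + 1) ∣ monoSeries φ ψ a - monoSeries φ' ψ' a := by
  obtain ⟨a, b, c⟩ := a
  simp only at ha
  have hdiff : monoSeries φ ψ (a, b, c) - monoSeries φ' ψ' (a, b, c) =
      PowerSeries.X ^ a * ((φ ^ b - φ' ^ b) * ψ ^ c + φ' ^ b * (ψ ^ c - ψ' ^ c)) := by
    simp only [monoSeries]; ring
  have hb : PowerSeries.X ^ N ∣ φ ^ b - φ' ^ b := hd.trans (sub_dvd_pow_sub_pow _ _ _)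
  have hc : PowerSeries.X ^ N ∣ ψ ^ c - ψ' ^ c := he.trans (sub_dvd_pow_sub_pow _ _ _)
  rw [hdiff]
  rcases Nat.eq_zero_or_pos a with rfl | hapos
  · rw [pow_zero, one_mul]
    refine dvd_add ?_ ?_
    · rcases Nat.eq_zero_or_pos c with rfl | hcpos
      · exact dvd_mul_of_dvd_left (X_pow_dvd_pow_sub_pow hφ' hφ hd (by omega)) _
      · rw [pow_succ]
        exact mul_dvd_mul hb (dvd_pow hψ (by omega))
    · rcases Nat.eq_zero_or_pos b with rfl | hbpos
      · exact dvd_mul_of_dvd_right (X_pow_dvd_pow_sub_pow hψ' hψ he (by omega)) _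
      · rw [pow_succ']
        exact mul_dvd_mul (dvd_pow hφ' (by omega)) hc
  · rw [pow_succ']
    exact mul_dvd_mul (dvd_pow_self _ (by omega))
      (dvd_add (dvd_mul_of_dvd_left hb _) (dvd_mul_of_dvd_right hc _))

variable {P : Type} [NormedAddCommGroup P] [NormedSpace ℝ P]

/-- The coefficient of `s ^ n` in the sum of the higher monomials. -/
def higherCoeff (Th : ℕ × ℕ × ℕ → P → ℝ × ℝ) (φ ψ : PowerSeries (P → ℝ)) (n : ℕ) (p : P) : ℝ × ℝ :=
  ∑ a ∈ higherIdx n, coeff n (monoSeries φ ψ a) p • Th a p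

/-- The linear part in `v` of the right-hand side. -/
def linPart (Th : ℕ × ℕ × ℕ → P → ℝ × ℝ) (p : P) : ℝ × ℝ →L[ℝ] ℝ × ℝ :=
  (ContinuousLinearMap.fst ℝ ℝ ℝ).smulRight (Th (0, 1, 0) p) +
    (ContinuousLinearMap.snd ℝ ℝ ℝ).smulRight (Th (0, 0, 1) p)

/-- The operator `ρ n - B` which acts on the `n`-th coefficient. -/
def coeffOp (Th : ℕ × ℕ × ℕ → P → ℝ × ℝ) (ϱ : P → ℝ) (n : ℕ) (p : P) : ℝ × ℝ →L[ℝ] ℝ × ℝ :=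
  (ϱ p * n) • (1 : ℝ × ℝ →L[ℝ] ℝ × ℝ) - linPart Th p

/-- The partial sums of the formal solution `v = (v₁, v₂)` of `ρ s v' = Θ(s, v)`. -/
def partialSol (Th : ℕ × ℕ × ℕ → P → ℝ × ℝ) (ϱ : P → ℝ) :
    ℕ → PowerSeries (P → ℝ) × PowerSeries (P → ℝ)
  | 0 => (0, 0)
  | n + 1 =>
    let V := partialSol Th ϱ n
    let w : P → ℝ × ℝ := fun p => Ring.inverse (coeffOp Th ϱ n p) (higherCoeff Th V.1 V.2 n p)
    (V.1 + monomial n (fun p => (w p).1), V.2 + monomial n (fun p => (w p).2))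

/-- The coefficients of the formal solution. -/
def solCoeff (Th : ℕ × ℕ × ℕ → P → ℝ × ℝ) (ϱ : P → ℝ) (n : ℕ) (p : P) : ℝ × ℝ :=
  Ring.inverse (coeffOp Th ϱ n p)
    (higherCoeff Th (partialSol Th ϱ n).1 (partialSol Th ϱ n).2 n p)

variable (Th : ℕ × ℕ × ℕ → P → ℝ × ℝ) (ϱ : P → ℝ)

/-- The first component of the formal solution. -/
def solSeries₁ : PowerSeries (P → ℝ) := PowerSeries.mk fun n p => (solCoeff Th ϱ n p).1

/-- The second component of the formal solution. -/
def solSeries₂ : PowerSeries (P → ℝ) := PowerSeries.mk fun n p => (solCoeff Th ϱ n p).2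

theorem coeff_partialSol (N j : ℕ) :
    coeff j (partialSol Th ϱ N).1 = (if j < N then fun p => (solCoeff Th ϱ j p).1 else 0) ∧
    coeff j (partialSol Th ϱ N).2 = (if j < N then fun p => (solCoeff Th ϱ j p).2 else 0) := by
  induction N with
  | zero => simp [partialSol]
  | succ N ih =>
    simp only [partialSol, map_add, ih.1, ih.2, coeff_monomial]
    rcases lt_trichotomy j N with h | h | h
    · simp [h, h.ne, Nat.lt_succ_of_lt h]
    · subst h
      simp [solCoeff]
    · simp [h.ne', not_lt.2 h.le, not_lt.2 (Nat.succ_le_of_lt h)]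

theorem higherIdx_zero : higherIdx 0 = ∅ := by
  ext ⟨a, b, c⟩
  simp only [higherIdx, mem_filter, mem_product, Finset.mem_range, Finset.notMem_empty, iff_false]
  omega

theorem solCoeff_zero (p : P) : solCoeff Th ϱ 0 p = 0 := by
  simp [solCoeff, higherCoeff, higherIdx_zero]

theorem X_dvd_partialSol (N : ℕ) :
    PowerSeries.X ∣ (partialSol Th ϱ N).1 ∧ PowerSeries.X ∣ (partialSol Th ϱ N).2 := by
  rw [X_dvd_iff, X_dvd_iff, ← coeff_zero_eq_constantCoeff_apply,
    ← coeff_zero_eq_constantCoeff_apply, (coeff_partialSol Th ϱ N 0).1,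
    (coeff_partialSol Th ϱ N 0).2]
  constructor <;> split_ifs <;> first | rfl | (funext p; simp [solCoeff_zero])

theorem X_dvd_solSeries :
    PowerSeries.X ∣ solSeries₁ Th ϱ ∧ PowerSeries.X ∣ solSeries₂ Th ϱ := by
  rw [X_dvd_iff, X_dvd_iff, ← coeff_zero_eq_constantCoeff_apply,
    ← coeff_zero_eq_constantCoeff_apply, solSeries₁, solSeries₂, coeff_mk, coeff_mk]
  constructor <;> (funext p; simp [solCoeff_zero])

theorem X_pow_dvd_solSeries_sub (N : ℕ) :
    PowerSeries.X ^ N ∣ solSeries₁ Th ϱ - (partialSol Th ϱ N).1 ∧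
    PowerSeries.X ^ N ∣ solSeries₂ Th ϱ - (partialSol Th ϱ N).2 := by
  rw [X_pow_dvd_iff, X_pow_dvd_iff]
  constructor <;> intro j hj
  · rw [map_sub, (coeff_partialSol Th ϱ N j).1, solSeries₁, coeff_mk, if_pos hj, sub_self]
  · rw [map_sub, (coeff_partialSol Th ϱ N j).2, solSeries₂, coeff_mk, if_pos hj, sub_self]

/-- The right-hand side of the recursion at order `n` involves only coefficients of lower order:
linear terms in `v` alone are excluded, and `v` has no constant term. -/
theorem higherCoeff_partialSol {n N : ℕ} (h : n ≤ N) (p : P) :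
    higherCoeff Th (partialSol Th ϱ N).1 (partialSol Th ϱ N).2 n p =
      higherCoeff Th (solSeries₁ Th ϱ) (solSeries₂ Th ϱ) n p := by
  refine sum_congr rfl fun a ha => ?_
  have h1 := X_pow_dvd_monoSeries_sub (X_dvd_solSeries Th ϱ).1 (X_dvd_partialSol Th ϱ N).1
    (X_dvd_solSeries Th ϱ).2 (X_dvd_partialSol Th ϱ N).2 (X_pow_dvd_solSeries_sub Th ϱ N).1
    (X_pow_dvd_solSeries_sub Th ϱ N).2 (mem_filter.1 ha).2
  have h2 := X_pow_dvd_iff.1 h1 n (by omega)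
  rw [map_sub, sub_eq_zero] at h2
  rw [h2]

/-- The recursion `(ρ n - B) vₙ = RHSₙ(v)` for the coefficients of the formal solution. -/
theorem solCoeff_eq (n : ℕ) (p : P) : solCoeff Th ϱ n p = Ring.inverse (coeffOp Th ϱ n p)
    (higherCoeff Th (solSeries₁ Th ϱ) (solSeries₂ Th ϱ) n p) := by
  rw [solCoeff, higherCoeff_partialSol Th ϱ le_rfl]

variable {Th ϱ}

theorem SmoothCoeffs.monoSeries {φ ψ : PowerSeries (P → ℝ)} (hφ : SmoothCoeffs φ)
    (hψ : SmoothCoeffs ψ) (a : ℕ × ℕ × ℕ) : SmoothCoeffs (monoSeries φ ψ a) :=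
  ((SmoothCoeffs.X.pow _).mul (hφ.pow _)).mul (hψ.pow _)

theorem contDiff_linPart (hTh : ∀ a, ContDiff ℝ ∞ (Th a)) : ContDiff ℝ ∞ (linPart Th) := by
  have := hTh (0, 1, 0)
  have := hTh (0, 0, 1)
  unfold linPart
  exact (contDiff_const.smulRight (hTh _)).add (contDiff_const.smulRight (hTh _))

theorem contDiff_coeffOp (hTh : ∀ a, ContDiff ℝ ∞ (Th a)) (hϱ : ContDiff ℝ ∞ ϱ) (n : ℕ) :
    ContDiff ℝ ∞ (coeffOp Th ϱ n) :=
  ((hϱ.mul contDiff_const).smul contDiff_const).sub (contDiff_linPart hTh)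

theorem contDiff_inverse_coeffOp (hTh : ∀ a, ContDiff ℝ ∞ (Th a)) (hϱ : ContDiff ℝ ∞ ϱ)
    (hu : ∀ n p, IsUnit (coeffOp Th ϱ n p)) (n : ℕ) :
    ContDiff ℝ ∞ fun p => Ring.inverse (coeffOp Th ϱ n p) := by
  rw [contDiff_iff_contDiffAt]
  intro p
  obtain ⟨u, hu⟩ := hu n p
  have h := contDiffAt_ringInverse ℝ (n := ∞) u
  rw [hu] at h
  exact h.comp p (contDiff_coeffOp hTh hϱ n).contDiffAt

theorem contDiff_higherCoeff (hTh : ∀ a, ContDiff ℝ ∞ (Th a)) {φ ψ : PowerSeries (P → ℝ)}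
    (hφ : SmoothCoeffs φ) (hψ : SmoothCoeffs ψ) (n : ℕ) :
    ContDiff ℝ ∞ (higherCoeff Th φ ψ n) :=
  ContDiff.sum fun a _ => (hφ.monoSeries hψ a n).smul (hTh a)

theorem smoothCoeffs_partialSol (hTh : ∀ a, ContDiff ℝ ∞ (Th a)) (hϱ : ContDiff ℝ ∞ ϱ)
    (hu : ∀ n p, IsUnit (coeffOp Th ϱ n p)) (N : ℕ) :
    SmoothCoeffs (partialSol Th ϱ N).1 ∧ SmoothCoeffs (partialSol Th ϱ N).2 := by
  induction N with
  | zero => exact ⟨fun n => contDiff_const (c := (0 : ℝ)), fun n => contDiff_const (c := (0 : ℝ))⟩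
  | succ N ih =>
    have hw := (contDiff_inverse_coeffOp hTh hϱ hu N).clm_apply
      (contDiff_higherCoeff hTh ih.1 ih.2 N)
    constructor <;> intro n <;> simp only [partialSol, map_add, coeff_monomial]
    · refine (ih.1 n).add ?_
      split_ifs
      · exact hw.fst
      · exact contDiff_const (c := (0 : ℝ))
    · refine (ih.2 n).add ?_
      split_ifs
      · exact hw.snd
      · exact contDiff_const (c := (0 : ℝ))

theorem contDiff_solCoeff (hTh : ∀ a, ContDiff ℝ ∞ (Th a)) (hϱ : ContDiff ℝ ∞ ϱ)
    (hu : ∀ n p, IsUnit (coeffOp Th ϱ n p)) (n : ℕ) : ContDiff ℝ ∞ (solCoeff Th ϱ n) :=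
  (contDiff_inverse_coeffOp hTh hϱ hu n).clm_apply
    (contDiff_higherCoeff hTh (smoothCoeffs_partialSol hTh hϱ hu n).1
      (smoothCoeffs_partialSol hTh hϱ hu n).2 n)

theorem higherIdx_mono {n N : ℕ} (h : n ≤ N) : higherIdx n ⊆ higherIdx N := by
  intro a
  simp only [higherIdx, mem_filter, mem_product, Finset.mem_range]
  omega

theorem sum_range_half_pow_le (n : ℕ) : ∑ i ∈ range n, (1 / 2 : ℝ) ^ i ≤ 2 := by
  have := Summable.sum_le_tsum (range n) (fun i _ => by positivity)
    (summable_geometric_two)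
  rwa [tsum_geometric_two] at this

/-- With `s ~ η²` and `v ~ η`, the sum of the higher terms is quadratically small in `η`. -/
theorem sum_higherIdx_le (N : ℕ) {η : ℝ} (hη : 0 < η) (hη1 : η ≤ 1) :
    ∑ a ∈ higherIdx N, (η ^ 2 / 4) ^ a.1 * (η / 2) ^ a.2.1 * (η / 2) ^ a.2.2 ≤ 8 * η ^ 2 := by
  have h1 : ∀ a ∈ higherIdx N, (η ^ 2 / 4) ^ a.1 * (η / 2) ^ a.2.1 * (η / 2) ^ a.2.2 ≤
      η ^ 2 * ((1 / 2) ^ a.1 * ((1 / 2) ^ a.2.1 * (1 / 2) ^ a.2.2)) := by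
    intro a ha
    have ha2 := (mem_filter.1 ha).2
    have e : (η ^ 2 / 4) ^ a.1 * (η / 2) ^ a.2.1 * (η / 2) ^ a.2.2 =
        η ^ (2 * a.1 + a.2.1 + a.2.2) * ((1 / 4) ^ a.1 * ((1 / 2) ^ a.2.1 * (1 / 2) ^ a.2.2)) := by
      rw [pow_add, pow_add, pow_mul, div_eq_mul_one_div (η ^ 2), div_eq_mul_one_div η, mul_pow,
        mul_pow, mul_pow]
      ring
    rw [e]
    refine mul_le_mul (pow_le_pow_of_le_one hη.le hη1 ha2) ?_ (by positivity) (by positivity)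
    gcongr
    norm_num
  calc _ ≤ _ := sum_le_sum h1
    _ = η ^ 2 * ∑ a ∈ higherIdx N, (1 / 2 : ℝ) ^ a.1 * ((1 / 2) ^ a.2.1 * (1 / 2) ^ a.2.2) := by
        rw [mul_sum]
    _ ≤ η ^ 2 * ∑ a ∈ (range (N + 1)) ×ˢ (range (N + 1)) ×ˢ (range (N + 1)),
          (1 / 2 : ℝ) ^ a.1 * ((1 / 2) ^ a.2.1 * (1 / 2) ^ a.2.2) := by
        refine mul_le_mul_of_nonneg_left (sum_le_sum_of_subset_of_nonneg
          (Finset.filter_subset _ _) fun a _ _ => by positivity) (by positivity)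
    _ = η ^ 2 * ((∑ i ∈ range (N + 1), (1 / 2 : ℝ) ^ i) * ((∑ i ∈ range (N + 1), (1 / 2 : ℝ) ^ i) *
          ∑ i ∈ range (N + 1), (1 / 2 : ℝ) ^ i)) := by
        simp only [sum_product, ← mul_sum, ← sum_mul]
    _ ≤ η ^ 2 * (2 * (2 * 2)) := by
        have := sum_range_half_pow_le (N + 1)
        have h0 : 0 ≤ ∑ i ∈ range (N + 1), (1 / 2 : ℝ) ^ i := sum_nonneg fun i _ => by positivity
        gcongr
    _ = 8 * η ^ 2 := by ring

/-- The a priori estimate: at every order `k` of differentiation the partial sums of the weighted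
norm of the formal solution stay below the same bound, with a weight `ν` that does not depend
on `k`. -/
theorem sum_jetNorm_solCoeff_le (hTh : ∀ a, ContDiff ℝ ∞ (Th a)) (hϱ : ContDiff ℝ ∞ ϱ)
    (hu : ∀ n p, IsUnit (coeffOp Th ϱ n p)) {k : ℕ} {θ C₀ M K η : ℝ} {p : P}
    (hθ : 0 ≤ θ) (hC₀ : 0 < C₀) (hM : 0 < M) (hK : 0 < K) (hη : 0 < η) (hη1 : η ≤ 1)
    (hηs : 64 * K * C₀ * M * η ≤ 1)
    (hJT : ∀ a : ℕ × ℕ × ℕ, jetNorm k θ (Th a) p ≤ 2 * C₀ * M ^ (a.1 + a.2.1 + a.2.2))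
    (hJI : ∀ n : ℕ, jetNorm k (θ / (n + 1)) (fun p => Ring.inverse (coeffOp Th ϱ n p)) p ≤ 2 * K)
    (N : ℕ) :
    ∑ n ∈ range N, (η ^ 2 / (4 * M)) ^ n * jetNorm k (θ / (n + 1)) (solCoeff Th ϱ n) p ≤
      η / (2 * M) := by
  set ν := η ^ 2 / (4 * M) with hν
  set κ := η / (2 * M) with hκ
  have hν0 : 0 ≤ ν := by positivity
  induction N with
  | zero => simpa using (by positivity : 0 ≤ κ)
  | succ N ih =>
    obtain ⟨hs1, hs2⟩ := smoothCoeffs_partialSol hTh hϱ hu N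
    -- By the induction hypothesis the partial sums of the solution have norm at most `κ`.
    have hpart : ∀ (φ : PowerSeries (P → ℝ)) (L : ℝ × ℝ →L[ℝ] ℝ), ‖L‖ ≤ 1 →
        (∀ j, coeff j φ = if j < N then fun p => L (solCoeff Th ϱ j p) else 0) →
        seriesNorm k θ ν (N + 1) p φ ≤ κ := by
      intro φ L hL hφ
      rw [seriesNorm, sum_range_succ, hφ N, if_neg (lt_irrefl _),
        show (0 : P → ℝ) = fun _ => 0 from rfl, jetNorm_zero, mul_zero, add_zero]
      refine (sum_le_sum fun n hn => ?_).trans ih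
      rw [hφ n, if_pos (Finset.mem_range.1 hn)]
      gcongr
      exact jetNorm_clm_comp (by positivity) L hL (contDiff_solCoeff hTh hϱ hu n)
    have hn1 := hpart (partialSol Th ϱ N).1 (ContinuousLinearMap.fst ℝ ℝ ℝ)
      (ContinuousLinearMap.norm_fst_le ℝ ℝ ℝ) fun j => (coeff_partialSol Th ϱ N j).1
    have hn2 := hpart (partialSol Th ϱ N).2 (ContinuousLinearMap.snd ℝ ℝ ℝ)
      (ContinuousLinearMap.norm_snd_le ℝ ℝ ℝ) fun j => (coeff_partialSol Th ϱ N j).2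
    set φ := (partialSol Th ϱ N).1
    set ψ := (partialSol Th ϱ N).2
    have hmono : ∀ a : ℕ × ℕ × ℕ, seriesNorm k θ ν (N + 1) p (monoSeries φ ψ a) ≤
        ν ^ a.1 * κ ^ a.2.1 * κ ^ a.2.2 := by
      intro a
      refine (seriesNorm_mul hθ hν0 ((SmoothCoeffs.X.pow _).mul (hs1.pow _)) (hs2.pow _)).trans ?_
      refine mul_le_mul ((seriesNorm_mul hθ hν0 (SmoothCoeffs.X.pow _) (hs1.pow _)).trans ?_)
        ((seriesNorm_pow hθ hν0 hs2 _).trans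
          (pow_le_pow_left₀ (seriesNorm_nonneg hθ hν0 _) hn2 _))
        (seriesNorm_nonneg hθ hν0 _) (by positivity)
      exact mul_le_mul ((seriesNorm_pow hθ hν0 SmoothCoeffs.X _).trans
          (pow_le_pow_left₀ (seriesNorm_nonneg hθ hν0 _) (seriesNorm_X_le hν0) _))
        ((seriesNorm_pow hθ hν0 hs1 _).trans
          (pow_le_pow_left₀ (seriesNorm_nonneg hθ hν0 _) hn1 _))
        (seriesNorm_nonneg hθ hν0 _) (by positivity)
    have hterm : ∀ n ∈ range (N + 1),
        ν ^ n * jetNorm k (θ / (n + 1)) (solCoeff Th ϱ n) p ≤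
        4 * K * C₀ * ∑ a ∈ higherIdx N, M ^ (a.1 + a.2.1 + a.2.2) *
          (ν ^ n * jetNorm k (θ / (n + 1)) (coeff n (monoSeries φ ψ a)) p) := by
      intro n hn
      have hnN : n ≤ N := Nat.lt_succ_iff.1 (Finset.mem_range.1 hn)
      have ht : 0 ≤ θ / ((n : ℝ) + 1) := by positivity
      have htθ : θ / ((n : ℝ) + 1) ≤ θ := div_le_self hθ (by linarith [n.cast_nonneg (α := ℝ)])
      have hfun : solCoeff Th ϱ n =
          fun p => Ring.inverse (coeffOp Th ϱ n p) (higherCoeff Th φ ψ n p) := by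
        funext q
        rw [solCoeff_eq, higherCoeff_partialSol Th ϱ hnN]
      have h1 : jetNorm k (θ / (n + 1)) (solCoeff Th ϱ n) p ≤
          2 * K * jetNorm k (θ / (n + 1)) (higherCoeff Th φ ψ n) p := by
        rw [hfun]
        refine (jetNorm_clm_apply ht (contDiff_inverse_coeffOp hTh hϱ hu n)
          (contDiff_higherCoeff hTh hs1 hs2 n)).trans ?_
        exact mul_le_mul_of_nonneg_right (hJI n) (jetNorm_nonneg ht _)
      have h2 : jetNorm k (θ / (n + 1)) (higherCoeff Th φ ψ n) p ≤
          ∑ a ∈ higherIdx n, jetNorm k (θ / (n + 1)) (coeff n (monoSeries φ ψ a)) p *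
            (2 * C₀ * M ^ (a.1 + a.2.1 + a.2.2)) := by
        refine (jetNorm_sum ht _ fun a _ => (hs1.monoSeries hs2 a n).smul (hTh a)).trans ?_
        refine sum_le_sum fun a _ => ?_
        refine (jetNorm_smul ht (hs1.monoSeries hs2 a n) (hTh a)).trans ?_
        exact mul_le_mul_of_nonneg_left ((jetNorm_mono ht htθ _).trans (hJT a))
          (jetNorm_nonneg ht _)
      have h3 : ∑ a ∈ higherIdx n, jetNorm k (θ / (n + 1)) (coeff n (monoSeries φ ψ a)) p *
            (2 * C₀ * M ^ (a.1 + a.2.1 + a.2.2)) ≤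
          ∑ a ∈ higherIdx N, jetNorm k (θ / (n + 1)) (coeff n (monoSeries φ ψ a)) p *
            (2 * C₀ * M ^ (a.1 + a.2.1 + a.2.2)) :=
        sum_le_sum_of_subset_of_nonneg (higherIdx_mono hnN) fun a _ _ =>
          mul_nonneg (jetNorm_nonneg ht _) (by positivity)
      calc _ ≤ ν ^ n * (2 * K * ∑ a ∈ higherIdx N,
            jetNorm k (θ / (n + 1)) (coeff n (monoSeries φ ψ a)) p *
            (2 * C₀ * M ^ (a.1 + a.2.1 + a.2.2))) := by
              gcongr
              exact h1.trans (mul_le_mul_of_nonneg_left (h2.trans h3) (by positivity))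
        _ = _ := by
          rw [mul_sum, mul_sum, mul_sum]
          exact sum_congr rfl fun a _ => by ring
    calc _ ≤ _ := sum_le_sum hterm
      _ = 4 * K * C₀ * ∑ a ∈ higherIdx N, M ^ (a.1 + a.2.1 + a.2.2) *
            seriesNorm k θ ν (N + 1) p (monoSeries φ ψ a) := by
          rw [← mul_sum, sum_comm]
          simp only [seriesNorm, mul_sum]
      _ ≤ 4 * K * C₀ * ∑ a ∈ higherIdx N, M ^ (a.1 + a.2.1 + a.2.2) *
            (ν ^ a.1 * κ ^ a.2.1 * κ ^ a.2.2) := by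
          gcongr with a _
          exact hmono a
      _ = 4 * K * C₀ * ∑ a ∈ higherIdx N,
            (η ^ 2 / 4) ^ a.1 * (η / 2) ^ a.2.1 * (η / 2) ^ a.2.2 := by
          have e1 : η ^ 2 / 4 = M * ν := by rw [hν]; field_simp
          have e2 : η / 2 = M * κ := by rw [hκ]; field_simp
          congr 1
          refine sum_congr rfl fun a _ => ?_
          rw [e1, e2, mul_pow, mul_pow, mul_pow, pow_add, pow_add]
          ring
      _ ≤ 4 * K * C₀ * (8 * η ^ 2) := by
          gcongr
          exact sum_higherIdx_le N hη hη1
      _ ≤ κ := by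
          rw [hκ, le_div_iff₀ (by positivity)]
          nlinarith

/-- The derivatives of the operators `ρ n - B` grow at most linearly in `n`. -/
theorem norm_iteratedFDeriv_coeffOp_le (hTh : ∀ a, ContDiff ℝ ∞ (Th a)) (hϱ : ContDiff ℝ ∞ ϱ)
    {M : ℝ} (hT : ∀ k : ℕ, ∃ C, ∀ (a : ℕ × ℕ × ℕ) (p : P),
      ‖iteratedFDeriv ℝ k (Th a) p‖ ≤ C * M ^ (a.1 + a.2.1 + a.2.2))
    (hR : ∀ k : ℕ, ∃ C, ∀ p, ‖iteratedFDeriv ℝ k ϱ p‖ ≤ C) (j : ℕ) :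
    ∃ C, 0 ≤ C ∧ ∀ (n : ℕ) (p : P), ‖iteratedFDeriv ℝ j (coeffOp Th ϱ n) p‖ ≤ (n + 1) * C := by
  obtain ⟨CR, hCR⟩ := hR j
  obtain ⟨CT, hCT⟩ := hT j
  let V := ℝ × ℝ
  let L₀ : ℝ →L[ℝ] (V →L[ℝ] V) := (ContinuousLinearMap.id ℝ ℝ).smulRight (1 : V →L[ℝ] V)
  let L₁ : V →L[ℝ] (V →L[ℝ] V) :=
    -(ContinuousLinearMap.smulRightL ℝ V V (ContinuousLinearMap.fst ℝ ℝ ℝ))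
  let L₂ : V →L[ℝ] (V →L[ℝ] V) :=
    -(ContinuousLinearMap.smulRightL ℝ V V (ContinuousLinearMap.snd ℝ ℝ ℝ))
  have hle : (j : WithTop ℕ∞) ≤ ∞ := by exact_mod_cast le_top
  have hfun : ∀ n : ℕ, coeffOp Th ϱ n =
      (fun p => ((n : ℝ) • L₀) (ϱ p)) + ((fun p => L₁ (Th (0, 1, 0) p)) +
        fun p => L₂ (Th (0, 0, 1) p)) := by
    intro n
    funext p
    ext <;> simp [coeffOp, linPart, L₀, L₁, L₂] <;> ring
  refine ⟨‖L₀‖ * |CR| + (‖L₁‖ * |CT * M| + ‖L₂‖ * |CT * M|), by positivity, fun n p => ?_⟩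
  have c0 : ContDiff ℝ j (fun p => ((n : ℝ) • L₀) (ϱ p)) :=
    (((n : ℝ) • L₀).contDiff.comp hϱ).of_le hle
  have c1 : ContDiff ℝ j (fun p => L₁ (Th (0, 1, 0) p)) := (L₁.contDiff.comp (hTh _)).of_le hle
  have c2 : ContDiff ℝ j (fun p => L₂ (Th (0, 0, 1) p)) := (L₂.contDiff.comp (hTh _)).of_le hle
  have c12 : ContDiff ℝ j ((fun p => L₁ (Th (0, 1, 0) p)) + fun p => L₂ (Th (0, 0, 1) p)) :=
    c1.add c2
  rw [hfun, iteratedFDeriv_add_apply c0.contDiffAt c12.contDiffAt,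
    iteratedFDeriv_add_apply c1.contDiffAt c2.contDiffAt]
  have b0 := ((n : ℝ) • L₀).norm_iteratedFDeriv_comp_left (f := ϱ) (x := p)
    (hϱ.of_le hle).contDiffAt le_rfl
  have b1 := L₁.norm_iteratedFDeriv_comp_left (f := Th (0, 1, 0)) (x := p)
    ((hTh _).of_le hle).contDiffAt le_rfl
  have b2 := L₂.norm_iteratedFDeriv_comp_left (f := Th (0, 0, 1)) (x := p)
    ((hTh _).of_le hle).contDiffAt le_rfl
  have d1 : ‖iteratedFDeriv ℝ j (Th (0, 1, 0)) p‖ ≤ |CT * M| :=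
    (by simpa using hCT (0, 1, 0) p : _ ≤ CT * M).trans (le_abs_self _)
  have d2 : ‖iteratedFDeriv ℝ j (Th (0, 0, 1)) p‖ ≤ |CT * M| :=
    (by simpa using hCT (0, 0, 1) p : _ ≤ CT * M).trans (le_abs_self _)
  have d0 : ‖iteratedFDeriv ℝ j ϱ p‖ ≤ |CR| := (hCR p).trans (le_abs_self _)
  rw [norm_smul, Real.norm_natCast] at b0
  have hn : (0 : ℝ) ≤ n := n.cast_nonneg
  calc _ ≤ n * ‖L₀‖ * |CR| + (‖L₁‖ * |CT * M| + ‖L₂‖ * |CT * M|) := by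
        refine (norm_add_le _ _).trans (add_le_add (b0.trans ?_) ((norm_add_le _ _).trans
          (add_le_add (b1.trans ?_) (b2.trans ?_))))
        · gcongr
        · gcongr
        · gcongr
    _ ≤ _ := by
        have : 0 ≤ ‖L₁‖ * |CT * M| + ‖L₂‖ * |CT * M| := by positivity
        have h0 : 0 ≤ ‖L₀‖ * |CR| := by positivity
        nlinarith

/-- The formal solution of `ρ s v' = Θ(s, v)` converges on a disc of radius `ν` that is uniform in
the parameter, and so do its derivatives of all orders with respect to the parameter, up to
polynomial factors. No lower bound on `|ρ|` is assumed. -/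
theorem exists_bounds_solCoeff (hTh : ∀ a, ContDiff ℝ ∞ (Th a)) (hϱ : ContDiff ℝ ∞ ϱ)
    (hu : ∀ n p, IsUnit (coeffOp Th ϱ n p)) {M K κ₀ : ℝ} (hM : 0 < M) (hK : 0 < K) (hκ₀ : 0 < κ₀)
    (hI : ∀ n p, ‖Ring.inverse (coeffOp Th ϱ n p)‖ ≤ K)
    (hT : ∀ k : ℕ, ∃ C, ∀ (a : ℕ × ℕ × ℕ) (p : P),
      ‖iteratedFDeriv ℝ k (Th a) p‖ ≤ C * M ^ (a.1 + a.2.1 + a.2.2))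
    (hR : ∀ k : ℕ, ∃ C, ∀ p, ‖iteratedFDeriv ℝ k ϱ p‖ ≤ C) :
    ∃ ν κ : ℝ, 0 < ν ∧ 0 < κ ∧ κ ≤ κ₀ ∧ M * κ ≤ 1 / 2 ∧ ν ≤ κ₀ ∧ M * ν ≤ 1 / 2 ∧
      (∀ (N : ℕ) (p : P), ∑ n ∈ range N, ν ^ n * ‖solCoeff Th ϱ n p‖ ≤ κ) ∧
      ∀ k : ℕ, ∃ C, 0 ≤ C ∧ ∀ (n : ℕ) (p : P),
        ‖iteratedFDeriv ℝ k (solCoeff Th ϱ n) p‖ ≤ C * (n + 1) ^ k / ν ^ n := by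
  choose CT hCT using hT
  set C₀ := |CT 0| + 1 with hC₀
  have hC₀0 : 0 < C₀ := by positivity
  obtain ⟨η, hη, hη1, hηs, hηκ, hην⟩ : ∃ η : ℝ, 0 < η ∧ η ≤ 1 ∧ 64 * K * C₀ * M * η ≤ 1 ∧
      η / (2 * M) ≤ κ₀ ∧ η ^ 2 / (4 * M) ≤ κ₀ := by
    have hlim : ∀ (f : ℝ → ℝ), Continuous f → f 0 = 0 → ∀ ε, 0 < ε → ∀ᶠ η in 𝓝 (0 : ℝ), f η ≤ ε := by
      intro f hf h0 ε hε
      have : Tendsto f (𝓝 0) (𝓝 0) := by simpa [h0] using hf.tendsto 0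
      exact (this.eventually_lt_const hε).mono fun _ h => h.le
    have := (hlim (fun η => η) (by fun_prop) rfl 1 one_pos).and
      ((hlim (fun η => 64 * K * C₀ * M * η) (by fun_prop) (by simp) 1 one_pos).and
      ((hlim (fun η => η / (2 * M)) (by fun_prop) (by simp) κ₀ hκ₀).and
      (hlim (fun η => η ^ 2 / (4 * M)) (by fun_prop) (by simp) κ₀ hκ₀)))
    obtain ⟨η, h, hpos⟩ := ((this.filter_mono nhdsWithin_le_nhds).and
      (self_mem_nhdsWithin : Ioi (0 : ℝ) ∈ 𝓝[>] 0)).exists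
    exact ⟨η, hpos, h⟩
  set ν := η ^ 2 / (4 * M) with hν
  have hν0 : 0 < ν := by positivity
  -- The weight `θ` of the derivatives depends on the order `k`, but the radius `ν` does not.
  have main : ∀ k : ℕ, ∃ θ : ℝ, 0 < θ ∧ ∀ (N : ℕ) (p : P), ∑ n ∈ range N,
      ν ^ n * jetNorm k (θ / (n + 1)) (solCoeff Th ϱ n) p ≤ η / (2 * M) := by
    intro k
    choose CO hCO0 hCO using fun j => norm_iteratedFDeriv_coeffOp_le hTh hϱ
      (fun k => ⟨CT k, hCT k⟩) hR j
    obtain ⟨θ₁, hθ₁, hθ₁1, h₁⟩ := exists_pos_sum_pow_le k CO hCO0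
      (show 0 < 1 / (2 * K) by positivity)
    obtain ⟨θ₂, hθ₂, -, h₂⟩ := exists_pos_sum_pow_le k (fun j => |CT j|) (fun j => abs_nonneg _)
      hC₀0
    set θ := min θ₁ θ₂
    have hθ : 0 < θ := lt_min hθ₁ hθ₂
    refine ⟨θ, hθ, fun N p => sum_jetNorm_solCoeff_le hTh hϱ hu hθ.le hC₀0 hM hK hη hη1 hηs ?_ ?_ N⟩
    · intro a
      set A := M ^ (a.1 + a.2.1 + a.2.2)
      have hA : 0 < A := by positivity
      rw [jetNorm_eq_norm_add]
      have e0 : ‖Th a p‖ ≤ C₀ * A := by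
        have := hCT 0 a p
        rw [norm_iteratedFDeriv_zero] at this
        refine this.trans (mul_le_mul_of_nonneg_right ?_ hA.le)
        linarith [le_abs_self (CT 0)]
      have e1 : ∑ j ∈ range k, θ ^ (j + 1) / (j + 1).factorial *
          ‖iteratedFDeriv ℝ (j + 1) (Th a) p‖ ≤ C₀ * A := by
        calc _ ≤ ∑ j ∈ range k, θ ^ (j + 1) * |CT (j + 1)| * A := by
              refine sum_le_sum fun j _ => ?_
              have hf : θ ^ (j + 1) / (j + 1).factorial ≤ θ ^ (j + 1) :=
                div_le_self (by positivity) (by exact_mod_cast (j + 1).factorial_pos)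
              have hg : ‖iteratedFDeriv ℝ (j + 1) (Th a) p‖ ≤ |CT (j + 1)| * A :=
                (hCT (j + 1) a p).trans (mul_le_mul_of_nonneg_right (le_abs_self _) hA.le)
              rw [mul_assoc]
              exact mul_le_mul hf hg (norm_nonneg _) (by positivity)
          _ = (∑ j ∈ range k, θ ^ (j + 1) * |CT (j + 1)|) * A := by rw [sum_mul]
          _ ≤ _ := mul_le_mul_of_nonneg_right (h₂ θ hθ (min_le_right _ _)) hA.le
      linarith
    · intro n
      have hn : (0 : ℝ) < n + 1 := by positivity
      refine jetNorm_inverse_le (by positivity) (contDiff_coeffOp hTh hϱ n)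
        (contDiff_inverse_coeffOp hTh hϱ hu n) (fun q => Ring.mul_inverse_cancel _ (hu n q))
        (fun q => Ring.inverse_mul_cancel _ (hu n q)) hK (hI n p) ?_
      refine (sum_le_sum fun j _ => ?_).trans (h₁ θ hθ (min_le_left _ _))
      have hf : (θ / ((n : ℝ) + 1)) ^ (j + 1) / (j + 1).factorial ≤
          θ ^ (j + 1) / ((n : ℝ) + 1) := by
        refine (div_le_self (by positivity)
          (by exact_mod_cast (j + 1).factorial_pos)).trans ?_
        rw [div_pow]
        gcongr
        exact le_self_pow₀ (by linarith [n.cast_nonneg (α := ℝ)]) (by omega)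
      calc _ ≤ θ ^ (j + 1) / ((n : ℝ) + 1) * ((n + 1) * CO (j + 1)) :=
            mul_le_mul hf (hCO (j + 1) n p) (norm_nonneg _) (by positivity)
        _ = _ := by field_simp
  refine ⟨ν, η / (2 * M), hν0, by positivity, hηκ, ?_, hην, ?_, ?_, ?_⟩
  · field_simp
    linarith
  · rw [hν]
    field_simp
    nlinarith
  · intro N p
    obtain ⟨θ, hθ, h⟩ := main 0
    refine (sum_le_sum fun n _ => ?_).trans (h N p)
    exact mul_le_mul_of_nonneg_left (norm_le_jetNorm (by positivity) _) (by positivity)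
  · intro k
    obtain ⟨θ, hθ, h⟩ := main k
    clear_value ν
    refine ⟨η / (2 * M) * k.factorial / θ ^ k, by positivity, fun n p => ?_⟩
    have hn : (0 : ℝ) < n + 1 := by positivity
    have h1 : ν ^ n * jetNorm k (θ / (n + 1)) (solCoeff Th ϱ n) p ≤ η / (2 * M) :=
      (single_le_sum (f := fun n : ℕ => ν ^ n * jetNorm k (θ / (n + 1)) (solCoeff Th ϱ n) p)
        (fun i _ => mul_nonneg (by positivity) (jetNorm_nonneg (by positivity) _))
        (Finset.mem_range.2 (Nat.lt_succ_self n))).trans (h (n + 1) p)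
    have h2 := le_jetNorm (k := k) (t := θ / ((n : ℝ) + 1)) (p := p) (by positivity)
      (solCoeff Th ϱ n) le_rfl
    have h3 := (mul_le_mul_of_nonneg_left h2 (by positivity : 0 ≤ ν ^ n)).trans h1
    rw [div_pow] at h3
    rw [le_div_iff₀ (by positivity), div_mul_eq_mul_div, le_div_iff₀ (by positivity)]
    have h4 : ν ^ n * (θ ^ k / ((n : ℝ) + 1) ^ k / k.factorial *
        ‖iteratedFDeriv ℝ k (solCoeff Th ϱ n) p‖) =
        (‖iteratedFDeriv ℝ k (solCoeff Th ϱ n) p‖ * ν ^ n * θ ^ k) /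
          (((n : ℝ) + 1) ^ k * k.factorial) := by field_simp
    rw [h4, div_le_iff₀ (by positivity)] at h3
    linarith

end Recursion

/-! ### Convergence of the formal solution -/

section Convergence

open Finset PowerSeries

/-- `φ` converges absolutely on the closed disc of radius `ν`, with weighted norm at most `C`. -/
def NormLE (ν C : ℝ) (φ : PowerSeries ℝ) : Prop :=
  Summable (fun n => |coeff n φ| * ν ^ n) ∧ ∑' n, |coeff n φ| * ν ^ n ≤ C

variable {ν s : ℝ}

theorem NormLE.summable_norm {C : ℝ} {φ : PowerSeries ℝ} (h : NormLE ν C φ) (hs : |s| ≤ ν) :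
    Summable fun n => ‖coeff n φ * s ^ n‖ := by
  refine h.1.of_nonneg_of_le (fun n => norm_nonneg _) fun n => ?_
  rw [norm_mul, norm_pow, Real.norm_eq_abs, Real.norm_eq_abs]
  gcongr

/-- The sum of a power series. -/
def evalSeries (s : ℝ) (φ : PowerSeries ℝ) : ℝ := ∑' n, coeff n φ * s ^ n

theorem NormLE.mul (hν : 0 ≤ ν) {C D : ℝ} {φ ψ : PowerSeries ℝ} (hφ : NormLE ν C φ)
    (hψ : NormLE ν D ψ) : NormLE ν (C * D) (φ * ψ) := by
  have hφ' : Summable fun n => ‖|coeff n φ| * ν ^ n‖ := hφ.1.norm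
  have hψ' : Summable fun n => ‖|coeff n ψ| * ν ^ n‖ := hψ.1.norm
  have hS := summable_sum_mul_antidiagonal_of_summable_norm' hφ' hφ.1 hψ' hψ.1
  have hT := tsum_mul_tsum_eq_tsum_sum_antidiagonal_of_summable_norm hφ' hψ'
  have hle : ∀ n, |coeff n (φ * ψ)| * ν ^ n ≤
      ∑ x ∈ antidiagonal n, |coeff x.1 φ| * ν ^ x.1 * (|coeff x.2 ψ| * ν ^ x.2) := by
    intro n
    rw [coeff_mul]
    calc _ ≤ (∑ x ∈ antidiagonal n, |coeff x.1 φ * coeff x.2 ψ|) * ν ^ n := by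
          gcongr
          exact abs_sum_le_sum_abs _ _
      _ = _ := by
          rw [sum_mul]
          refine sum_congr rfl fun x hx => ?_
          rw [← HasAntidiagonal.mem_antidiagonal.1 hx, abs_mul, pow_add]
          ring
  have hsum : Summable fun n => |coeff n (φ * ψ)| * ν ^ n :=
    hS.of_nonneg_of_le (fun n => by positivity) hle
  refine ⟨hsum, (hsum.tsum_le_tsum hle hS).trans ?_⟩
  rw [← hT]
  have h1 : 0 ≤ ∑' n, |coeff n φ| * ν ^ n := tsum_nonneg fun n => by positivity
  have h2 : 0 ≤ ∑' n, |coeff n ψ| * ν ^ n := tsum_nonneg fun n => by positivity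
  exact mul_le_mul hφ.2 hψ.2 h2 (h1.trans hφ.2)

theorem evalSeries_mul {C D : ℝ} {φ ψ : PowerSeries ℝ} (hφ : NormLE ν C φ)
    (hψ : NormLE ν D ψ) (hs : |s| ≤ ν) :
    evalSeries s (φ * ψ) = evalSeries s φ * evalSeries s ψ := by
  rw [evalSeries, evalSeries, evalSeries, tsum_mul_tsum_eq_tsum_sum_antidiagonal_of_summable_norm
    (hφ.summable_norm hs) (hψ.summable_norm hs)]
  refine tsum_congr fun n => ?_
  rw [coeff_mul, sum_mul]
  refine sum_congr rfl fun x hx => ?_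
  rw [← HasAntidiagonal.mem_antidiagonal.1 hx, pow_add]
  ring

theorem normLE_one : NormLE ν 1 1 := by
  have h : ∀ n, n ≠ 0 → |coeff n (1 : PowerSeries ℝ)| * ν ^ n = 0 := by
    intro n hn; simp [coeff_one, hn]
  exact ⟨(hasSum_single 0 h).summable, by rw [tsum_eq_single 0 h]; simp⟩

theorem evalSeries_one : evalSeries s 1 = 1 := by
  rw [evalSeries, tsum_eq_single 0 (fun n hn => by simp [coeff_one, hn])]
  simp

theorem normLE_X : NormLE ν ν PowerSeries.X := by
  have h : ∀ n, n ≠ 1 → |coeff n (PowerSeries.X : PowerSeries ℝ)| * ν ^ n = 0 := by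
    intro n hn; simp [coeff_X, hn]
  exact ⟨(hasSum_single 1 h).summable, by rw [tsum_eq_single 1 h]; simp⟩

theorem evalSeries_X : evalSeries s PowerSeries.X = s := by
  rw [evalSeries, tsum_eq_single 1 (fun n hn => by simp [coeff_X, hn])]
  simp

theorem NormLE.pow (hν : 0 ≤ ν) {C : ℝ} {φ : PowerSeries ℝ} (hφ : NormLE ν C φ) (n : ℕ) :
    NormLE ν (C ^ n) (φ ^ n) := by
  induction n with
  | zero => simpa using normLE_one
  | succ n ih => rw [pow_succ, pow_succ]; exact ih.mul hν hφ

theorem evalSeries_pow (hν : 0 ≤ ν) {C : ℝ} {φ : PowerSeries ℝ} (hφ : NormLE ν C φ) (hs : |s| ≤ ν)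
    (n : ℕ) : evalSeries s (φ ^ n) = evalSeries s φ ^ n := by
  induction n with
  | zero => simpa using evalSeries_one
  | succ n ih => rw [pow_succ, pow_succ, evalSeries_mul (hφ.pow hν n) hφ hs, ih]

theorem normLE_monoSeries (hν : 0 ≤ ν) {κ : ℝ} {φ ψ : PowerSeries ℝ} (hφ : NormLE ν κ φ)
    (hψ : NormLE ν κ ψ) (a : ℕ × ℕ × ℕ) :
    NormLE ν (ν ^ a.1 * κ ^ a.2.1 * κ ^ a.2.2) (monoSeries φ ψ a) :=
  ((normLE_X.pow hν _).mul hν (hφ.pow hν _)).mul hν (hψ.pow hν _)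

theorem evalSeries_monoSeries (hν : 0 ≤ ν) {κ : ℝ} {φ ψ : PowerSeries ℝ} (hφ : NormLE ν κ φ)
    (hψ : NormLE ν κ ψ) (hs : |s| ≤ ν) (a : ℕ × ℕ × ℕ) :
    evalSeries s (monoSeries φ ψ a) =
      s ^ a.1 * evalSeries s φ ^ a.2.1 * evalSeries s ψ ^ a.2.2 := by
  rw [monoSeries, evalSeries_mul ((normLE_X.pow hν _).mul hν (hφ.pow hν _)) (hψ.pow hν _) hs,
    evalSeries_mul (normLE_X.pow hν _) (hφ.pow hν _) hs, evalSeries_pow hν normLE_X hs,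
    evalSeries_pow hν hφ hs, evalSeries_pow hν hψ hs, evalSeries_X]

/-- A bound for sums over exponents in a geometric situation. -/
theorem summable_pow_prod {x y : ℝ} (hx : 0 ≤ x) (hx1 : x < 1) (hy : 0 ≤ y) (hy1 : y < 1) :
    Summable fun a : ℕ × ℕ × ℕ => x ^ a.1 * (y ^ a.2.1 * y ^ a.2.2) := by
  have h1 := summable_geometric_of_lt_one hx hx1
  have h2 := summable_geometric_of_lt_one hy hy1
  exact h1.mul_of_nonneg (h2.mul_of_nonneg h2 (fun n => by positivity) fun n => by positivity)
    (fun n => by positivity) (fun n => by positivity)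

theorem coeff_monoSeries_eq_zero {φ ψ : PowerSeries ℝ} (hφ : PowerSeries.X ∣ φ)
    (hψ : PowerSeries.X ∣ ψ) {a : ℕ × ℕ × ℕ} {n : ℕ} (h : n < a.1 + a.2.1 + a.2.2) :
    coeff n (monoSeries φ ψ a) = 0 := by
  have : PowerSeries.X ^ (a.1 + a.2.1 + a.2.2) ∣ monoSeries φ ψ a := by
    rw [pow_add, pow_add]
    exact mul_dvd_mul (mul_dvd_mul dvd_rfl (pow_dvd_pow_of_dvd hφ _)) (pow_dvd_pow_of_dvd hψ _)
  exact X_pow_dvd_iff.1 this n h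

/-- Substitution of power series: the values of the substituted series are the sums of the
composed one. -/
theorem hasSum_substitution (hν : 0 ≤ ν) {κ M C : ℝ} (hκ : 0 ≤ κ) (hM : 0 ≤ M)
    (hMν : M * ν ≤ 1 / 2) (hMκ : M * κ ≤ 1 / 2)
    {φ ψ : PowerSeries ℝ} (hφ : NormLE ν κ φ) (hψ : NormLE ν κ ψ)
    {t : ℕ × ℕ × ℕ → ℝ × ℝ} (ht : ∀ a, ‖t a‖ ≤ C * M ^ (a.1 + a.2.1 + a.2.2)) (hs : |s| ≤ ν)
    {r : ℕ → ℝ × ℝ} (hr : ∀ n, HasSum (fun a => coeff n (monoSeries φ ψ a) • t a) (r n)) :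
    HasSum (fun a : ℕ × ℕ × ℕ =>
      (s ^ a.1 * evalSeries s φ ^ a.2.1 * evalSeries s ψ ^ a.2.2) • t a)
      (∑' n, s ^ n • r n) := by
  have hC : 0 ≤ C := by simpa using (norm_nonneg _).trans (ht 0)
  have hm := fun a => normLE_monoSeries hν hφ hψ a
  set g : (ℕ × ℕ × ℕ) × ℕ → ℝ × ℝ := fun x =>
    (coeff x.2 (monoSeries φ ψ x.1) * s ^ x.2) • t x.1
  have hrow : ∀ a, HasSum (fun n => g (a, n))
      ((s ^ a.1 * evalSeries s φ ^ a.2.1 * evalSeries s ψ ^ a.2.2) • t a) := by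
    intro a
    rw [← evalSeries_monoSeries hν hφ hψ hs]
    exact ((hm a).summable_norm hs).of_norm.hasSum.smul_const (t a)
  have hrown : ∀ a, Summable fun n => ‖g (a, n)‖ := by
    intro a
    simp only [g, norm_smul]
    exact ((hm a).summable_norm hs).mul_right _
  have hbound : ∀ a, ∑' n, ‖g (a, n)‖ ≤ C * ((1 / 2) ^ a.1 * ((1 / 2) ^ a.2.1 * (1 / 2) ^ a.2.2)) := by
    intro a
    have h1 : ∑' n, ‖g (a, n)‖ ≤ (ν ^ a.1 * κ ^ a.2.1 * κ ^ a.2.2) * ‖t a‖ := by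
      simp only [g, norm_smul]
      rw [tsum_mul_right]
      refine mul_le_mul_of_nonneg_right ?_ (norm_nonneg _)
      refine (((hm a).summable_norm hs).tsum_le_tsum (fun n => ?_) (hm a).1).trans (hm a).2
      rw [norm_mul, norm_pow, Real.norm_eq_abs, Real.norm_eq_abs]
      gcongr
    refine h1.trans ?_
    calc _ ≤ (ν ^ a.1 * κ ^ a.2.1 * κ ^ a.2.2) * (C * M ^ (a.1 + a.2.1 + a.2.2)) := by
          gcongr; exact ht a
      _ = C * ((M * ν) ^ a.1 * ((M * κ) ^ a.2.1 * (M * κ) ^ a.2.2)) := by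
          rw [pow_add, pow_add, mul_pow, mul_pow, mul_pow]; ring
      _ ≤ _ := by gcongr
  have hsum : Summable fun x => ‖g x‖ := by
    rw [summable_prod_of_nonneg fun x => norm_nonneg _]
    refine ⟨hrown, ?_⟩
    refine Summable.of_nonneg_of_le (fun a => tsum_nonneg fun n => norm_nonneg _) hbound ?_
    exact (summable_pow_prod (by norm_num) (by norm_num) (by norm_num) (by norm_num)).mul_left C
  have h1 : HasSum (fun a : ℕ × ℕ × ℕ =>
      (s ^ a.1 * evalSeries s φ ^ a.2.1 * evalSeries s ψ ^ a.2.2) • t a) (∑' x, g x) :=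
    hsum.of_norm.hasSum.prod_fiberwise hrow
  have h2 : HasSum (fun n => s ^ n • r n) (∑' x, g x) := by
    have hsw : HasSum (fun x : ℕ × (ℕ × ℕ × ℕ) => g (x.2, x.1)) (∑' x, g x) :=
      (Equiv.prodComm ℕ (ℕ × ℕ × ℕ)).hasSum_iff.2 hsum.of_norm.hasSum
    refine hsw.prod_fiberwise fun n => ?_
    have := (hr n).const_smul (s ^ n)
    refine this.congr_fun ?_ 
    intro a
    simp only [g, smul_smul, mul_comm]
  rw [h2.tsum_eq]
  exact h1

variable {P : Type} [NormedAddCommGroup P] [NormedSpace ℝ P]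

/-- The formal solution satisfies the equation coefficientwise. -/
theorem hasSum_coeff_solSeries {Th : ℕ × ℕ × ℕ → P → ℝ × ℝ} {ϱ : P → ℝ}
    (hu : ∀ n p, IsUnit (coeffOp Th ϱ n p)) (h0 : ∀ p, Th 0 p = 0) (n : ℕ) (p : P) :
    HasSum (fun a => coeff n (monoSeries (PowerSeries.mk fun n => (solCoeff Th ϱ n p).1)
      (PowerSeries.mk fun n => (solCoeff Th ϱ n p).2) a) • Th a p)
      ((ϱ p * n) • solCoeff Th ϱ n p) := by
  set φ : PowerSeries ℝ := PowerSeries.mk fun n => (solCoeff Th ϱ n p).1 with hφdef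
  set ψ : PowerSeries ℝ := PowerSeries.mk fun n => (solCoeff Th ϱ n p).2 with hψdef
  have hφ : PowerSeries.X ∣ φ := by
    rw [X_dvd_iff, ← coeff_zero_eq_constantCoeff_apply, coeff_mk, solCoeff_zero]; rfl
  have hψ : PowerSeries.X ∣ ψ := by
    rw [X_dvd_iff, ← coeff_zero_eq_constantCoeff_apply, coeff_mk, solCoeff_zero]; rfl
  have hmap : ∀ a, coeff n (monoSeries (solSeries₁ Th ϱ) (solSeries₂ Th ϱ) a) p =
      coeff n (monoSeries φ ψ a) := by
    intro a
    have e1 : φ = PowerSeries.map (Pi.evalRingHom (fun _ : P => ℝ) p) (solSeries₁ Th ϱ) := by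
      ext j; simp [φ, solSeries₁]
    have e2 : ψ = PowerSeries.map (Pi.evalRingHom (fun _ : P => ℝ) p) (solSeries₂ Th ϱ) := by
      ext j; simp [ψ, solSeries₂]
    have e3 : monoSeries φ ψ a = PowerSeries.map (Pi.evalRingHom (fun _ : P => ℝ) p)
        (monoSeries (solSeries₁ Th ϱ) (solSeries₂ Th ϱ) a) := by
      rw [monoSeries, monoSeries, e1, e2]; simp
    rw [e3, coeff_map]; rfl
  set S : Finset (ℕ × ℕ × ℕ) := insert (0, 1, 0) (insert (0, 0, 1) (higherIdx n)) with hS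
  have hsupp : ∀ a ∉ S, coeff n (monoSeries φ ψ a) • Th a p = 0 := by
    rintro ⟨a, b, c⟩ ha
    by_cases hdeg : 2 ≤ 2 * a + b + c
    · rw [coeff_monoSeries_eq_zero hφ hψ, zero_smul]
      by_contra! hle
      refine ha (Finset.mem_insert_of_mem (Finset.mem_insert_of_mem ?_))
      simp only [higherIdx, mem_filter, mem_product, Finset.mem_range]
      simp only at hle
      omega
    · have : (a = 0 ∧ b = 0 ∧ c = 0) ∨ (a = 0 ∧ b = 1 ∧ c = 0) ∨ (a = 0 ∧ b = 0 ∧ c = 1) := by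
        omega
      rcases this with ⟨rfl, rfl, rfl⟩ | ⟨rfl, rfl, rfl⟩ | ⟨rfl, rfl, rfl⟩
      · rw [show ((0, 0, 0) : ℕ × ℕ × ℕ) = 0 from rfl, h0, smul_zero]
      · exact absurd (by simp [S]) ha
      · exact absurd (by simp [S]) ha
  have hval : ∑ a ∈ S, coeff n (monoSeries φ ψ a) • Th a p = (ϱ p * n) • solCoeff Th ϱ n p := by
    have hn1 : ((0, 1, 0) : ℕ × ℕ × ℕ) ∉ insert ((0, 0, 1) : ℕ × ℕ × ℕ) (higherIdx n) := by
      simp [higherIdx]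
    have hn2 : ((0, 0, 1) : ℕ × ℕ × ℕ) ∉ higherIdx n := by simp [higherIdx]
    have hrec : coeffOp Th ϱ n p (solCoeff Th ϱ n p) =
        ∑ a ∈ higherIdx n, coeff n (monoSeries φ ψ a) • Th a p := by
      rw [solCoeff_eq, ← mul_apply_eq_comp, Ring.mul_inverse_cancel _ (hu n p),
        one_apply_eq_self, higherCoeff]
      exact sum_congr rfl fun a _ => by rw [hmap]
    rw [sum_insert hn1, sum_insert hn2, ← hrec]
    simp only [monoSeries, coeffOp, linPart, φ, ψ]
    simp
    abel
  rw [← hval]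
  exact hasSum_sum_of_ne_finset_zero hsupp

end Convergence

/-! ### Power series with coefficients in `ℓ¹` -/

section EllOne

/-- Absolutely summable sequences. -/
abbrev Ell1 (F : Type) [NormedAddCommGroup F] : Type := lp (fun _ : ℕ => F) 1

variable {F : Type} [NormedAddCommGroup F] [NormedSpace ℂ F] [CompleteSpace F]

/-- The sum `∑ sⁿ xₙ`, as an operator on sequences. -/
def powEval (F : Type) [NormedAddCommGroup F] [NormedSpace ℂ F] (s : ℂ) : Ell1 F →L[ℂ] F :=
  ∑' n : ℕ, s ^ n • (lp.evalCLM ℂ (fun _ : ℕ => F) 1 n)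

theorem norm_evalCLM_le (n : ℕ) : ‖(lp.evalCLM ℂ (fun _ : ℕ => F) 1 n)‖ ≤ 1 :=
  ContinuousLinearMap.opNorm_le_bound _ zero_le_one fun x => by
    rw [one_mul]
    exact lp.norm_apply_le_norm (by simp) x n

theorem norm_powEval_term_le (s : ℂ) (n : ℕ) :
    ‖s ^ n • (lp.evalCLM ℂ (fun _ : ℕ => F) 1 n)‖ ≤ ‖s‖ ^ n := by
  rw [norm_smul, norm_pow]
  exact mul_le_of_le_one_right (by positivity) (norm_evalCLM_le n)

theorem hasSum_powEval {s : ℂ} (hs : ‖s‖ < 1) (x : Ell1 F) :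
    HasSum (fun n : ℕ => s ^ n • x n) (powEval F s x) := by
  have h : Summable fun n : ℕ => s ^ n • (lp.evalCLM ℂ (fun _ : ℕ => F) 1 n) :=
    Summable.of_norm_bounded (summable_geometric_of_lt_one (norm_nonneg s) hs)
      (norm_powEval_term_le s)
  have h' := h.hasSum.mapL (ContinuousLinearMap.apply ℂ F x : (Ell1 F →L[ℂ] F) →L[ℂ] F)
  exact h'

theorem differentiableOn_powEval : DifferentiableOn ℂ (powEval F) (Metric.ball 0 1) := by
  intro s hs
  rw [mem_ball_zero_iff] at hs
  obtain ⟨ρ, h1, h2⟩ := exists_between hs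
  have hρ : 0 ≤ ρ := (norm_nonneg s).trans h1.le
  have := Complex.differentiableOn_tsum_of_summable_norm (summable_geometric_of_lt_one hρ h2)
    (F := fun (n : ℕ) (s : ℂ) => s ^ n • (lp.evalCLM ℂ (fun _ : ℕ => F) 1 n))
    (U := Metric.ball 0 ρ) (fun n => by fun_prop) Metric.isOpen_ball (fun n w hw => by
      rw [mem_ball_zero_iff] at hw
      exact (norm_powEval_term_le w n).trans (by gcongr))
  exact (this.differentiableAt (Metric.isOpen_ball.mem_nhds
    (mem_ball_zero_iff.2 h1))).differentiableWithinAt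

theorem contDiffOn_powEval : ContDiffOn ℝ ∞ (powEval F) (Metric.ball 0 1) :=
  (differentiableOn_powEval.contDiffOn Metric.isOpen_ball).restrict_scalars ℝ

end EllOne

/-! ### Solutions of the singular equation with smooth parameters -/

section SingularSolution

open Finset PowerSeries

variable {P : Type} [NormedAddCommGroup P] [NormedSpace ℝ P]

/-- Termwise differentiation of a power series. -/
theorem tsum_smul_hasDerivAt {b : ℕ → ℝ × ℝ} {ν₀ ν κ : ℝ} (hν : 0 < ν) (hν₀ : ν < ν₀)
    (hb : ∀ n, ‖b n‖ ≤ κ / ν₀ ^ n) {s : ℝ} (hs : |s| < ν) :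
    HasDerivAt (fun s : ℝ => ∑' n : ℕ, s ^ n • b n) (∑' n : ℕ, ((n : ℝ) * s ^ (n - 1)) • b n) s := by
  have hν₀0 : 0 < ν₀ := hν.trans hν₀
  have hκ : 0 ≤ κ := by simpa using (norm_nonneg _).trans (hb 0)
  have hq : ν / ν₀ < 1 := by rwa [div_lt_one hν₀0]
  have hu : Summable fun n : ℕ => (n : ℝ) ^ 1 * (ν / ν₀) ^ n * (κ / ν) :=
    (summable_pow_mul_geometric_of_norm_lt_one (R := ℝ) (r := ν / ν₀) 1
      (by rw [Real.norm_of_nonneg (div_nonneg hν.le hν₀0.le)]; exact hq)).mul_right (κ / ν)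
  have h1 : ∀ (n : ℕ) (y : ℝ), y ∈ Metric.ball (0 : ℝ) ν →
      HasDerivAt (fun y : ℝ => y ^ n • b n) (((n : ℝ) * y ^ (n - 1)) • b n) y :=
    fun n y _ => (hasDerivAt_pow n y).smul_const (b n)
  have h2 : ∀ (n : ℕ) (y : ℝ), y ∈ Metric.ball (0 : ℝ) ν →
      ‖((n : ℝ) * y ^ (n - 1)) • b n‖ ≤ (n : ℝ) ^ 1 * (ν / ν₀) ^ n * (κ / ν) := by
    intro n y hy
    rw [mem_ball_zero_iff, Real.norm_eq_abs] at hy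
    rw [norm_smul, norm_mul, norm_pow, Real.norm_natCast, Real.norm_eq_abs]
    rcases Nat.eq_zero_or_pos n with rfl | hn
    · simp
    · calc _ ≤ (n : ℝ) * ν ^ (n - 1) * (κ / ν₀ ^ n) := by
            gcongr
            exact hb n
        _ = _ := by
            have : ν ^ n = ν ^ (n - 1) * ν := by rw [← pow_succ]; congr 1; omega
            rw [div_pow, this, pow_one]
            field_simp
  have h3 : Summable fun n : ℕ => (0 : ℝ) ^ n • b n :=
    summable_of_ne_finset_zero (s := {0}) fun n hn => by
      have : n ≠ 0 := by simpa using hn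
      simp [this]
  exact hasDerivAt_tsum_of_isPreconnected hu Metric.isOpen_ball
    (convex_ball (0 : ℝ) ν).isPreconnected h1 h2 (Metric.mem_ball_self hν) h3 (by simpa using hs)

/-- The embedding of pairs of reals in pairs of complex numbers. -/
def castPair : ℝ × ℝ →L[ℝ] ℂ × ℂ := Complex.ofRealCLM.prodMap Complex.ofRealCLM

@[simp] theorem castPair_apply (x : ℝ × ℝ) : castPair x = ((x.1 : ℂ), (x.2 : ℂ)) := rfl

theorem norm_castPair_le : ‖castPair‖ ≤ 1 := by
  refine ContinuousLinearMap.opNorm_le_bound _ zero_le_one fun x => ?_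
  simp [Prod.norm_def]

/-- A sequence of smooth functions, with suitable bounds on all derivatives, is a smooth function
with values in sequences. -/
theorem exists_ell1_of_bounds {F : Type} [NormedAddCommGroup F] [NormedSpace ℂ F] [CompleteSpace F]
    {b : ℕ → P → F} (hb : ∀ n, ContDiff ℝ ∞ (b n)) {ν₀ ν : ℝ} (hν : 0 < ν) (hν₀ : ν < ν₀)
    (hbd : ∀ k : ℕ, ∃ C, 0 ≤ C ∧ ∀ (n : ℕ) (p : P),
        ‖iteratedFDeriv ℝ k (b n) p‖ ≤ C * (n + 1) ^ k / ν₀ ^ n) :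
    ∃ c : P → Ell1 F, ContDiff ℝ ∞ c ∧ ∀ p n, c p n = ν ^ n • b n p := by
  have hν₀0 : 0 < ν₀ := hν.trans hν₀
  have hq : ν / ν₀ < 1 := by rwa [div_lt_one hν₀0]
  choose C hC0 hC using hbd
  let L : ℕ → F →L[ℝ] Ell1 F := fun n => lp.singleContinuousLinearMap ℝ (fun _ : ℕ => F) 1 n
  have hL : ∀ n, ‖L n‖ ≤ 1 := fun n =>
    ContinuousLinearMap.opNorm_le_bound _ zero_le_one fun x => by
      rw [one_mul]
      exact (lp.norm_single (E := fun _ : ℕ => F) (p := 1) (by simp) n x).le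
  let u : ℕ → ℕ → ℝ := fun k n => C k * (((n + 1 : ℕ) : ℝ) ^ k * (ν / ν₀) ^ n)
  have hu : ∀ k, Summable (u k) := by
    intro k
    have h := summable_pow_mul_geometric_of_norm_lt_one (r := ν / ν₀) k
      (by rw [Real.norm_of_nonneg (by positivity)]; exact hq)
    have h' := ((summable_nat_add_iff 1).2 h).mul_left (C k * (ν / ν₀)⁻¹)
    refine h'.congr fun n => ?_
    simp only [u]
    have : ν / ν₀ ≠ 0 := by positivity
    rw [pow_succ]
    field_simp
  have hsm : ∀ n, ContDiff ℝ ∞ fun p => (ν ^ n • L n) (b n p) := fun n =>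
    (ν ^ n • L n).contDiff.comp (hb n)
  have hle : ∀ (k n : ℕ) (p : P), (k : ℕ∞) ≤ ⊤ →
      ‖iteratedFDeriv ℝ k (fun p => (ν ^ n • L n) (b n p)) p‖ ≤ u k n := by
    intro k n p _
    have h := (ν ^ n • L n).norm_iteratedFDeriv_comp_left (f := b n) (x := p) (n := k)
      (N := ∞) (hb n).contDiffAt (by exact_mod_cast le_top)
    refine h.trans ?_
    have h2 : ‖ν ^ n • L n‖ ≤ ν ^ n := by
      rw [norm_smul, norm_pow, Real.norm_of_nonneg hν.le]
      exact mul_le_of_le_one_right (by positivity) (hL n)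
    calc _ ≤ ν ^ n * (C k * (n + 1) ^ k / ν₀ ^ n) := by
          gcongr
          exact hC k n p
      _ = u k n := by simp only [u]; push_cast; rw [div_pow]; ring
  have hsmooth := contDiff_tsum (N := ⊤) hsm (fun k _ => hu k) hle
  refine ⟨_, hsmooth, fun p n => ?_⟩
  have hsum : Summable fun n => (ν ^ n • L n) (b n p) := by
    refine Summable.of_norm_bounded (hu 0) fun n => ?_
    have := hle 0 n p le_top
    rwa [norm_iteratedFDeriv_zero] at this
  have h1 := hsum.hasSum.mapL (lp.evalCLM ℝ (fun _ : ℕ => F) 1 n)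
  have h2 : HasSum (fun j => lp.evalCLM ℝ (fun _ : ℕ => F) 1 n ((ν ^ j • L j) (b j p)))
      (ν ^ n • b n p) := by
    have h3 : lp.evalCLM ℝ (fun _ : ℕ => F) 1 n ((ν ^ n • L n) (b n p)) = ν ^ n • b n p := by
      change (ν ^ n • lp.single 1 n (b n p) : Ell1 F) n = _
      rw [lp.coeFn_smul, Pi.smul_apply, lp.single_apply_self]
    rw [← h3]
    refine hasSum_single n fun j hj => ?_
    have h4 : (lp.single 1 j (b j p) : Ell1 F) n = 0 :=
      lp.single_apply_ne (E := fun _ : ℕ => F) 1 j (b j p) hj.symm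
    change ν ^ j • (lp.single 1 j (b j p) : Ell1 F) n = 0
    rw [h4, smul_zero]
  exact h1.unique h2

/-- The equation `ρ s v' = Θ(s, v)` has a solution `v` that vanishes at `s = 0`, is holomorphic in
`s` and smooth in the parameter, on a disc that does not depend on the parameter. -/
theorem exists_singular_solution {Th : ℕ × ℕ × ℕ → P → ℝ × ℝ} {ϱ : P → ℝ}
    (hTh : ∀ a, ContDiff ℝ ∞ (Th a)) (hϱ : ContDiff ℝ ∞ ϱ)
    (hu : ∀ n p, IsUnit (coeffOp Th ϱ n p)) {M K κ₀ : ℝ} (hM : 0 < M) (hK : 0 < K) (hκ₀ : 0 < κ₀)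
    (hI : ∀ n p, ‖Ring.inverse (coeffOp Th ϱ n p)‖ ≤ K)
    (hT : ∀ k : ℕ, ∃ C, ∀ (a : ℕ × ℕ × ℕ) (p : P),
      ‖iteratedFDeriv ℝ k (Th a) p‖ ≤ C * M ^ (a.1 + a.2.1 + a.2.2))
    (hR : ∀ k : ℕ, ∃ C, ∀ p, ‖iteratedFDeriv ℝ k ϱ p‖ ≤ C) (h0 : ∀ p, Th 0 p = 0) :
    ∃ (ν : ℝ) (W : ℂ × P → ℂ × ℂ) (w : ℝ → P → ℝ × ℝ), 0 < ν ∧ ν ≤ κ₀ ∧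
      ContDiffOn ℝ ∞ W (Metric.ball 0 ν ×ˢ Set.univ) ∧
      (∀ p, DifferentiableOn ℂ (fun s => W (s, p)) (Metric.ball 0 ν)) ∧
      (∀ s p, |s| < ν → W ((s : ℂ), p) = (((w s p).1 : ℂ), ((w s p).2 : ℂ))) ∧
      (∀ s p, |s| < ν → ‖w s p‖ ≤ κ₀) ∧
      ∀ s p, |s| < ν → ∃ w' : ℝ × ℝ, HasDerivAt (fun s => w s p) w' s ∧
        HasSum (fun a : ℕ × ℕ × ℕ => (s ^ a.1 * (w s p).1 ^ a.2.1 * (w s p).2 ^ a.2.2) • Th a p)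
          ((ϱ p * s) • w') := by
  obtain ⟨ν₀, κ, hν₀, hκ, hκκ, hMκ, hνκ, hMν, hS, hbd⟩ :=
    exists_bounds_solCoeff hTh hϱ hu hM hK hκ₀ hI hT hR
  set ν := ν₀ / 2 with hνdef
  have hν : 0 < ν := by positivity
  have hlt : ν < ν₀ := by rw [hνdef]; linarith
  obtain ⟨CT, hCT⟩ := hT 0
  have hbsm : ∀ n, ContDiff ℝ ∞ fun p => castPair (solCoeff Th ϱ n p) := fun n =>
    castPair.contDiff.comp (contDiff_solCoeff hTh hϱ hu n)
  obtain ⟨c, hc, hcn⟩ := exists_ell1_of_bounds (b := fun n p => castPair (solCoeff Th ϱ n p))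
    hbsm hν hlt (fun k => by
      obtain ⟨C, hC0, hC⟩ := hbd k
      refine ⟨C, hC0, fun n p => le_trans ?_ (hC n p)⟩
      have h := castPair.norm_iteratedFDeriv_comp_left (f := solCoeff Th ϱ n) (x := p) (n := k)
        (N := ∞) (contDiff_solCoeff hTh hϱ hu n).contDiffAt (by exact_mod_cast le_top)
      exact h.trans (mul_le_of_le_one_left (norm_nonneg _) norm_castPair_le))
  have hsolb : ∀ n p, ‖solCoeff Th ϱ n p‖ ≤ κ / ν₀ ^ n := by
    intro n p
    rw [le_div_iff₀ (by positivity), mul_comm]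
    exact (single_le_sum (f := fun n => ν₀ ^ n * ‖solCoeff Th ϱ n p‖) (fun i _ => by positivity)
      (Finset.mem_range.2 (Nat.lt_succ_self n))).trans (hS (n + 1) p)
  have hsumN : ∀ p, Summable fun n => ν₀ ^ n * ‖solCoeff Th ϱ n p‖ := fun p =>
    summable_of_sum_range_le (fun n => by positivity) fun N => hS N p
  have htsumN : ∀ p, ∑' n, ν₀ ^ n * ‖solCoeff Th ϱ n p‖ ≤ κ := fun p =>
    Real.tsum_le_of_sum_range_le (fun n => by positivity) fun N => hS N p
  have hsumS : ∀ (s : ℝ) (p : P), |s| < ν → Summable fun n : ℕ => s ^ n • solCoeff Th ϱ n p := by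
    intro s p hs
    refine Summable.of_norm_bounded (hsumN p) fun n => ?_
    rw [norm_smul, norm_pow, Real.norm_eq_abs]
    gcongr
    exact hs.le.trans hlt.le
  set w : ℝ → P → ℝ × ℝ := fun s p => ∑' n : ℕ, s ^ n • solCoeff Th ϱ n p with hw
  set W : ℂ × P → ℂ × ℂ := fun x => powEval (ℂ × ℂ) (x.1 / ν) (c x.2) with hW
  have hmaps : ∀ s ∈ Metric.ball (0 : ℂ) ν, s / ν ∈ Metric.ball (0 : ℂ) 1 := by
    intro s hs
    rw [mem_ball_zero_iff] at hs ⊢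
    rw [norm_div, Complex.norm_real, Real.norm_of_nonneg hν.le, div_lt_one hν]
    exact hs
  refine ⟨ν, W, w, hν, hlt.le.trans hνκ, ?_, ?_, ?_, ?_, ?_⟩
  · have h1 : ContDiffOn ℝ ∞ (fun x : ℂ × P => powEval (ℂ × ℂ) (x.1 / ν))
        (Metric.ball 0 ν ×ˢ Set.univ) :=
      contDiffOn_powEval.comp (by fun_prop) fun x hx => hmaps _ hx.1
    have h2 : ContDiffOn ℝ ∞ (fun x : ℂ × P => c x.2) (Metric.ball 0 ν ×ˢ Set.univ) :=
      (hc.comp contDiff_snd).contDiffOn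
    have hB : ContDiff ℝ ∞ fun q : (Ell1 (ℂ × ℂ) →L[ℂ] ℂ × ℂ) × Ell1 (ℂ × ℂ) => q.1 q.2 :=
      (isBoundedBilinearMap_apply (𝕜 := ℂ) (E := Ell1 (ℂ × ℂ)) (F := ℂ × ℂ)).contDiff.restrict_scalars
        ℝ
    exact hB.comp_contDiffOn (h1.prodMk h2)
  · intro p
    have h1 : DifferentiableOn ℂ (fun s : ℂ => powEval (ℂ × ℂ) (s / ν)) (Metric.ball 0 ν) :=
      DifferentiableOn.comp (g := powEval (ℂ × ℂ)) (t := Metric.ball 0 1) differentiableOn_powEval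
        (by fun_prop) hmaps
    exact h1.clm_apply (differentiableOn_const (c p))
  · intro s p hs
    have hs' : ‖((s : ℂ) / ν)‖ < 1 := by
      simpa using hmaps (s : ℂ) (by simpa using hs)
    have h1 := hasSum_powEval hs' (c p)
    have h2 := (hsumS s p hs).hasSum.mapL castPair
    have h3 : (fun n : ℕ => ((s : ℂ) / ν) ^ n • c p n) =
        fun n : ℕ => castPair (s ^ n • solCoeff Th ϱ n p) := by
      funext n
      rw [hcn]
      have : (ν : ℂ) ≠ 0 := by exact_mod_cast hν.ne'
      ext <;> simp [div_pow] <;> field_simp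
    rw [h3] at h1
    exact h1.unique h2
  · intro s p hs
    refine (tsum_of_norm_bounded ((hsumN p).hasSum) fun n => ?_).trans ((htsumN p).trans hκκ)
    rw [norm_smul, norm_pow, Real.norm_eq_abs]
    gcongr
    exact hs.le.trans hlt.le
  · intro s p hs
    refine ⟨_, tsum_smul_hasDerivAt hν hlt (fun n => hsolb n p) hs, ?_⟩
    have hn : ∀ (L : ℝ × ℝ →L[ℝ] ℝ), ‖L‖ ≤ 1 →
        NormLE ν₀ κ (PowerSeries.mk fun n => L (solCoeff Th ϱ n p)) := by
      intro L hL
      have hle : ∀ n, |coeff n (PowerSeries.mk fun n => L (solCoeff Th ϱ n p))| * ν₀ ^ n ≤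
          ν₀ ^ n * ‖solCoeff Th ϱ n p‖ := by
        intro n
        rw [coeff_mk, mul_comm]
        gcongr
        exact (L.le_opNorm _).trans (mul_le_of_le_one_left (norm_nonneg _) hL)
      have hsum := (hsumN p).of_nonneg_of_le (fun n => by positivity) hle
      exact ⟨hsum, (hsum.tsum_le_tsum hle (hsumN p)).trans (htsumN p)⟩
    have hev : ∀ L : ℝ × ℝ →L[ℝ] ℝ,
        evalSeries s (PowerSeries.mk fun n => L (solCoeff Th ϱ n p)) = L (w s p) := by
      intro L
      rw [evalSeries, hw, L.map_tsum (hsumS s p hs)]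
      refine tsum_congr fun n => ?_
      rw [coeff_mk, map_smul, smul_eq_mul, mul_comm]
    have key := hasSum_substitution hν₀.le hκ.le hM.le hMν hMκ
      (hn _ (ContinuousLinearMap.norm_fst_le ℝ ℝ ℝ)) (hn _ (ContinuousLinearMap.norm_snd_le ℝ ℝ ℝ))
      (t := fun a => Th a p) (C := CT)
      (fun a => by simpa using hCT a p) (hs.le.trans hlt.le)
      (fun n => hasSum_coeff_solSeries hu h0 n p)
    rw [hev, hev] at key
    -- `s * ∑ n s ^ (n - 1) vₙ = ∑ n s ^ n vₙ`, where the term `n = 0` vanishes on both sides.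
    suffices hfin : (ϱ p * s) • ∑' n : ℕ, ((n : ℝ) * s ^ (n - 1)) • solCoeff Th ϱ n p =
        ∑' n : ℕ, s ^ n • (ϱ p * (n : ℝ)) • solCoeff Th ϱ n p by
      rw [hfin]
      exact key
    rw [← tsum_const_smul'']
    refine tsum_congr fun n => ?_
    rcases Nat.eq_zero_or_pos n with rfl | hn
    · simp
    · have : s ^ n = s ^ (n - 1) * s := by rw [← pow_succ]; congr 1; omega
      rw [smul_smul, smul_smul, this]
      congr 1
      ring

end SingularSolution

section

set_option maxSynthPendingDepth 5

/-! ### Functions that are holomorphic in some variables and smooth in the others -/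

section SmoothHol

variable {A B F F' : Type} [NormedAddCommGroup A] [NormedSpace ℂ A]
  [NormedAddCommGroup B] [NormedSpace ℂ B]
  [NormedAddCommGroup F] [NormedSpace ℂ F] [NormedAddCommGroup F'] [NormedSpace ℂ F']
  {E E' X : Type} [NormedAddCommGroup E] [NormedSpace ℝ E]
  [NormedAddCommGroup E'] [NormedSpace ℝ E'] [NormedAddCommGroup X] [NormedSpace ℝ X]

/-- A real derivative that commutes with multiplication by `I` is a complex derivative. -/
theorem differentiableAt_complex_of_hasFDerivAt {φ : A → F} {L : A →L[ℝ] F} {a : A}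
    (h : HasFDerivAt φ L a) (hL : ∀ b, L (Complex.I • b) = Complex.I • L b) :
    DifferentiableAt ℂ φ a := by
  let L' : A →L[ℂ] F :=
    { toFun := L
      map_add' := L.map_add
      map_smul' := fun c b => by
        have hr : ∀ (x : ℝ) (b : A), L ((x : ℂ) • b) = (x : ℂ) • L b := fun x b => by
          rw [Complex.coe_smul, Complex.coe_smul, L.map_smul]
        rw [RingHom.id_apply, ← Complex.re_add_im c, add_smul, add_smul, mul_smul, mul_smul,
          L.map_add, hr, hr, hL]
      cont := L.continuous }
  exact (HasFDerivAt.of_isLittleO h.isLittleO : HasFDerivAt φ L' a).differentiableAt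

/-- Along a complex direction in which `f` is holomorphic, its derivative is complex linear. -/
theorem fderiv_apply_I_smul {f : X → F} {ι : A → X} {j : A →L[ℝ] X} {a : A}
    (hf : DifferentiableAt ℝ f (ι a)) (hι : HasFDerivAt ι j a)
    (h : DifferentiableAt ℂ (fun a => f (ι a)) a) (b : A) :
    fderiv ℝ f (ι a) (j (Complex.I • b)) = Complex.I • fderiv ℝ f (ι a) (j b) := by
  have h1 : HasFDerivAt (fun a => f (ι a)) ((fderiv ℝ f (ι a)).comp j) a :=
    hf.hasFDerivAt.comp a hι
  have h2 := h1.unique (h.hasFDerivAt.restrictScalars ℝ)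
  have h3 := fun b => congrArg (fun L : A →L[ℝ] F => L b) h2
  simp only [ContinuousLinearMap.comp_apply, ContinuousLinearMap.coe_restrictScalars'] at h3
  rw [h3, h3, map_smul]

/-- `g (w, q)` is smooth on `O` and holomorphic in `w`. -/
structure SmoothHol (g : A × E → F) (O : Set (A × E)) : Prop where
  smooth : ContDiffOn ℝ ∞ g O
  hol : ∀ w q, (w, q) ∈ O → DifferentiableAt ℂ (fun w => g (w, q)) w

variable {g : A × E → F} {O : Set (A × E)}

theorem SmoothHol.fderiv_I_smul (h : SmoothHol g O) (hO : IsOpen O) {v : A × E} (hv : v ∈ O)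
    (a : A) : fderiv ℝ g v (Complex.I • a, 0) = Complex.I • fderiv ℝ g v (a, 0) :=
  fderiv_apply_I_smul (ι := fun w : A => (w, v.2)) (j := ContinuousLinearMap.inl ℝ A E) (a := v.1)
    ((h.smooth.contDiffAt (hO.mem_nhds hv)).differentiableAt (by simp))
    (hasFDerivAt_prodMk_left v.1 v.2) (h.hol _ _ hv) a

theorem SmoothHol.of_fderiv (hO : IsOpen O) (h : ContDiffOn ℝ ∞ g O)
    (hI : ∀ v ∈ O, ∀ a : A, fderiv ℝ g v (Complex.I • a, 0) = Complex.I • fderiv ℝ g v (a, 0)) :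
    SmoothHol g O :=
  ⟨h, fun w q hv => differentiableAt_complex_of_hasFDerivAt
    (((h.contDiffAt (hO.mem_nhds hv)).differentiableAt (by simp)).hasFDerivAt.comp w
      (hasFDerivAt_prodMk_left w q)) fun b => hI _ hv b⟩

/-- For a smooth function it suffices to check holomorphy on a dense set. -/
theorem SmoothHol.of_dense (hO : IsOpen O) (h : ContDiffOn ℝ ∞ g O) {D : Set (A × E)}
    (hD : Dense D) (hol : ∀ w q, (w, q) ∈ O ∩ D → DifferentiableAt ℂ (fun w => g (w, q)) w) :
    SmoothHol g O := by
  refine SmoothHol.of_fderiv hO h fun v hv a => ?_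
  have hc : ContinuousAt (fun v => fderiv ℝ g v (Complex.I • a, 0) -
      Complex.I • fderiv ℝ g v (a, 0)) v := by
    have := (h.continuousOn_fderiv_of_isOpen hO (by simp)).continuousAt (hO.mem_nhds hv)
    exact (this.clm_apply continuousAt_const).sub
      ((this.clm_apply continuousAt_const).const_smul Complex.I)
  by_contra hne
  have hne' := hc.eventually_ne (sub_ne_zero.2 hne)
  have hcl : v ∈ closure (O ∩ D) := hD.open_subset_closure_inter hO hv
  obtain ⟨x, hx, hxO⟩ := (mem_closure_iff_frequently.1 hcl).and_eventually hne' |>.exists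
  refine hxO (sub_eq_zero.2 ?_)
  exact fderiv_apply_I_smul (ι := fun w : A => (w, x.2)) (j := ContinuousLinearMap.inl ℝ A E)
    (a := x.1) ((h.contDiffAt (hO.mem_nhds hx.1)).differentiableAt (by simp))
    (hasFDerivAt_prodMk_left x.1 x.2) (hol _ _ hx) a

theorem SmoothHol.mono {O' : Set (A × E)} (h : SmoothHol g O) (hO : O' ⊆ O) : SmoothHol g O' :=
  ⟨h.smooth.mono hO, fun w q hv => h.hol w q (hO hv)⟩

/-- Substitution of holomorphic variables and of parameters. -/
theorem SmoothHol.subst (hg : SmoothHol g O) {φ : B × E' → A} {ψ : E' → E}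
    {O' : Set (B × E')} (hφ : SmoothHol φ O')
    (hψ : ContDiffOn ℝ ∞ (fun v : B × E' => ψ v.2) O') (hmaps : ∀ v ∈ O', (φ v, ψ v.2) ∈ O) :
    SmoothHol (fun v => g (φ v, ψ v.2)) O' :=
  ⟨hg.smooth.comp (hφ.smooth.prodMk hψ) hmaps, fun w q hv =>
    DifferentiableAt.comp (g := fun w => g (w, ψ q)) w (hg.hol _ _ (hmaps _ hv))
      (hφ.hol w q hv)⟩

theorem SmoothHol.prodMk {g' : A × E → F'} (h : SmoothHol g O) (h' : SmoothHol g' O) :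
    SmoothHol (fun v => (g v, g' v)) O :=
  ⟨h.smooth.prodMk h'.smooth, fun w q hv => (h.hol w q hv).prodMk (h'.hol w q hv)⟩

theorem SmoothHol.add {g' : A × E → F} (h : SmoothHol g O) (h' : SmoothHol g' O) :
    SmoothHol (fun v => g v + g' v) O :=
  ⟨h.smooth.add h'.smooth, fun w q hv => (h.hol w q hv).add (h'.hol w q hv)⟩

theorem SmoothHol.sub {g' : A × E → F} (h : SmoothHol g O) (h' : SmoothHol g' O) :
    SmoothHol (fun v => g v - g' v) O :=
  ⟨h.smooth.sub h'.smooth, fun w q hv => (h.hol w q hv).sub (h'.hol w q hv)⟩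

theorem SmoothHol.mul {g g' : A × E → ℂ} (h : SmoothHol g O) (h' : SmoothHol g' O) :
    SmoothHol (fun v => g v * g' v) O :=
  ⟨h.smooth.mul h'.smooth, fun w q hv => (h.hol w q hv).mul (h'.hol w q hv)⟩

theorem SmoothHol.div {g g' : A × E → ℂ} (h : SmoothHol g O) (h' : SmoothHol g' O)
    (h0 : ∀ v ∈ O, g' v ≠ 0) : SmoothHol (fun v => g v / g' v) O :=
  ⟨by
    simp only [div_eq_mul_inv]
    exact h.smooth.mul (h'.smooth.inv h0), fun w q hv => by
    simp only [div_eq_mul_inv]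
    exact (h.hol w q hv).mul (DifferentiableAt.inv (h'.hol w q hv) (h0 _ hv))⟩

theorem SmoothHol.param {ψ : E → F} (h : ContDiffOn ℝ ∞ (fun v : A × E => ψ v.2) O) :
    SmoothHol (fun v => ψ v.2) O :=
  ⟨h, fun _ q _ => differentiableAt_const (ψ q)⟩

theorem SmoothHol.clm (L : A →L[ℂ] F) : SmoothHol (fun v : A × E => L v.1) O :=
  ⟨((L.restrictScalars ℝ).contDiff.comp contDiff_fst).contDiffOn, fun _ _ _ => L.differentiableAt⟩

end SmoothHol

/-! ### Taylor coefficients as integrals over circles -/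

section Cauchy

variable {F : Type} [NormedAddCommGroup F] [NormedSpace ℂ F]
  {E : Type} [NormedAddCommGroup E] [NormedSpace ℝ E]

/-- The circle of radius `ρ`, parametrized by the unit interval. -/
def circ (ρ : ℝ) : C(UI, ℂ) :=
  ⟨fun k => circleMap 0 ρ (2 * Real.pi * k), by fun_prop⟩

theorem circ_apply (ρ : ℝ) (k : UI) : circ ρ k = circleMap 0 ρ (2 * Real.pi * k) := rfl

theorem norm_circ {ρ : ℝ} (hρ : 0 < ρ) (k : UI) : ‖circ ρ k‖ = ρ := by
  rw [circ_apply, norm_circleMap_zero, abs_of_pos hρ]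

/-- The `n`-th Taylor coefficient, in terms of the values on the circle of radius `ρ`. -/
def cauchyCoeff (F : Type) [NormedAddCommGroup F] [NormedSpace ℂ F] {ρ : ℝ} (hρ : 0 < ρ) (n : ℕ) :
    C(UI, F) →L[ℂ] F :=
  LinearMap.mkContinuous
    { toFun := fun η => meanCLM F ⟨fun k => (circ ρ k)⁻¹ ^ n • η k,
        (((circ ρ).continuous.inv₀ fun k => by
          rw [← norm_ne_zero_iff, norm_circ hρ]; exact hρ.ne').pow n).smul η.continuous⟩
      map_add' := fun η η' => by
        rw [← map_add]
        congr 1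
        ext k
        simp
      map_smul' := fun c η => by
        rw [RingHom.id_apply, meanCLM_apply, meanCLM_apply, ← intervalIntegral.integral_smul]
        congr 1
        ext σ
        simp only [ext01, ContinuousMap.coe_mk, ContinuousMap.smul_apply]
        rw [smul_comm] } ((ρ⁻¹) ^ n) (fun η => by
      refine ((meanCLM F).le_opNorm _).trans ?_
      refine (mul_le_of_le_one_left (norm_nonneg _) norm_meanCLM_le).trans ?_
      rw [ContinuousMap.norm_le _ (by positivity)]
      intro k
      rw [ContinuousMap.coe_mk, norm_smul, norm_pow, norm_inv, norm_circ hρ]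
      gcongr
      exact η.norm_coe_le_norm k)

theorem norm_cauchyCoeff_le {ρ : ℝ} (hρ : 0 < ρ) (n : ℕ) : ‖cauchyCoeff F hρ n‖ ≤ (ρ⁻¹) ^ n :=
  LinearMap.mkContinuous_norm_le _ (by positivity) _

/-- The Taylor expansion of a holomorphic function, in terms of its values on a circle. -/
theorem hasSum_cauchyCoeff [CompleteSpace F] {ρ ρ₀ : ℝ} (hρ : 0 < ρ) (hρ₀ : ρ < ρ₀) {f : ℂ → F}
    (hf : DifferentiableOn ℂ f (Metric.ball 0 ρ₀)) {η : C(UI, F)} (hη : ∀ k, η k = f (circ ρ k))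
    {z : ℂ} (hz : ‖z‖ < ρ) : HasSum (fun n : ℕ => z ^ n • cauchyCoeff F hρ n η) (f z) := by
  have hps := DifferentiableOn.hasFPowerSeriesOnBall (R := ρ.toNNReal) (c := 0) (f := f)
    (hf.mono (by
      rw [Real.coe_toNNReal _ hρ.le]
      exact Metric.closedBall_subset_ball hρ₀)) (by simpa using hρ)
  have hs := hps.hasSum (y := z) (by
    rw [Metric.mem_eball, edist_zero_right, ← ofReal_norm]
    rw [← ENNReal.ofReal]
    exact (ENNReal.ofReal_lt_ofReal_iff hρ).2 hz)
  rw [zero_add] at hs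
  convert hs using 2 with n
  rw [cauchyPowerSeries_apply, Real.coe_toNNReal _ hρ.le]
  have h1 : cauchyCoeff F hρ n η =
      ∫ σ in (0 : ℝ)..1, (circleMap 0 ρ (2 * Real.pi * σ))⁻¹ ^ n •
        f (circleMap 0 ρ (2 * Real.pi * σ)) :=
    meanCLM_eq _ _ fun k => by
      rw [ContinuousMap.coe_mk, hη]
      rfl
  have h2 := intervalIntegral.integral_comp_mul_left (a := 0) (b := 1) (c := 2 * Real.pi)
    (fun θ => (circleMap 0 ρ θ)⁻¹ ^ n • f (circleMap 0 ρ θ)) (by positivity)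
  rw [h1, h2, mul_zero, mul_one, circleIntegral, ← intervalIntegral.integral_smul,
    ← intervalIntegral.integral_smul, ← intervalIntegral.integral_smul]
  refine intervalIntegral.integral_congr fun θ _ => ?_
  have hne : circleMap 0 ρ θ ≠ 0 := circleMap_ne_center hρ.ne'
  simp only [deriv_circleMap, sub_zero, ← Complex.coe_smul, smul_smul]
  congr 1
  have hpi : (Real.pi : ℂ) ≠ 0 := by exact_mod_cast Real.pi_ne_zero
  push_cast
  rw [div_pow, inv_pow]
  field_simp

variable {P : Type} [NormedAddCommGroup P] [NormedSpace ℝ P]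

theorem fderiv_paramFun_I {K : Type} [TopologicalSpace K] [CompactSpace K] {A : Type}
    [NormedAddCommGroup A] [NormedSpace ℝ A] {O : Set (A × E)} (hO : IsOpen O) {Γ : A × E → F}
    (hΓ : ContDiffOn ℝ ∞ Γ O) {θ : C(K, A)} {x e e' : E} (hx : ∀ k, (θ k, x) ∈ O)
    (h : ∀ v ∈ O, fderiv ℝ Γ v (0, e') = Complex.I • fderiv ℝ Γ v (0, e)) :
    fderiv ℝ (paramFun Γ θ) x e' = Complex.I • fderiv ℝ (paramFun Γ θ) x e := by
  ext k
  rw [ContinuousMap.smul_apply, fderiv_paramFun_apply hO hΓ hx, fderiv_paramFun_apply hO hΓ hx,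
    h _ (hx k)]

/-- The Taylor expansion in the holomorphic variable of a function that also depends on parameters.
Holomorphy is expressed by the Cauchy–Riemann equation `hI`. -/
theorem hasSum_cauchyCoeff_paramFun [CompleteSpace F] {ρ ρ₀ : ℝ} (hρ : 0 < ρ) (hρ₀ : ρ < ρ₀)
    {U : Set E} (hU : IsOpen U) {Γ : ℂ × E → F} (hΓ : ContDiffOn ℝ ∞ Γ (Metric.ball 0 ρ₀ ×ˢ U))
    (hI : ∀ v ∈ Metric.ball (0 : ℂ) ρ₀ ×ˢ U,
      fderiv ℝ Γ v (Complex.I, 0) = Complex.I • fderiv ℝ Γ v (1, 0))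
    {z : ℂ} (hz : ‖z‖ < ρ) {q : E} (hq : q ∈ U) :
    HasSum (fun n : ℕ => z ^ n • cauchyCoeff F hρ n (paramFun Γ (circ ρ) q)) (Γ (z, q)) := by
  have hO : IsOpen (Metric.ball (0 : ℂ) ρ₀ ×ˢ U) := Metric.isOpen_ball.prod hU
  have hc : ∀ k, (circ ρ k, q) ∈ Metric.ball (0 : ℂ) ρ₀ ×ˢ U := fun k =>
    ⟨by rw [mem_ball_zero_iff, norm_circ hρ]; exact hρ₀, hq⟩
  refine hasSum_cauchyCoeff hρ hρ₀ (f := fun z => Γ (z, q)) (fun w hw => ?_)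
    (fun k => paramFun_apply hΓ.continuousOn hc k) hz
  have hv : (w, q) ∈ Metric.ball (0 : ℂ) ρ₀ ×ˢ U := ⟨hw, hq⟩
  have hd := ((hΓ.contDiffAt (hO.mem_nhds hv)).differentiableAt (by simp)).hasFDerivAt.comp w
      (hasFDerivAt_prodMk_left (𝕜 := ℝ) w q)
  refine DifferentiableAt.differentiableWithinAt
    (differentiableAt_complex_iff_differentiableAt_real.2 ⟨hd.differentiableAt, ?_⟩)
  have := hd.fderiv
  change fderiv ℝ (fun z => Γ (z, q)) w = _ at this
  rw [this]
  simpa using hI _ hv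


/-- The Taylor coefficient of index `a`, of a function of three variables, in terms of the values
on a torus. -/
def cauchyCoeff₃ (F : Type) [NormedAddCommGroup F] [NormedSpace ℂ F] {ρ : ℝ} (hρ : 0 < ρ)
    (a : ℕ × ℕ × ℕ) : C(UI, C(UI, C(UI, F))) →L[ℂ] F :=
  cauchyCoeff F hρ a.1 ∘L cauchyCoeff C(UI, F) hρ a.2.1 ∘L cauchyCoeff C(UI, C(UI, F)) hρ a.2.2

theorem norm_cauchyCoeff₃_le {ρ : ℝ} (hρ : 0 < ρ) (a : ℕ × ℕ × ℕ) :
    ‖cauchyCoeff₃ F hρ a‖ ≤ (ρ⁻¹) ^ (a.1 + a.2.1 + a.2.2) := by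
  have h1 := norm_cauchyCoeff_le (F := F) hρ a.1
  have h2 := norm_cauchyCoeff_le (F := C(UI, F)) hρ a.2.1
  have h3 := norm_cauchyCoeff_le (F := C(UI, C(UI, F))) hρ a.2.2
  rw [pow_add, pow_add, mul_assoc]
  refine (ContinuousLinearMap.opNorm_comp_le _ _).trans (mul_le_mul h1 ?_ (norm_nonneg _)
    (by positivity))
  exact (ContinuousLinearMap.opNorm_comp_le _ _).trans (mul_le_mul h2 h3 (norm_nonneg _)
    (by positivity))

/-- The Taylor expansion in three holomorphic variables; all coefficients come from one smooth
function of the parameter with values on a torus. -/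
theorem exists_taylor_three [CompleteSpace F] {ρ ρ₀ : ℝ} (hρ : 0 < ρ) (hρ₀ : ρ < ρ₀)
    {U : Set P} (hU : IsOpen U) {g : (ℂ × ℂ × ℂ) × P → F}
    (hg : SmoothHol g (Metric.ball 0 ρ₀ ×ˢ U)) :
    ∃ c : P → C(UI, C(UI, C(UI, F))), ContDiffOn ℝ ∞ c U ∧
      ∀ p ∈ U, ∀ z₁ z₂ z₃ : ℂ, ‖z₁‖ < ρ → ‖z₂‖ < ρ → ‖z₃‖ < ρ →
        HasSum (fun a : ℕ × ℕ × ℕ => (z₁ ^ a.1 * z₂ ^ a.2.1 * z₃ ^ a.2.2) •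
          cauchyCoeff₃ F hρ a (c p)) (g ((z₁, z₂, z₃), p)) := by
  have hρ₀' := hρ.trans hρ₀
  set b : Set ℂ := Metric.ball 0 ρ₀ with hb
  have hbo : IsOpen b := Metric.isOpen_ball
  have hcb : ∀ k, circ ρ k ∈ b := fun k => by
    rw [hb, mem_ball_zero_iff, norm_circ hρ]; exact hρ₀
  set Γ : ℂ × ℂ × ℂ × P → F := fun v => g ((v.1, v.2.1, v.2.2.1), v.2.2.2) with hΓdef
  have hbig : IsOpen (Metric.ball (0 : ℂ × ℂ × ℂ) ρ₀ ×ˢ U) := Metric.isOpen_ball.prod hU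
  have hmem : ∀ v ∈ b ×ˢ b ×ˢ b ×ˢ U,
      ((v.1, v.2.1, v.2.2.1), v.2.2.2) ∈ Metric.ball (0 : ℂ × ℂ × ℂ) ρ₀ ×ˢ U := by
    rintro ⟨v1, v2, v3, p⟩ ⟨h1, h2, h3, h4⟩
    refine ⟨?_, h4⟩
    simp only [hb, mem_ball_zero_iff] at h1 h2 h3
    simp [Prod.norm_def, h1, h2, h3]
  have hO1 : IsOpen (b ×ˢ b ×ˢ b ×ˢ U) := hbo.prod (hbo.prod (hbo.prod hU))
  have hO2 : IsOpen (b ×ˢ b ×ˢ U) := hbo.prod (hbo.prod hU)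
  have hO3 : IsOpen (b ×ˢ U) := hbo.prod hU
  have hΓ : ContDiffOn ℝ ∞ Γ (b ×ˢ b ×ˢ b ×ˢ U) :=
    hg.smooth.comp (by fun_prop) hmem
  -- The derivative in each of the three directions is complex linear.
  have hdir : ∀ (w : ℂ × ℂ × ℂ), ∀ v ∈ b ×ˢ b ×ˢ b ×ˢ U,
      fderiv ℝ Γ v (Complex.I * w.1, Complex.I * w.2.1, Complex.I * w.2.2, 0) =
        Complex.I • fderiv ℝ Γ v (w.1, w.2.1, w.2.2, 0) := by
    intro w v hv
    let τ : (ℂ × ℂ × ℂ × P) →L[ℝ] (ℂ × ℂ × ℂ) × P :=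
      (((ContinuousLinearMap.fst ℝ ℂ (ℂ × ℂ × P)).prod
        (((ContinuousLinearMap.fst ℝ ℂ (ℂ × P)) ∘L ContinuousLinearMap.snd ℝ ℂ (ℂ × ℂ × P)).prod
        ((ContinuousLinearMap.fst ℝ ℂ P) ∘L (ContinuousLinearMap.snd ℝ ℂ (ℂ × P)) ∘L
          ContinuousLinearMap.snd ℝ ℂ (ℂ × ℂ × P)))).prod
        ((ContinuousLinearMap.snd ℝ ℂ P) ∘L (ContinuousLinearMap.snd ℝ ℂ (ℂ × P)) ∘L
          ContinuousLinearMap.snd ℝ ℂ (ℂ × ℂ × P)))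
    have hd := ((hg.smooth.contDiffAt (hbig.mem_nhds (hmem v hv))).differentiableAt
      (by simp)).hasFDerivAt
    have hΓd : HasFDerivAt Γ ((fderiv ℝ g (τ v)).comp τ) v :=
      HasFDerivAt.comp (g := g) v hd τ.hasFDerivAt
    rw [hΓd.fderiv]
    exact hg.fderiv_I_smul hbig (hmem v hv) w
  set Γ₁ : ℂ × ℂ × P → C(UI, F) := paramFun Γ (circ ρ) with hΓ₁def
  have hm1 : ∀ x ∈ b ×ˢ b ×ˢ U, ∀ k, (circ ρ k, x) ∈ b ×ˢ b ×ˢ b ×ˢ U := fun x hx k =>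
    ⟨hcb k, hx⟩
  have hΓ₁ : ContDiffOn ℝ ∞ Γ₁ (b ×ˢ b ×ˢ U) := contDiffOn_paramFun hO1 hΓ hm1
  set Γ₂ : ℂ × P → C(UI, C(UI, F)) := paramFun Γ₁ (circ ρ) with hΓ₂def
  have hm2 : ∀ x ∈ b ×ˢ U, ∀ k, (circ ρ k, x) ∈ b ×ˢ b ×ˢ U := fun x hx k => ⟨hcb k, hx⟩
  have hΓ₂ : ContDiffOn ℝ ∞ Γ₂ (b ×ˢ U) := contDiffOn_paramFun hO2 hΓ₁ hm2
  have hm3 : ∀ x ∈ U, ∀ k, (circ ρ k, x) ∈ b ×ˢ U := fun x hx k => ⟨hcb k, hx⟩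
  have hI1 : ∀ v ∈ b ×ˢ b ×ˢ b ×ˢ U,
      fderiv ℝ Γ v (Complex.I, 0) = Complex.I • fderiv ℝ Γ v (1, 0) := fun v hv => by
    simpa [Prod.zero_eq_mk] using hdir (1, 0, 0) v hv
  have hI2 : ∀ v ∈ b ×ˢ b ×ˢ U,
      fderiv ℝ Γ₁ v (Complex.I, 0) = Complex.I • fderiv ℝ Γ₁ v (1, 0) := fun v hv =>
    fderiv_paramFun_I hO1 hΓ (hm1 v hv) fun v hv => by simpa [Prod.zero_eq_mk] using hdir (0, 1, 0) v hv
  have hI3 : ∀ v ∈ b ×ˢ U,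
      fderiv ℝ Γ₂ v (Complex.I, 0) = Complex.I • fderiv ℝ Γ₂ v (1, 0) := fun v hv =>
    fderiv_paramFun_I hO2 hΓ₁ (hm2 v hv) fun v hv =>
      fderiv_paramFun_I hO1 hΓ (hm1 v hv) fun v hv => by simpa using hdir (0, 0, 1) v hv
  refine ⟨paramFun Γ₂ (circ ρ), contDiffOn_paramFun hO3 hΓ₂ hm3, ?_⟩
  intro p hp z₁ z₂ z₃ hz₁ hz₂ hz₃
  have hzb : ∀ {z : ℂ}, ‖z‖ < ρ → z ∈ b := fun hz => by
    rw [hb, mem_ball_zero_iff]; exact hz.trans hρ₀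
  have e1 := hasSum_cauchyCoeff_paramFun (F := F) hρ hρ₀ (hbo.prod (hbo.prod hU)) hΓ hI1 hz₁
    (q := (z₂, z₃, p)) ⟨hzb hz₂, hzb hz₃, hp⟩
  have e2 := hasSum_cauchyCoeff_paramFun (F := C(UI, F)) hρ hρ₀ (hbo.prod hU) hΓ₁ hI2 hz₂
    (q := (z₃, p)) ⟨hzb hz₃, hp⟩
  have e3 := hasSum_cauchyCoeff_paramFun (F := C(UI, C(UI, F))) hρ hρ₀ hU hΓ₂ hI3 hz₃ (q := p) hp
  set c := paramFun Γ₂ (circ ρ) p with hcdef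
  set f : ℕ × ℕ × ℕ → F := fun a => (z₁ ^ a.1 * z₂ ^ a.2.1 * z₃ ^ a.2.2) •
          cauchyCoeff₃ F hρ a c with hf
  have hq : ∀ {z : ℂ}, ‖z‖ < ρ → Summable fun n : ℕ => (‖z‖ / ρ) ^ n := fun {z} hz =>
    summable_geometric_of_lt_one (by positivity) (by rwa [div_lt_one hρ])
  have hsummable : Summable f := by
    have hs := (((hq hz₁).mul_of_nonneg ((hq hz₂).mul_of_nonneg (hq hz₃)
      (fun n => by positivity) (fun n => by positivity)) (fun n => by positivity)
      (fun n => by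
        have := norm_nonneg z₂
        have := norm_nonneg z₃
        change 0 ≤ _ * _
        positivity)).mul_right ‖c‖)
    refine Summable.of_norm_bounded hs fun a => ?_
    rw [hf]
    simp only [norm_smul, norm_mul, norm_pow]
    calc _ ≤ ‖z₁‖ ^ a.1 * ‖z₂‖ ^ a.2.1 * ‖z₃‖ ^ a.2.2 *
          ((ρ⁻¹) ^ (a.1 + a.2.1 + a.2.2) * ‖c‖) := by
          gcongr
          exact (cauchyCoeff₃ F hρ a).le_of_opNorm_le (norm_cauchyCoeff₃_le hρ a) c
      _ = _ := by
          simp only [div_pow, pow_add, inv_pow]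
          field_simp
  obtain ⟨T, hT⟩ := hsummable
  have hTa : ∀ n, HasSum (fun q : ℕ × ℕ => f (n, q))
      (z₁ ^ n • cauchyCoeff F hρ n (Γ₁ (z₂, z₃, p))) := by
    intro n
    obtain ⟨S, hS⟩ := hT.summable.prod_factor n
    have e2' := (e2.mapL (cauchyCoeff F hρ n)).const_smul (z₁ ^ n)
    have h3 := hS.prod_fiberwise (g := fun k => z₁ ^ n • cauchyCoeff F hρ n
        (z₂ ^ k • cauchyCoeff C(UI, F) hρ k (Γ₂ (z₃, p)))) fun k => by
      have := ((e3.mapL (cauchyCoeff C(UI, F) hρ k)).mapL (cauchyCoeff F hρ n)).const_smul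
        (z₁ ^ n * z₂ ^ k)
      rw [map_smul, smul_smul]
      convert this using 2 with j
      simp only [hf, cauchyCoeff₃, ContinuousLinearMap.comp_apply, map_smul, smul_smul]
    rwa [h3.unique e2'] at hS
  have := hT.prod_fiberwise hTa
  rw [this.unique e1] at hT
  exact hT

end Cauchy

end

section

set_option maxSynthPendingDepth 5

/-! ### Solution of the singular equation near the base parameter -/

section Local

/-- The real parts of a pair of complex numbers. -/
def rePair : ℂ × ℂ →L[ℝ] ℝ × ℝ := Complex.reCLM.prodMap Complex.reCLM

@[simp] theorem rePair_apply (z : ℂ × ℂ) : rePair z = (z.1.re, z.2.re) := rfl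

theorem norm_rePair_le : ‖rePair‖ ≤ 1 := by
  refine ContinuousLinearMap.opNorm_le_bound _ zero_le_one fun x => ?_
  rw [one_mul, rePair_apply, Prod.norm_def, Prod.norm_def]
  exact max_le_max (Complex.abs_re_le_norm _) (Complex.abs_re_le_norm _)

/-- A perturbation of an invertible element, with a bound on the inverse. -/
theorem isUnit_sub_and_norm_inverse_le {A : Type} [NormedRing A] [CompleteSpace A] {x y e : A}
    (hxy : x * y = 1) (hyx : y * x = 1) {K : ℝ} (hK : ‖y‖ ≤ K) (he : K * ‖e‖ ≤ 1 / 2) :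
    IsUnit (x - e) ∧ ‖Ring.inverse (x - e)‖ ≤ 2 * K := by
  have hK0 : 0 ≤ K := (norm_nonneg _).trans hK
  have hye : ‖y * e‖ ≤ 1 / 2 :=
    (norm_mul_le _ _).trans ((mul_le_mul_of_nonneg_right hK (norm_nonneg _)).trans he)
  have hu : IsUnit (1 - y * e) := (Units.oneSub (y * e) (by linarith)).isUnit
  have hx : IsUnit x := ⟨⟨x, y, hxy, hyx⟩, rfl⟩
  have hxe : x - e = x * (1 - y * e) := by rw [mul_sub, mul_one, ← mul_assoc, hxy, one_mul]
  have hU : IsUnit (x - e) := hxe ▸ hx.mul hu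
  refine ⟨hU, ?_⟩
  set z := Ring.inverse (x - e) with hz
  have h1 : (x - e) * z = 1 := Ring.mul_inverse_cancel _ hU
  have h2 : z = y + y * e * z := by
    have : y * ((x - e) * z) = y := by rw [h1, mul_one]
    rw [sub_mul, mul_sub, ← mul_assoc, hyx, one_mul, ← mul_assoc] at this
    rw [← sub_eq_iff_eq_add]
    exact this
  have h3 : ‖z‖ ≤ K + 1 / 2 * ‖z‖ := by
    calc ‖z‖ = ‖y + y * e * z‖ := by rw [← h2]
      _ ≤ ‖y‖ + ‖y * e * z‖ := norm_add_le _ _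
      _ ≤ K + 1 / 2 * ‖z‖ := by
        gcongr
        exact (norm_mul_le _ _).trans (mul_le_mul_of_nonneg_right hye (norm_nonneg _))
  linarith

/-- The rotation generator, divided by `l`. -/
def rotOp (l : ℝ) : ℝ × ℝ →L[ℝ] ℝ × ℝ :=
  (ContinuousLinearMap.fst ℝ ℝ ℝ).smulRight (0, l⁻¹) +
    (ContinuousLinearMap.snd ℝ ℝ ℝ).smulRight (-l⁻¹, 0)

/-- The operators `t - J / l` are invertible for real `t`, with a uniform bound, since the
eigenvalues of the rotation generator `J` are not real. -/
theorem exists_inverse_sub_rotOp {l : ℝ} (hl : l ≠ 0) (t : ℝ) :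
    ∃ y : ℝ × ℝ →L[ℝ] ℝ × ℝ, (t • (1 : ℝ × ℝ →L[ℝ] ℝ × ℝ) - rotOp l) * y = 1 ∧
      y * (t • (1 : ℝ × ℝ →L[ℝ] ℝ × ℝ) - rotOp l) = 1 ∧ ‖y‖ ≤ 2 * |l| := by
  set d := t ^ 2 + (l⁻¹) ^ 2 with hd
  have hl' : 0 < (l⁻¹) ^ 2 := by positivity
  have hd0 : 0 < d := by positivity
  refine ⟨d⁻¹ • (t • (1 : ℝ × ℝ →L[ℝ] ℝ × ℝ) + rotOp l), ?_, ?_, ?_⟩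
  · refine ContinuousLinearMap.ext fun v => ?_
    have : d * d⁻¹ = 1 := mul_inv_cancel₀ hd0.ne'
    refine Prod.ext ?_ ?_
    · simp [rotOp]
      linear_combination v.1 * this
    · simp [rotOp]
      linear_combination v.2 * this
  · refine ContinuousLinearMap.ext fun v => ?_
    have : d * d⁻¹ = 1 := mul_inv_cancel₀ hd0.ne'
    refine Prod.ext ?_ ?_
    · simp [rotOp]
      linear_combination v.1 * this
    · simp [rotOp]
      linear_combination v.2 * this
  · refine ContinuousLinearMap.opNorm_le_bound _ (by positivity) fun v => ?_
    have key : d⁻¹ * (|t| + |l⁻¹|) ≤ 2 * |l| := by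
      rw [inv_mul_le_iff₀ hd0, hd]
      have hb : 0 < |l| := abs_pos.2 hl
      rw [abs_inv, ← sq_abs t, ← sq_abs l⁻¹, abs_inv]
      have h1 : |l| * |l|⁻¹ = 1 := mul_inv_cancel₀ hb.ne'
      have h2 : 0 < |l|⁻¹ := by positivity
      nlinarith [sq_nonneg (|t| - |l|⁻¹), sq_nonneg (|t| * |l| - 1), abs_nonneg t,
        mul_nonneg hb.le (sq_nonneg (|t| - |l|⁻¹)), sq_nonneg (|t|)]
    have h1 : |v.1| ≤ ‖v‖ := norm_fst_le v
    have h2 : |v.2| ≤ ‖v‖ := norm_snd_le v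
    have hle : ∀ a b : ℝ, |a| ≤ ‖v‖ → |b| ≤ ‖v‖ →
        |d⁻¹ * (t * a + l⁻¹ * b)| ≤ 2 * |l| * ‖v‖ := by
      intro a b ha hb
      rw [abs_mul, abs_of_pos (inv_pos.2 hd0)]
      calc d⁻¹ * |t * a + l⁻¹ * b| ≤ d⁻¹ * (|t| * ‖v‖ + |l⁻¹| * ‖v‖) := by
            gcongr
            refine (abs_add_le _ _).trans ?_
            rw [abs_mul, abs_mul]
            gcongr
        _ = d⁻¹ * (|t| + |l⁻¹|) * ‖v‖ := by ring
        _ ≤ _ := by gcongr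
    rw [Prod.norm_def]
    refine max_le ?_ ?_
    · have := hle v.1 (-v.2) h1 (by rwa [abs_neg])
      have e : ((d⁻¹ • (t • (1 : ℝ × ℝ →L[ℝ] ℝ × ℝ) + rotOp l)) v).1 =
          d⁻¹ * (t * v.1 + l⁻¹ * -v.2) := by
        simp [rotOp]
        ring
      rwa [e, Real.norm_eq_abs]
    · have := hle v.2 v.1 h2 h1
      have e : ((d⁻¹ • (t • (1 : ℝ × ℝ →L[ℝ] ℝ × ℝ) + rotOp l)) v).2 =
          d⁻¹ * (t * v.2 + l⁻¹ * v.1) := by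
        simp [rotOp]
        ring
      rwa [e, Real.norm_eq_abs]

/-- The derivative of a power series at the origin. -/
theorem coeff_one_eq_of_hasSum {b : ℕ → ℝ × ℝ} {ν κ : ℝ} (hν : 0 < ν)
    (hb : ∀ n, ‖b n‖ ≤ κ / ν ^ n) {f : ℝ → ℝ × ℝ} {d : ℝ × ℝ}
    (hf : ∀ t, |t| < ν → HasSum (fun n : ℕ => t ^ n • b n) (f t)) (hd : HasDerivAt f d 0) :
    b 1 = d := by
  have h1 := tsum_smul_hasDerivAt (half_pos hν) (half_lt_self hν) hb (s := 0)
    (by simpa using hν)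
  have h2 : f =ᶠ[𝓝 0] fun s : ℝ => ∑' n : ℕ, s ^ n • b n := by
    filter_upwards [Metric.ball_mem_nhds (0 : ℝ) hν] with t ht
    exact (hf t (by simpa using ht)).tsum_eq.symm
  have h3 := (hd.congr_of_eventuallyEq h2.symm).unique h1
  rw [h3, tsum_eq_single 1]
  · simp
  · intro n hn
    rcases Nat.eq_zero_or_pos n with rfl | hn'
    · simp
    · have : n - 1 ≠ 0 := by omega
      simp [this]

variable {P : Type} [NormedAddCommGroup P] [NormedSpace ℝ P] [FiniteDimensional ℝ P]

/-- A smooth function that is constant off a ball has bounded derivatives. -/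
theorem exists_bound_iteratedFDeriv {X : Type} [NormedAddCommGroup X] [NormedSpace ℝ X]
    {G : P → X} (hG : ContDiff ℝ ∞ G) {ρ : ℝ} {x₀ : X} (h : ∀ p, ρ ≤ ‖p‖ → G p = x₀) (k : ℕ) :
    ∃ C, 0 ≤ C ∧ ∀ p, ‖iteratedFDeriv ℝ k G p‖ ≤ C := by
  have : ProperSpace P := FiniteDimensional.proper_real P
  have hc : Continuous (iteratedFDeriv ℝ k G) :=
    hG.continuous_iteratedFDeriv (by exact_mod_cast le_top)
  obtain ⟨C, hC⟩ := (isCompact_closedBall (0 : P) ρ).exists_bound_of_continuousOn hc.continuousOn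
  refine ⟨max C ‖x₀‖, le_max_of_le_right (norm_nonneg _), fun p => ?_⟩
  by_cases hp : ‖p‖ ≤ ρ
  · exact (hC p (by simpa using hp)).trans (le_max_left _ _)
  · have hE : G =ᶠ[𝓝 p] fun _ => x₀ := by
      have : {q : P | ρ < ‖q‖} ∈ 𝓝 p :=
        (isOpen_lt continuous_const continuous_norm).mem_nhds (not_le.1 hp)
      filter_upwards [this] with q hq using h q hq.le
    rw [(hE.iteratedFDeriv ℝ k).eq_of_nhds]
    refine le_max_of_le_right ?_
    rcases Nat.eq_zero_or_pos k with rfl | hk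
    · rw [norm_iteratedFDeriv_zero]
    · rw [iteratedFDeriv_const_of_ne hk.ne']
      simp

/-- A smooth map of `P` into a given ball that is the identity near the origin and vanishes off
the ball. -/
theorem exists_smooth_cutoff {ρ : ℝ} (hρ : 0 < ρ) : ∃ χ : P → P, ContDiff ℝ ∞ χ ∧
    (∀ p, ‖χ p‖ ≤ ρ) ∧ (∀ᶠ p in 𝓝 0, χ p = p) ∧ ∀ p, ρ ≤ ‖p‖ → χ p = 0 := by
  let f : ContDiffBump (0 : P) := ⟨ρ / 2, ρ, by positivity, by linarith⟩
  have h0 : ∀ p, ρ ≤ ‖p‖ → f p = 0 := fun p hp => f.zero_of_le_dist (by simpa [f] using hp)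
  refine ⟨fun p => f p • p, f.contDiff.smul contDiff_id, fun p => ?_, ?_, fun p hp => ?_⟩
  · by_cases hp : ρ ≤ ‖p‖
    · simpa [h0 p hp] using hρ.le
    · rw [norm_smul, Real.norm_of_nonneg f.nonneg]
      exact (mul_le_of_le_one_left (norm_nonneg _) f.le_one).trans (not_le.1 hp).le
  · filter_upwards [f.eventuallyEq_one] with p hp
    rw [hp, Pi.one_apply, one_smul]
  · simp [h0 p hp]


/-- The equation `ϱ(p) s v' = θ(s, v, p)` with `θ(0, 0, p) = 0` has, for small `p`, a solution with
`v = 0` at `s = 0`, holomorphic in `s`, on a disc independent of `p`, provided that at `p = 0` the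
derivative in `v` is a rotation generator. -/
theorem exists_slow_solution {Θ : (ℂ × ℂ × ℂ) × P → ℂ × ℂ} {ρ₀ : ℝ} (hρ₀ : 0 < ρ₀) {U : Set P}
    (hU : IsOpen U) (h0U : (0 : P) ∈ U) (hΘ : SmoothHol Θ (Metric.ball 0 ρ₀ ×ˢ U))
    {θ : ℝ → ℝ → ℝ → P → ℝ × ℝ}
    (hreal : ∀ p ∈ U, ∀ s a b : ℝ, |s| < ρ₀ → |a| < ρ₀ → |b| < ρ₀ →
      Θ (((s : ℂ), (a : ℂ), (b : ℂ)), p) = castPair (θ s a b p))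
    (h0 : ∀ p ∈ U, θ 0 0 0 p = 0) {l : ℝ} (hl : l ≠ 0)
    (hd₁ : HasDerivAt (fun t => θ 0 t 0 0) (0, l⁻¹) 0)
    (hd₂ : HasDerivAt (fun t => θ 0 0 t 0) (-l⁻¹, 0) 0) {ϱ : P →L[ℝ] ℝ} {κ₀ : ℝ} (hκ₀ : 0 < κ₀) :
    ∃ (ν : ℝ) (W : ℂ × P → ℂ × ℂ) (w : ℝ → P → ℝ × ℝ), 0 < ν ∧ ν ≤ κ₀ ∧
      SmoothHol W (Metric.ball 0 ν ×ˢ univ) ∧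
      (∀ s p, |s| < ν → W ((s : ℂ), p) = castPair (w s p)) ∧
      (∀ s p, |s| < ν → ‖w s p‖ ≤ κ₀) ∧
      ∀ᶠ p in 𝓝 0, ∀ s, |s| < ν → ∃ w' : ℝ × ℝ, HasDerivAt (fun s => w s p) w' s ∧
        (ϱ p * s) • w' = θ s (w s p).1 (w s p).2 p := by
  have hρ : 0 < ρ₀ / 2 := by positivity
  obtain ⟨c, hc, hsum⟩ := exists_taylor_three hρ (half_lt_self hρ₀) hU hΘ
  set ρ := ρ₀ / 2 with hρdef
  -- The real parts of the Taylor coefficients are the coefficients of the real equation.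
  set Th₀ : ℕ × ℕ × ℕ → P → ℝ × ℝ := fun a p => rePair (cauchyCoeff₃ (ℂ × ℂ) hρ a (c p)) with hTh₀
  have hTh₀sm : ∀ a, ContDiffOn ℝ ∞ (Th₀ a) U := fun a =>
    rePair.contDiff.comp_contDiffOn
      (((cauchyCoeff₃ (ℂ × ℂ) hρ a).restrictScalars ℝ).contDiff.comp_contDiffOn hc)
  have hsum₀ : ∀ p ∈ U, ∀ s a b : ℝ, |s| < ρ → |a| < ρ → |b| < ρ →
      HasSum (fun i : ℕ × ℕ × ℕ => (s ^ i.1 * a ^ i.2.1 * b ^ i.2.2) • Th₀ i p) (θ s a b p) := by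
    intro p hp s a b hs ha hb
    have h1 := (hsum p hp s a b (by simpa using hs) (by simpa using ha)
      (by simpa using hb)).mapL rePair
    have hlt : ρ < ρ₀ := half_lt_self hρ₀
    have hre : ∀ x : ℝ × ℝ, rePair (castPair x) = x := fun x => by ext <;> simp
    rw [hreal p hp s a b (hs.trans hlt) (ha.trans hlt) (hb.trans hlt), hre] at h1
    convert h1 using 1
    funext i
    have : ∀ (x : ℝ) (z : ℂ × ℂ), rePair ((x : ℂ) • z) = x • rePair z := by
      intro x z
      ext <;> simp
    rw [hTh₀, ← this]
    push_cast
    rfl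
  have hbd₀ : ∀ a p, ‖Th₀ a p‖ ≤ ‖c p‖ / ρ ^ (a.1 + a.2.1 + a.2.2) := by
    intro a p
    refine (rePair.le_opNorm _).trans ((mul_le_of_le_one_left (norm_nonneg _)
      norm_rePair_le).trans ?_)
    refine ((cauchyCoeff₃ (ℂ × ℂ) hρ a).le_of_opNorm_le (norm_cauchyCoeff₃_le hρ a) _).trans_eq ?_
    rw [inv_pow]
    ring
  have hT10 : Th₀ (0, 1, 0) 0 = (0, l⁻¹) := by
    refine coeff_one_eq_of_hasSum (b := fun n => Th₀ (0, n, 0) 0) hρ (κ := ‖c 0‖)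
      (fun n => by simpa using hbd₀ (0, n, 0) 0) (fun t ht => ?_) hd₁
    have h1 := hsum₀ 0 h0U 0 t 0 (by simpa using hρ) ht (by simpa using hρ)
    have hinj : Function.Injective fun n : ℕ => ((0, n, 0) : ℕ × ℕ × ℕ) := fun m n h => by
      simpa using h
    rw [← hinj.hasSum_iff] at h1
    · convert h1 using 1
      funext n
      simp
    · rintro ⟨i, j, k⟩ hx
      have : i ≠ 0 ∨ k ≠ 0 := by
        by_contra! hne
        exact hx ⟨j, by simp [hne.1, hne.2]⟩
      rcases this with h | h <;> simp [h]
  have hT01 : Th₀ (0, 0, 1) 0 = (-l⁻¹, 0) := by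
    refine coeff_one_eq_of_hasSum (b := fun n => Th₀ (0, 0, n) 0) hρ (κ := ‖c 0‖)
      (fun n => by simpa using hbd₀ (0, 0, n) 0) (fun t ht => ?_) hd₂
    have h1 := hsum₀ 0 h0U 0 0 t (by simpa using hρ) (by simpa using hρ) ht
    have hinj : Function.Injective fun n : ℕ => ((0, 0, n) : ℕ × ℕ × ℕ) := fun m n h => by
      simpa using h
    rw [← hinj.hasSum_iff] at h1
    · convert h1 using 1
      funext n
      simp
    · rintro ⟨i, j, k⟩ hx
      have : i ≠ 0 ∨ j ≠ 0 := by
        by_contra! hne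
        exact hx ⟨k, by simp [hne.1, hne.2]⟩
      rcases this with h | h <;> simp [h]
  have hlin0 : linPart Th₀ 0 = rotOp l := by rw [linPart, hT10, hT01, rotOp]
  have hlinc : ContinuousAt (linPart Th₀) 0 := by
    have h1 := (hTh₀sm (0, 1, 0)).continuousOn.continuousAt (hU.mem_nhds h0U)
    have h2 := (hTh₀sm (0, 0, 1)).continuousOn.continuousAt (hU.mem_nhds h0U)
    have e : ∀ L : ℝ × ℝ →L[ℝ] ℝ, Continuous fun x : ℝ × ℝ => L.smulRight x := fun L =>
      (ContinuousLinearMap.smulRightL ℝ (ℝ × ℝ) (ℝ × ℝ) L).continuous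
    exact ((e _).continuousAt.comp h1).add ((e _).continuousAt.comp h2)
  -- Parameters are cut off to a small ball, on which the linear part is close to that at `0`. The
  -- resulting equation is defined for all parameters, with uniform bounds.
  have hl0 : 0 < |l| := abs_pos.2 hl
  obtain ⟨ε, hε, hεb⟩ := Metric.eventually_nhds_iff_ball.1
    ((hlinc.eventually (Metric.ball_mem_nhds _ (show (0 : ℝ) < 1 / (4 * |l|) by positivity))).and
      (hU.mem_nhds h0U))
  obtain ⟨χ, hχ, hχle, hχid, hχ0⟩ := exists_smooth_cutoff (P := P) (half_pos hε)
  have hχb : ∀ p, χ p ∈ Metric.ball (0 : P) ε := fun p => by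
    rw [mem_ball_zero_iff]
    exact (hχle p).trans_lt (half_lt_self hε)
  have hχU : ∀ p, χ p ∈ U := fun p => (hεb _ (hχb p)).2
  set Th : ℕ × ℕ × ℕ → P → ℝ × ℝ := fun a p => Th₀ a (χ p) with hTh
  have hcχ : ContDiff ℝ ∞ fun p => c (χ p) :=
    contDiffOn_univ.1 (hc.comp hχ.contDiffOn fun p _ => hχU p)
  have hThsm : ∀ a, ContDiff ℝ ∞ (Th a) := fun a =>
    contDiffOn_univ.1 ((hTh₀sm a).comp hχ.contDiffOn fun p _ => hχU p)
  have hϱsm : ContDiff ℝ ∞ fun p => ϱ (χ p) := ϱ.contDiff.comp hχ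
  have hop : ∀ (n : ℕ) (p : P), IsUnit (coeffOp Th (fun p => ϱ (χ p)) n p) ∧
      ‖Ring.inverse (coeffOp Th (fun p => ϱ (χ p)) n p)‖ ≤ 2 * (2 * |l|) := by
    intro n p
    obtain ⟨y, hy1, hy2, hy3⟩ := exists_inverse_sub_rotOp hl (ϱ (χ p) * n)
    have he : coeffOp Th (fun p => ϱ (χ p)) n p = ((ϱ (χ p) * n) • (1 : ℝ × ℝ →L[ℝ] ℝ × ℝ) -
        rotOp l) - (linPart Th₀ (χ p) - linPart Th₀ 0) := by
      rw [hlin0, sub_sub, add_sub_cancel]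
      rfl
    rw [he]
    refine isUnit_sub_and_norm_inverse_le hy1 hy2 hy3 ?_
    have := (hεb _ (hχb p)).1
    rw [dist_eq_norm] at this
    calc 2 * |l| * ‖linPart Th₀ (χ p) - linPart Th₀ 0‖ ≤ 2 * |l| * (1 / (4 * |l|)) := by gcongr
      _ = 1 / 2 := by field_simp; norm_num
  obtain ⟨ν, W, w, hν, hνκ, hW, hWh, hWw, hwκ, hw⟩ := exists_singular_solution (M := ρ⁻¹)
    (K := 2 * (2 * |l|)) (κ₀ := min κ₀ (ρ / 2)) hThsm hϱsm (fun n p => (hop n p).1)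
    (by positivity) (by positivity) (lt_min hκ₀ (half_pos hρ)) (fun n p => (hop n p).2)
    (fun k => by
      obtain ⟨C, hC0, hC⟩ := exists_bound_iteratedFDeriv hcχ (ρ := ε / 2) (x₀ := c 0)
        (fun p hp => by rw [hχ0 p hp]) k
      refine ⟨C, fun a p => ?_⟩
      let L : C(UI, C(UI, C(UI, ℂ × ℂ))) →L[ℝ] ℝ × ℝ :=
        rePair ∘L (cauchyCoeff₃ (ℂ × ℂ) hρ a).restrictScalars ℝ
      have hL : ‖L‖ ≤ (ρ⁻¹) ^ (a.1 + a.2.1 + a.2.2) := by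
        refine (ContinuousLinearMap.opNorm_comp_le _ _).trans
          ((mul_le_of_le_one_left (norm_nonneg _) norm_rePair_le).trans ?_)
        rw [ContinuousLinearMap.norm_restrictScalars]
        exact norm_cauchyCoeff₃_le hρ a
      refine (L.norm_iteratedFDeriv_comp_left (f := fun p => c (χ p)) (x := p) (n := k) (N := ∞)
        hcχ.contDiffAt (by exact_mod_cast le_top)).trans ?_
      rw [mul_comm C]
      gcongr
      exact hC p)
    (fun k => by
      obtain ⟨C, -, hC⟩ := exists_bound_iteratedFDeriv hϱsm (ρ := ε / 2) (x₀ := 0)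
        (fun p hp => by rw [hχ0 p hp, map_zero]) k
      exact ⟨C, hC⟩)
    (fun p => by
      have h1 := hsum₀ (χ p) (hχU p) 0 0 0 (by simpa using hρ) (by simpa using hρ)
        (by simpa using hρ)
      rw [h0 _ (hχU p)] at h1
      have h2 := h1.unique (hasSum_single (0 : ℕ × ℕ × ℕ) fun i hi => by
        obtain ⟨i, j, k⟩ := i
        have : i ≠ 0 ∨ j ≠ 0 ∨ k ≠ 0 := by
          by_contra! hne
          exact hi (by simp [hne.1, hne.2.1, hne.2.2])
        rcases this with h | h | h <;> simp [h])
      simpa using h2.symm)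
  refine ⟨ν, W, w, hν, hνκ.trans (min_le_left _ _), ⟨hW, fun s p hs => ?_⟩, hWw,
    fun s p hs => (hwκ s p hs).trans (min_le_left _ _), ?_⟩
  · exact (hWh p).differentiableAt (Metric.isOpen_ball.mem_nhds hs.1)
  · filter_upwards [hχid] with p hp s hs
    obtain ⟨w', hw', hsw⟩ := hw s p hs
    refine ⟨w', hw', ?_⟩
    have hwρ : ‖w s p‖ < ρ := (hwκ s p hs).trans_lt ((min_le_right _ _).trans_lt (half_lt_self hρ))
    have hsρ : |s| < ρ := hs.trans_le (hνκ.trans ((min_le_right _ _).trans (half_le_self hρ.le)))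
    have h1 := hsum₀ (χ p) (hχU p) s (w s p).1 (w s p).2 hsρ ((norm_fst_le (w s p)).trans_lt hwρ)
      ((norm_snd_le (w s p)).trans_lt hwρ)
    have := hsw.unique h1
    rwa [hp] at this

end Local

end

/-! ### The chart system in complexified space variables -/

section Chart

variable {F G H f : ℝ → ℝ → ℝ → ℝ → ℝ → ℝ}

/-- The points `((x, y, z), (r, μ₂))` with complex `|x|, |y|, |z| < K` and real `|r| < ϱ`,
`|μ₂| < 1`. -/
def chartDom (K ϱ : ℝ) : Set ((ℂ × ℂ × ℂ) × (ℝ × ℝ)) :=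
  Metric.ball 0 K ×ˢ (Metric.ball 0 ϱ ×ˢ Metric.ball 0 1)

theorem isOpen_chartDom (K ϱ : ℝ) : IsOpen (chartDom K ϱ) :=
  Metric.isOpen_ball.prod (Metric.isOpen_ball.prod Metric.isOpen_ball)

/-- A real point of the complexified chart. -/
def castChart (x y z r μ₂ : ℝ) : (ℂ × ℂ × ℂ) × (ℝ × ℝ) := (((x : ℂ), (y : ℂ), (z : ℂ)), (r, μ₂))

theorem castChart_mem {K ϱ x y z r μ₂ : ℝ} : castChart x y z r μ₂ ∈ chartDom K ϱ ↔
    (|x| < K ∧ |y| < K ∧ |z| < K) ∧ |r| < ϱ ∧ |μ₂| < 1 := by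
  simp [castChart, chartDom, Prod.norm_def]

theorem chartDom_mono {K K' ϱ ϱ' : ℝ} (hK : K ≤ K') (hϱ : ϱ ≤ ϱ') :
    chartDom K ϱ ⊆ chartDom K' ϱ' :=
  prod_mono (Metric.ball_subset_ball hK) (prod_mono (Metric.ball_subset_ball hϱ) subset_rfl)

/-- The function `f (r² x, r y, r z, r², r μ₂) / r`, extended to `r = 0`. -/
theorem exists_chartQuot (hf : AnalyticInSpace f) (h0 : f 0 0 0 0 0 = 0) {K : ℝ} (hK : 0 < K) :
    ∃ ϱ, 0 < ϱ ∧ ∃ g : (ℂ × ℂ × ℂ) × (ℝ × ℝ) → ℂ, SmoothHol g (chartDom K ϱ) ∧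
      ∀ x y z r μ₂ : ℝ, castChart x y z r μ₂ ∈ chartDom K ϱ →
        (r : ℂ) * g (castChart x y z r μ₂) = f (r ^ 2 * x) (r * y) (r * z) (r ^ 2) (r * μ₂) ∧
        HasDerivAt (fun r : ℝ => (f (r ^ 2 * x) (r * y) (r * z) (r ^ 2) (r * μ₂) : ℂ))
          (g (castChart x y z 0 μ₂)) 0 := by
  obtain ⟨ρ, hρ, fc, hsm, hol, hre⟩ := hf
  set ϱ := min 1 (ρ / (K + 1)) with hϱdef
  have hK1 : 0 < K + 1 := by linarith
  have hϱ : 0 < ϱ := lt_min one_pos (by positivity)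
  have hb : ∀ r : ℝ, |r| < ϱ → |r| * (K + 1) < ρ ∧ |r ^ 2| ≤ |r| := by
    intro r hr
    refine ⟨(lt_div_iff₀ hK1).1 (hr.trans_le (min_le_right _ _)), ?_⟩
    rw [abs_pow, sq]
    exact mul_le_of_le_one_left (abs_nonneg _) (hr.le.trans (min_le_left _ _))
  have hb1 : ∀ r t : ℝ, |r| < ϱ → 0 ≤ t → t < K + 1 → |r| * t < ρ := fun r t hr h0 ht =>
    (mul_le_mul_of_nonneg_left ht.le (abs_nonneg r)).trans_lt (hb r hr).1
  have hb2 : ∀ r t : ℝ, |r| < ϱ → 0 ≤ t → t < K + 1 → |r ^ 2| * t < ρ := fun r t hr h0 ht =>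
    (mul_le_mul_of_nonneg_right (hb r hr).2 h0).trans_lt (hb1 r t hr h0 ht)
  let s : ℝ × (ℂ × ℂ × ℂ) × ℝ → (ℂ × ℂ × ℂ) × (ℝ × ℝ) := fun v =>
    (((v.1 ^ 2) • v.2.1.1, v.1 • v.2.1.2.1, v.1 • v.2.1.2.2), (v.1 ^ 2, v.1 * v.2.2))
  have hs : ContDiff ℝ ∞ s := by fun_prop
  set O : Set (ℝ × (ℂ × ℂ × ℂ) × ℝ) := Metric.ball 0 ϱ ×ˢ (Metric.ball 0 K ×ˢ Metric.ball 0 1)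
    with hOdef
  have hO : IsOpen O := Metric.isOpen_ball.prod (Metric.isOpen_ball.prod Metric.isOpen_ball)
  have hsO : ∀ v ∈ O, s v ∈ Metric.ball (0 : (ℂ × ℂ × ℂ) × (ℝ × ℝ)) ρ := by
    rintro ⟨r, ⟨w1, w2, w3⟩, μ⟩ ⟨h1, h2, h3⟩
    simp only [mem_ball_zero_iff, Prod.norm_def, max_lt_iff, Real.norm_eq_abs] at h1 h2 h3
    simp only [s, mem_ball_zero_iff, Prod.norm_def, max_lt_iff, norm_smul, norm_mul,
      Real.norm_eq_abs]
    refine ⟨⟨?_, ?_, ?_⟩, ?_, ?_⟩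
    · exact hb2 r _ h1 (norm_nonneg _) (by linarith)
    · exact hb1 r _ h1 (norm_nonneg _) (by linarith)
    · exact hb1 r _ h1 (norm_nonneg _) (by linarith)
    · simpa using hb2 r 1 h1 zero_le_one (by linarith)
    · exact hb1 r _ h1 (abs_nonneg _) (by linarith)
  set g₀ : ℝ × (ℂ × ℂ × ℂ) × ℝ → ℂ := fun v => fc (s v) with hg₀
  have hg₀sm : ContDiffOn ℝ ∞ g₀ O := hsm.comp hs.contDiffOn hsO
  have hstar : ∀ x ∈ O, ∀ σ ∈ Icc (0 : ℝ) 1, (σ • x.1, x.2) ∈ O := by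
    rintro ⟨r, q⟩ ⟨h1, h2⟩ σ hσ
    refine ⟨?_, h2⟩
    rw [mem_ball_zero_iff] at h1 ⊢
    rw [norm_smul, Real.norm_of_nonneg hσ.1]
    exact (mul_le_of_le_one_left (norm_nonneg _) hσ.2).trans_lt h1
  have hlin : ∀ x ∈ O, ∀ s : ℝ, fderiv ℝ g₀ x (s, 0) = s • fderiv ℝ g₀ x (1, 0) := by
    intro x _ s
    rw [← map_smul]
    simp
  have h00 : fc 0 = 0 := by
    have := hre 0 0 0 0 0 (by simpa using hρ) (by simpa using hρ) (by simpa using hρ)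
      (by simpa using hρ) (by simpa using hρ)
    rw [h0] at this
    simpa [Prod.zero_eq_mk] using this
  have hg₀0 : ∀ q, g₀ (0, q) = 0 := by
    intro q
    have : s (0, q) = 0 := by simp [s, Prod.zero_eq_mk]
    rw [hg₀]
    simp only [this, h00]
  have hmul : ∀ v ∈ O, (v.1 : ℂ) * hadamardQuot g₀ v = g₀ v := by
    intro v hv
    have := smul_hadamardQuot hO hg₀sm hstar hlin hv
    rw [hg₀0, sub_zero] at this
    rw [← this, Complex.real_smul]
  have hτ : ContDiff ℝ ∞ fun v : (ℂ × ℂ × ℂ) × (ℝ × ℝ) => (v.2.1, v.1, v.2.2) := by fun_prop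
  have hτO : ∀ v ∈ chartDom K ϱ, (v.2.1, v.1, v.2.2) ∈ O := fun v hv =>
    ⟨hv.2.1, hv.1, hv.2.2⟩
  refine ⟨ϱ, hϱ, fun v => hadamardQuot g₀ (v.2.1, v.1, v.2.2), ?_, ?_⟩
  · have hD : Dense {v : (ℂ × ℂ × ℂ) × (ℝ × ℝ) | v.2.1 ≠ 0} :=
      (dense_compl_singleton (0 : ℝ)).preimage (isOpenMap_fst.comp isOpenMap_snd)
    refine SmoothHol.of_dense (isOpen_chartDom K ϱ)
      ((contDiffOn_hadamardQuot hO hg₀sm hstar).comp hτ.contDiffOn hτO) hD ?_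
    rintro w ⟨r, μ⟩ ⟨hv, hr⟩
    have hr' : (r : ℂ) ≠ 0 := by exact_mod_cast hr
    have hE : (fun w => hadamardQuot g₀ (r, w, μ)) =ᶠ[𝓝 w]
        fun w => (r : ℂ)⁻¹ * fc ((s (r, w, μ)).1, (r ^ 2, r * μ)) := by
      have : ContinuousAt (fun w : ℂ × ℂ × ℂ => (w, (r, μ))) w := by fun_prop
      filter_upwards [this.preimage_mem_nhds ((isOpen_chartDom K ϱ).mem_nhds hv)] with w' hw'
      have := hmul _ (hτO _ hw')
      rw [eq_inv_mul_iff_mul_eq₀ hr']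
      exact this
    refine DifferentiableAt.congr_of_eventuallyEq ?_ hE
    have hm := hsO _ (hτO _ hv)
    have h1 : DifferentiableAt ℂ (fun w : ℂ × ℂ × ℂ => fc (w, (r ^ 2, r * μ)))
        (s (r, w, μ)).1 := by
      rw [mem_ball_zero_iff, Prod.norm_def, max_lt_iff] at hm
      exact (hol (r ^ 2, r * μ) (by rw [mem_ball_zero_iff]; exact hm.2)).differentiableAt
        (Metric.isOpen_ball.mem_nhds (by rw [mem_ball_zero_iff]; exact hm.1))
    have h2 : DifferentiableAt ℂ (fun w : ℂ × ℂ × ℂ => (s (r, w, μ)).1) w := by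
      simp only [s, ← Complex.coe_smul]
      fun_prop
    exact (h1.comp w h2).const_mul _
  · intro x y z r μ₂ hv
    have hreal : ∀ r : ℝ, |r| < ϱ → g₀ (r, ((x : ℂ), (y : ℂ), (z : ℂ)), μ₂) =
        f (r ^ 2 * x) (r * y) (r * z) (r ^ 2) (r * μ₂) := by
      intro r hr
      rw [castChart_mem] at hv
      obtain ⟨⟨hx, hy, hz⟩, -, hμ⟩ := hv
      rw [← hre]
      · simp [hg₀, s]
      · rw [abs_mul]
        exact hb2 r _ hr (abs_nonneg _) (by linarith)
      · rw [abs_mul]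
        exact hb1 r _ hr (abs_nonneg _) (by linarith)
      · rw [abs_mul]
        exact hb1 r _ hr (abs_nonneg _) (by linarith)
      · simpa using hb2 r 1 hr zero_le_one (by linarith)
      · rw [abs_mul]
        exact hb1 r _ hr (abs_nonneg _) (by linarith)
    refine ⟨?_, ?_⟩
    · rw [← hreal r (castChart_mem.1 hv).2.1]
      exact hmul _ (hτO _ hv)
    · have hv0 : castChart x y z 0 μ₂ ∈ chartDom K ϱ := by
        rw [castChart_mem] at hv ⊢
        exact ⟨hv.1, by simpa using hϱ, hv.2.2⟩
      have hm0 := hτO _ hv0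
      have h1 : hadamardQuot g₀ (0, ((x : ℂ), (y : ℂ), (z : ℂ)), μ₂) =
          fderiv ℝ g₀ (0, ((x : ℂ), (y : ℂ), (z : ℂ)), μ₂) (1, 0) :=
        hadamardQuot_zero hO hg₀sm hstar hm0
      have h2 : HasDerivAt (fun r : ℝ => g₀ (r, ((x : ℂ), (y : ℂ), (z : ℂ)), μ₂))
          (fderiv ℝ g₀ (0, ((x : ℂ), (y : ℂ), (z : ℂ)), μ₂) (1, 0)) 0 := by
        have hd := ((hg₀sm.contDiffAt (hO.mem_nhds hm0)).differentiableAt (by simp)).hasFDerivAt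
        have hc : HasDerivAt (fun r : ℝ => (r, (((x : ℂ), (y : ℂ), (z : ℂ)), μ₂)))
            ((1 : ℝ), (0 : (ℂ × ℂ × ℂ) × ℝ)) 0 :=
          (hasDerivAt_id (0 : ℝ)).prodMk (hasDerivAt_const _ _)
        exact hd.comp_hasDerivAt (0 : ℝ) hc
      rw [← h1] at h2
      refine h2.congr_of_eventuallyEq ?_
      filter_upwards [Metric.ball_mem_nhds (0 : ℝ) hϱ] with r hr
      exact (hreal r (by simpa using hr)).symm

/-- A function bounded by a multiple of `r²` has derivative `0` at `r = 0`. -/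
theorem hasDerivAt_zero_of_le_sq {φ : ℝ → ℝ} {C : ℝ} (h : ∀ᶠ r in 𝓝 (0 : ℝ), |φ r| ≤ C * r ^ 2) :
    HasDerivAt φ 0 0 := by
  have h0 : φ 0 = 0 := by simpa using h.self_of_nhds
  rw [hasDerivAt_iff_isLittleO]
  simp only [h0, sub_zero, smul_zero]
  have h1 : φ =O[𝓝 0] fun r : ℝ => r ^ 2 :=
    Asymptotics.IsBigO.of_bound C (h.mono fun r hr => by simpa using hr)
  exact h1.trans_isLittleO (by
    have := Asymptotics.isLittleO_pow_pow (𝕜 := ℝ) (m := 1) (n := 2) (by norm_num)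
    simpa using this)

theorem tendsto_chart (x y z μ₂ : ℝ) :
    Tendsto (fun r : ℝ => ((r ^ 2 * x, r * y, r * z, r ^ 2, r * μ₂) : ℝ × ℝ × ℝ × ℝ × ℝ))
      (𝓝 0) (𝓝 0) := by
  have : Continuous fun r : ℝ => ((r ^ 2 * x, r * y, r * z, r ^ 2, r * μ₂) : ℝ × ℝ × ℝ × ℝ × ℝ) := by
    fun_prop
  exact this.tendsto' 0 0 (by ext <;> simp)

/-- Along the chart `F = O(r²)`. -/
theorem OrderF.hasDerivAt_chart (hF : OrderF F) (x y z μ₂ : ℝ) :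
    HasDerivAt (fun r : ℝ => F (r ^ 2 * x) (r * y) (r * z) (r ^ 2) (r * μ₂)) 0 0 := by
  obtain ⟨C, hC⟩ := hF.bound
  refine hasDerivAt_zero_of_le_sq (C := C * (|x| + 1 + (|y| + |z|) ^ 2)) ?_
  filter_upwards [(tendsto_chart x y z μ₂).eventually hC] with r hr
  refine hr.trans_eq ?_
  simp only [Real.norm_eq_abs, abs_mul, abs_pow, sq_abs]
  rw [abs_of_nonneg (by positivity), ← mul_add, mul_pow, sq_abs]
  ring

/-- Along the chart `H = O(r²)`. -/
theorem OrderH.hasDerivAt_chart (hH : OrderH H) (x y z μ₂ : ℝ) :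
    HasDerivAt (fun r : ℝ => H (r ^ 2 * x) (r * y) (r * z) (r ^ 2) (r * μ₂)) 0 0 := by
  obtain ⟨C, hC⟩ := hH.bound
  refine hasDerivAt_zero_of_le_sq (C := |C| * (|x| * |z| + |x| * |y| + z ^ 2 + 1)) ?_
  filter_upwards [(tendsto_chart x y z μ₂).eventually hC,
    Metric.ball_mem_nhds (0 : ℝ) one_pos] with r hr hr1
  have hr1' : |r| ≤ 1 := by simpa using (mem_ball_zero_iff.1 hr1).le
  refine hr.trans ?_
  simp only [Real.norm_eq_abs, abs_mul, abs_pow, sq_abs, mul_pow]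
  rw [abs_of_nonneg (by positivity)]
  calc C * (r ^ 2 * |x| * (|r| * |z|) + r ^ 2 * |x| * (|r| * |y|) + r ^ 2 * z ^ 2 + r ^ 2)
      ≤ |C| * (r ^ 2 * |x| * (1 * |z|) + r ^ 2 * |x| * (1 * |y|) + r ^ 2 * z ^ 2 + r ^ 2) := by
        gcongr
        exact le_abs_self C
    _ = _ := by ring

theorem OrderF.eq_zero (hF : OrderF F) : F 0 0 0 0 0 = 0 := by
  have := (OrderF.hasDerivAt_chart hF 0 0 0 0)
  obtain ⟨C, hC⟩ := hF.bound
  simpa using hC.self_of_nhds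

theorem OrderG.eq_zero (hG : OrderG G) : ∀ᶠ μ in 𝓝 (0 : ℝ), G 0 0 0 0 μ = 0 := by
  obtain ⟨C, hC⟩ := hG.bound
  have : Tendsto (fun μ : ℝ => ((0, 0, 0, 0, μ) : ℝ × ℝ × ℝ × ℝ × ℝ)) (𝓝 0) (𝓝 0) := by
    have : Continuous fun μ : ℝ => ((0, 0, 0, 0, μ) : ℝ × ℝ × ℝ × ℝ × ℝ) := by fun_prop
    exact this.tendsto' 0 0 rfl
  filter_upwards [this.eventually hC] with μ hμ
  simpa using hμ

theorem OrderH.eq_zero (hH : OrderH H) : H 0 0 0 0 0 = 0 := by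
  obtain ⟨C, hC⟩ := hH.bound
  simpa using hC.self_of_nhds

theorem hasDerivAt_of_ofReal {φ : ℝ → ℝ} {c : ℂ} {t : ℝ}
    (h : HasDerivAt (fun r => (φ r : ℂ)) c t) : HasDerivAt φ c.re t ∧ c = (c.re : ℂ) := by
  have h1 : HasDerivAt φ c.re t :=
    Complex.reCLM.hasFDerivAt.comp_hasDerivAt t h
  exact ⟨h1, h.unique h1.ofReal_comp⟩

/-- The linear part of `G` along the chart. -/
theorem AnalyticInSpace.hasDerivAt_chart (hGa : AnalyticInSpace G) (hG : OrderG G)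
    (x y z μ₂ : ℝ) :
    HasDerivAt (fun r : ℝ => (G (r ^ 2 * x) (r * y) (r * z) (r ^ 2) (r * μ₂) : ℂ))
      ((a₁ G * y + a₂ G * z : ℝ) : ℂ) 0 := by
  obtain ⟨ρ, hρ, fc, hsm, -, hre⟩ := hGa
  have hd := ((hsm.contDiffAt (Metric.ball_mem_nhds 0 hρ)).differentiableAt (by simp)).hasFDerivAt
  set L := fderiv ℝ fc 0 with hL
  -- `G` is differentiated along curves through the origin, as the restriction of the smooth `fc`.
  have hcurve : ∀ (c : ℝ → ℝ × ℝ × ℝ × ℝ × ℝ) (c' : ℝ × ℝ × ℝ × ℝ × ℝ), c 0 = 0 →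
      HasDerivAt c c' 0 → HasDerivAt (fun r => (G (c r).1 (c r).2.1 (c r).2.2.1 (c r).2.2.2.1
        (c r).2.2.2.2 : ℂ)) (L (((c'.1 : ℂ), (c'.2.1 : ℂ), (c'.2.2.1 : ℂ)),
          (c'.2.2.2.1, c'.2.2.2.2))) 0 := by
    intro c c' h0 hc
    have hL : ∀ l : ℝ × ℝ × ℝ × ℝ × ℝ →L[ℝ] ℝ, HasDerivAt (fun r => l (c r)) (l c') 0 := fun l =>
      l.hasFDerivAt.comp_hasDerivAt 0 hc
    have e1 := hL (.fst ℝ _ _)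
    have e2 := hL (.fst ℝ _ _ ∘L .snd ℝ _ _)
    have e3 := hL (.fst ℝ _ _ ∘L .snd ℝ _ _ ∘L .snd ℝ _ _)
    have e4 := hL (.fst ℝ _ _ ∘L .snd ℝ _ _ ∘L .snd ℝ _ _ ∘L .snd ℝ _ _)
    have e5 := hL (.snd ℝ _ _ ∘L .snd ℝ _ _ ∘L .snd ℝ _ _ ∘L .snd ℝ _ _)
    have hc2 : HasDerivAt (fun r => ((((c r).1 : ℂ), ((c r).2.1 : ℂ), ((c r).2.2.1 : ℂ)),
        ((c r).2.2.2.1, (c r).2.2.2.2))) (((c'.1 : ℂ), (c'.2.1 : ℂ), (c'.2.2.1 : ℂ)),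
          (c'.2.2.2.1, c'.2.2.2.2)) 0 :=
      (e1.ofReal_comp.prodMk (e2.ofReal_comp.prodMk e3.ofReal_comp)).prodMk (e4.prodMk e5)
    have hz : ((((c 0).1 : ℂ), ((c 0).2.1 : ℂ), ((c 0).2.2.1 : ℂ)),
        ((c 0).2.2.2.1, (c 0).2.2.2.2)) = (0 : (ℂ × ℂ × ℂ) × (ℝ × ℝ)) := by
      rw [h0]
      simp [Prod.zero_eq_mk]
    have h3 := HasFDerivAt.comp_hasDerivAt_of_eq (0 : ℝ) hd hc2 hz.symm
    refine h3.congr_of_eventuallyEq ?_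
    have hcc : Tendsto c (𝓝 0) (𝓝 0) := by
      have := hc.continuousAt.tendsto
      rwa [h0] at this
    filter_upwards [hcc.eventually (Metric.ball_mem_nhds 0 hρ)] with r hr
    replace hr : ‖c r‖ < ρ := mem_ball_zero_iff.1 hr
    simp only [Prod.norm_def, max_lt_iff, Real.norm_eq_abs] at hr
    exact (hre _ _ _ _ _ hr.1 hr.2.1 hr.2.2.1 hr.2.2.2.1 hr.2.2.2.2).symm
  have hmain := hcurve (fun r => (r ^ 2 * x, r * y, r * z, r ^ 2, r * μ₂)) (0, y, z, 0, μ₂)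
    (by ext <;> simp) (by
      have hsq : HasDerivAt (fun r : ℝ => r ^ 2) 0 0 := by simpa using hasDerivAt_pow 2 (0 : ℝ)
      have hid : ∀ c : ℝ, HasDerivAt (fun r : ℝ => r * c) c 0 := fun c => hasDerivAt_mul_const c
      have h1 : HasDerivAt (fun r : ℝ => r ^ 2 * x) 0 0 := by simpa using hsq.mul_const x
      exact h1.prodMk ((hid y).prodMk ((hid z).prodMk (hsq.prodMk (hid μ₂)))))
  have hy := hcurve (fun s => (0, s, 0, 0, 0)) (0, 1, 0, 0, 0) rfl
    ((hasDerivAt_const _ _).prodMk ((hasDerivAt_id _).prodMk (hasDerivAt_const _ _)))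
  have hz := hcurve (fun s => (0, 0, s, 0, 0)) (0, 0, 1, 0, 0) rfl
    ((hasDerivAt_const _ _).prodMk ((hasDerivAt_const _ _).prodMk
      ((hasDerivAt_id _).prodMk (hasDerivAt_const _ _))))
  have hμ := hcurve (fun s => (0, 0, 0, 0, s)) (0, 0, 0, 0, 1) rfl
    ((hasDerivAt_const _ _).prodMk ((hasDerivAt_const _ _).prodMk
      ((hasDerivAt_const _ _).prodMk ((hasDerivAt_const _ _).prodMk (hasDerivAt_id _)))))
  have hμ0 : L (((0 : ℂ), (0 : ℂ), (0 : ℂ)), ((0 : ℝ), (1 : ℝ))) = 0 := by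
    have h1 : HasDerivAt (fun s : ℝ => (G 0 0 0 0 s : ℂ)) 0 0 := by
      refine (hasDerivAt_const (0 : ℝ) (0 : ℂ)).congr_of_eventuallyEq ?_
      filter_upwards [hG.eq_zero] with s hs
      rw [hs, Complex.ofReal_zero]
    have := hμ.unique h1
    simpa using this
  obtain ⟨hy1, hy2⟩ := hasDerivAt_of_ofReal hy
  obtain ⟨hz1, hz2⟩ := hasDerivAt_of_ofReal hz
  rw [← hy1.deriv] at hy2
  rw [← hz1.deriv] at hz2
  simp only [Complex.ofReal_zero, Complex.ofReal_one] at hy2 hz2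
  convert hmain using 1
  have hsplit : (((((0 : ℝ) : ℂ), (y : ℂ), (z : ℂ)), ((0 : ℝ), μ₂)) : (ℂ × ℂ × ℂ) × (ℝ × ℝ)) =
      y • (((0 : ℂ), (1 : ℂ), (0 : ℂ)), ((0 : ℝ), (0 : ℝ))) +
      z • (((0 : ℂ), (0 : ℂ), (1 : ℂ)), ((0 : ℝ), (0 : ℝ))) +
      μ₂ • (((0 : ℂ), (0 : ℂ), (0 : ℂ)), ((0 : ℝ), (1 : ℝ))) := by
    simp
  rw [hsplit, map_add, map_add, map_smul, map_smul, map_smul, hμ0, hy2, hz2, smul_zero, add_zero,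
    Complex.real_smul, Complex.real_smul, a₁, a₂]
  push_cast
  ring

/-- The slow equation is `y' = r slowRate`. At `r = 0` this uses `G = 0` at the origin. -/
theorem chartField_snd_fst (hG : OrderG G) (r μ₂ x y z : ℝ) :
    (chartField F G H r (r * μ₂) x y z).2.1 = r * slowRate G r μ₂ x y z := by
  rw [chartField, slowRate]
  rcases eq_or_ne r 0 with rfl | hr
  · simpa using hG.eq_zero.self_of_nhds
  · simp only [if_neg hr]
    field_simp

/-- The components of the chart system extend to functions that are holomorphic in `(x, y, z)` and
smooth in `(r, μ₂)`, also for `r ≤ 0`. -/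
theorem exists_chart (hF : AnalyticInSpace F) (hG : AnalyticInSpace G) (hH : AnalyticInSpace H)
    (hF' : OrderF F) (hG' : OrderG G) (hH' : OrderH H) {K : ℝ} (hK : 0 < K) :
    ∃ ϱ, 0 < ϱ ∧ ∃ f₁ f₂ q : (ℂ × ℂ × ℂ) × (ℝ × ℝ) → ℂ, SmoothHol f₁ (chartDom K ϱ) ∧
      SmoothHol f₂ (chartDom K ϱ) ∧ SmoothHol q (chartDom K ϱ) ∧
      ∀ x y z r μ₂ : ℝ, castChart x y z r μ₂ ∈ chartDom K ϱ →
        f₁ (castChart x y z r μ₂) = ((chartField F G H r (r * μ₂) x y z).1 : ℂ) ∧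
        f₂ (castChart x y z r μ₂) = ((chartField F G H r (r * μ₂) x y z).2.2 : ℂ) ∧
        q (castChart x y z r μ₂) = (slowRate G r μ₂ x y z : ℂ) := by
  obtain ⟨ϱF, hϱF, gF, hgF, hgF'⟩ := exists_chartQuot hF hF'.eq_zero hK
  obtain ⟨ϱG, hϱG, gG, hgG, hgG'⟩ := exists_chartQuot hG hG'.eq_zero.self_of_nhds hK
  obtain ⟨ϱH, hϱH, gH, hgH, hgH'⟩ := exists_chartQuot hH hH'.eq_zero hK
  set ϱ := min ϱF (min ϱG ϱH) with hϱdef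
  have hϱ : 0 < ϱ := lt_min hϱF (lt_min hϱG hϱH)
  have sF := chartDom_mono (le_refl K) (min_le_left ϱF (min ϱG ϱH))
  have sG := chartDom_mono (le_refl K) ((min_le_right ϱF (min ϱG ϱH)).trans (min_le_left _ _))
  have sH := chartDom_mono (le_refl K) ((min_le_right ϱF (min ϱG ϱH)).trans (min_le_right _ _))
  have hx : SmoothHol (fun v : (ℂ × ℂ × ℂ) × (ℝ × ℝ) => v.1.1) (chartDom K ϱ) :=
    SmoothHol.clm (ContinuousLinearMap.fst ℂ ℂ (ℂ × ℂ))
  have hy : SmoothHol (fun v : (ℂ × ℂ × ℂ) × (ℝ × ℝ) => v.1.2.1) (chartDom K ϱ) :=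
    SmoothHol.clm (ContinuousLinearMap.fst ℂ ℂ ℂ ∘L ContinuousLinearMap.snd ℂ ℂ (ℂ × ℂ))
  have hz : SmoothHol (fun v : (ℂ × ℂ × ℂ) × (ℝ × ℝ) => v.1.2.2) (chartDom K ϱ) :=
    SmoothHol.clm (ContinuousLinearMap.snd ℂ ℂ ℂ ∘L ContinuousLinearMap.snd ℂ ℂ (ℂ × ℂ))
  have hp : ∀ {ψ : ℝ × ℝ → ℝ}, ContDiff ℝ ∞ ψ →
      SmoothHol (fun v : (ℂ × ℂ × ℂ) × (ℝ × ℝ) => ((ψ v.2 : ℝ) : ℂ)) (chartDom K ϱ) :=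
    fun {ψ} hψ => SmoothHol.param (ψ := fun p : ℝ × ℝ => ((ψ p : ℝ) : ℂ))
      (Complex.ofRealCLM.contDiff.comp (hψ.comp contDiff_snd)).contDiffOn
  refine ⟨ϱ, hϱ, fun v => v.1.2.1 - ((v.2.1 * v.2.2 + 1 : ℝ) : ℂ) * v.1.2.2 + gF v,
    fun v => v.1.1 + v.1.2.2 * v.1.2.2 + v.1.2.2 * gH v,
    fun v => ((v.2.2 / 2 : ℝ) : ℂ) + gG v, ?_, ?_, ?_, ?_⟩
  · exact (hy.sub ((hp (ψ := fun p => p.1 * p.2 + 1) (by fun_prop)).mul hz)).add (hgF.mono sF)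
  · exact (hx.add (hz.mul hz)).add (hz.mul (hgH.mono sH))
  · exact (hp (ψ := fun p => p.2 / 2) (by fun_prop)).add (hgG.mono sG)
  · intro x y z r μ₂ hv
    obtain ⟨eF, dF⟩ := hgF' x y z r μ₂ (sF hv)
    obtain ⟨eG, dG⟩ := hgG' x y z r μ₂ (sG hv)
    obtain ⟨eH, dH⟩ := hgH' x y z r μ₂ (sH hv)
    have dF' := dF.unique (OrderF.hasDerivAt_chart hF' x y z μ₂).ofReal_comp
    have dH' := dH.unique (OrderH.hasDerivAt_chart hH' x y z μ₂).ofReal_comp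
    have dG' := dG.unique (AnalyticInSpace.hasDerivAt_chart hG hG' x y z μ₂)
    have hgen : ∀ {g : (ℂ × ℂ × ℂ) × (ℝ × ℝ) → ℂ} {f : ℝ},
        (r : ℂ) * g (castChart x y z r μ₂) = f → (g (castChart x y z 0 μ₂) = ((0 : ℝ) : ℂ)) →
        g (castChart x y z r μ₂) = ((r * (f / r ^ 2) : ℝ) : ℂ) := by
      intro g f h1 h2
      rcases eq_or_ne r 0 with rfl | hr
      · rw [h2]; simp
      · have hr' : (r : ℂ) ≠ 0 := by exact_mod_cast hr
        push_cast
        rw [← h1]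
        field_simp
    have eF' := hgen eF dF'
    have eH' := hgen eH dH'
    refine ⟨?_, ?_, ?_⟩
    · rw [castChart] at eF'
      simp only [chartField, castChart, eF']
      push_cast
      ring
    · rw [castChart] at eH'
      simp only [chartField, castChart, eH']
      push_cast
      ring
    · have eG' : gG (castChart x y z r μ₂) = ((if r = 0 then a₁ G * y + a₂ G * z
          else G (r ^ 2 * x) (r * y) (r * z) (r ^ 2) (r * μ₂) / r : ℝ) : ℂ) := by
        rcases eq_or_ne r 0 with rfl | hr
        · rw [if_pos rfl, dG']
        · have hr' : (r : ℂ) ≠ 0 := by exact_mod_cast hr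
          rw [if_neg hr]
          push_cast
          rw [← eG]
          field_simp
      simp only [eG', slowRate]
      rw [castChart]
      push_cast
      rfl

end Chart

/-! ### Equilibria of the chart system -/

section Manifold

theorem isInvertible_of_inverse {X Y : Type} [NormedAddCommGroup X] [NormedSpace ℝ X]
    [NormedAddCommGroup Y] [NormedSpace ℝ Y] {L : X →L[ℝ] Y} (M : Y →L[ℝ] X)
    (h₁ : ∀ x, M (L x) = x) (h₂ : ∀ y, L (M y) = y) : L.IsInvertible :=
  ⟨ContinuousLinearEquiv.equivOfInverse L M h₁ h₂, rfl⟩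

variable {P : Type} [NormedAddCommGroup P] [NormedSpace ℝ P]

/-- Division of a function of `((s, a, b), p)` that vanishes at `s = 0` by the complex variable
`s`. -/
theorem exists_div_variable {U : Set P} (hU : IsOpen U) {B : Set (ℂ × ℂ)} (hB : IsOpen B) {σ : ℝ}
   {g : (ℂ × ℂ × ℂ) × P → ℂ} (hg : SmoothHol g ((Metric.ball 0 σ ×ˢ B) ×ˢ U))
    (h0 : ∀ c ∈ B, ∀ p ∈ U, g ((0, c), p) = 0) :
    ∃ Φ : (ℂ × ℂ × ℂ) × P → ℂ, SmoothHol Φ ((Metric.ball 0 σ ×ˢ B) ×ˢ U) ∧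
      ∀ v ∈ (Metric.ball (0 : ℂ) σ ×ˢ B) ×ˢ U, v.1.1 * Φ v = g v := by
  set D := (Metric.ball (0 : ℂ) σ ×ˢ B) ×ˢ U with hD
  have hDo : IsOpen D := (Metric.isOpen_ball.prod hB).prod hU
  set O : Set (ℂ × (ℂ × ℂ) × P) := Metric.ball 0 σ ×ˢ (B ×ˢ U) with hO
  have hOo : IsOpen O := Metric.isOpen_ball.prod (hB.prod hU)
  set g' : ℂ × (ℂ × ℂ) × P → ℂ := fun x => g ((x.1, x.2.1), x.2.2) with hg'
  have hOD : ∀ x ∈ O, ((x.1, x.2.1), x.2.2) ∈ D := fun x hx => ⟨⟨hx.1, hx.2.1⟩, hx.2.2⟩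
  have hDO : ∀ v ∈ D, (v.1.1, v.1.2, v.2) ∈ O := fun v hv => ⟨hv.1.1, hv.1.2, hv.2⟩
  have hg'S : SmoothHol g' O := ⟨hg.smooth.comp (by fun_prop) hOD, fun w q hv => by
    have h1 := hg.hol (w, q.1) q.2 (hOD _ hv)
    have h2 : DifferentiableAt ℂ (fun w : ℂ => (w, q.1)) w := by fun_prop
    exact DifferentiableAt.comp (g := fun w => g (w, q.2)) w h1 h2⟩
  have hstar : ∀ x ∈ O, ∀ τ ∈ Icc (0 : ℝ) 1, (τ • x.1, x.2) ∈ O := by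
    rintro ⟨s, q⟩ ⟨h1, h2⟩ τ hτ
    refine ⟨?_, h2⟩
    rw [mem_ball_zero_iff] at h1 ⊢
    rw [norm_smul, Real.norm_of_nonneg hτ.1]
    exact (mul_le_of_le_one_left (norm_nonneg _) hτ.2).trans_lt h1
  have hlin : ∀ x ∈ O, ∀ s : ℂ, fderiv ℝ g' x (s, 0) = s • fderiv ℝ g' x (1, 0) := by
    intro x hx s
    have hI := hg'S.fderiv_I_smul hOo hx 1
    have hsplit : ((s, 0) : ℂ × (ℂ × ℂ) × P) = s.re • (1, 0) + s.im • (Complex.I • (1 : ℂ), 0) := by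
      ext1
      · apply Complex.ext <;> simp
      · simp
    rw [hsplit, map_add, map_smul, map_smul, hI]
    conv_rhs => rw [← Complex.re_add_im s, add_smul, mul_smul]
    rfl
  have hmul : ∀ x ∈ O, x.1 * hadamardQuot g' x = g' x := by
    intro x hx
    have := smul_hadamardQuot hOo hg'S.smooth hstar hlin hx
    have h00 : g' (0, x.2) = 0 := h0 _ hx.2.1 _ hx.2.2
    rw [h00, sub_zero] at this
    exact this
  have hmulD : ∀ v ∈ D, v.1.1 * hadamardQuot g' (v.1.1, v.1.2, v.2) = g v := fun v hv =>
    hmul _ (hDO v hv)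
  refine ⟨fun v => hadamardQuot g' (v.1.1, v.1.2, v.2), ?_, hmulD⟩
  have hdense : Dense {v : (ℂ × ℂ × ℂ) × P | v.1.1 ≠ 0} :=
    (dense_compl_singleton (0 : ℂ)).preimage (isOpenMap_fst.comp isOpenMap_fst)
  refine SmoothHol.of_dense hDo
    ((contDiffOn_hadamardQuot hOo hg'S.smooth hstar).comp (by fun_prop) hDO) hdense ?_
  rintro w p ⟨hv, hw⟩
  have hw : w.1 ≠ 0 := hw
  have hE : (fun w : ℂ × ℂ × ℂ => hadamardQuot g' (w.1, w.2, p)) =ᶠ[𝓝 w]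
      fun w => (w.1)⁻¹ * g (w, p) := by
    have h1 : ContinuousAt (fun w : ℂ × ℂ × ℂ => (w, p)) w := by fun_prop
    have h2 : ∀ᶠ w' : ℂ × ℂ × ℂ in 𝓝 w, w'.1 ≠ 0 := continuousAt_fst.eventually_ne hw
    filter_upwards [h1.preimage_mem_nhds (hDo.mem_nhds hv), h2] with w' hw' hne
    rw [eq_inv_mul_iff_mul_eq₀ hne]
    exact hmulD _ hw'
  refine DifferentiableAt.congr_of_eventuallyEq ?_ hE
  exact (DifferentiableAt.inv differentiableAt_fst hw).mul (hg.hol w p hv)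

/-- A function that is continuous in a real variable near `0` is determined at `0` by its values
elsewhere. -/
theorem eq_of_eq_ne {Y : Type} [TopologicalSpace Y] [T2Space Y] {φ ψ : ℝ → Y}
    (hφ : ContinuousAt φ 0) (hψ : ContinuousAt ψ 0) (h : ∀ᶠ s in 𝓝 0, s ≠ 0 → φ s = ψ s) :
    φ 0 = ψ 0 := by
  refine tendsto_nhds_unique (hφ.tendsto.mono_left (nhdsWithin_le_nhds (s := {0}ᶜ))) ?_
  refine (hψ.tendsto.mono_left (nhdsWithin_le_nhds (s := {0}ᶜ))).congr' ?_
  exact eventually_nhdsWithin_iff.2 (h.mono fun s hs hne => (hs hne).symm)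

variable {F G H : ℝ → ℝ → ℝ → ℝ → ℝ → ℝ}

theorem chartField_zero (hG' : OrderG G) (μ₂ x y z : ℝ) :
    chartField F G H 0 (0 * μ₂) x y z = (y - z, 0, x + z ^ 2) := by
  have h := hG'.eq_zero.self_of_nhds
  rw [chartField]
  simp [h]

theorem slowRate_zero (μ₂ x y z : ℝ) :
    slowRate G 0 μ₂ x y z = μ₂ / 2 + (a₁ G * y + a₂ G * z) := by
  rw [slowRate, if_pos rfl]

theorem contDiff_castChart : ContDiff ℝ ∞ fun u : (ℝ × ℝ) × (ℝ × ℝ × ℝ) =>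
    castChart u.2.1 u.2.2.1 u.2.2.2 u.1.1 u.1.2 := by
  have h : ∀ {φ : (ℝ × ℝ) × (ℝ × ℝ × ℝ) → ℝ}, ContDiff ℝ ∞ φ →
      ContDiff ℝ ∞ fun u => ((φ u : ℝ) : ℂ) := fun hφ => Complex.ofRealCLM.contDiff.comp hφ
  exact ((h (by fun_prop)).prodMk ((h (by fun_prop)).prodMk (h (by fun_prop)))).prodMk
    (by fun_prop)

/-- The chart system, with the slow equation divided by `r`, has an equilibrium close to the origin
for all small parameters, by the implicit function theorem. -/
theorem exists_equilibrium (hlam : a₁ G + a₂ G ≠ 0) (hG' : OrderG G) {K ϱ : ℝ} (hK : 0 < K)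
    (hϱ : 0 < ϱ) {f₁ f₂ q : (ℂ × ℂ × ℂ) × (ℝ × ℝ) → ℂ} (hf₁ : ContDiffOn ℝ ∞ f₁ (chartDom K ϱ))
    (hf₂ : ContDiffOn ℝ ∞ f₂ (chartDom K ϱ)) (hq : ContDiffOn ℝ ∞ q (chartDom K ϱ))
    (hreal : ∀ x y z r μ₂ : ℝ, castChart x y z r μ₂ ∈ chartDom K ϱ →
        f₁ (castChart x y z r μ₂) = ((chartField F G H r (r * μ₂) x y z).1 : ℂ) ∧
        f₂ (castChart x y z r μ₂) = ((chartField F G H r (r * μ₂) x y z).2.2 : ℂ) ∧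
        q (castChart x y z r μ₂) = (slowRate G r μ₂ x y z : ℂ)) :
    ∃ ψ : ℝ × ℝ → ℝ × ℝ × ℝ, ψ 0 = 0 ∧ (∀ᶠ p in 𝓝 0, ContDiffAt ℝ ∞ ψ p) ∧
      ∀ᶠ p in 𝓝 0, (f₁ (castChart (ψ p).1 (ψ p).2.1 (ψ p).2.2 p.1 p.2) = 0 ∧
        f₂ (castChart (ψ p).1 (ψ p).2.1 (ψ p).2.2 p.1 p.2) = 0 ∧
        q (castChart (ψ p).1 (ψ p).2.1 (ψ p).2.2 p.1 p.2) = 0) := by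
  set c : (ℝ × ℝ) × (ℝ × ℝ × ℝ) → (ℂ × ℂ × ℂ) × (ℝ × ℝ) :=
    fun u => castChart u.2.1 u.2.2.1 u.2.2.2 u.1.1 u.1.2 with hc
  have hcs : ContDiff ℝ ∞ c := contDiff_castChart
  set O : Set ((ℝ × ℝ) × (ℝ × ℝ × ℝ)) := c ⁻¹' chartDom K ϱ with hOdef
  have hO : IsOpen O := (isOpen_chartDom K ϱ).preimage hcs.continuous
  set e : (ℝ × ℝ) × (ℝ × ℝ × ℝ) → ℝ × ℝ × ℝ :=
    fun u => ((f₁ (c u)).re, (f₂ (c u)).re, (q (c u)).re) with he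
  have hre : ∀ {f : (ℂ × ℂ × ℂ) × (ℝ × ℝ) → ℂ}, ContDiffOn ℝ ∞ f (chartDom K ϱ) →
      ContDiffOn ℝ ∞ (fun u => (f (c u)).re) O := fun hf =>
    Complex.reCLM.contDiff.comp_contDiffOn (hf.comp hcs.contDiffOn fun u hu => hu)
  have hes : ContDiffOn ℝ ∞ e O := (hre hf₁).prodMk ((hre hf₂).prodMk (hre hq))
  have h0O : ((0 : ℝ × ℝ), (0 : ℝ × ℝ × ℝ)) ∈ O := by
    refine castChart_mem.2 ?_
    simp [hK, hϱ]
  have heq : ∀ u ∈ O, e u = ((chartField F G H u.1.1 (u.1.1 * u.1.2) u.2.1 u.2.2.1 u.2.2.2).1,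
      (chartField F G H u.1.1 (u.1.1 * u.1.2) u.2.1 u.2.2.1 u.2.2.2).2.2,
      slowRate G u.1.1 u.1.2 u.2.1 u.2.2.1 u.2.2.2) := by
    intro u hu
    obtain ⟨h1, h2, h3⟩ := hreal _ _ _ _ _ hu
    simp only [he, hc, h1, h2, h3, Complex.ofReal_re]
  have hbase : ∀ w : ℝ × ℝ × ℝ, ((0 : ℝ × ℝ), w) ∈ O →
      e (0, w) = (w.2.1 - w.2.2, w.1 + w.2.2 ^ 2, a₁ G * w.2.1 + a₂ G * w.2.2) := by
    intro w hw
    rw [heq _ hw]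
    simp only [Prod.fst_zero, Prod.snd_zero]
    rw [chartField_zero hG', slowRate_zero]
    simp
  have hder : HasFDerivAt (fun w : ℝ × ℝ × ℝ => e (0, w))
      (fderiv ℝ e (0, 0) ∘L .inr ℝ (ℝ × ℝ) (ℝ × ℝ × ℝ)) 0 :=
    ((hes.contDiffAt (hO.mem_nhds h0O)).differentiableAt (by simp)).hasFDerivAt.comp 0
      (hasFDerivAt_prodMk_right 0 0)
  let π₁ : ℝ × ℝ × ℝ →L[ℝ] ℝ := .fst ℝ _ _
  let π₂ : ℝ × ℝ × ℝ →L[ℝ] ℝ := .fst ℝ _ _ ∘L .snd ℝ _ _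
  let π₃ : ℝ × ℝ × ℝ →L[ℝ] ℝ := .snd ℝ _ _ ∘L .snd ℝ _ _
  have hder' : HasFDerivAt (fun w : ℝ × ℝ × ℝ => e (0, w))
      ((π₂ - π₃).prod (π₁.prod (a₁ G • π₂ + a₂ G • π₃))) 0 := by
    have h1 : HasFDerivAt (fun w : ℝ × ℝ × ℝ =>
        (w.2.1 - w.2.2, w.1 + w.2.2 ^ 2, a₁ G * w.2.1 + a₂ G * w.2.2))
        ((π₂ - π₃).prod (π₁.prod (a₁ G • π₂ + a₂ G • π₃))) 0 := by
      have e1 : HasFDerivAt (fun w : ℝ × ℝ × ℝ => w.1) π₁ 0 := π₁.hasFDerivAt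
      have e2 : HasFDerivAt (fun w : ℝ × ℝ × ℝ => w.2.1) π₂ 0 := π₂.hasFDerivAt
      have e3 : HasFDerivAt (fun w : ℝ × ℝ × ℝ => w.2.2) π₃ 0 := π₃.hasFDerivAt
      have e4 : HasFDerivAt (fun w : ℝ × ℝ × ℝ => w.1 + w.2.2 ^ 2) π₁ 0 := by
        have := e1.add (e3.pow 2)
        simp only [Prod.snd_zero, smul_zero, zero_smul, add_zero, pow_one,
          Nat.add_one_sub_one] at this
        exact this
      exact (e2.sub e3).prodMk (e4.prodMk ((e2.const_mul _).add (e3.const_mul _)))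
    refine h1.congr_of_eventuallyEq ?_
    have h2 : ContinuousAt (fun w : ℝ × ℝ × ℝ => ((0 : ℝ × ℝ), w)) 0 := by fun_prop
    filter_upwards [h2.preimage_mem_nhds (hO.mem_nhds h0O)] with w hw using hbase w hw
  have hinv : (fderiv ℝ e (0, 0) ∘L .inr ℝ (ℝ × ℝ) (ℝ × ℝ × ℝ)).IsInvertible := by
    rw [hder.unique hder']
    refine isInvertible_of_inverse (π₂.prod (((a₁ G + a₂ G)⁻¹ • (π₃ + a₂ G • π₁)).prod
      ((a₁ G + a₂ G)⁻¹ • (π₃ - a₁ G • π₁)))) (fun w => ?_) (fun w => ?_)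
    · refine Prod.ext ?_ (Prod.ext ?_ ?_)
      · simp [π₁, π₂, π₃]
      · simp [π₁, π₂, π₃]
        field_simp
        ring
      · simp [π₁, π₂, π₃]
        field_simp
        ring
    · refine Prod.ext ?_ (Prod.ext ?_ ?_)
      · simp [π₁, π₂, π₃]
        field_simp
        ring
      · simp [π₁, π₂, π₃]
      · simp [π₁, π₂, π₃]
        field_simp
        ring
  obtain ⟨ψ, h1, h2, h3, -⟩ := exists_smooth_implicitFunction hO hes h0O
    ((hbase 0 h0O).trans (by simp [Prod.zero_eq_mk])) hinv
  refine ⟨ψ, h1, h2, ?_⟩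
  filter_upwards [h3] with p hp
  obtain ⟨e1, e2, e3⟩ := hreal _ _ _ _ _ hp.1
  have := hp.2
  simp only [he, hc, Prod.mk_eq_zero] at this
  simp only at e1 e2 e3
  rw [e1, e2, e3, Complex.ofReal_re, Complex.ofReal_re, Complex.ofReal_re] at this
  rw [e1, e2, e3, this.1, this.2.1, this.2.2]
  simp

end Manifold

/-! ### The invariance equation near the equilibrium -/

section Invariant

variable {F G H : ℝ → ℝ → ℝ → ℝ → ℝ → ℝ}

/-- The functions `f₁`, `f₂`, `q` extend the components of the chart system. -/
def ExtendsChart (F G H : ℝ → ℝ → ℝ → ℝ → ℝ → ℝ) (K ϱ : ℝ)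
    (f₁ f₂ q : (ℂ × ℂ × ℂ) × (ℝ × ℝ) → ℂ) : Prop :=
  ∀ x y z r μ₂ : ℝ, castChart x y z r μ₂ ∈ chartDom K ϱ →
    f₁ (castChart x y z r μ₂) = ((chartField F G H r (r * μ₂) x y z).1 : ℂ) ∧
    f₂ (castChart x y z r μ₂) = ((chartField F G H r (r * μ₂) x y z).2.2 : ℂ) ∧
    q (castChart x y z r μ₂) = (slowRate G r μ₂ x y z : ℂ)

theorem continuous_castChart_fst (a b : ℝ) (p : ℝ × ℝ) :
    Continuous fun t : ℝ => ((((t : ℂ), (a : ℂ), (b : ℂ)), p) : (ℂ × ℂ × ℂ) × (ℝ × ℝ)) := by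
  fun_prop

/-- In the coordinates `x = x* + s a`, `y = y* + s`, `z = z* + s (1 + b)` around the equilibrium
`(x*, y*, z*)`, the equation for an invariant graph `(a, b)` over `s` reads
`r s (a, b)' = Θ`. -/
theorem exists_rescaled_equation (hlam : a₁ G + a₂ G ≠ 0) (hG' : OrderG G) {ϱ : ℝ}
    (hϱ : 0 < ϱ) {f₁ f₂ q : (ℂ × ℂ × ℂ) × (ℝ × ℝ) → ℂ} (hf₁ : SmoothHol f₁ (chartDom 4 ϱ))
    (hf₂ : SmoothHol f₂ (chartDom 4 ϱ)) (hq : SmoothHol q (chartDom 4 ϱ))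
    (hreal : ExtendsChart F G H 4 ϱ f₁ f₂ q) :
    ∃ (ψ : ℝ × ℝ → ℝ × ℝ × ℝ) (ε : ℝ) (Θ : (ℂ × ℂ × ℂ) × (ℝ × ℝ) → ℂ × ℂ), 0 < ε ∧
      ψ 0 = 0 ∧ ContDiffOn ℝ ∞ ψ (Metric.ball 0 ε) ∧
      (∀ p ∈ Metric.ball (0 : ℝ × ℝ) ε, ‖ψ p‖ < 1 / 2 ∧ |p.1| < ϱ ∧ |p.2| < 1) ∧
      SmoothHol Θ (Metric.ball 0 ε ×ˢ Metric.ball 0 ε) ∧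
      (∀ p ∈ Metric.ball (0 : ℝ × ℝ) ε, ∀ s a b : ℝ, |s| < ε → |a| < ε → |b| < ε →
        ∃ (θ : ℝ × ℝ) (χ : ℝ), Θ (((s : ℂ), (a : ℂ), (b : ℂ)), p) = castPair θ ∧
          slowRate G p.1 p.2 ((ψ p).1 + s * a) ((ψ p).2.1 + s) ((ψ p).2.2 + s * (1 + b)) =
            s * χ ∧
          (chartField F G H p.1 (p.1 * p.2) ((ψ p).1 + s * a) ((ψ p).2.1 + s)
            ((ψ p).2.2 + s * (1 + b))).1 = s * (χ * (θ.1 + p.1 * a)) ∧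
          (chartField F G H p.1 (p.1 * p.2) ((ψ p).1 + s * a) ((ψ p).2.1 + s)
            ((ψ p).2.2 + s * (1 + b))).2.2 = s * (χ * (θ.2 + p.1 * (1 + b)))) ∧
      ∀ a b : ℝ, |a| < ε → |b| < ε → Θ (((0 : ℂ), (a : ℂ), (b : ℂ)), 0) =
        castPair ((a₁ G + a₂ G + a₂ G * b)⁻¹ • (-b, a)) := by
  obtain ⟨ψ, hψ0, hψs, hψe⟩ := exists_equilibrium hlam hG' (by norm_num : (0 : ℝ) < 4) hϱ
    hf₁.smooth hf₂.smooth hq.smooth hreal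
  have hψc : ContinuousAt ψ 0 := hψs.self_of_nhds.continuousAt
  have hnear : ∀ᶠ p in 𝓝 (0 : ℝ × ℝ), ‖ψ p‖ < 1 / 2 ∧ |p.1| < ϱ ∧ |p.2| < 1 := by
    have h1 : ∀ᶠ p in 𝓝 (0 : ℝ × ℝ), ‖ψ p‖ < 1 / 2 :=
      hψc.norm.eventually (gt_mem_nhds (by simp [hψ0]))
    have h2 : ∀ᶠ p in 𝓝 (0 : ℝ × ℝ), |p.1| < ϱ :=
      (continuous_fst.abs.tendsto' (0 : ℝ × ℝ) 0 (by simp)).eventually (gt_mem_nhds hϱ)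
    have h3 : ∀ᶠ p in 𝓝 (0 : ℝ × ℝ), |p.2| < 1 :=
      (continuous_snd.abs.tendsto' (0 : ℝ × ℝ) 0 (by simp)).eventually (gt_mem_nhds one_pos)
    exact h1.and (h2.and h3)
  obtain ⟨ε₁, hε₁, hU⟩ := Metric.eventually_nhds_iff_ball.1 (hψs.and (hψe.and hnear))
  set U : Set (ℝ × ℝ) := Metric.ball 0 ε₁ with hUdef
  have hUo : IsOpen U := Metric.isOpen_ball
  set B : Set (ℂ × ℂ) := Metric.ball 0 3 with hBdef
  have hBo : IsOpen B := Metric.isOpen_ball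
  set D := (Metric.ball (0 : ℂ) 1 ×ˢ B) ×ˢ U with hD
  have hDo : IsOpen D := (Metric.isOpen_ball.prod hBo).prod hUo
  have hψU : ContDiffOn ℝ ∞ ψ U := fun p hp => (hU p hp).1.contDiffWithinAt
  -- The blow-up `(s, a, c) ↦ (x* + s a, y* + s, z* + s c)`.
  set φ : (ℂ × ℂ × ℂ) × (ℝ × ℝ) → ℂ × ℂ × ℂ := fun v =>
    (((ψ v.2).1 : ℂ) + v.1.1 * v.1.2.1, ((ψ v.2).2.1 : ℂ) + v.1.1,
      ((ψ v.2).2.2 : ℂ) + v.1.1 * v.1.2.2) with hφ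
  have hφS : SmoothHol φ D := by
    have hs : SmoothHol (fun v : (ℂ × ℂ × ℂ) × (ℝ × ℝ) => v.1.1) D :=
      SmoothHol.clm (ContinuousLinearMap.fst ℂ ℂ (ℂ × ℂ))
    have ha : SmoothHol (fun v : (ℂ × ℂ × ℂ) × (ℝ × ℝ) => v.1.2.1) D :=
      SmoothHol.clm (ContinuousLinearMap.fst ℂ ℂ ℂ ∘L ContinuousLinearMap.snd ℂ ℂ (ℂ × ℂ))
    have hb : SmoothHol (fun v : (ℂ × ℂ × ℂ) × (ℝ × ℝ) => v.1.2.2) D :=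
      SmoothHol.clm (ContinuousLinearMap.snd ℂ ℂ ℂ ∘L ContinuousLinearMap.snd ℂ ℂ (ℂ × ℂ))
    have hp : ∀ L : ℝ × ℝ × ℝ →L[ℝ] ℝ,
        SmoothHol (fun v : (ℂ × ℂ × ℂ) × (ℝ × ℝ) => ((L (ψ v.2) : ℝ) : ℂ)) D := fun L =>
      SmoothHol.param (ψ := fun p : ℝ × ℝ => ((L (ψ p) : ℝ) : ℂ))
        ((Complex.ofRealCLM ∘L L).contDiff.comp_contDiffOn
          (hψU.comp contDiff_snd.contDiffOn fun v hv => hv.2))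
    exact ((hp (.fst ℝ _ _)).add (hs.mul ha)).prodMk
      (((hp (.fst ℝ _ _ ∘L .snd ℝ _ _)).add hs).prodMk
      ((hp (.snd ℝ _ _ ∘L .snd ℝ _ _)).add (hs.mul hb)))
  have hφD : ∀ v ∈ D, (φ v, v.2) ∈ chartDom 4 ϱ := by
    rintro ⟨⟨s, a, b⟩, p⟩ ⟨⟨hs, hc⟩, hp⟩
    obtain ⟨-, -, hψp, hp1, hp2⟩ := hU p hp
    simp only [hBdef, mem_ball_zero_iff, Prod.norm_def, max_lt_iff] at hs hc hψp
    obtain ⟨ha, hb⟩ := hc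
    obtain ⟨h1, h2, h3⟩ := hψp
    have hmul : ∀ c : ℂ, ‖c‖ < 3 → ‖s * c‖ < 3 := fun c hc => by
      rw [norm_mul]
      exact (mul_le_of_le_one_left (norm_nonneg _) hs.le).trans_lt hc
    have hre : ∀ x : ℝ, ‖x‖ < 1 / 2 → ‖(x : ℂ)‖ < 1 / 2 := fun x hx => by
      rwa [Complex.norm_real]
    refine ⟨?_, by simpa using hp1, by simpa using hp2⟩
    simp only [hφ, mem_ball_zero_iff, Prod.norm_def, max_lt_iff]
    refine ⟨?_, ?_, ?_⟩
    · linarith [norm_add_le ((ψ p).1 : ℂ) (s * a), hre _ h1, hmul a ha]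
    · linarith [norm_add_le ((ψ p).2.1 : ℂ) s, hre _ h2]
    · linarith [norm_add_le ((ψ p).2.2 : ℂ) (s * b), hre _ h3, hmul b hb]
  have hφr : ∀ (s a b : ℝ) (p : ℝ × ℝ), (φ (((s : ℂ), (a : ℂ), (b : ℂ)), p), p) =
      castChart ((ψ p).1 + s * a) ((ψ p).2.1 + s) ((ψ p).2.2 + s * b) p.1 p.2 := by
    intro s a b p
    simp [hφ, castChart]
  have hpar : ContDiffOn ℝ ∞ (fun v : (ℂ × ℂ × ℂ) × (ℝ × ℝ) => id v.2) D :=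
    contDiff_snd.contDiffOn
  have hφ0 : ∀ c ∈ B, ∀ p ∈ U, (φ ((0, c), p), p) =
      castChart (ψ p).1 (ψ p).2.1 (ψ p).2.2 p.1 p.2 := by
    intro c _ p _
    simp [hφ, castChart]
  obtain ⟨Φ₁, hΦ₁, hm₁⟩ := exists_div_variable hUo hBo (hf₁.subst hφS hpar hφD)
    (fun c hc p hp => by
      have := (hU p hp).2.1.1
      rwa [← hφ0 c hc p hp] at this)
  obtain ⟨Φ₂, hΦ₂, hm₂⟩ := exists_div_variable hUo hBo (hf₂.subst hφS hpar hφD)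
    (fun c hc p hp => by
      have := (hU p hp).2.1.2.1
      rwa [← hφ0 c hc p hp] at this)
  obtain ⟨X, hX, hmX⟩ := exists_div_variable hUo hBo (hq.subst hφS hpar hφD)
    (fun c hc p hp => by
      have := (hU p hp).2.1.2.2
      rwa [← hφ0 c hc p hp] at this)
  -- The quotients `Φ₁`, `Φ₂`, `X` by `s` are real at real points: for `s ≠ 0` as quotients of real
  -- numbers, at `s = 0` by continuity.
  have hDr : ∀ {s a b : ℝ} {p : ℝ × ℝ}, |s| < 1 → |a| < 3 → |b| < 3 → p ∈ U →
      (((s : ℂ), (a : ℂ), (b : ℂ)), p) ∈ D := by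
    intro s a b p hs ha hb hp
    refine ⟨⟨by simpa using hs, ?_⟩, hp⟩
    simp [hBdef, Prod.norm_def, ha, hb]
  have hcont : ∀ {Φ : (ℂ × ℂ × ℂ) × (ℝ × ℝ) → ℂ}, SmoothHol Φ D → ∀ {a b : ℝ} {p : ℝ × ℝ},
      |a| < 3 → |b| < 3 → p ∈ U →
      ContinuousAt (fun t : ℝ => Φ (((t : ℂ), (a : ℂ), (b : ℂ)), p)) 0 := by
    intro Φ hΦ a b p ha hb hp
    have h1 := hΦ.smooth.continuousOn.continuousAt
      (hDo.mem_nhds (hDr (s := 0) (by simp) ha hb hp))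
    exact ContinuousAt.comp (g := Φ) h1 (continuous_castChart_fst a b p).continuousAt
  have hsmall : ∀ᶠ t : ℝ in 𝓝 0, |t| < 1 :=
    (continuous_abs.tendsto' (0 : ℝ) 0 abs_zero).eventually (gt_mem_nhds one_pos)
  have him : ∀ {Φ : (ℂ × ℂ × ℂ) × (ℝ × ℝ) → ℂ}, SmoothHol Φ D →
      ∀ {a b : ℝ} {p : ℝ × ℝ}, |a| < 3 → |b| < 3 → p ∈ U → (∀ s : ℝ, |s| < 1 →
        ∃ x : ℝ, (s : ℂ) * Φ (((s : ℂ), (a : ℂ), (b : ℂ)), p) = x) →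
      ∀ s : ℝ, |s| < 1 → (Φ (((s : ℂ), (a : ℂ), (b : ℂ)), p)).im = 0 := by
    intro Φ hΦ a b p ha hb hp h
    have hne : ∀ s : ℝ, |s| < 1 → s ≠ 0 → (Φ (((s : ℂ), (a : ℂ), (b : ℂ)), p)).im = 0 := by
      intro s hs h0
      obtain ⟨x, hx⟩ := h s hs
      have := congrArg Complex.im hx
      rw [Complex.im_ofReal_mul, Complex.ofReal_im] at this
      exact (mul_eq_zero.1 this).resolve_left h0
    intro s hs
    rcases eq_or_ne s 0 with rfl | h0
    · exact eq_of_eq_ne (φ := fun t : ℝ => (Φ (((t : ℂ), (a : ℂ), (b : ℂ)), p)).im)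
        (ψ := fun _ => 0) (Complex.continuous_im.continuousAt.comp (hcont hΦ ha hb hp))
        continuousAt_const (hsmall.mono fun t ht h => hne t ht h)
    · exact hne s hs h0
  -- At real points the quotients reproduce the chart system.
  have hvals : ∀ {s a b : ℝ} {p : ℝ × ℝ}, |s| < 1 → |a| < 3 → |b| < 3 → p ∈ U →
      (s : ℂ) * Φ₁ (((s : ℂ), (a : ℂ), (b : ℂ)), p) = ((chartField F G H p.1 (p.1 * p.2)
        ((ψ p).1 + s * a) ((ψ p).2.1 + s) ((ψ p).2.2 + s * b)).1 : ℂ) ∧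
      (s : ℂ) * Φ₂ (((s : ℂ), (a : ℂ), (b : ℂ)), p) = ((chartField F G H p.1 (p.1 * p.2)
        ((ψ p).1 + s * a) ((ψ p).2.1 + s) ((ψ p).2.2 + s * b)).2.2 : ℂ) ∧
      (s : ℂ) * X (((s : ℂ), (a : ℂ), (b : ℂ)), p) = (slowRate G p.1 p.2
        ((ψ p).1 + s * a) ((ψ p).2.1 + s) ((ψ p).2.2 + s * b) : ℂ) := by
    intro s a b p hs ha hb hp
    have hv := hDr hs ha hb hp
    have hc := hφD _ hv
    simp only [hφr] at hc
    obtain ⟨e1, e2, e3⟩ := hreal _ _ _ _ _ hc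
    rw [← hφr] at e1 e2 e3
    exact ⟨(hm₁ _ hv).trans e1, (hm₂ _ hv).trans e2, (hmX _ hv).trans e3⟩
  have h0U : (0 : ℝ × ℝ) ∈ U := Metric.mem_ball_self hε₁
  have hbase : ∀ {Φ : (ℂ × ℂ × ℂ) × (ℝ × ℝ) → ℂ}, SmoothHol Φ D → ∀ {a b : ℝ}, |a| < 3 →
      |b| < 3 → ∀ {g : ℝ → ℝ}, ContinuousAt g 0 → (∀ s : ℝ, |s| < 1 →
        (s : ℂ) * Φ (((s : ℂ), (a : ℂ), (b : ℂ)), 0) = ((s * g s : ℝ) : ℂ)) →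
      Φ (((0 : ℂ), (a : ℂ), (b : ℂ)), 0) = (g 0 : ℂ) := by
    intro Φ hΦ a b ha hb g hg h
    have := eq_of_eq_ne (φ := fun t : ℝ => Φ (((t : ℂ), (a : ℂ), (b : ℂ)), 0))
      (ψ := fun t => (g t : ℂ)) (hcont hΦ ha hb h0U)
      (Complex.continuous_ofReal.continuousAt.comp hg) (hsmall.mono fun t ht hne => by
        have h1 := h t ht
        rw [Complex.ofReal_mul] at h1
        exact mul_left_cancel₀ (Complex.ofReal_ne_zero.2 hne) h1)
    simpa using this
  have hb1 : ∀ {a b : ℝ}, |a| < 3 → |b| < 3 →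
      Φ₁ (((0 : ℂ), (a : ℂ), (b : ℂ)), 0) = ((1 - b : ℝ) : ℂ) ∧
      Φ₂ (((0 : ℂ), (a : ℂ), (b : ℂ)), 0) = ((a + 0 * b ^ 2 : ℝ) : ℂ) ∧
      X (((0 : ℂ), (a : ℂ), (b : ℂ)), 0) = ((a₁ G + a₂ G * b : ℝ) : ℂ) := by
    intro a b ha hb
    refine ⟨hbase hΦ₁ ha hb (g := fun _ => 1 - b) continuousAt_const fun s hs => ?_,
      hbase hΦ₂ ha hb (g := fun s => a + s * b ^ 2) (by fun_prop) fun s hs => ?_,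
      hbase hX ha hb (g := fun _ => a₁ G + a₂ G * b) continuousAt_const fun s hs => ?_⟩
    · rw [(hvals hs ha hb h0U).1]
      simp only [Prod.fst_zero, Prod.snd_zero, chartField_zero hG', hψ0]
      congr 1
      ring
    · rw [(hvals hs ha hb h0U).2.1]
      simp only [Prod.fst_zero, Prod.snd_zero, chartField_zero hG', hψ0]
      congr 1
      ring
    · rw [(hvals hs ha hb h0U).2.2]
      simp only [Prod.fst_zero, Prod.snd_zero, slowRate_zero, hψ0]
      congr 1
      ring
  -- Dividing by `X` requires `X ≠ 0`. Near `s = 0`, `c = 1` this holds, where `X` is close to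
  -- `∂G/∂y + ∂G/∂z`.
  set O := D ∩ X ⁻¹' {0}ᶜ with hO
  have hOo : IsOpen O := hX.smooth.continuousOn.isOpen_inter_preimage hDo isOpen_compl_singleton
  let τ : (ℂ × ℂ × ℂ) × (ℝ × ℝ) → (ℂ × ℂ × ℂ) × (ℝ × ℝ) := fun v =>
    ((v.1.1, v.1.2.1, 1 + v.1.2.2), v.2)
  have hτ : ContDiff ℝ ∞ τ := by fun_prop
  have hτ0 : τ 0 ∈ O := by
    have h1 : τ 0 = ((((0 : ℝ) : ℂ), ((0 : ℝ) : ℂ), ((1 : ℝ) : ℂ)), 0) := by simp [τ]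
    refine ⟨?_, ?_⟩
    · rw [h1]
      exact hDr (by simp) (by simp) (by simp) h0U
    · have := (hb1 (a := 0) (b := 1) (by simp) (by simp)).2.2
      rw [mem_preimage, h1, Complex.ofReal_zero, ← Complex.ofReal_zero]
      rw [Complex.ofReal_zero] at this ⊢
      rw [this]
      simp only [mul_one, mem_compl_iff, mem_singleton_iff]
      exact_mod_cast hlam
  obtain ⟨ε, hε, hεO⟩ := Metric.isOpen_iff.1 (hOo.preimage hτ.continuous) 0 hτ0
  have hε1 : ∀ v ∈ Metric.ball (0 : ℂ × ℂ × ℂ) ε ×ˢ Metric.ball (0 : ℝ × ℝ) ε, τ v ∈ O := by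
    intro v hv
    refine hεO ?_
    rw [ball_prod_same] at hv
    exact hv
  have hpU : ∀ p ∈ Metric.ball (0 : ℝ × ℝ) ε, p ∈ U := fun p hp =>
    (hε1 (0, p) ⟨Metric.mem_ball_self hε, hp⟩).1.2
  have hshift : ∀ {Φ : (ℂ × ℂ × ℂ) × (ℝ × ℝ) → ℂ}, SmoothHol Φ D →
      SmoothHol (fun v => Φ (τ v)) (Metric.ball 0 ε ×ˢ Metric.ball 0 ε) := fun {Φ} hΦ =>
    ⟨hΦ.smooth.comp hτ.contDiffOn fun v hv => (hε1 v hv).1, fun w p hv =>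
      DifferentiableAt.comp (g := fun w : ℂ × ℂ × ℂ => Φ (w, p))
        (f := fun w : ℂ × ℂ × ℂ => (w.1, w.2.1, 1 + w.2.2)) w
        (hΦ.hol _ _ (hε1 _ hv).1) (by fun_prop)⟩
  have hcoord : ∀ L : ℂ × ℂ × ℂ →L[ℂ] ℂ, SmoothHol (fun v : (ℂ × ℂ × ℂ) × (ℝ × ℝ) => L v.1)
      (Metric.ball 0 ε ×ˢ Metric.ball 0 ε) := fun L => SmoothHol.clm L
  have hrS : SmoothHol (fun v : (ℂ × ℂ × ℂ) × (ℝ × ℝ) => ((v.2.1 : ℝ) : ℂ))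
      (Metric.ball 0 ε ×ˢ Metric.ball 0 ε) :=
    SmoothHol.param (ψ := fun p : ℝ × ℝ => ((p.1 : ℝ) : ℂ))
      (Complex.ofRealCLM.contDiff.comp (contDiff_fst.comp contDiff_snd)).contDiffOn
  have hone : SmoothHol (fun v : (ℂ × ℂ × ℂ) × (ℝ × ℝ) => (1 : ℂ))
      (Metric.ball 0 ε ×ˢ Metric.ball 0 ε) :=
    SmoothHol.param (ψ := fun _ : ℝ × ℝ => (1 : ℂ)) contDiffOn_const
  have hXne : ∀ v ∈ Metric.ball (0 : ℂ × ℂ × ℂ) ε ×ˢ Metric.ball (0 : ℝ × ℝ) ε, X (τ v) ≠ 0 :=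
    fun v hv => (hε1 v hv).2
  refine ⟨ψ, ε, fun v => (Φ₁ (τ v) / X (τ v) - (v.2.1 : ℂ) * v.1.2.1,
    Φ₂ (τ v) / X (τ v) - (v.2.1 : ℂ) * (1 + v.1.2.2)), hε, hψ0, hψU.mono hpU,
    fun p hp => (hU p (hpU p hp)).2.2, ?_, ?_, ?_⟩
  · exact (((hshift hΦ₁).div (hshift hX) hXne).sub (hrS.mul
      (hcoord (.fst ℂ ℂ ℂ ∘L .snd ℂ ℂ (ℂ × ℂ))))).prodMk
      (((hshift hΦ₂).div (hshift hX) hXne).sub (hrS.mul (hone.add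
      (hcoord (.snd ℂ ℂ ℂ ∘L .snd ℂ ℂ (ℂ × ℂ))))))
  · intro p hp s a b hs ha hb
    have hv : (((s : ℂ), (a : ℂ), (b : ℂ)), p) ∈
        Metric.ball (0 : ℂ × ℂ × ℂ) ε ×ˢ Metric.ball (0 : ℝ × ℝ) ε :=
      ⟨by simp [Prod.norm_def, hs, ha, hb], hp⟩
    have hτv : τ (((s : ℂ), (a : ℂ), (b : ℂ)), p) =
        (((s : ℂ), (a : ℂ), ((1 + b : ℝ) : ℂ)), p) := by simp [τ]
    have hm := hε1 _ hv
    rw [hτv] at hm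
    have hs1 : |s| < 1 := by simpa using hm.1.1.1
    have hab := hm.1.1.2
    simp only [hBdef, mem_ball_zero_iff, Prod.norm_def, max_lt_iff, Complex.norm_real,
      Real.norm_eq_abs] at hab
    obtain ⟨ha3, hb3⟩ := hab
    have hpu := hpU p hp
    have i1 := him hΦ₁ ha3 hb3 hpu (fun s hs => ⟨_, (hvals hs ha3 hb3 hpu).1⟩) s hs1
    have i2 := him hΦ₂ ha3 hb3 hpu (fun s hs => ⟨_, (hvals hs ha3 hb3 hpu).2.1⟩) s hs1
    have i3 := him hX ha3 hb3 hpu (fun s hs => ⟨_, (hvals hs ha3 hb3 hpu).2.2⟩) s hs1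
    obtain ⟨v1, v2, v3⟩ := hvals hs1 ha3 hb3 hpu
    obtain ⟨x1, hx1⟩ : ∃ x : ℝ, Φ₁ (((s : ℂ), (a : ℂ), ((1 + b : ℝ) : ℂ)), p) = x :=
      ⟨_, Complex.ext rfl i1⟩
    obtain ⟨x2, hx2⟩ : ∃ x : ℝ, Φ₂ (((s : ℂ), (a : ℂ), ((1 + b : ℝ) : ℂ)), p) = x :=
      ⟨_, Complex.ext rfl i2⟩
    obtain ⟨x3, hx3⟩ : ∃ x : ℝ, X (((s : ℂ), (a : ℂ), ((1 + b : ℝ) : ℂ)), p) = x :=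
      ⟨_, Complex.ext rfl i3⟩
    rw [hx1] at v1
    rw [hx2] at v2
    rw [hx3] at v3
    have hx30 : x3 ≠ 0 := by
      have := hm.2
      rw [mem_preimage, hx3] at this
      simpa using this
    refine ⟨(x1 / x3 - p.1 * a, x2 / x3 - p.1 * (1 + b)), x3, ?_, ?_, ?_, ?_⟩
    · simp only [hτv, hx1, hx2, hx3, castPair_apply]
      push_cast
      rfl
    · exact_mod_cast v3.symm
    · rw [sub_add_cancel, mul_div_cancel₀ _ hx30]
      exact_mod_cast v1.symm
    · rw [sub_add_cancel, mul_div_cancel₀ _ hx30]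
      exact_mod_cast v2.symm
  · intro a b ha hb
    have hv : (((0 : ℂ), (a : ℂ), (b : ℂ)), (0 : ℝ × ℝ)) ∈
        Metric.ball (0 : ℂ × ℂ × ℂ) ε ×ˢ Metric.ball (0 : ℝ × ℝ) ε :=
      ⟨by simp [Prod.norm_def, ha, hb], Metric.mem_ball_self hε⟩
    have hτv : τ (((0 : ℂ), (a : ℂ), (b : ℂ)), 0) =
        (((0 : ℂ), (a : ℂ), ((1 + b : ℝ) : ℂ)), 0) := by simp [τ]
    have hm := hε1 _ hv
    rw [hτv] at hm
    have hab := hm.1.1.2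
    simp only [hBdef, mem_ball_zero_iff, Prod.norm_def, max_lt_iff, Complex.norm_real,
      Real.norm_eq_abs] at hab
    obtain ⟨e1, e2, e3⟩ := hb1 hab.1 hab.2
    simp only [hτv, e1, e2, e3, castPair_apply]
    simp only [Prod.fst_zero, Complex.ofReal_zero, zero_mul, sub_zero, Prod.smul_mk, smul_eq_mul,
      Prod.mk.injEq]
    constructor
    · push_cast
      rw [div_eq_inv_mul]
      congr 1
      · congr 1
        ring
      · ring
    · push_cast
      rw [div_eq_inv_mul]
      congr 1
      · congr 1
        ring
      · ring

end Invariant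

/-! ### Invariant graphs -/

section Invariant

variable {F G H : ℝ → ℝ → ℝ → ℝ → ℝ → ℝ}

/-- The derivative at `v = 0` of the rescaled equation for the critical parameter. -/
theorem hasFDerivAt_rotation_div (l c : ℝ) (hl : l ≠ 0) :
    HasFDerivAt (fun v : ℝ × ℝ => (l + c * v.2)⁻¹ • ((-v.2, v.1) : ℝ × ℝ)) (rotOp l) 0 := by
  have h1 : HasFDerivAt (fun v : ℝ × ℝ => l + c * v.2) (c • ContinuousLinearMap.snd ℝ ℝ ℝ) 0 :=
    (hasFDerivAt_snd.const_mul c).const_add l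
  have h2 : DifferentiableAt ℝ (fun v : ℝ × ℝ => (l + c * v.2)⁻¹) 0 :=
    h1.differentiableAt.inv (by simpa using hl)
  have h3 : HasFDerivAt (fun v : ℝ × ℝ => ((-v.2, v.1) : ℝ × ℝ))
      ((-ContinuousLinearMap.snd ℝ ℝ ℝ).prod (ContinuousLinearMap.fst ℝ ℝ ℝ)) 0 :=
    hasFDerivAt_snd.neg.prodMk hasFDerivAt_fst
  have h4 := h2.hasFDerivAt.smul h3
  refine h4.congr_fderiv ?_
  refine ContinuousLinearMap.ext fun v => ?_
  ext <;> simp [rotOp, mul_comm]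

/-- The one-parameter family of zeros `α(p)` of `Θ(0, ·, p)`. -/
theorem exists_zero_branch {l c : ℝ} (hl : l ≠ 0) {ε : ℝ} (hε : 0 < ε)
    {Θ : (ℂ × ℂ × ℂ) × (ℝ × ℝ) → ℂ × ℂ}
    (hΘ : ContDiffOn ℝ ∞ Θ (Metric.ball 0 ε ×ˢ Metric.ball 0 ε))
    (hbase : ∀ a b : ℝ, |a| < ε → |b| < ε → Θ (((0 : ℂ), (a : ℂ), (b : ℂ)), 0) =
        castPair ((l + c * b)⁻¹ • (-b, a))) :
    ∃ α : ℝ × ℝ → ℝ × ℝ, α 0 = 0 ∧ (∀ᶠ p in 𝓝 0, ContDiffAt ℝ ∞ α p) ∧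
      ∀ᶠ p in 𝓝 0, rePair (Θ (((0 : ℂ), ((α p).1 : ℂ), ((α p).2 : ℂ)), p)) = 0 := by
  let τ : (ℝ × ℝ) × (ℝ × ℝ) → (ℂ × ℂ × ℂ) × (ℝ × ℝ) := fun u =>
    (((0 : ℂ), (u.2.1 : ℂ), (u.2.2 : ℂ)), u.1)
  have hτ : ContDiff ℝ ∞ τ := by
    have h : ∀ {φ : (ℝ × ℝ) × (ℝ × ℝ) → ℝ}, ContDiff ℝ ∞ φ →
        ContDiff ℝ ∞ fun u => ((φ u : ℝ) : ℂ) := fun hφ => Complex.ofRealCLM.contDiff.comp hφ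
    exact (contDiff_const.prodMk ((h (by fun_prop)).prodMk (h (by fun_prop)))).prodMk
      contDiff_fst
  set D := Metric.ball (0 : ℂ × ℂ × ℂ) ε ×ˢ Metric.ball (0 : ℝ × ℝ) ε with hD
  set O := τ ⁻¹' D with hO
  have hOo : IsOpen O := (Metric.isOpen_ball.prod Metric.isOpen_ball).preimage hτ.continuous
  have h0O : ((0 : ℝ × ℝ), (0 : ℝ × ℝ)) ∈ O := by
    simp [hO, hD, τ, hε]
  set e : (ℝ × ℝ) × (ℝ × ℝ) → ℝ × ℝ := fun u => rePair (Θ (τ u)) with he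
  have hes : ContDiffOn ℝ ∞ e O :=
    rePair.contDiff.comp_contDiffOn (hΘ.comp hτ.contDiffOn fun u hu => hu)
  have hb : ∀ v : ℝ × ℝ, ((0 : ℝ × ℝ), v) ∈ O → e (0, v) = (l + c * v.2)⁻¹ • (-v.2, v.1) := by
    intro v hv
    have h1 := hv.1
    simp only [τ, mem_ball_zero_iff, Prod.norm_def, max_lt_iff, Complex.norm_real,
      Real.norm_eq_abs] at h1
    have hre : ∀ x : ℝ × ℝ, rePair (castPair x) = x := fun x => by ext <;> simp
    simp only [he, τ, hbase _ _ h1.2.1 h1.2.2, hre]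
  have hder : HasFDerivAt (fun w : ℝ × ℝ => e (0, w))
      (fderiv ℝ e (0, 0) ∘L .inr ℝ (ℝ × ℝ) (ℝ × ℝ)) 0 :=
    ((hes.contDiffAt (hOo.mem_nhds h0O)).differentiableAt (by simp)).hasFDerivAt.comp 0
      (hasFDerivAt_prodMk_right 0 0)
  have hder' : HasFDerivAt (fun w : ℝ × ℝ => e (0, w)) (rotOp l) 0 := by
    refine (hasFDerivAt_rotation_div l c hl).congr_of_eventuallyEq ?_
    have h2 : ContinuousAt (fun w : ℝ × ℝ => ((0 : ℝ × ℝ), w)) 0 := by fun_prop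
    filter_upwards [h2.preimage_mem_nhds (hOo.mem_nhds h0O)] with w hw using hb w hw
  obtain ⟨α, h1, h2, h3, -⟩ := exists_smooth_implicitFunction hOo hes h0O
    ((hb 0 h0O).trans (by simp [Prod.zero_eq_mk])) (by
      rw [hder.unique hder']
      refine isInvertible_of_inverse ((l • ContinuousLinearMap.snd ℝ ℝ ℝ).prod
        (-l • ContinuousLinearMap.fst ℝ ℝ ℝ)) (fun w => ?_) (fun w => ?_) <;>
      · ext <;> simp [rotOp] <;> field_simp)
  exact ⟨α, h1, h2, h3.mono fun p hp => hp.2⟩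

/-- The chart system has a family of locally invariant graphs `(x, z) = m (y, r, μ₂)`, holomorphic
in `y` on a fixed disc and smooth in the parameters. -/
theorem exists_invariant_graph (hF : AnalyticInSpace F) (hG : AnalyticInSpace G)
    (hH : AnalyticInSpace H) (hF' : OrderF F) (hG' : OrderG G) (hH' : OrderH H)
    (hlam : a₁ G + a₂ G ≠ 0) :
    ∃ (ε : ℝ) (M : ℂ × (ℝ × ℝ) → ℂ × ℂ) (m : ℝ → ℝ → ℝ → ℝ × ℝ), 0 < ε ∧ ε ≤ 1 ∧
      SmoothHol M (Metric.ball 0 ε ×ˢ Metric.ball 0 ε) ∧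
      ∀ y r μ₂ : ℝ, |y| < ε → |r| < ε → |μ₂| < ε →
        M ((y : ℂ), (r, μ₂)) = castPair (m y r μ₂) ∧ ‖m y r μ₂‖ < 1 ∧
        ∃ m' : ℝ × ℝ, HasDerivAt (fun s => m s r μ₂) m' y ∧
          ((chartField F G H r (r * μ₂) (m y r μ₂).1 y (m y r μ₂).2).1,
            (chartField F G H r (r * μ₂) (m y r μ₂).1 y (m y r μ₂).2).2.2) =
          (chartField F G H r (r * μ₂) (m y r μ₂).1 y (m y r μ₂).2).2.1 • m' := by
  obtain ⟨ϱ, hϱ, f₁, f₂, q, hf₁, hf₂, hq, hreal⟩ :=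
    exists_chart hF hG hH hF' hG' hH' (K := 4) (by norm_num)
  obtain ⟨ψ, ε₀, Θ₀, hε₀, hψ0, hψ, hψb, hΘ₀, heq, hbase⟩ :=
    exists_rescaled_equation hlam hG' hϱ hf₁ hf₂ hq hreal
  obtain ⟨α, hα0, hαs, hα⟩ := exists_zero_branch hlam hε₀ hΘ₀.smooth hbase
  -- On a ball of parameters the branch of zeros stays in half of the domain of `Θ₀`.
  have hαc : ContinuousAt α 0 := hαs.self_of_nhds.continuousAt
  have hψc : ContinuousAt ψ 0 :=
    (hψ.contDiffAt (Metric.ball_mem_nhds 0 hε₀)).continuousAt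
  have hαsmall : ∀ᶠ p in 𝓝 0, ‖α p‖ < min (ε₀ / 2) (1 / 8) :=
    hαc.norm.eventually (gt_mem_nhds (by simp [hα0, hε₀]))
  obtain ⟨ε₁, hε₁, hU⟩ := Metric.eventually_nhds_iff_ball.1
    (hαs.and (hα.and (hαsmall.and (Metric.ball_mem_nhds (0 : ℝ × ℝ) hε₀))))
  set U : Set (ℝ × ℝ) := Metric.ball 0 ε₁ with hUdef
  set l := a₁ G + a₂ G with hl
  set ρ₀ := ε₀ / 2 with hρ₀
  have hρ₀0 : 0 < ρ₀ := by positivity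
  have hU0 : (0 : ℝ × ℝ) ∈ U := Metric.mem_ball_self hε₁
  have hαU : ContDiffOn ℝ ∞ α U := fun p hp => (hU p hp).1.contDiffWithinAt
  have hαb : ∀ p ∈ U, |(α p).1| < ρ₀ ∧ |(α p).2| < ρ₀ ∧ |(α p).1| < 1 / 8 ∧ |(α p).2| < 1 / 8 := by
    intro p hp
    have h := lt_min_iff.1 (hU p hp).2.2.1
    exact ⟨(norm_fst_le (α p)).trans_lt h.1, (norm_snd_le (α p)).trans_lt h.1,
      (norm_fst_le (α p)).trans_lt h.2, (norm_snd_le (α p)).trans_lt h.2⟩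
  have hUε₀ : ∀ p ∈ U, p ∈ Metric.ball (0 : ℝ × ℝ) ε₀ := fun p hp => (hU p hp).2.2.2
  -- The equation is centred at the branch of zeros, so that it has no constant term.
  set D := Metric.ball (0 : ℂ × ℂ × ℂ) ρ₀ ×ˢ U with hD
  set φ : (ℂ × ℂ × ℂ) × (ℝ × ℝ) → ℂ × ℂ × ℂ := fun v =>
    (v.1.1, ((α v.2).1 : ℂ) + v.1.2.1, ((α v.2).2 : ℂ) + v.1.2.2) with hφ
  have hφS : SmoothHol φ D := by
    have hc : ∀ L : ℂ × ℂ × ℂ →L[ℂ] ℂ,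
      SmoothHol (fun v : (ℂ × ℂ × ℂ) × (ℝ × ℝ) => L v.1) D := fun L => SmoothHol.clm L
    have hp : ∀ L : ℝ × ℝ →L[ℝ] ℝ,
        SmoothHol (fun v : (ℂ × ℂ × ℂ) × (ℝ × ℝ) => ((L (α v.2) : ℝ) : ℂ)) D := fun L =>
      SmoothHol.param (ψ := fun p : ℝ × ℝ => ((L (α p) : ℝ) : ℂ))
        ((Complex.ofRealCLM ∘L L).contDiff.comp_contDiffOn
          (hαU.comp contDiff_snd.contDiffOn fun v hv => hv.2))
    exact (hc (.fst ℂ ℂ _)).prodMk (((hp (.fst ℝ _ _)).add (hc (.fst ℂ ℂ ℂ ∘L .snd ℂ ℂ _))).prodMk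
      ((hp (.snd ℝ _ _)).add (hc (.snd ℂ ℂ ℂ ∘L .snd ℂ ℂ _))))
  have hφD : ∀ v ∈ D, (φ v, v.2) ∈ Metric.ball (0 : ℂ × ℂ × ℂ) ε₀ ×ˢ Metric.ball (0 : ℝ × ℝ) ε₀ := by
    rintro ⟨⟨s, a, b⟩, p⟩ ⟨hv, hp⟩
    refine ⟨?_, hUε₀ p hp⟩
    obtain ⟨h1, h2, -, -⟩ := hαb p hp
    simp only [mem_ball_zero_iff, Prod.norm_def, max_lt_iff] at hv
    simp only [hφ, mem_ball_zero_iff, Prod.norm_def, max_lt_iff]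
    have e1 : ‖((α p).1 : ℂ)‖ < ρ₀ := by rwa [Complex.norm_real]
    have e2 : ‖((α p).2 : ℂ)‖ < ρ₀ := by rwa [Complex.norm_real]
    refine ⟨by linarith [hv.1], ?_, ?_⟩
    · linarith [norm_add_le ((α p).1 : ℂ) a, hv.2.1]
    · linarith [norm_add_le ((α p).2 : ℂ) b, hv.2.2]
  have hΘS := hΘ₀.subst hφS (ψ := fun p => p) contDiff_snd.contDiffOn hφD
  set θ : ℝ → ℝ → ℝ → ℝ × ℝ → ℝ × ℝ := fun s a b p =>
    rePair (Θ₀ (((s : ℂ), (((α p).1 + a : ℝ) : ℂ), (((α p).2 + b : ℝ) : ℂ)), p)) with hθ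
  have hcast : ∀ p ∈ U, ∀ s a b : ℝ, |s| < ρ₀ → |a| < ρ₀ → |b| < ρ₀ →
      |s| < ε₀ ∧ |(α p).1 + a| < ε₀ ∧ |(α p).2 + b| < ε₀ := by
    intro p hp s a b hs ha hb
    obtain ⟨h1, h2, -, -⟩ := hαb p hp
    refine ⟨by linarith, ?_, ?_⟩
    · linarith [abs_add_le (α p).1 a]
    · linarith [abs_add_le (α p).2 b]
  have hre : ∀ x : ℝ × ℝ, rePair (castPair x) = x := fun x => by ext <;> simp
  have hθΘ : ∀ p ∈ U, ∀ s a b : ℝ, |s| < ρ₀ → |a| < ρ₀ → |b| < ρ₀ →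
      Θ₀ (((s : ℂ), (((α p).1 + a : ℝ) : ℂ), (((α p).2 + b : ℝ) : ℂ)), p) =
        castPair (θ s a b p) := by
    intro p hp s a b hs ha hb
    obtain ⟨h1, h2, h3⟩ := hcast p hp s a b hs ha hb
    obtain ⟨t, -, ht, -⟩ := heq p (hUε₀ p hp) s _ _ h1 h2 h3
    rw [hθ]
    simp only [ht, hre]
  have hθ0 : ∀ a b : ℝ, |a| < ε₀ → |b| < ε₀ → θ 0 a b 0 = (l + a₂ G * b)⁻¹ • (-b, a) := by
    intro a b ha hb
    have := hbase a b ha hb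
    simp only [hθ, hα0, Prod.fst_zero, Prod.snd_zero, zero_add, Complex.ofReal_zero, this, hre]
  obtain ⟨ν, W, w, hν, hνκ, hW, hWw, hwκ, hw⟩ := exists_slow_solution (Θ := fun v => Θ₀ (φ v, v.2))
    (U := U) (θ := θ) hρ₀0 Metric.isOpen_ball hU0 hΘS (fun p hp s a b hs ha hb => by
      rw [← hθΘ p hp s a b hs ha hb]
      simp [hφ])
    (fun p hp => by
      have := (hU p hp).2.1
      simpa [hθ] using this)
    hlam (by
      have h1 : HasDerivAt (fun t : ℝ => l⁻¹ • ((-0, t) : ℝ × ℝ)) (l⁻¹ • ((-0, 1) : ℝ × ℝ)) 0 :=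
        HasDerivAt.fun_const_smul _ (((hasDerivAt_const _ _).neg.congr_deriv (by simp)).prodMk
          (hasDerivAt_id _))
      have h2 : HasDerivAt (fun t : ℝ => l⁻¹ • ((-0, t) : ℝ × ℝ)) (0, l⁻¹) 0 := by
        simpa using h1
      refine h2.congr_of_eventuallyEq ?_
      filter_upwards [Metric.ball_mem_nhds (0 : ℝ) hε₀] with t ht
      rw [hθ0 t 0 (by simpa using ht) (by simpa using hε₀)]
      simp)
    (by
      have hc : HasDerivAt (fun t : ℝ => ((0, t) : ℝ × ℝ)) (0, 1) 0 :=
        (hasDerivAt_const _ _).prodMk (hasDerivAt_id _)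
      have h1 := (hasFDerivAt_rotation_div l (a₂ G) hlam).comp_hasDerivAt_of_eq (0 : ℝ) hc rfl
      have h2 : rotOp l (0, 1) = (-l⁻¹, 0) := by ext <;> simp [rotOp]
      rw [h2] at h1
      refine h1.congr_of_eventuallyEq ?_
      filter_upwards [Metric.ball_mem_nhds (0 : ℝ) hε₀] with t ht
      rw [hθ0 0 t (by simpa using hε₀) (by simpa using ht)]
      rfl)
    (ϱ := .fst ℝ ℝ ℝ) (κ₀ := min (ρ₀ / 2) (1 / 8)) (lt_min (by positivity) (by norm_num))
  -- The solution is a function of `s = y - y*`; for small parameters `|s| < ν` on a fixed disc in `y`.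
  have hψsmall : ∀ᶠ p in 𝓝 0, ‖ψ p‖ < min (ν / 2) (1 / 2) :=
    hψc.norm.eventually (gt_mem_nhds (by simp [hψ0, hν]))
  obtain ⟨ε₂, hε₂, hV⟩ := Metric.eventually_nhds_iff_ball.1
    (hw.and (hψsmall.and (Metric.ball_mem_nhds (0 : ℝ × ℝ) hε₁)))
  set ε := min (min ε₂ (ν / 2)) 1 with hεdef
  have hε : 0 < ε := lt_min (lt_min hε₂ (by positivity)) one_pos
  have hεε₂ : ε ≤ ε₂ := (min_le_left _ _).trans (min_le_left _ _)
  have hεν : ε ≤ ν / 2 := (min_le_left _ _).trans (min_le_right _ _)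
  have hVε : ∀ p ∈ Metric.ball (0 : ℝ × ℝ) ε, p ∈ Metric.ball (0 : ℝ × ℝ) ε₂ := fun p hp =>
    Metric.ball_subset_ball hεε₂ hp
  have hy : ∀ p ∈ Metric.ball (0 : ℝ × ℝ) ε, |(ψ p).2.1| < ν / 2 ∧ ‖ψ p‖ < 1 / 2 := by
    intro p hp
    have h := lt_min_iff.1 (hV p (hVε p hp)).2.1
    exact ⟨((norm_fst_le (ψ p).2).trans (norm_snd_le (ψ p))).trans_lt h.1, h.2⟩
  have hpU : ∀ p ∈ Metric.ball (0 : ℝ × ℝ) ε, p ∈ U := fun p hp => (hV p (hVε p hp)).2.2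
  have hψε : ContDiffOn ℝ ∞ ψ (Metric.ball 0 ε) := hψ.mono fun p hp => hUε₀ p (hpU p hp)
  set E := Metric.ball (0 : ℂ) ε ×ˢ Metric.ball (0 : ℝ × ℝ) ε with hE
  have hpψ : ∀ L : ℝ × ℝ × ℝ →L[ℝ] ℝ,
      SmoothHol (fun v : ℂ × (ℝ × ℝ) => ((L (ψ v.2) : ℝ) : ℂ)) E := fun L =>
    SmoothHol.param (ψ := fun p : ℝ × ℝ => ((L (ψ p) : ℝ) : ℂ))
      ((Complex.ofRealCLM ∘L L).contDiff.comp_contDiffOn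
        (hψε.comp contDiff_snd.contDiffOn fun v hv => hv.2))
  have hpα : ∀ L : ℝ × ℝ →L[ℝ] ℝ,
      SmoothHol (fun v : ℂ × (ℝ × ℝ) => ((L (α v.2) : ℝ) : ℂ)) E := fun L =>
    SmoothHol.param (ψ := fun p : ℝ × ℝ => ((L (α p) : ℝ) : ℂ))
      ((Complex.ofRealCLM ∘L L).contDiff.comp_contDiffOn
        (hαU.comp contDiff_snd.contDiffOn fun v hv => hpU _ hv.2))
  have hone : SmoothHol (fun _ : ℂ × (ℝ × ℝ) => (1 : ℂ)) E :=
    SmoothHol.param (ψ := fun _ : ℝ × ℝ => (1 : ℂ)) contDiffOn_const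
  have hsS : SmoothHol (fun v : ℂ × (ℝ × ℝ) => v.1 - ((ψ v.2).2.1 : ℂ)) E :=
    (SmoothHol.clm (ContinuousLinearMap.id ℂ ℂ)).sub (hpψ (.fst ℝ _ _ ∘L .snd ℝ _ _))
  have hsE : ∀ v ∈ E, (v.1 - ((ψ v.2).2.1 : ℂ), v.2) ∈ Metric.ball (0 : ℂ) ν ×ˢ univ := by
    intro v hv
    refine ⟨?_, mem_univ _⟩
    have h1 := hv.1
    have h2 : ‖((ψ v.2).2.1 : ℂ)‖ < ν / 2 := by
      rw [Complex.norm_real]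
      exact (hy _ hv.2).1
    rw [mem_ball_zero_iff] at h1 ⊢
    linarith [norm_sub_le v.1 ((ψ v.2).2.1 : ℂ)]
  have hWS := hW.subst hsS (ψ := fun p => p) contDiff_snd.contDiffOn hsE
  have hW₁ : SmoothHol (fun v : ℂ × (ℝ × ℝ) => (W (v.1 - ((ψ v.2).2.1 : ℂ), v.2)).1) E :=
    ⟨contDiff_fst.comp_contDiffOn hWS.smooth, fun y p hv => (hWS.hol y p hv).fst⟩
  have hW₂ : SmoothHol (fun v : ℂ × (ℝ × ℝ) => (W (v.1 - ((ψ v.2).2.1 : ℂ), v.2)).2) E :=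
    ⟨contDiff_snd.comp_contDiffOn hWS.smooth, fun y p hv => (hWS.hol y p hv).snd⟩
  refine ⟨ε, fun v => (((ψ v.2).1 : ℂ) + (v.1 - ((ψ v.2).2.1 : ℂ)) *
      (((α v.2).1 : ℂ) + (W (v.1 - ((ψ v.2).2.1 : ℂ), v.2)).1),
    ((ψ v.2).2.2 : ℂ) + (v.1 - ((ψ v.2).2.1 : ℂ)) *
      (1 + (((α v.2).2 : ℂ) + (W (v.1 - ((ψ v.2).2.1 : ℂ), v.2)).2))),
    fun y r μ₂ => ((ψ (r, μ₂)).1 + (y - (ψ (r, μ₂)).2.1) *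
      ((α (r, μ₂)).1 + (w (y - (ψ (r, μ₂)).2.1) (r, μ₂)).1),
    (ψ (r, μ₂)).2.2 + (y - (ψ (r, μ₂)).2.1) *
      (1 + ((α (r, μ₂)).2 + (w (y - (ψ (r, μ₂)).2.1) (r, μ₂)).2))),
    hε, min_le_right _ _, ?_, ?_⟩
  · exact ((hpψ (.fst ℝ _ _)).add (hsS.mul ((hpα (.fst ℝ _ _)).add hW₁))).prodMk
      ((hpψ (.snd ℝ _ _ ∘L .snd ℝ _ _)).add
        (hsS.mul (hone.add ((hpα (.snd ℝ _ _)).add hW₂))))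
  · intro y r μ₂ hyε hr hμ
    set p : ℝ × ℝ := (r, μ₂) with hp
    have hpε : p ∈ Metric.ball (0 : ℝ × ℝ) ε := by
      simp [hp, Prod.norm_def, hr, hμ]
    obtain ⟨hyν, hψp⟩ := hy p hpε
    set s := y - (ψ p).2.1 with hs
    have hsν : |s| < ν := by linarith [abs_sub y (ψ p).2.1]
    have hwb := hwκ s p hsν
    have hw1 : |(w s p).1| ≤ min (ρ₀ / 2) (1 / 8) := (norm_fst_le (w s p)).trans hwb
    have hw2 : |(w s p).2| ≤ min (ρ₀ / 2) (1 / 8) := (norm_snd_le (w s p)).trans hwb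
    have hν8 : ν ≤ 1 / 8 := hνκ.trans (min_le_right _ _)
    have hνρ : ν ≤ ρ₀ / 2 := hνκ.trans (min_le_left _ _)
    obtain ⟨hα1, hα2, hα3, hα4⟩ := hαb p (hpU p hpε)
    refine ⟨?_, ?_, ?_⟩
    · have e1 : (y : ℂ) - ((ψ p).2.1 : ℂ) = ((s : ℝ) : ℂ) := by rw [hs]; push_cast; rfl
      simp only [e1, hWw s p hsν, castPair_apply]
      simp only [hs, hp]
      push_cast
      rfl
    · have k1 := hw1.trans (min_le_right _ _)
      have k2 := hw2.trans (min_le_right _ _)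
      have hψ1 : |(ψ p).1| < 1 / 2 := (norm_fst_le (ψ p)).trans_lt hψp
      have hψ2 : |(ψ p).2.2| < 1 / 2 :=
        ((norm_snd_le (ψ p).2).trans (norm_snd_le (ψ p))).trans_lt hψp
      have hs8 : |s| ≤ 1 / 8 := hsν.le.trans hν8
      rw [Prod.norm_def, max_lt_iff, Real.norm_eq_abs, Real.norm_eq_abs]
      constructor
      · calc _ ≤ |(ψ p).1| + |s| * |(α p).1 + (w s p).1| := by
              rw [← abs_mul]
              exact abs_add_le _ _
          _ ≤ |(ψ p).1| + 1 / 8 * (1 / 8 + 1 / 8) := by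
              gcongr
              exact (abs_add_le _ _).trans (add_le_add hα3.le k1)
          _ < 1 := by linarith
      · calc _ ≤ |(ψ p).2.2| + |s| * |1 + ((α p).2 + (w s p).2)| := by
              rw [← abs_mul]
              exact abs_add_le _ _
          _ ≤ |(ψ p).2.2| + 1 / 8 * (1 + (1 / 8 + 1 / 8)) := by
              gcongr
              refine (abs_add_le _ _).trans (add_le_add (by simp) ?_)
              exact (abs_add_le _ _).trans (add_le_add hα4.le k2)
          _ < 1 := by linarith
    · obtain ⟨w', hw', hsw⟩ := (hV p (hVε p hpε)).1 s hsν
      have k1 : |(w s p).1| < ρ₀ := by linarith [hw1.trans (min_le_left _ _)]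
      have k2 : |(w s p).2| < ρ₀ := by linarith [hw2.trans (min_le_left _ _)]
      have hsρ : |s| < ρ₀ := by linarith
      obtain ⟨c1, c2, c3⟩ := hcast p (hpU p hpε) s _ _ hsρ k1 k2
      obtain ⟨t, χ, ht, hχ, hc1, hc2⟩ := heq p (hUε₀ p (hpU p hpε)) s _ _ c1 c2 c3
      have htθ : t = θ s (w s p).1 (w s p).2 p := by
        rw [hθΘ p (hpU p hpε) s _ _ hsρ k1 k2] at ht
        rw [← hre t, ← ht, hre]
      rw [← hsw] at htθ
      have hyy : (ψ p).2.1 + s = y := by rw [hs]; ring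
      rw [hyy] at hχ hc1 hc2
      refine ⟨((α p).1 + (w s p).1 + s * w'.1, 1 + ((α p).2 + (w s p).2) + s * w'.2), ?_, ?_⟩
      · have hd : HasDerivAt (fun y : ℝ => y - (ψ p).2.1) 1 y := (hasDerivAt_id y).sub_const _
        have hww : HasDerivAt (fun y : ℝ => w (y - (ψ p).2.1) p) w' y := by
          have := HasDerivAt.scomp y (g₁ := fun s => w s p) hw' hd
          rw [one_smul] at this
          exact this
        have hw1 : HasDerivAt (fun y : ℝ => (w (y - (ψ p).2.1) p).1) w'.1 y :=
          (ContinuousLinearMap.fst ℝ ℝ ℝ).hasFDerivAt.comp_hasDerivAt y hww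
        have hw2 : HasDerivAt (fun y : ℝ => (w (y - (ψ p).2.1) p).2) w'.2 y :=
          (ContinuousLinearMap.snd ℝ ℝ ℝ).hasFDerivAt.comp_hasDerivAt y hww
        have g1 := ((hd.mul (hw1.const_add (α p).1)).const_add (ψ p).1)
        have g2 := ((hd.mul ((hw2.const_add (α p).2).const_add 1)).const_add (ψ p).2.2)
        have := g1.prodMk g2
        simp only [one_mul] at this
        exact this
      · have hsf := chartField_snd_fst (F := F) (H := H) hG' p.1 p.2
          ((ψ p).1 + s * ((α p).1 + (w s p).1)) y ((ψ p).2.2 + s * (1 + ((α p).2 + (w s p).2)))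
        rw [hχ] at hsf
        change (_, _) = _ • _
        simp only [hp] at hc1 hc2 hsf htθ ⊢
        rw [hc1, hc2, hsf, htθ]
        simp only [ContinuousLinearMap.coe_fst', Prod.smul_fst, Prod.smul_snd, smul_eq_mul,
          Prod.smul_mk, Prod.mk.injEq]
        constructor <;> ring

end Invariant

/-! ### The slow manifold as a power series -/

section SlowManifold

variable {F G H : ℝ → ℝ → ℝ → ℝ → ℝ → ℝ}

/-- Functionals with geometrically decaying norms define an operator into `ℓ¹`. -/
theorem exists_ell1_of_norm_le {X : Type} [NormedAddCommGroup X] [NormedSpace ℝ X]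
    (C : ℕ → X →L[ℝ] ℝ × ℝ) {q : ℝ} (hq0 : 0 ≤ q) (hq : q < 1) (hC : ∀ n x, ‖C n x‖ ≤ q ^ n * ‖x‖) :
    ∃ T : X →L[ℝ] lp (fun _ : ℕ => ℝ × ℝ) 1, ∀ x n, (T x : ℕ → ℝ × ℝ) n = C n x := by
  let L : ℕ → ℝ × ℝ →L[ℝ] lp (fun _ : ℕ => ℝ × ℝ) 1 := fun n =>
    lp.singleContinuousLinearMap ℝ (fun _ : ℕ => ℝ × ℝ) 1 n
  have hsum : Summable fun n => L n ∘L C n := by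
    refine Summable.of_norm_bounded (summable_geometric_of_lt_one hq0 hq) fun n => ?_
    refine ContinuousLinearMap.opNorm_le_bound _ (by positivity) fun x => ?_
    exact (lp.norm_single (E := fun _ : ℕ => ℝ × ℝ) (p := 1) (by simp) n (C n x)).le.trans (hC n x)
  refine ⟨∑' n, L n ∘L C n, fun h n => ?_⟩
  have h1 := (hsum.hasSum.mapL (ContinuousLinearMap.apply ℝ _ h)).mapL
    (lp.evalCLM ℝ (fun _ : ℕ => ℝ × ℝ) 1 n)
  have h2 : HasSum (fun j => lp.evalCLM ℝ (fun _ : ℕ => ℝ × ℝ) 1 n (L j (C j h))) (C n h) := by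
    have h3 : lp.evalCLM ℝ (fun _ : ℕ => ℝ × ℝ) 1 n (L n (C n h)) = C n h :=
      lp.single_apply_self (E := fun _ : ℕ => ℝ × ℝ) 1 n _
    have := hasSum_single (f := fun j => lp.evalCLM ℝ (fun _ : ℕ => ℝ × ℝ) 1 n (L j (C j h))) n
      fun j hj => lp.single_apply_ne (E := fun _ : ℕ => ℝ × ℝ) 1 j _ hj.symm
    rwa [h3] at this
  exact h1.unique h2

/-- The scaled Taylor coefficients `aₙ νⁿ` at `0`, as a summable sequence that depends linearly on
the values on a circle of radius `ρ > ν`. -/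
theorem exists_scaled_taylor {ρ ν : ℝ} (hν : 0 < ν) (hνρ : ν < ρ) :
    ∃ T : C(UI, ℂ × ℂ) →L[ℝ] lp (fun _ : ℕ => ℝ × ℝ) 1,
      ∀ h n, (T h : ℕ → ℝ × ℝ) n = ν ^ n • rePair (cauchyCoeff (ℂ × ℂ) (hν.trans hνρ) n h) := by
  have hρ := hν.trans hνρ
  refine exists_ell1_of_norm_le (q := ν / ρ)
    (fun n => ν ^ n • (rePair ∘L (cauchyCoeff (ℂ × ℂ) hρ n).restrictScalars ℝ)) (by positivity)
    (by rwa [div_lt_one hρ]) fun n h => ?_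
  have h1 : ‖cauchyCoeff (ℂ × ℂ) hρ n h‖ ≤ (ρ⁻¹) ^ n * ‖h‖ :=
    (ContinuousLinearMap.le_opNorm _ _).trans
      (mul_le_mul_of_nonneg_right (norm_cauchyCoeff_le hρ n) (norm_nonneg _))
  have h2 : ‖rePair (cauchyCoeff (ℂ × ℂ) hρ n h)‖ ≤ (ρ⁻¹) ^ n * ‖h‖ :=
    (rePair.le_opNorm _).trans ((mul_le_of_le_one_left (norm_nonneg _) norm_rePair_le).trans h1)
  change ‖ν ^ n • rePair (cauchyCoeff (ℂ × ℂ) hρ n h)‖ ≤ _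
  rw [norm_smul, norm_pow, Real.norm_of_nonneg hν.le, div_eq_mul_inv, mul_pow, mul_assoc]
  gcongr

/-- Existence of the slow manifolds. They extend to `|y₂| < ε`, and to parameters of either sign
with `|r|, |μ₂| < ε`. -/
theorem exists_slowManifold (hF : AnalyticInSpace F) (hG : AnalyticInSpace G)
    (hH : AnalyticInSpace H) (hF' : OrderF F) (hG' : OrderG G) (hH' : OrderH H)
    (hlam : a₁ G + a₂ G ≠ 0) :
    ∃ (ε : ℝ) (m : ℝ → ℝ → ℝ → ℝ × ℝ), 0 < ε ∧ ε ≤ 1 ∧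
      IsSlowManifold F G H (ε / 2) (ε / 2) (ε / 2) m ∧
      ContDiffOn ℝ ∞ (fun q : ℝ × ℝ × ℝ => m q.1 q.2.1 q.2.2) (Metric.ball 0 ε) ∧
      ∀ y r μ₂ : ℝ, |y| < ε → |r| < ε → |μ₂| < ε → ‖m y r μ₂‖ < 1 ∧
        m y 0 μ₂ = (-y ^ 2, y) ∧
        ((chartField F G H r (r * μ₂) (m y r μ₂).1 y (m y r μ₂).2).1,
            (chartField F G H r (r * μ₂) (m y r μ₂).1 y (m y r μ₂).2).2.2) =
          (chartField F G H r (r * μ₂) (m y r μ₂).1 y (m y r μ₂).2).2.1 •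
            deriv (fun s => m s r μ₂) y := by
  obtain ⟨ε, M, m, hε, hε1, hM, hm⟩ := exists_invariant_graph hF hG hH hF' hG' hH' hlam
  have hcrit : ∀ y μ₂ : ℝ, |y| < ε → |μ₂| < ε → m y 0 μ₂ = (-y ^ 2, y) := by
    intro y μ₂ hy hμ
    obtain ⟨-, -, m', -, h⟩ := hm y 0 μ₂ hy (by simpa using hε) hμ
    rw [chartField_zero hG'] at h
    simp only [zero_smul, Prod.mk_eq_zero] at h
    have h2 : (m y 0 μ₂).2 = y := by linarith [h.1]
    have h1 : (m y 0 μ₂).1 = -y ^ 2 := by rw [h2] at h; linarith [h.2]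
    exact Prod.ext h1 h2
  have hinv : ∀ y r μ₂ : ℝ, |y| < ε → |r| < ε → |μ₂| < ε →
      ((chartField F G H r (r * μ₂) (m y r μ₂).1 y (m y r μ₂).2).1,
            (chartField F G H r (r * μ₂) (m y r μ₂).1 y (m y r μ₂).2).2.2) =
          (chartField F G H r (r * μ₂) (m y r μ₂).1 y (m y r μ₂).2).2.1 •
            deriv (fun s => m s r μ₂) y := by
    intro y r μ₂ hy hr hμ
    obtain ⟨-, -, m', hd, h⟩ := hm y r μ₂ hy hr hμ
    rw [hd.deriv, h]
  have habs : ∀ {x a : ℝ}, |x| ≤ a / 2 → 0 < a → |x| < a := fun h h' => by linarith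
  refine ⟨ε, m, hε, hε1, ⟨?_, ?_, ?_⟩, ?_, fun y r μ₂ hy hr hμ =>
    ⟨(hm y r μ₂ hy hr hμ).2.1, hcrit y μ₂ hy hμ, hinv y r μ₂ hy hr hμ⟩⟩
  · have hν : 0 < ε / 2 := by positivity
    have hνρ : ε / 2 < 3 * ε / 4 := by linarith
    have hρ := hν.trans hνρ
    have hρε : 3 * ε / 4 < ε := by linarith
    obtain ⟨T, hT⟩ := exists_scaled_taylor hν hνρ
    have hbox : ∀ p ∈ Icc 0 (ε / 2) ×ˢ Icc (-(ε / 2)) (ε / 2), p ∈ Metric.ball (0 : ℝ × ℝ) ε := by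
      rintro ⟨r, μ₂⟩ ⟨hr, hμ⟩
      rw [mem_ball_zero_iff, Prod.norm_def, max_lt_iff]
      exact ⟨habs (abs_le.2 ⟨by linarith [hr.1], hr.2⟩) hε, habs (abs_le.2 hμ) hε⟩
    refine ⟨fun p => T (paramFun M (circ (3 * ε / 4)) p), ?_, ?_⟩
    · refine T.contDiff.comp_contDiffOn ((contDiffOn_paramFun
        (Metric.isOpen_ball.prod Metric.isOpen_ball) hM.smooth fun p hp k => ⟨?_, hp⟩).mono hbox)
      rw [mem_ball_zero_iff, norm_circ hρ]
      exact hρε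
    · intro r hr μ₂ hμ y hy
      have hp := hbox (r, μ₂) ⟨hr, hμ⟩
      have hyb : |y| ≤ ε / 2 := abs_le.2 hy
      rw [mem_ball_zero_iff, Prod.norm_def, max_lt_iff] at hp
      have h1 := hasSum_cauchyCoeff_paramFun (F := ℂ × ℂ) hρ hρε Metric.isOpen_ball hM.smooth
        (fun v hv => by
          have := hM.fderiv_I_smul (Metric.isOpen_ball.prod Metric.isOpen_ball) hv 1
          simpa using this)
        (z := (y : ℂ)) (by rw [Complex.norm_real]; exact hyb.trans_lt hνρ)
        (q := (r, μ₂)) (hbox (r, μ₂) ⟨hr, hμ⟩)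
      have h2 := h1.mapL rePair
      rw [(hm y r μ₂ (habs hyb hε) hp.1 hp.2).1] at h2
      have hre : rePair (castPair (m y r μ₂)) = m y r μ₂ := by ext <;> simp
      rw [hre] at h2
      refine h2.congr_fun fun n => ?_
      rw [hT, div_pow, smul_smul, div_mul_cancel₀ _ (by positivity)]
      have : ∀ (x : ℝ) (z : ℂ × ℂ), rePair ((x : ℂ) • z) = x • rePair z := by
        intro x z
        ext <;> simp
      rw [← this]
      push_cast
      rfl
  · intro r hr μ₂ hμ y hy
    exact hinv y r μ₂ (habs (abs_le.2 ⟨hy.1.le, hy.2.le⟩) hε)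
      (habs (abs_le.2 ⟨by linarith [hr.1], hr.2⟩) hε) (habs (abs_le.2 hμ) hε)
  · intro μ₂ hμ y hy
    exact hcrit y μ₂ (habs (abs_le.2 hy) hε) (habs (abs_le.2 hμ) hε)
  · have h1 : ContDiffOn ℝ ∞ (fun q : ℝ × ℝ × ℝ => rePair (M ((q.1 : ℂ), (q.2.1, q.2.2))))
        (Metric.ball 0 ε) := by
      refine rePair.contDiff.comp_contDiffOn (hM.smooth.comp
        (((Complex.ofRealCLM.contDiff.comp contDiff_fst).prodMk contDiff_snd).contDiffOn) ?_)
      intro q hq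
      rw [mem_ball_zero_iff, Prod.norm_def, max_lt_iff] at hq
      refine ⟨?_, ?_⟩
      · rw [mem_ball_zero_iff]
        simpa using hq.1
      · rw [mem_ball_zero_iff]
        exact hq.2
    refine h1.congr fun q hq => ?_
    simp only [mem_ball_zero_iff, Prod.norm_def, max_lt_iff, Real.norm_eq_abs] at hq
    rw [(hm q.1 q.2.1 q.2.2 hq.1 hq.2.1 hq.2.2).1]
    ext <;> simp

end SlowManifold

/-! ### The straightened system in the coordinates `u = h v` -/

section ScaledField

variable {F G H : ℝ → ℝ → ℝ → ℝ → ℝ → ℝ}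

/-- The domain of the scaled field, in the variables `(h, (v, Y, r, μ₂))`. -/
def scaledDom (h₁ K ε ϱ : ℝ) : Set (ℝ × ((ℝ × ℝ) × ℝ × ℝ × ℝ)) :=
  Metric.ball 0 h₁ ×ˢ (Metric.ball 0 K ×ˢ Metric.ball 0 ε ×ˢ Metric.ball 0 ϱ ×ˢ Metric.ball 0 ε)

theorem isOpen_scaledDom (h₁ K ε ϱ : ℝ) : IsOpen (scaledDom h₁ K ε ϱ) :=
  Metric.isOpen_ball.prod (Metric.isOpen_ball.prod (Metric.isOpen_ball.prod
    (Metric.isOpen_ball.prod Metric.isOpen_ball)))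

theorem mem_scaledDom {h₁ K ε ϱ h Y r μ₂ : ℝ} {v : ℝ × ℝ} :
    (h, (v, Y, r, μ₂)) ∈ scaledDom h₁ K ε ϱ ↔
      |h| < h₁ ∧ ‖v‖ < K ∧ |Y| < ε ∧ |r| < ϱ ∧ |μ₂| < ε := by
  simp only [scaledDom, mem_prod, mem_ball_zero_iff, Real.norm_eq_abs]

/-- With `u = h v` the straightened system becomes `v' = W (h, (v, Y, r, μ₂))` where `W` is smooth
up to `h = 0`. -/
theorem exists_scaledField (hF : AnalyticInSpace F) (hG : AnalyticInSpace G)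
    (hH : AnalyticInSpace H) (hF' : OrderF F) (hG' : OrderG G) (hH' : OrderH H)
    {ε : ℝ} {m : ℝ → ℝ → ℝ → ℝ × ℝ} (hε : 0 < ε) (hε1 : ε ≤ 1)
    (hms : ContDiffOn ℝ ∞ (fun q : ℝ × ℝ × ℝ => m q.1 q.2.1 q.2.2) (Metric.ball 0 ε))
    (hm : ∀ y r μ₂ : ℝ, |y| < ε → |r| < ε → |μ₂| < ε → ‖m y r μ₂‖ < 1 ∧
        m y 0 μ₂ = (-y ^ 2, y) ∧
        ((chartField F G H r (r * μ₂) (m y r μ₂).1 y (m y r μ₂).2).1,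
            (chartField F G H r (r * μ₂) (m y r μ₂).1 y (m y r μ₂).2).2.2) =
          (chartField F G H r (r * μ₂) (m y r μ₂).1 y (m y r μ₂).2).2.1 •
            deriv (fun s => m s r μ₂) y)
    {h₁ K : ℝ} (hh₁ : 0 < h₁) (hK : 0 < K) :
    ∃ (ϱ : ℝ) (W : ℝ × ((ℝ × ℝ) × ℝ × ℝ × ℝ) → ℝ × ℝ), 0 < ϱ ∧ ϱ ≤ ε ∧
      ContDiffOn ℝ ∞ W (scaledDom h₁ K ε ϱ) ∧
      ContDiffOn ℝ ∞ (fun p : ℝ × ((ℝ × ℝ) × ℝ × ℝ × ℝ) =>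
        straightRate G m p.2.2.2.1 p.2.2.2.2 (p.1 • p.2.1) p.2.2.1) (scaledDom h₁ K ε ϱ) ∧
      ∀ (h Y r μ₂ : ℝ) (v : ℝ × ℝ), (h, (v, Y, r, μ₂)) ∈ scaledDom h₁ K ε ϱ →
        h • W (h, (v, Y, r, μ₂)) = straightField F G H m r μ₂ (h • v) Y ∧
        (r = 0 → W (h, (v, Y, r, μ₂)) = (-v.2, v.1 + 2 * Y * v.2 + h * v.2 ^ 2)) := by
  have hK' : 0 < 1 + h₁ * K := by positivity
  obtain ⟨ϱ₀, hϱ₀, f₁, f₂, q, hf₁, hf₂, hq, hreal⟩ := exists_chart hF hG hH hF' hG' hH' hK'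
  set ϱ := min ϱ₀ ε with hϱdef
  have hϱ : 0 < ϱ := lt_min hϱ₀ hε
  set O := scaledDom h₁ K ε ϱ with hOdef
  have hO : IsOpen O := isOpen_scaledDom _ _ _ _
  let E := ℝ × ((ℝ × ℝ) × ℝ × ℝ × ℝ)
  let par : E → ℝ × ℝ × ℝ := fun p => p.2.2
  have hparO : ∀ p ∈ O, par p ∈ Metric.ball (0 : ℝ × ℝ × ℝ) ε := by
    rintro ⟨h, v, Y, r, μ₂⟩ hp
    obtain ⟨-, -, h3, h4, h5⟩ := mem_scaledDom.1 hp
    simp only [par, mem_ball_zero_iff, Prod.norm_def, max_lt_iff, Real.norm_eq_abs]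
    exact ⟨h3, h4.trans_le (min_le_right _ _), h5⟩
  have hpar : ContDiff ℝ ∞ par := contDiff_snd.comp contDiff_snd
  have hmO : ContDiffOn ℝ ∞ (fun p : E => m p.2.2.1 p.2.2.2.1 p.2.2.2.2) O :=
    hms.comp hpar.contDiffOn hparO
  have hm'O : ContDiffOn ℝ ∞ (fun p : E => deriv (fun s => m s p.2.2.2.1 p.2.2.2.2) p.2.2.1) O := by
    have h1 : ContDiffOn ℝ ∞ (fun w : ℝ × ℝ × ℝ =>
        fderiv ℝ (fun q : ℝ × ℝ × ℝ => m q.1 q.2.1 q.2.2) w (1, 0)) (Metric.ball 0 ε) :=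
      (hms.fderiv_of_isOpen Metric.isOpen_ball (by simp)).clm_apply contDiffOn_const
    refine (h1.comp hpar.contDiffOn hparO).congr fun p hp => ?_
    have h2 := ((hms.contDiffAt (Metric.isOpen_ball.mem_nhds (hparO p hp))).differentiableAt
      (by simp)).hasFDerivAt
    have h3 : HasDerivAt (fun s : ℝ => (s, p.2.2.2)) ((1 : ℝ), (0 : ℝ × ℝ)) p.2.2.1 :=
      (hasDerivAt_id _).prodMk (hasDerivAt_const _ _)
    exact (h2.comp_hasDerivAt_of_eq p.2.2.1 h3 rfl).deriv
  let pos : E → ℝ × ℝ := fun p => m p.2.2.1 p.2.2.2.1 p.2.2.2.2 + p.1 • p.2.1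
  have hpos : ContDiffOn ℝ ∞ pos O :=
    hmO.add (contDiff_fst.smul (contDiff_fst.comp contDiff_snd)).contDiffOn
  let c : E → (ℂ × ℂ × ℂ) × (ℝ × ℝ) := fun p =>
    castChart (pos p).1 p.2.2.1 (pos p).2 p.2.2.2.1 p.2.2.2.2
  have hc : ContDiffOn ℝ ∞ c O := by
    have h1 : ContDiffOn ℝ ∞ (fun p : E => (p.2.2.2, ((pos p).1, p.2.2.1, (pos p).2))) O :=
      (ContDiff.contDiffOn (by fun_prop)).prodMk ((contDiff_fst.comp_contDiffOn hpos).prodMk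
        ((ContDiff.contDiffOn (by fun_prop)).prodMk (contDiff_snd.comp_contDiffOn hpos)))
    exact contDiff_castChart.comp_contDiffOn h1
  have hcO : ∀ p ∈ O, c p ∈ chartDom (1 + h₁ * K) ϱ₀ := by
    rintro ⟨h, v, Y, r, μ₂⟩ hp
    obtain ⟨h1, h2, h3, h4, h5⟩ := mem_scaledDom.1 hp
    have h6 : ‖pos (h, v, Y, r, μ₂)‖ < 1 + h₁ * K := by
      have h7 := (hm Y r μ₂ h3 (h4.trans_le (min_le_right _ _)) h5).1
      have h8 : ‖h • v‖ ≤ h₁ * K := by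
        rw [norm_smul, Real.norm_eq_abs]
        gcongr
      exact (norm_add_le _ _).trans_lt (by linarith)
    have hK1 : 0 ≤ h₁ * K := by positivity
    exact castChart_mem.2 ⟨⟨(norm_fst_le _).trans_lt h6, by linarith, (norm_snd_le _).trans_lt h6⟩,
      h4.trans_le (min_le_left _ _), by linarith⟩
  have hre : ∀ {f : (ℂ × ℂ × ℂ) × (ℝ × ℝ) → ℂ}, ContDiffOn ℝ ∞ f (chartDom (1 + h₁ * K) ϱ₀) →
      ContDiffOn ℝ ∞ (fun p => (f (c p)).re) O := fun hf =>
    Complex.reCLM.contDiff.comp_contDiffOn (hf.comp hc hcO)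
  let g : E → ℝ × ℝ := fun p => ((f₁ (c p)).re, (f₂ (c p)).re) -
    (p.2.2.2.1 * (q (c p)).re) • deriv (fun s => m s p.2.2.2.1 p.2.2.2.2) p.2.2.1
  have hg : ContDiffOn ℝ ∞ g O :=
    ((hre hf₁.smooth).prodMk (hre hf₂.smooth)).sub
      (((ContDiff.contDiffOn (by fun_prop)).mul (hre hq.smooth)).smul hm'O)
  have hgV : ∀ (h Y r μ₂ : ℝ) (v : ℝ × ℝ), (h, (v, Y, r, μ₂)) ∈ O →
      g (h, (v, Y, r, μ₂)) = straightField F G H m r μ₂ (h • v) Y := by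
    intro h Y r μ₂ v hp
    obtain ⟨e1, e2, e3⟩ := hreal _ _ _ _ _ (hcO _ hp)
    have h1 := chartField_snd_fst (F := F) (H := H) hG' r μ₂
      (pos (h, v, Y, r, μ₂)).1 Y (pos (h, v, Y, r, μ₂)).2
    simp only [g, c, straightField, e1, e2, e3, Complex.ofReal_re]
    rw [← h1]
  have hstar : ∀ x ∈ O, ∀ σ ∈ Icc (0 : ℝ) 1, (σ • x.1, x.2) ∈ O := by
    rintro ⟨h, v, Y, r, μ₂⟩ hp σ hσ
    obtain ⟨h1, h2⟩ := mem_scaledDom.1 hp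
    refine mem_scaledDom.2 ⟨?_, h2⟩
    rw [smul_eq_mul, abs_mul, abs_of_nonneg hσ.1]
    exact (mul_le_of_le_one_left (abs_nonneg _) hσ.2).trans_lt h1
  have hg0 : ∀ (Y r μ₂ : ℝ) (v : ℝ × ℝ), ((0 : ℝ), (v, Y, r, μ₂)) ∈ O →
      g (0, (v, Y, r, μ₂)) = 0 := by
    intro Y r μ₂ v hp
    obtain ⟨h1, h2, h3, h4, h5⟩ := mem_scaledDom.1 hp
    rw [hgV _ _ _ _ _ hp, straightField]
    simp only [zero_smul, add_zero]
    rw [(hm Y r μ₂ h3 (h4.trans_le (min_le_right _ _)) h5).2.2, sub_self]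
  have hgr : ∀ (h Y μ₂ : ℝ) (v : ℝ × ℝ), (h, (v, Y, 0, μ₂)) ∈ O →
      g (h, (v, Y, 0, μ₂)) = h • (-v.2, v.1 + 2 * Y * v.2 + h * v.2 ^ 2) := by
    intro h Y μ₂ v hp
    obtain ⟨h1, h2, h3, h4, h5⟩ := mem_scaledDom.1 hp
    rw [hgV _ _ _ _ _ hp, straightField, (hm Y 0 μ₂ h3 (by simpa using hε) h5).2.1,
      chartField_zero hG']
    ext
    · simp
    · simp
      ring
  refine ⟨ϱ, hadamardQuot g, hϱ, min_le_right _ _, contDiffOn_hadamardQuot hO hg hstar, ?_, ?_⟩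
  · refine (hre hq.smooth).congr ?_
    rintro ⟨h, v, Y, r, μ₂⟩ hp
    simp only [c, (hreal _ _ _ _ _ (hcO _ hp)).2.2, Complex.ofReal_re, straightRate, pos]
  · intro h Y r μ₂ v hp
    have hsm : h • hadamardQuot g (h, (v, Y, r, μ₂)) = g (h, (v, Y, r, μ₂)) := by
      rw [smul_hadamardQuot hO hg hstar (fun x _ s => by rw [← map_smul]; simp) hp,
        hg0 Y r μ₂ v (by simpa using hstar _ hp 0 (by simp)), sub_zero]
    refine ⟨hsm.trans (hgV _ _ _ _ _ hp), ?_⟩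
    rintro rfl
    rw [hgr _ _ _ _ hp] at hsm
    rcases eq_or_ne h 0 with rfl | hh
    · rw [hadamardQuot_zero hO hg hstar hp]
      have h2 : HasDerivAt (fun h : ℝ => g (h, (v, Y, 0, μ₂)))
          (fderiv ℝ g (0, (v, Y, 0, μ₂)) (1, 0)) 0 :=
        ((hg.contDiffAt (hO.mem_nhds hp)).differentiableAt (by simp)).hasFDerivAt.comp_hasDerivAt_of_eq
          (0 : ℝ) ((hasDerivAt_id (0 : ℝ)).prodMk (hasDerivAt_const (0 : ℝ) (v, Y, (0 : ℝ), μ₂))) rfl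
      have h3 : HasDerivAt (fun h : ℝ => h • ((-v.2, v.1 + 2 * Y * v.2 + h * v.2 ^ 2) : ℝ × ℝ))
          (-v.2, v.1 + 2 * Y * v.2 + 0 * v.2 ^ 2) 0 := by
        have h4 : HasDerivAt (fun h : ℝ => ((-v.2, v.1 + 2 * Y * v.2 + h * v.2 ^ 2) : ℝ × ℝ))
            (0, 1 * v.2 ^ 2) 0 :=
          (hasDerivAt_const _ _).prodMk (((hasDerivAt_id _).mul_const _).const_add _)
        exact ((hasDerivAt_id (0 : ℝ)).smul h4).congr_deriv (by simp)
      refine h2.unique (h3.congr_of_eventuallyEq ?_)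
      have hcont : ContinuousAt (fun h : ℝ => (h, (v, Y, (0 : ℝ), μ₂))) 0 := by fun_prop
      filter_upwards [hcont.preimage_mem_nhds (hO.mem_nhds hp)] with h hh using hgr _ _ _ _ hh
    · exact smul_right_injective _ hh hsm

end ScaledField

section

set_option maxSynthPendingDepth 5

/-! ### Volterra operators -/

section Volterra

variable {E : Type} [NormedAddCommGroup E] [NormedSpace ℝ E] [CompleteSpace E]

theorem hasDerivAt_integral_ext01 (η : C(UI, E)) (s : ℝ) :
    HasDerivAt (fun s : ℝ => ∫ σ in (0 : ℝ)..s, ext01 η σ) (ext01 η s) s :=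
  ((continuous_ext01 η).integral_hasStrictDerivAt 0 s).hasDerivAt

/-- The primitive that vanishes at `0`. -/
def volterra (E : Type) [NormedAddCommGroup E] [NormedSpace ℝ E] [CompleteSpace E] :
    C(UI, E) →L[ℝ] C(UI, E) :=
  LinearMap.mkContinuous
    { toFun := fun η => ⟨fun k => ∫ σ in (0 : ℝ)..k, ext01 η σ,
        (continuous_iff_continuousAt.2 fun s => (hasDerivAt_integral_ext01 η s).continuousAt).comp
          continuous_subtype_val⟩
      map_add' := fun η η' => by
        ext k
        simp only [ContinuousMap.coe_mk, ContinuousMap.add_apply]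
        rw [← intervalIntegral.integral_add ((continuous_ext01 η).intervalIntegrable _ _)
          ((continuous_ext01 η').intervalIntegrable _ _)]
        rfl
      map_smul' := fun c η => by
        ext k
        simp only [ContinuousMap.coe_mk, ContinuousMap.smul_apply, RingHom.id_apply]
        rw [← intervalIntegral.integral_smul]
        rfl } 1 (fun η => by
      rw [one_mul, ContinuousMap.norm_le _ (norm_nonneg _)]
      intro k
      have := intervalIntegral.norm_integral_le_of_norm_le_const (a := 0) (b := (k : ℝ))
        (f := ext01 η) (C := ‖η‖) fun σ _ => norm_ext01_le η σ
      refine this.trans (mul_le_of_le_one_right (norm_nonneg _) ?_)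
      rw [sub_zero, abs_of_nonneg k.2.1]
      exact k.2.2)

theorem volterra_apply (η : C(UI, E)) (k : UI) :
    volterra E η k = ∫ σ in (0 : ℝ)..k, ext01 η σ := rfl

theorem ext01_coe (η : C(UI, E)) (k : UI) : ext01 η k = η k := ext01_of_mem η k.2

/-- The integral equation is equivalent to the initial value problem. -/
theorem eq_const_add_volterra_iff {η g : C(UI, E)} {z₀ : E} :
    η = ContinuousMap.const UI z₀ + volterra E g ↔
      ext01 η 0 = z₀ ∧
        ∀ s ∈ Icc (0 : ℝ) 1, HasDerivWithinAt (ext01 η) (ext01 g s) (Icc 0 1) s := by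
  have key : ∀ s ∈ Icc (0 : ℝ) 1, HasDerivWithinAt
      (ext01 (ContinuousMap.const UI z₀ + volterra E g)) (ext01 g s) (Icc 0 1) s := by
    intro s hs
    refine ((hasDerivAt_integral_ext01 g s).const_add z₀).hasDerivWithinAt.congr_of_mem
      (fun t ht => ?_) hs
    rw [ext01_of_mem _ ht]
    rfl
  have key0 : ext01 (ContinuousMap.const UI z₀ + volterra E g) 0 = z₀ := by
    rw [ext01_of_mem _ ⟨le_rfl, zero_le_one⟩, ContinuousMap.add_apply, volterra_apply]
    simp
  constructor
  · rintro h
    rw [h]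
    exact ⟨key0, key⟩
  · rintro ⟨h0, h⟩
    have hconst := constant_of_derivWithin_zero (a := (0 : ℝ)) (b := 1)
      (f := fun s => ext01 η s - ext01 (ContinuousMap.const UI z₀ + volterra E g) s)
      (fun s hs => ((h s hs).sub (key s hs)).differentiableWithinAt) (fun s hs => by
        have h1 := (h s (Ico_subset_Icc_self hs)).fun_sub (key s (Ico_subset_Icc_self hs))
        rw [h1.derivWithin (uniqueDiffOn_Icc zero_lt_one s (Ico_subset_Icc_self hs)), sub_self])
    ext1 k
    have := hconst k k.2
    simp only [h0, key0, sub_self, ext01_coe] at this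
    exact sub_eq_zero.1 this

/-- The operator `η ↦ ∫₀ B η`. -/
def volOp (B : C(UI, E →L[ℝ] E)) : C(UI, E) →L[ℝ] C(UI, E) := volterra E ∘L applyCLM UI E E B

/-- The factorial decay of the iterates of a Volterra operator. -/
theorem norm_volOp_pow_apply_le (B : C(UI, E →L[ℝ] E)) (n : ℕ) (η : C(UI, E)) (k : UI) :
    ‖(volOp B ^ n) η k‖ ≤ (‖B‖ * k) ^ n / n.factorial * ‖η‖ := by
  induction n generalizing k with
  | zero => simpa using η.norm_coe_le_norm k
  | succ n ih =>
    have h1 : (volOp B ^ (n + 1)) η k =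
        ∫ σ in (0 : ℝ)..k, ext01 (applyCLM UI E E B ((volOp B ^ n) η)) σ := by
      rw [pow_succ']
      rfl
    have h2 : ∀ σ ∈ Ioc (0 : ℝ) k, ‖ext01 (applyCLM UI E E B ((volOp B ^ n) η)) σ‖ ≤
        ‖B‖ ^ (n + 1) / n.factorial * ‖η‖ * σ ^ n := by
      intro σ hσ
      have hσ1 : σ ∈ Icc (0 : ℝ) 1 := ⟨hσ.1.le, hσ.2.trans k.2.2⟩
      rw [ext01_of_mem _ hσ1, applyCLM_apply]
      calc _ ≤ ‖B ⟨σ, hσ1⟩‖ * ‖(volOp B ^ n) η ⟨σ, hσ1⟩‖ := ContinuousLinearMap.le_opNorm _ _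
        _ ≤ ‖B‖ * ((‖B‖ * σ) ^ n / n.factorial * ‖η‖) :=
            mul_le_mul (B.norm_coe_le_norm _) (ih _) (norm_nonneg _) (norm_nonneg B)
        _ = _ := by rw [mul_pow]; ring
    rw [h1]
    refine (intervalIntegral.norm_integral_le_of_norm_le k.2.1 (Eventually.of_forall h2)
      (Continuous.intervalIntegrable (by fun_prop) _ _)).trans (le_of_eq ?_)
    rw [intervalIntegral.integral_const_mul, integral_pow, Nat.factorial_succ]
    push_cast
    rw [mul_pow]
    field_simp
    simp

/-- The Neumann series of a Volterra operator converges. -/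
theorem isUnit_one_sub_volOp (B : C(UI, E →L[ℝ] E)) : IsUnit (1 - volOp B) := by
  obtain ⟨n, hn⟩ := ((FloorSemiring.tendsto_pow_div_factorial_atTop ‖B‖).eventually
    (gt_mem_nhds one_pos)).exists
  have hnorm : ‖volOp B ^ n‖ < 1 := by
    refine (ContinuousLinearMap.opNorm_le_bound _ (by positivity) fun η => ?_).trans_lt hn
    rw [ContinuousMap.norm_le _ (by positivity)]
    intro k
    refine (norm_volOp_pow_apply_le B n η k).trans ?_
    have : ‖B‖ * k ≤ ‖B‖ := mul_le_of_le_one_right (norm_nonneg B) k.2.2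
    have h0 : 0 ≤ ‖B‖ * (k : ℝ) := mul_nonneg (norm_nonneg B) k.2.1
    gcongr
  have h1 : IsUnit (1 - volOp B ^ n) := isUnit_one_sub_of_norm_lt_one hnorm
  rw [← mul_neg_geom_sum] at h1
  refine ((Commute.isUnit_mul_iff ?_).1 h1).1
  exact (Commute.sum_right _ _ _ fun i _ =>
    ((Commute.one_left _).sub_left (Commute.refl _)).pow_right i)

theorem exists_eq_add_volOp (B : C(UI, E →L[ℝ] E)) (g : C(UI, E)) :
    ∃ η, η = g + volOp B η := by
  obtain ⟨u, hu⟩ := isUnit_one_sub_volOp B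
  refine ⟨(↑u⁻¹ : C(UI, E) →L[ℝ] C(UI, E)) g, ?_⟩
  have h : (u * ↑u⁻¹ : C(UI, E) →L[ℝ] C(UI, E)) g = g := by
    rw [Units.mul_inv]
    rfl
  rw [hu] at h
  rw [← sub_eq_iff_eq_add]
  exact h

theorem eq_of_eq_add_volOp (B : C(UI, E →L[ℝ] E)) {g η η' : C(UI, E)} (h : η = g + volOp B η)
    (h' : η' = g + volOp B η') : η = η' := by
  obtain ⟨u, hu⟩ := isUnit_one_sub_volOp B
  have h1 : (u : C(UI, E) →L[ℝ] C(UI, E)) η = (u : C(UI, E) →L[ℝ] C(UI, E)) η' := by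
    rw [hu]
    exact (sub_eq_iff_eq_add.2 h).trans (sub_eq_iff_eq_add.2 h').symm
  have h2 : ∀ ζ : C(UI, E), (↑u⁻¹ * u : C(UI, E) →L[ℝ] C(UI, E)) ζ = ζ := fun ζ => by
    rw [Units.inv_mul]
    rfl
  rw [← h2 η, ← h2 η']
  exact congrArg (fun ζ => (↑u⁻¹ : C(UI, E) →L[ℝ] C(UI, E)) ζ) h1

end Volterra

end

section

set_option maxSynthPendingDepth 5

/-! ### Return orbits depend smoothly on parameters -/

section SmoothReturn

variable {Z P : Type} [NormedAddCommGroup Z] [NormedSpace ℝ Z] [CompleteSpace Z]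
  [NormedAddCommGroup P] [NormedSpace ℝ P] [CompleteSpace P]

/-- `(γ, T)` is an orbit segment of the field `X (·, π)`, parametrized by `[0, 1]` with time scale
`T`, that starts at `z₀` and ends on the hyperplane `ℓ = 0`. -/
structure IsReturnSegment (X : Z × P → Z) (O : Set (Z × P)) (z₀ : Z) (ℓ : Z →L[ℝ] ℝ) (π : P)
    (γ : C(UI, Z)) (T : ℝ) : Prop where
  mem : ∀ k, (γ k, π) ∈ O
  init : ext01 γ 0 = z₀
  ode : ∀ s ∈ Icc (0 : ℝ) 1, HasDerivWithinAt (ext01 γ) (T • X (ext01 γ s, π)) (Icc 0 1) s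
  final : ℓ (ext01 γ 1) = 0

/-- The pair `(γ, π)` as a function on the unit interval, linear in both arguments. -/
def pairCLM (Z P : Type) [NormedAddCommGroup Z] [NormedSpace ℝ Z] [NormedAddCommGroup P]
    [NormedSpace ℝ P] : P × C(UI, Z) →L[ℝ] C(UI, Z × P) :=
  (ContinuousLinearMap.inr ℝ Z P).compLeftContinuous ℝ UI ∘L
      ContinuousLinearMap.const ℝ UI ∘L .fst ℝ P C(UI, Z) +
    (ContinuousLinearMap.inl ℝ Z P).compLeftContinuous ℝ UI ∘L .snd ℝ P C(UI, Z)

theorem pairCLM_apply (u : P × C(UI, Z)) (k : UI) : pairCLM Z P u k = (u.2 k, u.1) := by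
  have : pairCLM Z P u k = (0, u.1) + (u.2 k, 0) := rfl
  simp [this]

variable {X : Z × P → Z} {O : Set (Z × P)} {z₀ : Z} {ℓ : Z →L[ℝ] ℝ}

theorem isReturnSegment_iff (hX : ContDiffOn ℝ ∞ X O) {π : P} {γ : C(UI, Z)}
    {T : ℝ} (hγ : ∀ k, (γ k, π) ∈ O) : IsReturnSegment X O z₀ ℓ π γ T ↔
      γ = ContinuousMap.const UI z₀ + T • volterra Z (superpos X (pairCLM Z P (π, γ))) ∧
        ℓ (γ 1) = 0 := by
  have h1 : ext01 γ 1 = γ 1 := ext01_coe γ 1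
  have hθ : pairCLM Z P (π, γ) ∈ mapsInto UI O := fun k => by
    rw [pairCLM_apply]
    exact hγ k
  have h2 : ∀ s ∈ Icc (0 : ℝ) 1, ext01 (T • superpos X (pairCLM Z P (π, γ))) s =
      T • X (ext01 γ s, π) := by
    intro s hs
    rw [ext01_of_mem _ hs, ContinuousMap.smul_apply, superpos_apply hX.continuousOn hθ,
      pairCLM_apply, ext01_of_mem _ hs]
  rw [← map_smul, eq_const_add_volterra_iff]
  constructor
  · intro h
    exact ⟨⟨h.init, fun s hs => by rw [h2 s hs]; exact h.ode s hs⟩, h1 ▸ h.final⟩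
  · rintro ⟨⟨h3, h4⟩, h5⟩
    exact ⟨hγ, h3, fun s hs => by rw [← h2 s hs]; exact h4 s hs, h1 ▸ h5⟩

/-- A return segment that ends transversally depends smoothly on the parameter. The integral
equation `γ = z₀ + T ∫ X (γ, π)` is solved, together with `ℓ (γ 1) = 0`, for `(γ, T)`: linearized
at `(γ₀, T₀)` it is `η - B η - σ ∫ X = g`, with a Volterra operator `B`, and since
`ξ (s) = s X (γ₀ s)` solves `ξ - B ξ = ∫ X`, the condition at the end point determines `σ`. -/
theorem exists_smooth_return (hO : IsOpen O) (hX : ContDiffOn ℝ ∞ X O) {π₀ : P} {γ₀ : C(UI, Z)}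
    {T₀ : ℝ} (h₀ : IsReturnSegment X O z₀ ℓ π₀ γ₀ T₀) (hℓ : ℓ (X (ext01 γ₀ 1, π₀)) ≠ 0) :
    ∃ ψ : P → C(UI, Z) × ℝ, ψ π₀ = (γ₀, T₀) ∧ (∀ᶠ π in 𝓝 π₀, ContDiffAt ℝ ∞ ψ π) ∧
      ∀ᶠ π in 𝓝 π₀, IsReturnSegment X O z₀ ℓ π (ψ π).1 (ψ π).2 := by
  let L := pairCLM Z P
  let D : Set (P × (C(UI, Z) × ℝ)) := {v | ∀ k, (v.2.1 k, v.1) ∈ O}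
  let Lp : P × (C(UI, Z) × ℝ) →L[ℝ] C(UI, Z × P) := L ∘L
    ((ContinuousLinearMap.fst ℝ P _).prod (.fst ℝ _ ℝ ∘L .snd ℝ P _))
  have hLp : ∀ v k, Lp v k = (v.2.1 k, v.1) := fun v k => pairCLM_apply (v.1, v.2.1) k
  have hDL : D = Lp ⁻¹' mapsInto UI O := by
    ext v
    simp only [D, mem_ofPred_eq, mapsInto, mem_preimage, hLp]
  have hD : IsOpen D := by
    rw [hDL]
    exact (isOpen_mapsInto hO).preimage Lp.continuous
  let ev : C(UI, Z) →L[ℝ] ℝ := ℓ ∘L ContinuousMap.evalCLM ℝ (1 : UI)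
  let f : P × (C(UI, Z) × ℝ) → C(UI, Z) × ℝ := fun v =>
    (v.2.1 - (ContinuousMap.const UI z₀ + v.2.2 • volterra Z (superpos X (Lp v))), ev v.2.1)
  have hsup : ContDiffOn ℝ ∞ (fun v => superpos X (Lp v)) D :=
    (contDiffOn_superpos hO hX).comp Lp.contDiff.contDiffOn fun v hv => by
      rw [hDL] at hv
      exact hv
  have hf : ContDiffOn ℝ ∞ f D := by
    have h1 : ContDiffOn ℝ ∞ (fun v : P × (C(UI, Z) × ℝ) => v.2.1) D :=
      (contDiff_fst.comp contDiff_snd).contDiffOn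
    have h2 : ContDiffOn ℝ ∞ (fun v : P × (C(UI, Z) × ℝ) => v.2.2) D :=
      (contDiff_snd.comp contDiff_snd).contDiffOn
    exact (h1.sub (contDiffOn_const.add (h2.smul ((volterra Z).contDiff.comp_contDiffOn
      hsup)))).prodMk (ev.contDiff.comp_contDiffOn h1)
  have hfz : ∀ v ∈ D, f v = 0 ↔ IsReturnSegment X O z₀ ℓ v.1 v.2.1 v.2.2 := by
    intro v hv
    rw [isReturnSegment_iff hX hv, Prod.mk_eq_zero, sub_eq_zero]
    rfl
  have hv₀ : (π₀, (γ₀, T₀)) ∈ D := h₀.mem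
  have hγ₀X : ∀ s ∈ Icc (0 : ℝ) 1, (ext01 γ₀ s, π₀) ∈ O := fun s hs => by
    rw [ext01_of_mem _ hs]
    exact h₀.mem _
  set θ₀ : C(UI, Z × P) := Lp (π₀, (γ₀, T₀)) with hθ₀
  have hθO : θ₀ ∈ mapsInto UI O := by
    have := hv₀
    rw [hDL] at this
    exact this
  have hθk : ∀ k, θ₀ k = (γ₀ k, π₀) := fun k => hLp _ k
  have hX1 : ContDiffOn ℝ 1 X O := hX.of_le (by simp)
  have hXc := hX.continuousOn
  have hdX : ContinuousOn (fderiv ℝ X) O := hX1.continuousOn_fderiv_of_isOpen hO le_rfl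
  let B : C(UI, Z →L[ℝ] Z) := ⟨fun k => T₀ • (fderiv ℝ X (γ₀ k, π₀) ∘L .inl ℝ Z P), by
    refine Continuous.const_smul (Continuous.clm_comp ?_ continuous_const) T₀
    exact hdX.comp_continuous (by fun_prop) h₀.mem⟩
  set a := superpos X θ₀ with ha
  have hak : ∀ s (hs : s ∈ Icc (0 : ℝ) 1), ext01 a s = X (ext01 γ₀ s, π₀) := fun s hs => by
    rw [ext01_of_mem _ hs, ext01_of_mem _ hs, ha, superpos_apply hXc hθO, hθk]
  -- The linearization of the boundary value problem in `(γ, T)` is a Volterra equation for `γ`,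
  -- bordered by the transversality condition for `T`.
  have hlin : ∀ η : C(UI, Z) × ℝ, (fderiv ℝ f (π₀, (γ₀, T₀)) ∘L .inr ℝ P (C(UI, Z) × ℝ)) η =
      (η.1 - (volOp B η.1 + η.2 • volterra Z a), ℓ (η.1 1)) := by
    intro η
    have h1 : HasFDerivAt (fun v => superpos X (Lp v))
        (applyCLM UI (Z × P) Z (superpos (fderiv ℝ X) θ₀) ∘L Lp) (π₀, (γ₀, T₀)) := by
      have h0 : HasFDerivAt (superpos X) (applyCLM UI (Z × P) Z (superpos (fderiv ℝ X) θ₀))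
          (Lp (π₀, (γ₀, T₀))) := hasFDerivAt_superpos hO hX1 hθO
      exact h0.comp (π₀, (γ₀, T₀)) Lp.hasFDerivAt
    have h2 : HasFDerivAt (fun v : P × (C(UI, Z) × ℝ) => v.2.1)
        (.fst ℝ _ ℝ ∘L .snd ℝ P (C(UI, Z) × ℝ)) (π₀, (γ₀, T₀)) :=
      (ContinuousLinearMap.fst ℝ C(UI, Z) ℝ ∘L .snd ℝ P (C(UI, Z) × ℝ)).hasFDerivAt
    have h3 : HasFDerivAt (fun v : P × (C(UI, Z) × ℝ) => v.2.2)
        (.snd ℝ _ ℝ ∘L .snd ℝ P (C(UI, Z) × ℝ)) (π₀, (γ₀, T₀)) :=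
      (ContinuousLinearMap.snd ℝ C(UI, Z) ℝ ∘L .snd ℝ P (C(UI, Z) × ℝ)).hasFDerivAt
    have h4 := (h2.sub ((h3.smul ((volterra Z).hasFDerivAt.comp (π₀, (γ₀, T₀)) h1)).const_add
      (ContinuousMap.const UI z₀))).prodMk (ev.hasFDerivAt.comp (π₀, (γ₀, T₀)) h2)
    have h5 : fderiv ℝ f (π₀, (γ₀, T₀)) = _ := h4.fderiv
    rw [h5]
    have hB : T₀ • applyCLM UI (Z × P) Z (superpos (fderiv ℝ X) θ₀) (Lp (0, η)) =
        applyCLM UI Z Z B η.1 := by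
      ext1 k
      rw [ContinuousMap.smul_apply, applyCLM_apply, superpos_apply hdX hθO, hθk, hLp]
      rfl
    have hB' : volOp B η.1 = T₀ • volterra Z
        (applyCLM UI (Z × P) Z (superpos (fderiv ℝ X) θ₀) (Lp (0, η))) := by
      rw [← map_smul, hB]
      rfl
    rw [hB']
    rfl
  let ξ : C(UI, Z) := ⟨fun k => (k : ℝ) • X (γ₀ k, π₀), by
    exact continuous_subtype_val.smul (hXc.comp_continuous (by fun_prop) h₀.mem)⟩
  have hξ : ξ = volterra Z a + volOp B ξ := by
    have h1 := (eq_const_add_volterra_iff (η := ξ) (g := a + applyCLM UI Z Z B ξ) (z₀ := 0)).2 ?_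
    · rw [map_add] at h1
      refine h1.trans ?_
      ext1 k
      simp [volOp]
    have hξs : ∀ s ∈ Icc (0 : ℝ) 1, ext01 ξ s = s • X (ext01 γ₀ s, π₀) := fun s hs => by
      rw [ext01_of_mem _ hs, ext01_of_mem _ hs]
      rfl
    refine ⟨by rw [hξs 0 ⟨le_rfl, zero_le_one⟩, zero_smul], fun s hs => ?_⟩
    have h2 := ((hX.contDiffAt (hO.mem_nhds (hγ₀X s hs))).differentiableAt (by simp)).hasFDerivAt
    have h3 : HasDerivWithinAt (fun s => (ext01 γ₀ s, π₀)) (T₀ • X (ext01 γ₀ s, π₀), (0 : P))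
      (Icc 0 1) s := (h₀.ode s hs).prodMk (hasDerivWithinAt_const _ _ _)
    have h4 := (hasDerivWithinAt_id s (Icc 0 1)).smul (h2.comp_hasDerivWithinAt_of_eq s h3 rfl)
    refine (h4.congr_of_mem hξs hs).congr_deriv ?_
    have h5 : ext01 (a + applyCLM UI Z Z B ξ) s = X (ext01 γ₀ s, π₀) +
        T₀ • fderiv ℝ X (ext01 γ₀ s, π₀) (s • X (ext01 γ₀ s, π₀), 0) := by
      have h6 : ext01 (a + applyCLM UI Z Z B ξ) s = ext01 a s +
          T₀ • fderiv ℝ X (ext01 γ₀ s, π₀) (ext01 ξ s, 0) := by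
        simp only [ext01_of_mem _ hs]
        rfl
      rw [h6, hak s hs, hξs s hs]
    have h7 : ∀ (c : ℝ) (x : Z), (c • x, (0 : P)) = c • (x, (0 : P)) := fun (c : ℝ) (x : Z) => by
      rw [Prod.smul_mk, smul_zero]
    rw [h5, h7 s, h7 T₀, map_smul, map_smul, smul_comm, one_smul, add_comm]
    rfl
  have hξ1 : ℓ (ξ 1) ≠ 0 := by
    have : ξ 1 = X (ext01 γ₀ 1, π₀) := by
      have h1 : ext01 γ₀ 1 = γ₀ 1 := ext01_coe γ₀ 1
      rw [h1]
      exact one_smul ℝ (X (γ₀ 1, π₀))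
    rwa [this]
  have hinv : (fderiv ℝ f (π₀, (γ₀, T₀)) ∘L .inr ℝ P (C(UI, Z) × ℝ)).IsInvertible := by
    refine ⟨ContinuousLinearEquiv.ofBijective _ (LinearMap.ker_eq_bot'.2 ?_)
      (LinearMap.range_eq_top.2 ?_), ContinuousLinearEquiv.coe_ofBijective _ _ _⟩
    · intro η hη
      have hη' := (hlin η).symm.trans hη
      rw [Prod.mk_eq_zero, sub_eq_zero] at hη'
      have h1 : η.1 = η.2 • ξ := eq_of_eq_add_volOp B (g := η.2 • volterra Z a)
        (hη'.1.trans (add_comm _ _)) (by rw [map_smul, ← smul_add, ← hξ])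
      have h2 := hη'.2
      rw [h1, ContinuousMap.smul_apply, map_smul, smul_eq_mul, mul_eq_zero_iff_right hξ1] at h2
      refine Prod.ext ?_ h2
      rw [h1, h2, zero_smul]
      rfl
    · rintro ⟨g, c⟩
      obtain ⟨η, hη⟩ := exists_eq_add_volOp B g
      set σ := (c - ℓ (η 1)) / ℓ (ξ 1) with hσ
      refine ⟨(η + σ • ξ, σ), (hlin _).trans (Prod.ext ?_ ?_)⟩
      · have h1 : η - volOp B η = g := sub_eq_iff_eq_add.2 hη
        have h2 : ξ - volOp B ξ = volterra Z a := sub_eq_iff_eq_add.2 hξ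
        calc η + σ • ξ - (volOp B (η + σ • ξ) + σ • volterra Z a)
            = (η - volOp B η) + σ • ((ξ - volOp B ξ) - volterra Z a) := by
              rw [map_add, map_smul]
              module
          _ = g := by rw [h1, h2, sub_self, smul_zero, add_zero]
      · change ℓ (η 1 + σ • ξ 1) = c
        rw [map_add, map_smul, smul_eq_mul, hσ, div_mul_cancel₀ _ hξ1]
        ring
  obtain ⟨ψ, h1, h2, h3, -⟩ := exists_smooth_implicitFunction hD hf hv₀ ((hfz _ hv₀).2 h₀) hinv
  exact ⟨ψ, h1, h2, h3.mono fun π hπ => (hfz _ hπ.1).1 hπ.2⟩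

end SmoothReturn

end

section

set_option maxSynthPendingDepth 5

/-! ### Uniqueness, periodic solutions and first returns -/

section Uniqueness

variable {Z : Type} [NormedAddCommGroup Z] [NormedSpace ℝ Z]

/-- Uniqueness of solutions of an autonomous equation. A smooth field is locally Lipschitz on the
compact union of the two orbits. -/
theorem ode_eqOn {X : Z → Z} {O : Set Z} (hO : IsOpen O) (hX : ContDiffOn ℝ ∞ X O) {a b t₀ : ℝ}
    (ht₀ : t₀ ∈ Icc a b) {z w : ℝ → Z}
    (hz : ∀ t ∈ Icc a b, HasDerivWithinAt z (X (z t)) (Icc a b) t) (hzO : ∀ t ∈ Icc a b, z t ∈ O)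
    (hw : ∀ t ∈ Icc a b, HasDerivWithinAt w (X (w t)) (Icc a b) t) (hwO : ∀ t ∈ Icc a b, w t ∈ O)
    (h : z t₀ = w t₀) : EqOn z w (Icc a b) := by
  have hzc : ContinuousOn z (Icc a b) := fun t ht => (hz t ht).continuousWithinAt
  have hwc : ContinuousOn w (Icc a b) := fun t ht => (hw t ht).continuousWithinAt
  set S := z '' Icc a b ∪ w '' Icc a b with hS
  have hSc : IsCompact S := (isCompact_Icc.image_of_continuousOn hzc).union
    (isCompact_Icc.image_of_continuousOn hwc)
  have hSO : ∀ x ∈ S, x ∈ O := by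
    rintro x (⟨t, ht, rfl⟩ | ⟨t, ht, rfl⟩)
    exacts [hzO t ht, hwO t ht]
  obtain ⟨K, hK⟩ := LocallyLipschitzOn.exists_lipschitzOnWith_of_compact (f := X) hSc fun x hx => by
    obtain ⟨K, t, ht, hK⟩ := ((hX.contDiffAt (hO.mem_nhds (hSO x hx))).of_le
      (by simp : (1 : WithTop ℕ∞) ≤ ∞)).exists_lipschitzOnWith
    exact ⟨K, t, mem_nhdsWithin_of_mem_nhds ht, hK⟩
  have hzS : ∀ t ∈ Icc a b, z t ∈ S := fun t ht => Or.inl ⟨t, ht, rfl⟩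
  have hwS : ∀ t ∈ Icc a b, w t ∈ S := fun t ht => Or.inr ⟨t, ht, rfl⟩
  have hr : Icc t₀ b ⊆ Icc a b := Icc_subset_Icc_left ht₀.1
  have hl : Icc a t₀ ⊆ Icc a b := Icc_subset_Icc_right ht₀.2
  have hR : ∀ t ∈ Ico t₀ b, t ∈ Icc a b ∧ Icc a b ∈ 𝓝[≥] t := fun t ht =>
    ⟨hr (Ico_subset_Icc_self ht), Icc_mem_nhdsGE_of_mem ⟨ht₀.1.trans ht.1, ht.2⟩⟩
  have hL : ∀ t ∈ Ioc a t₀, t ∈ Icc a b ∧ Icc a b ∈ 𝓝[≤] t := fun t ht =>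
    ⟨hl (Ioc_subset_Icc_self ht), Icc_mem_nhdsLE_of_mem ⟨ht.1, ht.2.trans ht₀.2⟩⟩
  intro t ht
  rcases le_total t t₀ with h1 | h1
  · exact ODE_solution_unique_of_mem_Icc_left (v := fun _ => X) (s := fun _ => S)
      (fun _ _ => hK) (hzc.mono hl)
      (fun t ht => (hz t (hL t ht).1).mono_of_mem_nhdsWithin (hL t ht).2)
      (fun t ht => hzS t (hL t ht).1) (hwc.mono hl)
      (fun t ht => (hw t (hL t ht).1).mono_of_mem_nhdsWithin (hL t ht).2)
      (fun t ht => hwS t (hL t ht).1) h ⟨ht.1, h1⟩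
  · exact ODE_solution_unique_of_mem_Icc_right (v := fun _ => X) (s := fun _ => S)
      (fun _ _ => hK) (hzc.mono hr)
      (fun t ht => (hz t (hR t ht).1).mono_of_mem_nhdsWithin (hR t ht).2)
      (fun t ht => hzS t (hR t ht).1) (hwc.mono hr)
      (fun t ht => (hw t (hR t ht).1).mono_of_mem_nhdsWithin (hR t ht).2)
      (fun t ht => hwS t (hR t ht).1) h ⟨h1, ht.2⟩

/-- A solution that closes up extends to a periodic solution. -/
theorem exists_periodic_extension {X : Z → Z} {a T : ℝ} (hT : 0 < T) {z : ℝ → Z}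
    (hz : ∀ t ∈ Icc a (a + T), HasDerivWithinAt z (X (z t)) (Icc a (a + T)) t)
    (hper : z (a + T) = z a) : ∃ w : ℝ → Z, (∀ t, HasDerivAt w (X (w t)) t) ∧
      (∀ t, w (t + T) = w t) ∧ EqOn w z (Icc a (a + T)) ∧
      ∀ t, ∃ s ∈ Icc a (a + T), w t = z s := by
  set w : ℝ → Z := fun t => z (toIcoMod hT a t) with hw
  have key : ∀ (n : ℤ), ∀ t ∈ Icc (a + n • T) (a + T + n • T), w t = z (t - n • T) := by
    intro n t ht
    rcases ht.2.eq_or_lt with h | h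
    · have h1 : toIcoMod hT a t = a := by
        rw [toIcoMod_eq_iff hT]
        exact ⟨⟨le_rfl, by linarith⟩, n + 1, by rw [h, add_smul, one_smul]; ring⟩
      rw [hw]
      simp only [h1]
      rw [h, add_sub_cancel_right, hper]
    · have h1 : toIcoMod hT a t = t - n • T := by
        rw [toIcoMod_eq_iff hT]
        exact ⟨⟨by linarith [ht.1], by linarith⟩, n, by ring⟩
      rw [hw]
      simp only [h1]
  have hder : ∀ (n : ℤ), ∀ t ∈ Icc (a + n • T) (a + T + n • T),
      HasDerivWithinAt w (X (w t)) (Icc (a + n • T) (a + T + n • T)) t := by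
    intro n t ht
    have ht' : t - n • T ∈ Icc a (a + T) := ⟨by linarith [ht.1], by linarith [ht.2]⟩
    have h1 := (hz _ ht').scomp t ((hasDerivAt_id t).sub_const (n • T)).hasDerivWithinAt
      (t' := Icc a (a + T)) (s := Icc (a + n • T) (a + T + n • T))
      fun s hs => ⟨by simp only [id]; linarith [hs.1], by simp only [id]; linarith [hs.2]⟩
    rw [one_smul] at h1
    rw [key n t ht]
    exact h1.congr_of_mem (fun s hs => key n s hs) ht
  refine ⟨w, fun t => ?_, fun t => ?_, fun t ht => ?_, fun t => ?_⟩
  · have h1 := toIcoMod_mem_Ico hT a t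
    have h2 := toIocMod_mem_Ioc hT a t
    have h3 := toIcoMod_add_toIcoDiv_zsmul hT a t
    have h4 := toIocMod_add_toIocDiv_zsmul hT a t
    have hr : HasDerivWithinAt w (X (w t)) (Ici t) t :=
      (hder (toIcoDiv hT a t) t ⟨by linarith [h1.1], by linarith [h1.2]⟩).mono_of_mem_nhdsWithin
        (Icc_mem_nhdsGE_of_mem ⟨by linarith [h1.1], by linarith [h1.2]⟩)
    have hl : HasDerivWithinAt w (X (w t)) (Iic t) t :=
      (hder (toIocDiv hT a t) t ⟨by linarith [h2.1], by linarith [h2.2]⟩).mono_of_mem_nhdsWithin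
        (Icc_mem_nhdsLE_of_mem ⟨by linarith [h2.1], by linarith [h2.2]⟩)
    have := hl.union hr
    rwa [Iic_union_Ici, hasDerivWithinAt_univ] at this
  · simp only [hw, toIcoMod_add_right]
  · have := key 0 t (by simpa using ht)
    simpa using this
  · exact ⟨_, Ico_subset_Icc_self (toIcoMod_mem_Ico hT a t), rfl⟩

end Uniqueness

section FirstReturn

variable {Z P : Type} [NormedAddCommGroup Z] [NormedSpace ℝ Z] [CompleteSpace Z]
  [NormedAddCommGroup P] [NormedSpace ℝ P] [CompleteSpace P]

variable {X : Z × P → Z} {O : Set (Z × P)} {z₀ : Z} {ℓ ρ : Z →L[ℝ] ℝ}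

/-- A return segment whose end point is its first point on the section `ℓ = 0, ρ < 0`; in between
it may cross the hyperplane `ℓ = 0` only where `ρ > 0`. -/
structure IsFirstReturn (X : Z × P → Z) (O : Set (Z × P)) (z₀ : Z) (ℓ ρ : Z →L[ℝ] ℝ) (π : P)
    (γ : C(UI, Z)) (T : ℝ) : Prop extends IsReturnSegment X O z₀ ℓ π γ T where
  pos : 0 < T
  neg : ρ (ext01 γ 1) < 0
  between : ∀ s ∈ Ioo (0 : ℝ) 1, ℓ (ext01 γ s) = 0 → 0 < ρ (ext01 γ s)

theorem div_mem_unit {t T : ℝ} (hT : 0 < T) (ht : t ∈ Icc 0 T) : t / T ∈ Icc (0 : ℝ) 1 :=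
  ⟨div_nonneg ht.1 hT.le, (div_le_one hT).2 ht.2⟩

theorem IsReturnSegment.hasDerivWithinAt {π : P} {γ : C(UI, Z)} {T : ℝ}
    (h : IsReturnSegment X O z₀ ℓ π γ T) (hT : 0 < T) {t : ℝ} (ht : t ∈ Icc 0 T) :
    HasDerivWithinAt (fun t => ext01 γ (t / T)) (X (ext01 γ (t / T), π)) (Icc 0 T) t := by
  have h1 := (h.ode _ (div_mem_unit hT ht)).scomp t
    ((hasDerivAt_id t).div_const T).hasDerivWithinAt (t' := Icc 0 1) (s := Icc 0 T)
    fun s hs => div_mem_unit hT hs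
  refine h1.congr_deriv ?_
  rw [smul_smul, one_div, inv_mul_cancel₀ hT.ne', one_smul]

theorem IsReturnSegment.mem' {π : P} {γ : C(UI, Z)} {T : ℝ}
    (h : IsReturnSegment X O z₀ ℓ π γ T) (s : ℝ) : (ext01 γ s, π) ∈ O := h.mem _

/-- Both orbits agree on the shorter of the two time intervals; if its end were an interior time of
the other orbit, that orbit would meet the section there too early. -/
theorem IsFirstReturn.unique_aux (hO : IsOpen O) (hX : ContDiffOn ℝ ∞ X O) {π : P}
    {γ γ' : C(UI, Z)} {T T' : ℝ} (h : IsFirstReturn X O z₀ ℓ ρ π γ T)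
    (h' : IsFirstReturn X O z₀ ℓ ρ π γ' T') (hTT : T ≤ T') : (γ, T) = (γ', T') := by
  have hT := h.pos
  have hT' := h'.pos
  have hO' : IsOpen {z : Z | (z, π) ∈ O} := hO.preimage (by fun_prop)
  have hX' : ContDiffOn ℝ ∞ (fun z => X (z, π)) {z : Z | (z, π) ∈ O} :=
    hX.comp (contDiff_prodMk_left π).contDiffOn fun z hz => hz
  have hsub : Icc 0 T ⊆ Icc 0 T' := Icc_subset_Icc_right hTT
  have heq := ode_eqOn hO' hX' (a := 0) (b := T) ⟨le_rfl, hT.le⟩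
    (z := fun t => ext01 γ (t / T)) (w := fun t => ext01 γ' (t / T'))
    (fun t ht => h.hasDerivWithinAt hT ht) (fun t ht => h.mem' _)
    (fun t ht => (h'.hasDerivWithinAt hT' (hsub ht)).mono hsub) (fun t ht => h'.mem' _)
    (by simp only [zero_div, h.init, h'.init])
  have hTe : T = T' := by
    by_contra hne
    have hlt : T < T' := lt_of_le_of_ne hTT hne
    have h1 := heq ⟨hT.le, le_rfl⟩
    simp only [div_self hT.ne'] at h1
    have h2 := h'.between (T / T') ⟨by positivity, (div_lt_one hT').2 hlt⟩
    rw [← h1] at h2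
    exact lt_asymm (h2 h.final) h.neg
  subst hTe
  refine Prod.ext (ContinuousMap.ext fun k => ?_) rfl
  have h1 := heq (x := T * k) ⟨mul_nonneg hT.le k.2.1, mul_le_of_le_one_right hT.le k.2.2⟩
  simp only [mul_div_cancel_left₀ _ hT.ne', ext01_coe] at h1
  exact h1

theorem IsFirstReturn.unique (hO : IsOpen O) (hX : ContDiffOn ℝ ∞ X O) {π : P}
    {ψ ψ' : C(UI, Z) × ℝ} (h : IsFirstReturn X O z₀ ℓ ρ π ψ.1 ψ.2)
    (h' : IsFirstReturn X O z₀ ℓ ρ π ψ'.1 ψ'.2) : ψ = ψ' := by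
  rcases le_total ψ.2 ψ'.2 with hT | hT
  · exact h.unique_aux hO hX h' hT
  · exact (h'.unique_aux hO hX h hT).symm

theorem continuousAt_ext01_family {ψ : P → C(UI, Z) × ℝ} {π₀ : P} (hψ : ContinuousAt ψ π₀) (s : ℝ) :
    ContinuousAt (fun q : P × ℝ => ext01 (ψ q.1).1 q.2) (π₀, s) := by
  have h1 : Continuous fun q : C(UI, Z) × ℝ => ext01 q.1 q.2 :=
    (ContinuousEval.continuous_eval (F := C(UI, Z))).comp
      (continuous_fst.prodMk ((continuous_projIcc (h := zero_le_one)).comp continuous_snd))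
  have h2 : ContinuousAt (fun q : P × ℝ => ψ q.1) (π₀, s) :=
    ContinuousAt.comp (f := Prod.fst) (x := (π₀, s)) hψ continuousAt_fst
  exact h1.continuousAt.comp (f := fun q : P × ℝ => ((ψ q.1).1, q.2))
    (h2.fst.prodMk continuousAt_snd)

/-- Near a time at which `ℓ` vanishes transversally along the base segment there is, by Rolle's
theorem, at most one zero of `ℓ` along nearby segments. -/
theorem eventually_ne_zero_near (hO : IsOpen O) (hX : ContDiffOn ℝ ∞ X O) {π₀ : P}
    {ψ : P → C(UI, Z) × ℝ} (hψ : ContinuousAt ψ π₀)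
    (hseg : ∀ᶠ π in 𝓝 π₀, IsReturnSegment X O z₀ ℓ π (ψ π).1 (ψ π).2) (hpos : 0 < (ψ π₀).2)
    {e : ℝ} (he : e ∈ Icc (0 : ℝ) 1) (hℓ : ℓ (X (ext01 (ψ π₀).1 e, π₀)) ≠ 0)
    (hend : ∀ᶠ π in 𝓝 π₀, ℓ (ext01 (ψ π).1 e) = 0) :
    ∀ᶠ q in 𝓝 (π₀, e), q.2 ∈ Icc (0 : ℝ) 1 → q.2 ≠ e → ℓ (ext01 (ψ q.1).1 q.2) ≠ 0 := by
  have hc : ContinuousAt (fun q : P × ℝ => (ψ q.1).2 * ℓ (X (ext01 (ψ q.1).1 q.2, q.1)))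
      (π₀, e) := by
    have h1 : ContinuousAt (fun q : P × ℝ => ψ q.1) (π₀, e) :=
      ContinuousAt.comp (f := Prod.fst) (x := (π₀, e)) hψ continuousAt_fst
    have h2 := continuousAt_ext01_family hψ e
    have h4 : ContinuousAt X (ext01 (ψ π₀).1 e, π₀) :=
      hX.continuousOn.continuousAt (hO.mem_nhds (hseg.self_of_nhds.mem' e))
    exact h1.snd.mul (ℓ.continuous.continuousAt.comp
      (ContinuousAt.comp (f := fun q : P × ℝ => (ext01 (ψ q.1).1 q.2, q.1)) h4
        (h2.prodMk continuousAt_fst)))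
  have hne := hc.eventually_ne (mul_ne_zero hpos.ne' hℓ)
  rw [nhds_prod_eq, eventually_prod_iff] at hne
  obtain ⟨p₁, hp₁, p₂, hp₂, hne⟩ := hne
  obtain ⟨δ, hδ, hp₂⟩ := Metric.eventually_nhds_iff_ball.1 hp₂
  rw [nhds_prod_eq, eventually_prod_iff]
  refine ⟨_, hp₁.and (hseg.and hend), _, Metric.ball_mem_nhds e hδ, ?_⟩
  rintro π ⟨h1, h2, h3⟩ s hs hs01 hse h0
  have hsub : uIcc e s ⊆ Icc (0 : ℝ) 1 := fun x hx =>
    ⟨(le_min he.1 hs01.1).trans hx.1, hx.2.trans (max_le he.2 hs01.2)⟩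
  have hmin : min e s < max e s := min_lt_max.2 (Ne.symm hse)
  obtain ⟨c, hc, hc0⟩ := exists_hasDerivAt_eq_zero (f := fun s => ℓ (ext01 (ψ π).1 s))
    (f' := fun s => ℓ ((ψ π).2 • X (ext01 (ψ π).1 s, π))) hmin
    (ℓ.continuous.comp (continuous_ext01 _)).continuousOn (by
      rcases min_cases e s with h | h <;> rcases max_cases e s with h' | h' <;>
        simp [h.1, h'.1, h3, h0])
    (fun x hx => ℓ.hasFDerivAt.comp_hasDerivAt x
      ((h2.ode x (hsub (Ioo_subset_Icc_self hx))).hasDerivAt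
        (mem_of_superset (Ioo_mem_nhds hx.1 hx.2) (Ioo_subset_Icc_self.trans hsub))))
  refine hne h1 (hp₂ c ?_) (by simpa using hc0)
  exact (convex_ball e δ).ordConnected.uIcc_subset (Metric.mem_ball_self hδ) hs
    (Ioo_subset_Icc_self hc)

/-- A transversal first return persists, and depends smoothly on the parameter. -/
theorem exists_smooth_firstReturn (hO : IsOpen O) (hX : ContDiffOn ℝ ∞ X O) {π₀ : P}
    {γ₀ : C(UI, Z)} {T₀ : ℝ} (h₀ : IsFirstReturn X O z₀ ℓ ρ π₀ γ₀ T₀) (hz₀ : ℓ z₀ = 0)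
    (hℓ₀ : ℓ (X (z₀, π₀)) ≠ 0) (hℓ : ℓ (X (ext01 γ₀ 1, π₀)) ≠ 0) :
    ∃ ψ : P → C(UI, Z) × ℝ, (∀ᶠ π in 𝓝 π₀, ContDiffAt ℝ ∞ ψ π) ∧
      ∀ᶠ π in 𝓝 π₀, IsFirstReturn X O z₀ ℓ ρ π (ψ π).1 (ψ π).2 := by
  obtain ⟨ψ, hψ₀, hψ, hseg⟩ := exists_smooth_return hO hX h₀.toIsReturnSegment hℓ
  have hc : ContinuousAt ψ π₀ := hψ.self_of_nhds.continuousAt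
  refine ⟨ψ, hψ, ?_⟩
  have hpos₀ : 0 < (ψ π₀).2 := by rw [hψ₀]; exact h₀.pos
  have hmid : ∀ᶠ π in 𝓝 π₀, ∀ s ∈ Icc (0 : ℝ) 1, s ∈ Ioo (0 : ℝ) 1 →
      ℓ (ext01 (ψ π).1 s) = 0 → 0 < ρ (ext01 (ψ π).1 s) := by
    refine isCompact_Icc.eventually_forall_of_forall_eventually fun s hs => ?_
    rcases hs.1.eq_or_lt with rfl | h0
    · filter_upwards [eventually_ne_zero_near hO hX hc hseg hpos₀ (e := 0) ⟨le_rfl, zero_le_one⟩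
        (by rw [hψ₀, h₀.init]; exact hℓ₀) (hseg.mono fun π hπ => by rw [hπ.init]; exact hz₀)]
        with q hq hq1 h
      exact absurd h (hq (Ioo_subset_Icc_self hq1) hq1.1.ne')
    rcases hs.2.eq_or_lt with rfl | h1
    · filter_upwards [eventually_ne_zero_near hO hX hc hseg hpos₀ (e := 1) ⟨zero_le_one, le_rfl⟩
        (by rw [hψ₀]; exact hℓ) (hseg.mono fun π hπ => hπ.final)] with q hq hq1 h
      exact absurd h (hq (Ioo_subset_Icc_self hq1) hq1.2.ne)
    have hcs := continuousAt_ext01_family hc s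
    by_cases h : ℓ (ext01 (ψ π₀).1 s) = 0
    · have hρ : 0 < ρ (ext01 (ψ π₀).1 s) := by
        rw [hψ₀] at h ⊢
        exact h₀.between s ⟨h0, h1⟩ h
      filter_upwards [(ρ.continuous.continuousAt.comp hcs).eventually (lt_mem_nhds hρ)]
        with q hq _ _ using hq
    · filter_upwards [(ℓ.continuous.continuousAt.comp hcs).eventually_ne h] with q hq _ h'
      exact absurd h' hq
  have hT : ∀ᶠ π in 𝓝 π₀, 0 < (ψ π).2 := hc.snd.eventually (lt_mem_nhds hpos₀)
  have hρ : ∀ᶠ π in 𝓝 π₀, ρ (ext01 (ψ π).1 1) < 0 := by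
    have h1 : ContinuousAt (fun π => ρ (ext01 (ψ π).1 1)) π₀ :=
      ρ.continuous.continuousAt.comp ((continuousAt_ext01_family hc 1).comp
        (f := fun π => (π, (1 : ℝ))) (by fun_prop))
    exact h1.eventually (gt_mem_nhds (by simp only [hψ₀]; exact h₀.neg))
  filter_upwards [hseg, hmid, hT, hρ] with π h1 h2 h3 h4
  exact ⟨h1, h3, h4, fun s hs => h2 s (Ioo_subset_Icc_self hs) hs⟩

/-- The first return along a set of parameters, as one smooth function on a neighbourhood. -/
theorem exists_smooth_firstReturn_nhds (hO : IsOpen O) (hX : ContDiffOn ℝ ∞ X O) {K : Set P}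
    (hz₀ : ℓ z₀ = 0) (hK : ∀ π ∈ K, ℓ (X (z₀, π)) ≠ 0 ∧ ∃ γ T,
      IsFirstReturn X O z₀ ℓ ρ π γ T ∧ ℓ (X (ext01 γ 1, π)) ≠ 0) :
    ∃ (Ψ : P → C(UI, Z) × ℝ) (N : Set P), IsOpen N ∧ K ⊆ N ∧ ContDiffOn ℝ ∞ Ψ N ∧
      ∀ π ∈ N, IsFirstReturn X O z₀ ℓ ρ π (Ψ π).1 (Ψ π).2 := by
  classical
  let Ψ : P → C(UI, Z) × ℝ := fun π =>
    if h : ∃ ψ : C(UI, Z) × ℝ, IsFirstReturn X O z₀ ℓ ρ π ψ.1 ψ.2 then h.choose else 0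
  refine ⟨Ψ, {π | ∀ᶠ π' in 𝓝 π, ContDiffAt ℝ ∞ Ψ π' ∧ IsFirstReturn X O z₀ ℓ ρ π' (Ψ π').1 (Ψ π').2},
    isOpen_setOfPred_eventually_nhds, fun π₀ hπ₀ => ?_,
    fun π hπ => hπ.self_of_nhds.1.contDiffWithinAt, fun π hπ => hπ.self_of_nhds.2⟩
  obtain ⟨h1, γ, T, h2, h3⟩ := hK π₀ hπ₀
  obtain ⟨ψ, hψ, hret⟩ := exists_smooth_firstReturn hO hX h2 hz₀ h1 h3
  have heq : ∀ᶠ π in 𝓝 π₀, ψ π = Ψ π ∧ IsFirstReturn X O z₀ ℓ ρ π (Ψ π).1 (Ψ π).2 := by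
    filter_upwards [hret] with π hπ
    have hex : ∃ ψ : C(UI, Z) × ℝ, IsFirstReturn X O z₀ ℓ ρ π ψ.1 ψ.2 := ⟨ψ π, hπ⟩
    have h4 : IsFirstReturn X O z₀ ℓ ρ π (Ψ π).1 (Ψ π).2 := by
      simp only [Ψ, dif_pos hex]
      exact hex.choose_spec
    exact ⟨hπ.unique hO hX h4, h4⟩
  filter_upwards [eventually_eventually_nhds.2 heq, hψ] with π h4 h5
  exact ⟨h5.congr_of_eventuallyEq (h4.mono fun _ h => h.1.symm), h4.self_of_nhds.2⟩

end FirstReturn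

end

/-! ### Energy of the scaled layer problem -/

section LayerProblem

theorem hasDerivWithinAt_fst_snd {A B : Type} [NormedAddCommGroup A] [NormedSpace ℝ A]
    [NormedAddCommGroup B] [NormedSpace ℝ B] {f : ℝ → A × B} {f' : A × B} {s : Set ℝ} {t : ℝ}
    (h : HasDerivWithinAt f f' s t) : HasDerivWithinAt (fun t => (f t).1) f'.1 s t ∧
      HasDerivWithinAt (fun t => (f t).2) f'.2 s t :=
  ⟨(ContinuousLinearMap.fst ℝ A B).hasFDerivAt.comp_hasDerivWithinAt t h,
    (ContinuousLinearMap.snd ℝ A B).hasFDerivAt.comp_hasDerivWithinAt t h⟩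

/-- The scaled layer problem: `v` solves it if and only if `h v` solves the layer problem. -/
def scaledLayer (h : ℝ) (v : ℝ × ℝ) : ℝ × ℝ := (-v.2, v.1 + h * v.2 ^ 2)

/-- The potential `∫₀ˣ 2 s exp (2 h s) ds` of the scaled layer problem. -/
def potential (h x : ℝ) : ℝ := ∫ s in (0 : ℝ)..x, 2 * s * Real.exp (2 * h * s)

theorem hasDerivAt_potential (h x : ℝ) :
    HasDerivAt (potential h) (2 * x * Real.exp (2 * h * x)) x :=
  ((by fun_prop : Continuous fun s : ℝ => 2 * s * Real.exp (2 * h * s)).integral_hasStrictDerivAt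
    0 x).hasDerivAt

theorem potential_zero (h : ℝ) : potential h 0 = 0 := intervalIntegral.integral_same

theorem continuous_potential (h : ℝ) : Continuous (potential h) :=
  continuous_iff_continuousAt.2 fun x => (hasDerivAt_potential h x).continuousAt

theorem strictMonoOn_potential (h : ℝ) : StrictMonoOn (potential h) (Ici 0) := by
  refine strictMonoOn_of_deriv_pos (convex_Ici 0) (continuous_potential h).continuousOn ?_
  intro x hx
  rw [interior_Ici, mem_Ioi] at hx
  rw [(hasDerivAt_potential h x).deriv]
  positivity

theorem strictAntiOn_potential (h : ℝ) : StrictAntiOn (potential h) (Iic 0) := by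
  refine strictAntiOn_of_deriv_neg (convex_Iic 0) (continuous_potential h).continuousOn ?_
  intro x hx
  rw [interior_Iic, mem_Iio] at hx
  rw [(hasDerivAt_potential h x).deriv]
  have := Real.exp_pos (2 * h * x)
  nlinarith

theorem potential_nonneg (h x : ℝ) : 0 ≤ potential h x := by
  rw [← potential_zero h]
  rcases le_total x 0 with hx | hx
  · exact (strictAntiOn_potential h).antitoneOn hx (mem_Iic.2 le_rfl) hx
  · exact (strictMonoOn_potential h).monotoneOn (mem_Ici.2 le_rfl) hx hx

/-- This bounds the energy of the orbit through `(-1, 0)`, uniformly in `h ≥ 0`. -/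
theorem potential_neg_one_le_one {h : ℝ} (hh : 0 ≤ h) : potential h (-1) ≤ 1 := by
  have h1 : AntitoneOn (fun x => x ^ 2 - potential h x) (Iic 0) := by
    refine antitoneOn_of_deriv_nonpos (convex_Iic 0)
      ((continuous_pow 2).sub (continuous_potential h)).continuousOn
      (fun x _ => ((hasDerivAt_pow 2 x).sub
        (hasDerivAt_potential h x)).differentiableAt.differentiableWithinAt) fun x hx => ?_
    rw [interior_Iic, mem_Iio] at hx
    rw [((hasDerivAt_pow 2 x).fun_sub (hasDerivAt_potential h x)).deriv]
    have : Real.exp (2 * h * x) ≤ 1 := Real.exp_le_one_iff.2 (by nlinarith)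
    norm_num
    nlinarith
  have h2 := h1 (show (-1 : ℝ) ∈ Iic 0 by simp) (mem_Iic.2 le_rfl) (by norm_num)
  simp only [potential_zero] at h2
  linarith

/-- Hence the orbit through `(-1, 0)` stays in `v₁ ≤ 1`. -/
theorem potential_neg_one_le {h : ℝ} (hh : 0 ≤ h) : potential h (-1) ≤ potential h 1 := by
  have hd : ∀ x, HasDerivAt (fun x => potential h x - potential h (-x))
      (2 * x * Real.exp (2 * h * x) - 2 * (-x) * Real.exp (2 * h * (-x)) * -1) x := fun x =>
    (hasDerivAt_potential h x).sub
      (HasDerivAt.comp x (h₂ := potential h) (hasDerivAt_potential h (-x)) (hasDerivAt_neg x))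
  have h1 : MonotoneOn (fun x => potential h x - potential h (-x)) (Ici 0) := by
    refine monotoneOn_of_deriv_nonneg (convex_Ici 0)
      (fun x _ => (hd x).continuousAt.continuousWithinAt)
      (fun x _ => (hd x).differentiableAt.differentiableWithinAt) fun x hx => ?_
    rw [interior_Ici, mem_Ioi] at hx
    rw [(hd x).deriv]
    have : Real.exp (2 * h * (-x)) ≤ Real.exp (2 * h * x) := Real.exp_le_exp.2 (by nlinarith)
    nlinarith
  have h2 := h1 (mem_Ici.2 le_rfl) (show (1 : ℝ) ∈ Ici 0 by simp) zero_le_one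
  simp only [neg_zero, sub_self] at h2
  linarith

/-- The first integral of the scaled layer problem. -/
def layerEnergy (h : ℝ) (v : ℝ × ℝ) : ℝ :=
  v.2 ^ 2 * Real.exp (2 * h * v.1) + potential h v.1

/-- A priori bounds: the energy level of `(-1, 0)` is compact. -/
theorem layer_bounds {h : ℝ} (hh : 0 ≤ h) {v : ℝ × ℝ}
    (hv : layerEnergy h v = potential h (-1)) : |v.1| ≤ 1 ∧ |v.2| ≤ Real.exp h := by
  have he := Real.exp_pos (2 * h * v.1)
  rw [layerEnergy] at hv
  have h1 : potential h v.1 ≤ potential h (-1) := by nlinarith [sq_nonneg v.2]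
  have hlo : -1 ≤ v.1 := by
    by_contra! hlt
    exact absurd (strictAntiOn_potential h (show v.1 ∈ Iic 0 by simp; linarith)
      (show (-1 : ℝ) ∈ Iic 0 by simp) hlt) (not_lt.2 h1)
  have hhi : v.1 ≤ 1 := by
    by_contra! hlt
    exact absurd (strictMonoOn_potential h (show (1 : ℝ) ∈ Ici 0 by simp)
      (show v.1 ∈ Ici 0 by simp; linarith) hlt) (not_lt.2 (h1.trans (potential_neg_one_le hh)))
  refine ⟨abs_le.2 ⟨hlo, hhi⟩, ?_⟩
  have h2 : v.2 ^ 2 * Real.exp (2 * h * v.1) ≤ 1 := by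
    linarith [potential_nonneg h v.1, potential_neg_one_le_one hh]
  have h3 : Real.exp (-(2 * h)) ≤ Real.exp (2 * h * v.1) := Real.exp_le_exp.2 (by nlinarith)
  have h4 : v.2 ^ 2 ≤ Real.exp h ^ 2 := by
    have h5 : v.2 ^ 2 * Real.exp (-(2 * h)) ≤ 1 := by nlinarith [sq_nonneg v.2]
    have h6 : Real.exp (-(2 * h)) * Real.exp h ^ 2 = 1 := by
      rw [← Real.exp_nat_mul, ← Real.exp_add]
      simp
    nlinarith [Real.exp_pos h, sq_nonneg (Real.exp h)]
  exact abs_le_of_sq_le_sq h4 (Real.exp_pos h).le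

theorem hasDerivWithinAt_layerEnergy {h c : ℝ} {z : ℝ → ℝ × ℝ} {s : Set ℝ} {t : ℝ}
    (hz : HasDerivWithinAt z (c • scaledLayer h (z t)) s t) :
    HasDerivWithinAt (fun t => layerEnergy h (z t)) 0 s t := by
  obtain ⟨h1, h2⟩ := hasDerivWithinAt_fst_snd hz
  have h3 := ((h2.pow 2).mul ((h1.const_mul (2 * h)).exp)).add
    ((hasDerivAt_potential h (z t).1).comp_hasDerivWithinAt t h1)
  refine h3.congr_deriv ?_
  simp only [scaledLayer, Prod.smul_fst, Prod.smul_snd, smul_eq_mul, Pi.pow_apply]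
  push_cast
  ring

/-- Solutions of the scaled layer problem through `(-1, 0)` exist on arbitrarily long intervals.
Multiplying the field by a cutoff function does not change the first integral, hence the solution
of the cut off problem stays where the cutoff function is `1`. -/
theorem exists_layer_solution {h : ℝ} (hh : 0 ≤ h) {N : ℝ} (hN : 0 < N) :
    ∃ z : ℝ → ℝ × ℝ, z 0 = (-1, 0) ∧
      ∀ t ∈ Icc 0 N, HasDerivWithinAt z (scaledLayer h (z t)) (Icc 0 N) t ∧
        layerEnergy h (z t) = potential h (-1) := by
  let χ : ContDiffBump (0 : ℝ × ℝ) := ⟨Real.exp h + 1, Real.exp h + 2, by positivity, by linarith⟩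
  let X : ℝ × ℝ → ℝ × ℝ := fun v => χ v • scaledLayer h v
  have hX : ContDiff ℝ 1 X := by
    refine χ.contDiff.smul ?_
    unfold scaledLayer
    fun_prop
  have hXc : HasCompactSupport X := χ.hasCompactSupport.smul_right
  obtain ⟨L, hL⟩ := ContDiff.lipschitzWith_of_hasCompactSupport hXc hX one_ne_zero
  obtain ⟨C, hC⟩ := hXc.exists_bound_of_continuous hX.continuous
  have hC0 : 0 ≤ C := (norm_nonneg _).trans (hC 0)
  obtain ⟨z, hz0, hz⟩ := IsPicardLindelof.exists_eq_forall_mem_Icc_hasDerivWithinAt₀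
    (f := fun _ => X) (tmin := 0) (tmax := N) (t₀ := ⟨0, le_rfl, hN.le⟩) (x₀ := (-1, 0))
    (a := C.toNNReal * N.toNNReal) (L := C.toNNReal) (K := L)
    { lipschitzOnWith := fun _ _ => hL.lipschitzOnWith
      continuousOn := fun _ _ => continuousOn_const
      norm_le := fun _ _ x _ => (hC x).trans (Real.le_coe_toNNReal C)
      mul_max_le := by simp [hN.le] }
  have hE : ∀ t ∈ Icc 0 N, layerEnergy h (z t) = potential h (-1) := by
    intro t ht
    have hd := fun t ht => hasDerivWithinAt_layerEnergy (hz t ht)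
    rw [constant_of_derivWithin_zero (a := 0) (b := N) (f := fun t => layerEnergy h (z t))
      (fun t ht => (hd t ht).differentiableWithinAt)
      (fun t ht => (hd t (Ico_subset_Icc_self ht)).derivWithin
        (uniqueDiffOn_Icc hN t (Ico_subset_Icc_self ht))) t ht, hz0]
    simp [layerEnergy]
  refine ⟨z, hz0, fun t ht => ⟨?_, hE t ht⟩⟩
  have h1 := hz t ht
  have h2 : χ (z t) = 1 := by
    refine χ.one_of_mem_closedBall ?_
    obtain ⟨h3, h4⟩ := layer_bounds hh (hE t ht)
    rw [mem_closedBall_zero_iff, Prod.norm_def]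
    have := Real.exp_pos h
    exact max_le (h3.trans (by linarith)) (h4.trans (by linarith))
  simp only [X, h2, one_smul] at h1
  exact h1

end LayerProblem

/-! ### Periodic orbits of the scaled layer problem -/

section LayerOrbits

/-- The angular velocity of `(v₁, v₂ exp (h v₁))` is bounded below by `exp (-h)`; hence `v₂` has a
zero within a time that depends only on `h`. -/
theorem exists_zero_of_layer {h N : ℝ} (hh : 0 ≤ h) (hN : N = 1 + 4 * Real.exp h) {z : ℝ → ℝ × ℝ}
    (hz : ∀ t ∈ Icc 0 N, HasDerivWithinAt z (scaledLayer h (z t)) (Icc 0 N) t ∧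
      layerEnergy h (z t) = potential h (-1)) : ∃ t ∈ Ioc 0 N, (z t).2 = 0 := by
  by_contra! hne
  have he := Real.exp_pos h
  have hsub : ∀ t ∈ Icc 1 N, t ∈ Icc 0 N := fun t ht => ⟨by linarith [ht.1], ht.2⟩
  let p : ℝ → ℝ := fun t => (z t).1 / ((z t).2 * Real.exp (h * (z t).1))
  have hp : ∀ t ∈ Icc 1 N, ∃ d ≤ -Real.exp (-h), HasDerivWithinAt (fun t => Real.arctan (p t)) d
      (Icc 0 N) t := by
    intro t ht
    have hz2 := hne t ⟨by linarith [ht.1], ht.2⟩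
    obtain ⟨h1, h2⟩ := hasDerivWithinAt_fst_snd (hz t (hsub t ht)).1
    obtain ⟨b1, -⟩ := layer_bounds hh (hz t (hsub t ht)).2
    rw [abs_le] at b1
    set a := Real.exp (h * (z t).1) with ha
    have ha0 : 0 < a := Real.exp_pos _
    have h3 := (h1.fun_div (h2.fun_mul ((h1.const_mul h).exp)) (by positivity)).arctan
    refine ⟨_, ?_, h3⟩
    simp only [scaledLayer, ← ha]
    set x := (z t).1
    set y := (z t).2
    have hxy : 0 < x ^ 2 + (y * a) ^ 2 := by positivity
    have e1 : 1 / (1 + (x / (y * a)) ^ 2) *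
        ((-y * (y * a) - x * ((x + h * y ^ 2) * a + y * (a * (h * -y)))) / (y * a) ^ 2) =
        -(a * (x ^ 2 + y ^ 2) / (x ^ 2 + (y * a) ^ 2)) := by
      field_simp
      ring
    rw [e1, neg_le_neg_iff, le_div_iff₀ hxy]
    have i1 : Real.exp (-h) ≤ a := Real.exp_le_exp.2 (by nlinarith)
    have i2 : Real.exp (-h) * a ≤ 1 := by
      rw [ha, ← Real.exp_add, Real.exp_le_one_iff]
      nlinarith
    nlinarith [sq_nonneg x, mul_nonneg ha0.le (sq_nonneg y), mul_le_mul_of_nonneg_right i2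
      (mul_nonneg ha0.le (sq_nonneg y)), mul_le_mul_of_nonneg_right i1 (sq_nonneg x)]
  have h1 : Real.arctan (p N) - Real.arctan (p 1) ≤ -Real.exp (-h) * (N - 1) := by
    have hd : ∀ t ∈ Ioo 1 N, ∃ d ≤ -Real.exp (-h), HasDerivAt (fun t => Real.arctan (p t)) d t := by
      intro t ht
      obtain ⟨d, hd, h2⟩ := hp t (Ioo_subset_Icc_self ht)
      exact ⟨d, hd, h2.hasDerivAt (Icc_mem_nhds (by linarith [ht.1]) ht.2)⟩
    refine Convex.image_sub_le_mul_sub_of_deriv_le (convex_Icc 1 N)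
      (f := fun t => Real.arctan (p t)) (fun t ht => ?_) (fun t ht => ?_) (fun t ht => ?_)
      1 ⟨le_rfl, by linarith⟩ N ⟨by linarith, le_rfl⟩ (by linarith)
    · obtain ⟨d, -, h2⟩ := hp t ht
      exact h2.continuousWithinAt.mono hsub
    · rw [interior_Icc] at ht
      obtain ⟨d, -, h2⟩ := hd t ht
      exact h2.differentiableAt.differentiableWithinAt
    · rw [interior_Icc] at ht
      obtain ⟨d, h3, h2⟩ := hd t ht
      rwa [h2.deriv]
  have h2 : Real.exp (-h) * (N - 1) = 4 := by
    rw [hN, Real.exp_neg]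
    field_simp
    ring
  have := Real.arctan_lt_pi_div_two (p 1)
  have := Real.neg_pi_div_two_lt_arctan (p N)
  linarith [Real.pi_lt_four]

/-- Half of the orbit through `(-1, 0)`: it descends into `v₂ < 0` and returns to `v₂ = 0` with
`v₁ > 0`. -/
theorem exists_half_orbit {h : ℝ} (hh : 0 ≤ h) : ∃ (τ : ℝ) (z : ℝ → ℝ × ℝ), 0 < τ ∧
    z 0 = (-1, 0) ∧ (∀ t ∈ Icc 0 τ, HasDerivWithinAt z (scaledLayer h (z t)) (Icc 0 τ) t ∧
      layerEnergy h (z t) = potential h (-1)) ∧ (∀ t ∈ Ioo 0 τ, (z t).2 < 0) ∧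
    (z τ).2 = 0 ∧ 0 < (z τ).1 := by
  set N := 1 + 4 * Real.exp h with hN
  have hN0 : 0 < N := by positivity
  obtain ⟨z, hz0, hz⟩ := exists_layer_solution hh hN0
  have hzc : ContinuousOn z (Icc 0 N) := fun t ht => (hz t ht).1.continuousWithinAt
  have hz2c : ContinuousOn (fun t => (z t).2) (Icc 0 N) := continuous_snd.comp_continuousOn hzc
  have hdz : ∀ t ∈ Ioo 0 N, HasDerivAt (fun t => (z t).1) (-(z t).2) t ∧
      HasDerivAt (fun t => (z t).2) ((z t).1 + h * (z t).2 ^ 2) t := by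
    intro t ht
    obtain ⟨h1, h2⟩ := hasDerivWithinAt_fst_snd (hz t (Ioo_subset_Icc_self ht)).1
    exact ⟨h1.hasDerivAt (Icc_mem_nhds ht.1 ht.2), h2.hasDerivAt (Icc_mem_nhds ht.1 ht.2)⟩
  -- Initially the second component decreases, since its derivative is `-1` at the start.
  obtain ⟨δ, hδ, hδN, hneg⟩ : ∃ δ, 0 < δ ∧ δ ≤ N ∧ ∀ t ∈ Ioc 0 δ, (z t).2 < 0 := by
    have h1 : ContinuousWithinAt (fun t => (z t).1 + h * (z t).2 ^ 2) (Icc 0 N) 0 := by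
      have h2 := hzc 0 ⟨le_rfl, hN0.le⟩
      exact h2.fst.add ((h2.snd.pow 2).const_mul h)
    have h2 : ∀ᶠ t in 𝓝[Icc 0 N] 0, (z t).1 + h * (z t).2 ^ 2 < 0 :=
      h1.eventually (gt_mem_nhds (by simp [hz0]))
    obtain ⟨δ, hδ, hδs⟩ := Metric.mem_nhdsWithin_iff.1 h2
    set d := min (δ / 2) N with hd
    have hd0 : 0 < d := lt_min (by positivity) hN0
    have hanti : StrictAntiOn (fun t => (z t).2) (Icc 0 d) := by
      refine strictAntiOn_of_deriv_neg (convex_Icc 0 d)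
        (hz2c.mono (Icc_subset_Icc_right (min_le_right _ _))) fun t ht => ?_
      rw [interior_Icc] at ht
      have htN : t ∈ Ioo 0 N := ⟨ht.1, ht.2.trans_le (min_le_right _ _)⟩
      rw [(hdz t htN).2.deriv]
      refine hδs ⟨?_, Ioo_subset_Icc_self htN⟩
      rw [mem_ball_zero_iff, Real.norm_eq_abs, abs_of_pos ht.1]
      linarith [ht.2.trans_le (min_le_left (δ / 2) N)]
    refine ⟨d, hd0, min_le_right _ _, fun t ht => ?_⟩
    have := hanti ⟨le_rfl, hd0.le⟩ (Ioc_subset_Icc_self ht) ht.1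
    simpa [hz0] using this
  obtain ⟨t₁, ht₁, ht₁0⟩ := exists_zero_of_layer hh hN hz
  have ht₁δ : δ < t₁ := by
    by_contra! hle
    exact (hneg t₁ ⟨ht₁.1, hle⟩).ne ht₁0
  -- The first zero of the second component after time `δ`.
  set S := Icc δ N ∩ (fun t => (z t).2) ⁻¹' {0} with hS
  have hδsub : Icc δ N ⊆ Icc 0 N := Icc_subset_Icc_left hδ.le
  have hSc : IsCompact S := isCompact_Icc.of_isClosed_subset
    ((hz2c.mono hδsub).preimage_isClosed_of_isClosed isClosed_Icc isClosed_singleton)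
    inter_subset_left
  obtain ⟨τ, hτS, hτ⟩ := hSc.exists_isLeast ⟨t₁, ⟨ht₁δ.le, ht₁.2⟩, ht₁0⟩
  have hτ2 : (z τ).2 = 0 := hτS.2
  have hτδ : δ < τ := lt_of_le_of_ne hτS.1.1 fun heq =>
    (hneg δ ⟨hδ, le_rfl⟩).ne (by rw [heq]; exact hτ2)
  have hτ0 : 0 < τ := hδ.trans hτδ
  have hsub : Icc 0 τ ⊆ Icc 0 N := Icc_subset_Icc_right hτS.1.2
  have hnegτ : ∀ t ∈ Ioo 0 τ, (z t).2 < 0 := by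
    intro t ht
    rcases le_total t δ with h1 | h1
    · exact hneg t ⟨ht.1, h1⟩
    by_contra! hpos
    have h2 : Icc δ t ⊆ Icc 0 N := (Icc_subset_Icc hδ.le ht.2.le).trans hsub
    obtain ⟨s, hs, hs0⟩ := intermediate_value_Icc h1 (hz2c.mono h2)
      ⟨(hneg δ ⟨hδ, le_rfl⟩).le, hpos⟩
    have := hτ ⟨⟨hs.1, (h2 hs).2⟩, hs0⟩
    linarith [hs.2, ht.2]
  have hmono : StrictMonoOn (fun t => (z t).1) (Icc 0 τ) := by
    refine strictMonoOn_of_deriv_pos (convex_Icc 0 τ)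
      (continuous_fst.comp_continuousOn (hzc.mono hsub)) fun t ht => ?_
    rw [interior_Icc] at ht
    rw [(hdz t ⟨ht.1, ht.2.trans_le hτS.1.2⟩).1.deriv]
    exact neg_pos.2 (hnegτ t ht)
  have hτ1 : -1 < (z τ).1 := by
    have := hmono ⟨le_rfl, hτ0.le⟩ ⟨hτ0.le, le_rfl⟩ hτ0
    simpa [hz0] using this
  refine ⟨τ, z, hτ0, hz0, fun t ht => ⟨(hz t (hsub ht)).1.mono hsub, (hz t (hsub ht)).2⟩,
    hnegτ, hτ2, ?_⟩
  by_contra! hle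
  have h1 := (hz τ (hδsub hτS.1)).2
  simp only [layerEnergy, hτ2, ne_eq, OfNat.ofNat_ne_zero, not_false_eq_true, zero_pow, zero_mul,
    zero_add] at h1
  exact (strictAntiOn_potential h (show (-1 : ℝ) ∈ Iic 0 by simp) hle hτ1).ne h1

/-- The periodic solution of the scaled layer problem through `(-1, 0)`. It arises from the half
orbit by the symmetry `(t, v₁, v₂) ↦ (-t, v₁, -v₂)`. -/
theorem exists_layer_orbit {h : ℝ} (hh : 0 ≤ h) : ∃ (T : ℝ) (v : ℝ → ℝ × ℝ), 0 < T ∧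
    (∀ t, HasDerivAt v (scaledLayer h (v t)) t) ∧ v 0 = (-1, 0) ∧ v T = (-1, 0) ∧
    (∀ t, |(v t).1| ≤ 1 ∧ |(v t).2| ≤ Real.exp h) ∧
    (∀ t ∈ Ioo 0 T, (v t).2 = 0 → 0 < (v t).1) ∧ ∃ t ∈ Icc 0 T, (v t).2 ≠ 0 := by
  obtain ⟨τ, z, hτ, hz0, hz, hneg, hτ2, hτ1⟩ := exists_half_orbit hh
  let w : ℝ → ℝ × ℝ := fun t => ((z (2 * τ - t)).1, -(z (2 * τ - t)).2)
  let f : ℝ → ℝ × ℝ := fun t => if t ≤ τ then z t else w t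
  have hfz : ∀ t ∈ Icc 0 τ, f t = z t := fun t ht => if_pos ht.2
  have hfw : ∀ t ∈ Icc τ (0 + 2 * τ), f t = w t := by
    intro t ht
    rcases ht.1.eq_or_lt with rfl | h1
    · have : 2 * τ - τ = τ := by ring
      simp only [f, w, le_refl, if_true, this]
      exact Prod.ext rfl (by simp [hτ2])
    · exact if_neg (not_le.2 h1)
  have hrefl : ∀ t ∈ Icc τ (0 + 2 * τ), 2 * τ - t ∈ Icc 0 τ := fun t ht =>
    ⟨by linarith [ht.2], by linarith [ht.1]⟩
  have hw : ∀ t ∈ Icc τ (0 + 2 * τ),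
      HasDerivWithinAt w (scaledLayer h (w t)) (Icc τ (0 + 2 * τ)) t := by
    intro t ht
    have h1 := (hz _ (hrefl t ht)).1.scomp t
      (((hasDerivAt_id t).const_sub (2 * τ)).hasDerivWithinAt (s := Icc τ (0 + 2 * τ))) hrefl
    obtain ⟨h2, h3⟩ := hasDerivWithinAt_fst_snd h1
    refine (h2.prodMk h3.neg).congr_deriv ?_
    simp [w, scaledLayer]
  have hl : ∀ t ∈ Icc 0 τ, HasDerivWithinAt f (scaledLayer h (f t)) (Icc 0 τ) t := fun t ht => by
    rw [hfz t ht]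
    exact (hz t ht).1.congr_of_mem hfz ht
  have hr : ∀ t ∈ Icc τ (0 + 2 * τ),
      HasDerivWithinAt f (scaledLayer h (f t)) (Icc τ (0 + 2 * τ)) t := fun t ht => by
    rw [hfw t ht]
    exact (hw t ht).congr_of_mem hfw ht
  have hf : ∀ t ∈ Icc 0 (0 + 2 * τ),
      HasDerivWithinAt f (scaledLayer h (f t)) (Icc 0 (0 + 2 * τ)) t := by
    intro t ht
    rcases lt_trichotomy t τ with h1 | rfl | h1
    · exact (hl t ⟨ht.1, h1.le⟩).mono_of_mem_nhdsWithin
        (mem_nhdsWithin.2 ⟨Iio τ, isOpen_Iio, h1, fun s hs => ⟨hs.2.1, (le_of_lt hs.1)⟩⟩)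
    · have := (hl t ⟨ht.1, le_rfl⟩).union (hr t ⟨le_rfl, ht.2⟩)
      rwa [Icc_union_Icc_eq_Icc ht.1 ht.2] at this
    · exact (hr t ⟨h1.le, ht.2⟩).mono_of_mem_nhdsWithin
        (mem_nhdsWithin.2 ⟨Ioi τ, isOpen_Ioi, h1, fun s hs => ⟨(le_of_lt hs.1), hs.2.2⟩⟩)
  have hf0 : f 0 = (-1, 0) := (hfz 0 ⟨le_rfl, hτ.le⟩).trans hz0
  have hfT : f (0 + 2 * τ) = (-1, 0) := by
    rw [hfw _ ⟨by linarith, le_rfl⟩]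
    simp [w, hz0]
  obtain ⟨v, hv, -, hvf, hvs⟩ := exists_periodic_extension (a := 0) (T := 2 * τ) (by positivity) hf
    (hfT.trans hf0.symm)
  have hin : ∀ t ∈ Icc 0 (0 + 2 * τ), |(f t).1| ≤ 1 ∧ |(f t).2| ≤ Real.exp h := by
    intro t ht
    rcases le_total t τ with h1 | h1
    · rw [hfz t ⟨ht.1, h1⟩]
      exact layer_bounds hh (hz t ⟨ht.1, h1⟩).2
    · rw [hfw t ⟨h1, ht.2⟩]
      simpa [w] using layer_bounds hh (hz _ (hrefl t ⟨h1, ht.2⟩)).2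
  refine ⟨2 * τ, v, by positivity, hv, (hvf ⟨le_rfl, by linarith⟩).trans hf0, ?_, fun t => ?_,
    fun t ht => ?_, τ / 2, ⟨by linarith, by linarith⟩, ?_⟩
  · have := hvf ⟨by linarith, le_rfl⟩
    rw [hfT, zero_add] at this
    exact this
  · obtain ⟨s, hs, h1⟩ := hvs t
    rw [h1]
    exact hin s hs
  · rw [hvf ⟨ht.1.le, by linarith [ht.2]⟩]
    rcases lt_trichotomy t τ with h1 | rfl | h1
    · rw [hfz t ⟨ht.1.le, h1.le⟩]
      exact fun h0 => absurd h0 (hneg t ⟨ht.1, h1⟩).ne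
    · rw [hfz t ⟨ht.1.le, le_rfl⟩]
      exact fun _ => hτ1
    · rw [hfw t ⟨h1.le, by linarith [ht.2]⟩]
      intro h0
      exact absurd (neg_eq_zero.1 h0) (hneg _ ⟨by linarith [ht.2], by linarith⟩).ne
  · rw [hvf ⟨by linarith, by linarith⟩, hfz _ ⟨by linarith, by linarith⟩]
    exact (hneg _ ⟨by linarith, by linarith⟩).ne

end LayerOrbits

section

set_option maxSynthPendingDepth 5

/-! ### Return orbits of the scaled system -/

section ReturnFamily

/-- The states `(v, q, S)`. -/
abbrev State : Type := (ℝ × ℝ) × ℝ × ℝ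

/-- The parameters `(h, y, r, μ₂)`. -/
abbrev Param : Type := ℝ × ℝ × ℝ × ℝ

/-- The point `(h, (v, Y, r, μ₂))`, where `Y = y + r q`. -/
def toScaled (u : State × Param) : ℝ × ((ℝ × ℝ) × ℝ × ℝ × ℝ) :=
  (u.2.1, (u.1.1, u.2.2.1 + u.2.2.2.1 * u.1.2.1, u.2.2.2.1, u.2.2.2.2))

theorem contDiff_toScaled : ContDiff ℝ ∞ toScaled := by
  unfold toScaled
  fun_prop

/-- The system `v' = W`, `q' = Q` in the coordinates `u = h v`, `y₂ = y + r q`, together with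
`S' = v₂² exp (2 h v₁)`, which measures the change of the layer energy for `r = 0`. -/
def stateField (W : ℝ × ((ℝ × ℝ) × ℝ × ℝ × ℝ) → ℝ × ℝ) (Q : ℝ × ((ℝ × ℝ) × ℝ × ℝ × ℝ) → ℝ)
    (u : State × Param) : State :=
  (W (toScaled u), Q (toScaled u), u.1.1.2 ^ 2 * Real.exp (2 * u.2.1 * u.1.1.1))

/-- All orbits start at `u = (-h, 0)`, `y₂ = y`. -/
def startState : State := ((-1, 0), 0, 0)

/-- The coordinate `v₁`. -/
def fstCoord : State →L[ℝ] ℝ := .fst ℝ ℝ ℝ ∘L .fst ℝ (ℝ × ℝ) (ℝ × ℝ)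

/-- The coordinate `v₂`. -/
def sndCoord : State →L[ℝ] ℝ := .snd ℝ ℝ ℝ ∘L .fst ℝ (ℝ × ℝ) (ℝ × ℝ)

@[simp] theorem fstCoord_apply (z : State) : fstCoord z = z.1.1 := rfl

@[simp] theorem sndCoord_apply (z : State) : sndCoord z = z.1.2 := rfl

/-- The first return of the state system to `v₂ = 0, v₁ < 0`. -/
abbrev IsStateReturn (W : ℝ × ((ℝ × ℝ) × ℝ × ℝ × ℝ) → ℝ × ℝ)
    (Q : ℝ × ((ℝ × ℝ) × ℝ × ℝ × ℝ) → ℝ) (D : Set (ℝ × ((ℝ × ℝ) × ℝ × ℝ × ℝ))) (π : Param)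
    (γ : C(UI, State)) (T : ℝ) : Prop :=
  IsFirstReturn (stateField W Q) (toScaled ⁻¹' D) startState sndCoord fstCoord π γ T

variable {W : ℝ × ((ℝ × ℝ) × ℝ × ℝ × ℝ) → ℝ × ℝ} {Q : ℝ × ((ℝ × ℝ) × ℝ × ℝ × ℝ) → ℝ}
  {D : Set (ℝ × ((ℝ × ℝ) × ℝ × ℝ × ℝ))}

theorem contDiffOn_stateField (hW : ContDiffOn ℝ ∞ W D) (hQ : ContDiffOn ℝ ∞ Q D) :
    ContDiffOn ℝ ∞ (stateField W Q) (toScaled ⁻¹' D) :=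
  (hW.comp contDiff_toScaled.contDiffOn fun _ h => h).prodMk
    ((hQ.comp contDiff_toScaled.contDiffOn fun _ h => h).prodMk
      (ContDiff.contDiffOn (by fun_prop)))

/-- The return along the layer orbits, where `r = 0` and `y = 0`. -/
theorem exists_base_return {h₁ K ε ϱ a : ℝ} (hε : 0 < ε) (hϱ : 0 < ϱ)
    (hK : 1 + Real.exp h₁ < K) (hD : D = scaledDom (h₁ + 1) K ε ϱ)
    (hW0 : ∀ (h Y μ₂ : ℝ) (v : ℝ × ℝ), (h, (v, Y, 0, μ₂)) ∈ D →
      W (h, (v, Y, 0, μ₂)) = (-v.2, v.1 + 2 * Y * v.2 + h * v.2 ^ 2))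
    (hQ0 : ∀ (h μ₂ : ℝ) (v : ℝ × ℝ), (h, (v, 0, 0, μ₂)) ∈ D →
      Q (h, (v, 0, 0, μ₂)) = μ₂ / 2 + a * (h * v.2))
    {h μ₂ : ℝ} (hh : h ∈ Icc 0 h₁) (hμ : |μ₂| < ε) :
    sndCoord (stateField W Q (startState, (h, 0, 0, μ₂))) ≠ 0 ∧
    ∃ γ T, IsStateReturn W Q D (h, 0, 0, μ₂) γ T ∧
      sndCoord (stateField W Q (ext01 γ 1, (h, 0, 0, μ₂))) ≠ 0 ∧ (γ 1).1 = (-1, 0) ∧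
      (γ 1).2.1 = μ₂ * T / 2 ∧ 0 < (γ 1).2.2 := by
  obtain ⟨T, v, hT, hv, hv0, hvT, hvb, hbet, hex⟩ := exists_layer_orbit hh.1
  have hmem : ∀ (x : ℝ × ℝ) (q S : ℝ), |x.1| ≤ 1 ∧ |x.2| ≤ Real.exp h →
      (((x, q, S) : State), ((h, 0, 0, μ₂) : Param)) ∈ toScaled ⁻¹' D := by
    intro x q S hx
    rw [hD, mem_preimage, toScaled]
    refine mem_scaledDom.2 ⟨?_, ?_, by simpa using hε, by simpa using hϱ, hμ⟩
    · rw [abs_of_nonneg hh.1]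
      linarith [hh.2]
    · have h1 := Real.exp_pos h₁
      have h2 := Real.exp_le_exp.2 hh.2
      rw [Prod.norm_def, max_lt_iff]
      exact ⟨hx.1.trans_lt (by linarith), hx.2.trans_lt (by linarith)⟩
  have hfield : ∀ (x : ℝ × ℝ) (q S : ℝ), |x.1| ≤ 1 ∧ |x.2| ≤ Real.exp h →
      stateField W Q ((x, q, S), (h, 0, 0, μ₂)) =
        (scaledLayer h x, μ₂ / 2 + a * (h * x.2), x.2 ^ 2 * Real.exp (2 * h * x.1)) := by
    intro x q S hx
    have h1 := hmem x q S hx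
    rw [mem_preimage] at h1
    simp only [toScaled, zero_mul, add_zero] at h1
    simp only [stateField, toScaled, zero_mul, add_zero, hW0 _ _ _ _ h1, hQ0 _ _ _ h1,
      scaledLayer, mul_zero]
  have hcv : Continuous v := continuous_iff_continuousAt.2 fun t => (hv t).continuousAt
  have hcS : Continuous fun t => (v t).2 ^ 2 * Real.exp (2 * h * (v t).1) := by fun_prop
  let S : ℝ → ℝ := fun t => ∫ s in (0 : ℝ)..t, (v s).2 ^ 2 * Real.exp (2 * h * (v s).1)
  let z : ℝ → State := fun t => (v t, μ₂ / 2 * t - a * h * ((v t).1 + 1), S t)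
  have hz : ∀ t, HasDerivAt z (stateField W Q (z t, (h, 0, 0, μ₂))) t := by
    intro t
    rw [hfield _ _ _ (hvb t)]
    have h1 : HasDerivAt (fun t => (v t).1) (-(v t).2) t :=
      (ContinuousLinearMap.fst ℝ ℝ ℝ).hasFDerivAt.comp_hasDerivAt t (hv t)
    refine (hv t).prodMk (HasDerivAt.prodMk ?_ (hcS.integral_hasStrictDerivAt 0 t).hasDerivAt)
    exact (((hasDerivAt_id t).const_mul (μ₂ / 2)).sub
      ((h1.add_const 1).const_mul (a * h))).congr_deriv (by ring)
  have hzc : Continuous z := continuous_iff_continuousAt.2 fun t => (hz t).continuousAt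
  let γ : C(UI, State) := ⟨fun k => z (T * k), by fun_prop⟩
  have hγ : ∀ s ∈ Icc (0 : ℝ) 1, ext01 γ s = z (T * s) := fun s hs => by
    rw [ext01_of_mem _ hs]
    rfl
  have hend : ext01 γ 1 = z T := by rw [hγ 1 ⟨zero_le_one, le_rfl⟩, mul_one]
  have hγ1 : γ 1 = z T := by rw [← hend]; exact (ext01_coe γ 1).symm
  have hz0 : z 0 = startState := by simp [z, S, hv0, startState]
  have htr : ∀ x : State, x.1 = (-1, 0) →
      sndCoord (stateField W Q (x, (h, 0, 0, μ₂))) ≠ 0 := by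
    rintro ⟨x, q, S⟩ rfl
    rw [hfield _ _ _ (by simp [Real.exp_nonneg])]
    simp [scaledLayer]
  refine ⟨htr _ rfl, γ, T, ⟨⟨fun k => hmem _ _ _ (hvb _), ?_, fun s hs => ?_, ?_⟩, hT, ?_, ?_⟩,
    ?_, ?_, ?_, ?_⟩
  · rw [hγ 0 ⟨le_rfl, zero_le_one⟩, mul_zero, hz0]
  · have h1 := (hz (T * s)).scomp s ((hasDerivAt_id s).const_mul T)
    rw [hγ s hs]
    refine (h1.hasDerivWithinAt.congr_of_mem (fun t ht => hγ t ht) hs).congr_deriv ?_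
    rw [mul_one]
  · rw [hend, sndCoord_apply]
    simp [z, hvT]
  · rw [hend, fstCoord_apply]
    simp [z, hvT]
  · intro s hs
    rw [hγ s (Ioo_subset_Icc_self hs)]
    exact hbet (T * s) ⟨mul_pos hT hs.1, mul_lt_of_lt_one_right hT hs.2⟩
  · rw [hend]
    exact htr _ hvT
  · rw [hγ1]
    exact hvT
  · rw [hγ1]
    simp only [z, hvT]
    ring
  · rw [hγ1]
    obtain ⟨t, ht, hne⟩ := hex
    exact intervalIntegral.integral_pos hT hcS.continuousOn (fun _ _ => by positivity)
      ⟨t, ht, by positivity⟩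

/-- For `r = 0` the quantity `layerEnergy h v - 4 y S` is conserved. -/
theorem IsStateReturn.potential_eq {h y μ₂ : ℝ}
    (hW0 : ∀ (h Y μ₂ : ℝ) (v : ℝ × ℝ), (h, (v, Y, 0, μ₂)) ∈ D →
      W (h, (v, Y, 0, μ₂)) = (-v.2, v.1 + 2 * Y * v.2 + h * v.2 ^ 2))
    {γ : C(UI, State)} {T : ℝ} (hγ : IsStateReturn W Q D (h, y, 0, μ₂) γ T) :
    potential h (γ 1).1.1 - potential h (-1) = 4 * y * (γ 1).2.2 := by
  have hd : ∀ s ∈ Icc (0 : ℝ) 1, HasDerivWithinAt (fun s =>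
      layerEnergy h (ext01 γ s).1 - 4 * y * (ext01 γ s).2.2) 0 (Icc 0 1) s := by
    intro s hs
    have h0 := hγ.mem' s
    rw [mem_preimage] at h0
    simp only [toScaled, zero_mul, add_zero] at h0
    have hode := hγ.ode s hs
    simp only [stateField, toScaled, zero_mul, add_zero, hW0 _ _ _ _ h0] at hode
    obtain ⟨h1, h2⟩ := hasDerivWithinAt_fst_snd hode
    obtain ⟨h3, h4⟩ := hasDerivWithinAt_fst_snd h1
    have h5 := (hasDerivWithinAt_fst_snd h2).2
    have h6 := (((h4.pow 2).mul ((h3.const_mul (2 * h)).exp)).add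
      ((hasDerivAt_potential h (ext01 γ s).1.1).comp_hasDerivWithinAt s h3)).sub
        (h5.const_mul (4 * y))
    refine h6.congr_deriv ?_
    simp only [Prod.smul_fst, Prod.smul_snd, smul_eq_mul, Pi.pow_apply]
    push_cast
    ring
  have hc := constant_of_derivWithin_zero (a := (0 : ℝ)) (b := 1)
    (fun s hs => (hd s hs).differentiableWithinAt)
    (fun s hs => (hd s (Ico_subset_Icc_self hs)).derivWithin
      (uniqueDiffOn_Icc zero_lt_one s (Ico_subset_Icc_self hs))) 1 ⟨zero_le_one, le_rfl⟩
  have h1 : ext01 γ 1 = γ 1 := ext01_coe γ 1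
  have h2 : (γ 1).1.2 = 0 := by
    rw [← h1]
    exact hγ.final
  rw [hγ.init, h1] at hc
  simp only [layerEnergy, h2, startState] at hc
  norm_num at hc
  linarith

end ReturnFamily

end

/-! ### The curve of zeros of the displacement -/

section ZeroCurve

/-- `((h, r), (y, μ₂)) ↦ (h, y, r, μ₂)`. -/
def regroup : (ℝ × ℝ) × (ℝ × ℝ) →L[ℝ] Param :=
  (.fst ℝ ℝ ℝ ∘L .fst ℝ (ℝ × ℝ) (ℝ × ℝ)).prod ((.fst ℝ ℝ ℝ ∘L .snd ℝ (ℝ × ℝ) (ℝ × ℝ)).prod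
    ((.snd ℝ ℝ ℝ ∘L .fst ℝ (ℝ × ℝ) (ℝ × ℝ)).prod (.snd ℝ ℝ ℝ ∘L .snd ℝ (ℝ × ℝ) (ℝ × ℝ))))

@[simp] theorem regroup_apply (x y : ℝ × ℝ) : regroup (x, y) = (x.1, y.1, x.2, y.2) := rfl

/-- The implicit function theorem for `D (h, y, r, μ₂) = 0` along the segment
`0 ≤ h ≤ h₁`, `y = r = μ₂ = 0`. The local branches agree because, by compactness, the solution is
unique in a neighbourhood of uniform size. -/
theorem exists_zero_curve {h₁ : ℝ} {D : Param → ℝ × ℝ} {N : Set Param}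
    (hN : IsOpen N) (hD : ContDiffOn ℝ ∞ D N) (hKN : ∀ h ∈ Icc 0 h₁, ((h, 0, 0, 0) : Param) ∈ N)
    (h0 : ∀ h ∈ Icc 0 h₁, D (h, 0, 0, 0) = 0)
    (hy : ∀ h ∈ Icc 0 h₁, (fderiv ℝ D (h, 0, 0, 0) (0, 1, 0, 0)).1 ≠ 0)
    (hμ₁ : ∀ h ∈ Icc 0 h₁, (fderiv ℝ D (h, 0, 0, 0) (0, 0, 0, 1)).1 = 0)
    (hμ₂ : ∀ h ∈ Icc 0 h₁, (fderiv ℝ D (h, 0, 0, 0) (0, 0, 0, 1)).2 ≠ 0) {η : ℝ} (hη : 0 < η) :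
    ∃ r₁ > 0, ∃ Φ : ℝ × ℝ → ℝ × ℝ, ContDiffOn ℝ ∞ Φ (Icc 0 h₁ ×ˢ Icc 0 r₁) ∧
      (∀ h ∈ Icc 0 h₁, Φ (h, 0) = 0) ∧ ∀ x ∈ Icc 0 h₁ ×ˢ Icc 0 r₁,
        ‖Φ x‖ < η ∧ D (x.1, (Φ x).1, x.2, (Φ x).2) = 0 := by
  classical
  set f : (ℝ × ℝ) × (ℝ × ℝ) → ℝ × ℝ := D ∘ regroup with hf
  have hfs : ContDiffOn ℝ ∞ f (regroup ⁻¹' N) := hD.comp regroup.contDiff.contDiffOn fun _ h => h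
  have hloc : ∀ h ∈ Icc 0 h₁, ∃ ψ : ℝ × ℝ → ℝ × ℝ, ψ (h, 0) = 0 ∧
      (∀ᶠ x in 𝓝 (h, 0), ContDiffAt ℝ ∞ ψ x) ∧ (∀ᶠ x in 𝓝 (h, 0), f (x, ψ x) = 0) ∧
      ∀ᶠ v in 𝓝 ((h, 0), 0), f v = 0 ↔ ψ v.1 = v.2 := by
    intro h hh
    have hinv : (fderiv ℝ f ((h, 0), 0) ∘L .inr ℝ (ℝ × ℝ) (ℝ × ℝ)).IsInvertible := by
      set L := fderiv ℝ D (h, 0, 0, 0) with hL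
      have h1 : fderiv ℝ f ((h, 0), 0) = L ∘L regroup := by
        have h2 : HasFDerivAt D L (regroup ((h, 0), 0)) :=
          ((hD.contDiffAt (hN.mem_nhds (hKN h hh))).differentiableAt (by simp)).hasFDerivAt
        exact (h2.comp ((h, (0 : ℝ)), (0 : ℝ × ℝ)) regroup.hasFDerivAt).fderiv
      have h2 : ∀ w : ℝ × ℝ, (fderiv ℝ f ((h, 0), 0) ∘L .inr ℝ (ℝ × ℝ) (ℝ × ℝ)) w =
          w.1 • L (0, 1, 0, 0) + w.2 • L (0, 0, 0, 1) := by
        intro w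
        rw [h1, ← map_smul, ← map_smul, ← map_add]
        simp
      set A := L (0, 1, 0, 0)
      set B := L (0, 0, 0, 1)
      have hA : A.1 ≠ 0 := hy h hh
      have hB1 : B.1 = 0 := hμ₁ h hh
      have hB2 : B.2 ≠ 0 := hμ₂ h hh
      refine isInvertible_of_inverse ((A.1⁻¹ • ContinuousLinearMap.fst ℝ ℝ ℝ).prod
        (B.2⁻¹ • (ContinuousLinearMap.snd ℝ ℝ ℝ - (A.2 * A.1⁻¹) • ContinuousLinearMap.fst ℝ ℝ ℝ)))
        (fun w => ?_) (fun w => ?_)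
      · rw [h2]
        ext
        · simp [hB1]
          field_simp
        · simp [hB1]
          field_simp
          ring
      · rw [h2]
        ext
        · simp [hB1]
          field_simp
        · simp
          field_simp
          ring
    obtain ⟨ψ, e1, e2, e3, e4⟩ := exists_smooth_implicitFunction (hN.preimage regroup.continuous)
      hfs (x₀ := (h, 0)) (y₀ := 0) (hKN h hh) (h0 h hh) hinv
    exact ⟨ψ, e1, e2, e3.mono fun x hx => hx.2, e4⟩
  -- By compactness, zeros are unique in a neighbourhood whose size does not depend on `h`.
  have huniq : ∀ᶠ w : ℝ × (ℝ × ℝ) × (ℝ × ℝ) in 𝓝 0, ∀ h ∈ Icc 0 h₁,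
      f ((h, w.1), w.2.1) = 0 → f ((h, w.1), w.2.2) = 0 → w.2.1 = w.2.2 := by
    refine isCompact_Icc.eventually_forall_of_forall_eventually fun h hh => ?_
    obtain ⟨ψ, -, -, -, h4⟩ := hloc h hh
    have c1 : ContinuousAt (fun z : (ℝ × (ℝ × ℝ) × (ℝ × ℝ)) × ℝ => ((z.2, z.1.1), z.1.2.1))
      (0, h) := by fun_prop
    have c2 : ContinuousAt (fun z : (ℝ × (ℝ × ℝ) × (ℝ × ℝ)) × ℝ => ((z.2, z.1.1), z.1.2.2))
      (0, h) := by fun_prop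
    filter_upwards [c1.eventually h4, c2.eventually h4] with z hz1 hz2 k1 k2
    exact (hz1.1 k1).symm.trans (hz2.1 k2)
  obtain ⟨c, hc, huniq⟩ := Metric.eventually_nhds_iff_ball.1 huniq
  set c' := min c η with hc'
  have hc'0 : 0 < c' := lt_min hc hη
  have hex : ∀ᶠ r in 𝓝 (0 : ℝ), ∀ h ∈ Icc 0 h₁, ∃ ψ : ℝ × ℝ → ℝ × ℝ,
      ContDiffAt ℝ ∞ ψ (h, r) ∧ ∀ᶠ x in 𝓝 (h, r), ‖ψ x‖ < c' ∧ f (x, ψ x) = 0 := by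
    refine isCompact_Icc.eventually_forall_of_forall_eventually fun h hh => ?_
    obtain ⟨ψ, e1, e2, e3, -⟩ := hloc h hh
    have e4 : ∀ᶠ x in 𝓝 (h, 0), ‖ψ x‖ < c' :=
      e2.self_of_nhds.continuousAt.norm.eventually (gt_mem_nhds (by simpa [e1] using hc'0))
    have c1 : ContinuousAt (fun z : ℝ × ℝ => (z.2, z.1)) (0, h) := by fun_prop
    filter_upwards [c1.eventually (e2.and (eventually_eventually_nhds.2 (e4.and e3)))] with z hz
    exact ⟨ψ, hz⟩
  obtain ⟨d, hd, hex⟩ := Metric.eventually_nhds_iff_ball.1 hex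
  set r₁ := min (c / 2) (d / 2) with hr₁
  set Bx : Set (ℝ × ℝ) := Icc 0 h₁ ×ˢ Icc 0 r₁ with hBx
  have hr : ∀ x ∈ Bx, |x.2| < c ∧ |x.2| < d := by
    intro x hx
    rw [abs_of_nonneg hx.2.1]
    have h1 := hx.2.2.trans (min_le_left _ _)
    have h2 := hx.2.2.trans (min_le_right _ _)
    exact ⟨by linarith, by linarith⟩
  let Φ : ℝ × ℝ → ℝ × ℝ := fun x =>
    if h : ∃ y : ℝ × ℝ, ‖y‖ < c' ∧ f (x, y) = 0 then h.choose else 0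
  have huq : ∀ x ∈ Bx, ∀ y y' : ℝ × ℝ, ‖y‖ < c' ∧ f (x, y) = 0 → ‖y'‖ < c' ∧ f (x, y') = 0 →
      y = y' := by
    intro x hx y y' e1 e2
    refine huniq (x.2, y, y') ?_ x.1 hx.1 e1.2 e2.2
    rw [mem_ball_zero_iff, Prod.norm_def, max_lt_iff, Prod.norm_def, max_lt_iff]
    exact ⟨(hr x hx).1, e1.1.trans_le (min_le_left _ _), e2.1.trans_le (min_le_left _ _)⟩
  have hΦ : ∀ x, (∃ y : ℝ × ℝ, ‖y‖ < c' ∧ f (x, y) = 0) → ‖Φ x‖ < c' ∧ f (x, Φ x) = 0 := by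
    intro x hx
    simp only [Φ, dif_pos hx]
    exact hx.choose_spec
  have hψ : ∀ x ∈ Bx, ∃ ψ : ℝ × ℝ → ℝ × ℝ, ContDiffAt ℝ ∞ ψ x ∧
      ∀ᶠ x in 𝓝 x, ‖ψ x‖ < c' ∧ f (x, ψ x) = 0 := fun x hx =>
    hex x.2 (by rw [mem_ball_zero_iff]; exact (hr x hx).2) x.1 hx.1
  refine ⟨r₁, lt_min (by positivity) (by positivity), Φ, fun x hx => ?_, fun h hh => ?_,
    fun x hx => ?_⟩
  · obtain ⟨ψ, e1, e2⟩ := hψ x hx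
    have e3 : ∀ x' ∈ Bx, (‖ψ x'‖ < c' ∧ f (x', ψ x') = 0) → Φ x' = ψ x' := fun x' hx' h =>
      huq x' hx' _ _ (hΦ x' ⟨_, h⟩) h
    refine e1.contDiffWithinAt.congr_of_eventuallyEq ?_ (e3 x hx e2.self_of_nhds)
    filter_upwards [self_mem_nhdsWithin, mem_nhdsWithin_of_mem_nhds e2] with x' k1 k2
    exact e3 x' k1 k2
  · have hx : (h, (0 : ℝ)) ∈ Bx := ⟨hh, le_rfl, (lt_min (by positivity) (by positivity)).le⟩
    have e1 : ‖(0 : ℝ × ℝ)‖ < c' ∧ f ((h, 0), 0) = 0 := ⟨by simpa using hc'0, h0 h hh⟩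
    exact huq _ hx _ _ (hΦ _ ⟨0, e1⟩) e1
  · obtain ⟨ψ, -, e2⟩ := hψ x hx
    obtain ⟨k1, k2⟩ := hΦ x ⟨_, e2.self_of_nhds⟩
    exact ⟨k1.trans_le (min_le_right _ _), k2⟩

end ZeroCurve

section ReturnDerivatives

variable {W : ℝ × ((ℝ × ℝ) × ℝ × ℝ × ℝ) → ℝ × ℝ} {Q : ℝ × ((ℝ × ℝ) × ℝ × ℝ × ℝ) → ℝ}
  {D : Set (ℝ × ((ℝ × ℝ) × ℝ × ℝ × ℝ))}

/-- The displacement `(v₁ + 1, q)` at the first return. -/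
def displacement (Ψ : Param → C(UI, State) × ℝ) (π : Param) : ℝ × ℝ :=
  (((Ψ π).1 1).1.1 + 1, ((Ψ π).1 1).2.1)

theorem contDiffOn_displacement {Ψ : Param → C(UI, State) × ℝ} {N : Set Param}
    (hΨ : ContDiffOn ℝ ∞ Ψ N) : ContDiffOn ℝ ∞ (displacement Ψ) N := by
  have h1 : ContDiffOn ℝ ∞ (fun π => (Ψ π).1 1) N :=
    (ContinuousMap.evalCLM ℝ (1 : UI) : C(UI, State) →L[ℝ] State).contDiff.comp_contDiffOn
      (contDiff_fst.comp_contDiffOn hΨ)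
  exact ((contDiff_fst.comp contDiff_fst).comp_contDiffOn h1 |>.add contDiffOn_const).prodMk
    ((contDiff_fst.comp contDiff_snd).comp_contDiffOn h1)

/-- The derivatives of the displacement with respect to `y` and `μ₂`, along the layer orbits. -/
theorem displacement_derivatives {Ψ : Param → C(UI, State) × ℝ} {N : Set Param} (hN : IsOpen N)
    (hΨ : ContDiffOn ℝ ∞ Ψ N)
    (hret : ∀ π ∈ N, IsStateReturn W Q D π (Ψ π).1 (Ψ π).2)
    (hW0 : ∀ (h Y μ₂ : ℝ) (v : ℝ × ℝ), (h, (v, Y, 0, μ₂)) ∈ D →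
      W (h, (v, Y, 0, μ₂)) = (-v.2, v.1 + 2 * Y * v.2 + h * v.2 ^ 2))
    {h δ : ℝ} (hδ : 0 < δ) (hbase : ∀ μ₂, |μ₂| ≤ δ → ((h, 0, 0, μ₂) : Param) ∈ N ∧
      displacement Ψ (h, 0, 0, μ₂) = (0, μ₂ * (Ψ (h, 0, 0, μ₂)).2 / 2))
    (hS : 0 < ((Ψ (h, 0, 0, 0)).1 1).2.2) :
    (fderiv ℝ (displacement Ψ) (h, 0, 0, 0) (0, 1, 0, 0)).1 ≠ 0 ∧
    (fderiv ℝ (displacement Ψ) (h, 0, 0, 0) (0, 0, 0, 1)).1 = 0 ∧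
    (fderiv ℝ (displacement Ψ) (h, 0, 0, 0) (0, 0, 0, 1)).2 ≠ 0 := by
  obtain ⟨hmem, hd0⟩ := hbase 0 (by simpa using hδ.le)
  set L := fderiv ℝ (displacement Ψ) (h, 0, 0, 0) with hL
  have hd : HasFDerivAt (displacement Ψ) L (h, 0, 0, 0) :=
    (((contDiffOn_displacement hΨ).contDiffAt (hN.mem_nhds hmem)).differentiableAt
      (by simp)).hasFDerivAt
  have hdiff : DifferentiableAt ℝ Ψ (h, 0, 0, 0) :=
    (hΨ.contDiffAt (hN.mem_nhds hmem)).differentiableAt (by simp)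
  constructor
  · have hc : HasDerivAt (fun y : ℝ => ((h, y, 0, 0) : Param)) (0, 1, 0, 0) 0 :=
      (hasDerivAt_const _ _).prodMk ((hasDerivAt_id _).prodMk (hasDerivAt_const _ _))
    have h1 : HasDerivAt (fun y : ℝ => (displacement Ψ (h, y, 0, 0)).1) (L (0, 1, 0, 0)).1 0 :=
      (ContinuousLinearMap.fst ℝ ℝ ℝ).hasFDerivAt.comp_hasDerivAt (0 : ℝ)
        (hd.comp_hasDerivAt_of_eq (0 : ℝ) hc rfl)
    have h2 : HasDerivAt (fun y : ℝ => potential h ((displacement Ψ (h, y, 0, 0)).1 - 1))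
        (2 * (-1) * Real.exp (2 * h * (-1)) * (L (0, 1, 0, 0)).1) 0 := by
      have h3 := hasDerivAt_potential h (-1)
      refine h3.comp_of_eq (0 : ℝ) (h1.sub_const 1) ?_
      rw [hd0]
      norm_num
    have h4 : HasDerivAt (fun y : ℝ => 4 * y * ((Ψ (h, y, 0, 0)).1 1).2.2)
        (4 * ((Ψ (h, 0, 0, 0)).1 1).2.2) 0 := by
      have h5 : DifferentiableAt ℝ (fun y : ℝ => Ψ (h, y, 0, 0)) 0 :=
        DifferentiableAt.comp (0 : ℝ) hdiff hc.differentiableAt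
      have h6 : DifferentiableAt ℝ (fun y : ℝ => ((Ψ (h, y, 0, 0)).1 1).2.2) 0 :=
        ((ContinuousLinearMap.snd ℝ ℝ ℝ ∘L ContinuousLinearMap.snd ℝ (ℝ × ℝ) (ℝ × ℝ)) ∘L
          (ContinuousMap.evalCLM ℝ (1 : UI) : C(UI, State) →L[ℝ] State)).differentiableAt.comp
            (0 : ℝ) h5.fst
      exact (((hasDerivAt_id (0 : ℝ)).const_mul 4).mul h6.hasDerivAt).congr_deriv (by simp)
    -- Both sides of the energy identity are differentiated at `y = 0`.
    have h7 : (fun y : ℝ => potential h ((displacement Ψ (h, y, 0, 0)).1 - 1)) =ᶠ[𝓝 0]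
        fun y => 4 * y * ((Ψ (h, y, 0, 0)).1 1).2.2 + potential h (-1) := by
      filter_upwards [hc.continuousAt.preimage_mem_nhds (hN.mem_nhds hmem)] with y hy
      have h8 := (hret _ hy).potential_eq hW0
      rw [← h8, displacement]
      simp
    have h9 := h2.unique ((h4.add_const _).congr_of_eventuallyEq h7)
    intro hz
    rw [hz, mul_zero] at h9
    linarith
  · have hc : HasDerivAt (fun μ₂ : ℝ => ((h, 0, 0, μ₂) : Param)) (0, 0, 0, 1) 0 :=
      (hasDerivAt_const _ _).prodMk ((hasDerivAt_const _ _).prodMk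
        ((hasDerivAt_const _ _).prodMk (hasDerivAt_id _)))
    have h1 : HasDerivAt (fun μ₂ : ℝ => displacement Ψ (h, 0, 0, μ₂)) (L (0, 0, 0, 1)) 0 :=
      hd.comp_hasDerivAt_of_eq (0 : ℝ) hc rfl
    have h5 : DifferentiableAt ℝ (fun μ₂ : ℝ => (Ψ (h, 0, 0, μ₂)).2) 0 :=
      (DifferentiableAt.comp (0 : ℝ) hdiff hc.differentiableAt).snd
    have h6 : HasDerivAt (fun μ₂ : ℝ => ((0 : ℝ), μ₂ * (Ψ (h, 0, 0, μ₂)).2 / 2))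
        (0, (Ψ (h, 0, 0, 0)).2 / 2) 0 :=
      (hasDerivAt_const _ _).prodMk
        ((((hasDerivAt_id (0 : ℝ)).mul h5.hasDerivAt).div_const 2).congr_deriv (by simp))
    have h7 : (fun μ₂ : ℝ => displacement Ψ (h, 0, 0, μ₂)) =ᶠ[𝓝 0]
        fun μ₂ => ((0 : ℝ), μ₂ * (Ψ (h, 0, 0, μ₂)).2 / 2) := by
      filter_upwards [Metric.ball_mem_nhds (0 : ℝ) hδ] with μ₂ hμ
      exact (hbase μ₂ (mem_ball_zero_iff.1 hμ).le).2
    have h9 := h1.unique (h6.congr_of_eventuallyEq h7)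
    have hT := (hret _ hmem).pos
    rw [h9]
    exact ⟨rfl, by positivity⟩

end ReturnDerivatives

section

set_option maxSynthPendingDepth 5

/-! ### From the scaled system to the chart system -/

section ScaledSystem

variable {F G H : ℝ → ℝ → ℝ → ℝ → ℝ → ℝ} {m : ℝ → ℝ → ℝ → ℝ × ℝ} {ε : ℝ}
  {D : Set (ℝ × ((ℝ × ℝ) × ℝ × ℝ × ℝ))} {W : ℝ × ((ℝ × ℝ) × ℝ × ℝ × ℝ) → ℝ × ℝ}

/-- The slow rate `Q (h v, Y, r, μ₂)`. -/
def scaledRate (G : ℝ → ℝ → ℝ → ℝ → ℝ → ℝ) (m : ℝ → ℝ → ℝ → ℝ × ℝ)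
    (p : ℝ × ((ℝ × ℝ) × ℝ × ℝ × ℝ)) : ℝ :=
  straightRate G m p.2.2.2.1 p.2.2.2.2 (p.1 • p.2.1) p.2.2.1

/-- The straightened system in the coordinates `u = h v`: `m` parametrizes the slow manifolds, and
`v' = W`, `Y' = r scaledRate` for `(h, (v, Y, r, μ₂)) ∈ D`. -/
structure IsScaledSystem (F G H : ℝ → ℝ → ℝ → ℝ → ℝ → ℝ) (m : ℝ → ℝ → ℝ → ℝ × ℝ) (ε : ℝ)
    (D : Set (ℝ × ((ℝ × ℝ) × ℝ × ℝ × ℝ))) (W : ℝ × ((ℝ × ℝ) × ℝ × ℝ × ℝ) → ℝ × ℝ) : Prop where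
  smooth_m : ContDiffOn ℝ ∞ (fun q : ℝ × ℝ × ℝ => m q.1 q.2.1 q.2.2) (Metric.ball 0 ε)
  invariant : ∀ y r μ₂ : ℝ, |y| < ε → |r| < ε → |μ₂| < ε →
    ((chartField F G H r (r * μ₂) (m y r μ₂).1 y (m y r μ₂).2).1,
        (chartField F G H r (r * μ₂) (m y r μ₂).1 y (m y r μ₂).2).2.2) =
      (chartField F G H r (r * μ₂) (m y r μ₂).1 y (m y r μ₂).2).2.1 • deriv (fun s => m s r μ₂) y
  isOpen : IsOpen D
  bound : ∀ (h Y r μ₂ : ℝ) (v : ℝ × ℝ), (h, (v, Y, r, μ₂)) ∈ D → |Y| < ε ∧ |r| < ε ∧ |μ₂| < ε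
  origin : ∀ (h Y r μ₂ : ℝ) (v : ℝ × ℝ), (h, (v, Y, r, μ₂)) ∈ D → ((0 : ℝ), ((0 : ℝ × ℝ), Y, r, μ₂)) ∈ D
  smooth_W : ContDiffOn ℝ ∞ W D
  smooth_rate : ContDiffOn ℝ ∞ (scaledRate G m) D
  eq_straightField : ∀ (h Y r μ₂ : ℝ) (v : ℝ × ℝ), (h, (v, Y, r, μ₂)) ∈ D →
    h • W (h, (v, Y, r, μ₂)) = straightField F G H m r μ₂ (h • v) Y

/-- A solution of the straightened system is a solution of the chart system. -/
theorem IsScaledSystem.hasDerivWithinAt_chart (hS : IsScaledSystem F G H m ε D W) (hG : OrderG G)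
    {r μ₂ t : ℝ} {u : ℝ → ℝ × ℝ} {Y : ℝ → ℝ} {s : Set ℝ}
    (hY : |Y t| < ε ∧ |r| < ε ∧ |μ₂| < ε)
    (hu : HasDerivWithinAt u (straightField F G H m r μ₂ (u t) (Y t)) s t)
    (hYd : HasDerivWithinAt Y (r * straightRate G m r μ₂ (u t) (Y t)) s t) :
    HasDerivWithinAt (fun t => ((m (Y t) r μ₂ + u t).1, Y t, (m (Y t) r μ₂ + u t).2))
      (chartField F G H r (r * μ₂) (m (Y t) r μ₂ + u t).1 (Y t) (m (Y t) r μ₂ + u t).2) s t := by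
  have hmem : ((Y t, r, μ₂) : ℝ × ℝ × ℝ) ∈ Metric.ball (0 : ℝ × ℝ × ℝ) ε := by
    simpa [Prod.norm_def] using hY
  have hm : HasDerivAt (fun s => m s r μ₂) (deriv (fun s => m s r μ₂) (Y t)) (Y t) := by
    have h1 : DifferentiableAt ℝ (fun q : ℝ × ℝ × ℝ => m q.1 q.2.1 q.2.2) (Y t, r, μ₂) :=
      (hS.smooth_m.contDiffAt (Metric.isOpen_ball.mem_nhds hmem)).differentiableAt (by simp)
    exact (DifferentiableAt.comp (Y t) h1
      (by fun_prop : DifferentiableAt ℝ (fun s : ℝ => ((s, r, μ₂) : ℝ × ℝ × ℝ)) (Y t))).hasDerivAt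
  have h2 := (hm.scomp_hasDerivWithinAt t hYd).add hu
  have hrate := chartField_snd_fst (F := F) (H := H) hG r μ₂ (m (Y t) r μ₂ + u t).1 (Y t)
    (m (Y t) r μ₂ + u t).2
  rw [straightRate, ← hrate] at hYd h2
  obtain ⟨h3, h4⟩ := hasDerivWithinAt_fst_snd h2
  refine (h3.prodMk (hYd.prodMk h4)).congr_deriv ?_
  simp only [straightField]
  ext <;> simp

/-- In the time variable of the system, a return orbit solves the system. -/
theorem IsStateReturn.hasDerivWithinAt_state {Q : ℝ × ((ℝ × ℝ) × ℝ × ℝ × ℝ) → ℝ} {h y r μ₂ T : ℝ}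
    {γ : C(UI, State)} (hγ : IsStateReturn W Q D (h, y, r, μ₂) γ T) {t : ℝ} (ht : t ∈ Icc 0 T) :
    (h, ((ext01 γ (t / T)).1, y + r * (ext01 γ (t / T)).2.1, r, μ₂)) ∈ D ∧
    HasDerivWithinAt (fun t => (ext01 γ (t / T)).1)
      (W (h, ((ext01 γ (t / T)).1, y + r * (ext01 γ (t / T)).2.1, r, μ₂))) (Icc 0 T) t ∧
    HasDerivWithinAt (fun t => (ext01 γ (t / T)).2.1)
      (Q (h, ((ext01 γ (t / T)).1, y + r * (ext01 γ (t / T)).2.1, r, μ₂))) (Icc 0 T) t := by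
  have h1 := hγ.toIsReturnSegment.hasDerivWithinAt hγ.pos ht
  obtain ⟨h2, h3⟩ := hasDerivWithinAt_fst_snd h1
  refine ⟨?_, h2, (hasDerivWithinAt_fst_snd h3).1⟩
  rw [ext01_of_mem _ (div_mem_unit hγ.pos ht)]
  exact hγ.mem _

end ScaledSystem

end

section

set_option maxSynthPendingDepth 5

/-! ### The Melnikov functions -/

section MelnikovValue

/-- `ψ ↦ Aᵀ ψ` as a continuous linear map. -/
def linATCLM (z : ℝ) : ℝ × ℝ →L[ℝ] ℝ × ℝ :=
  ContinuousLinearMap.inl ℝ ℝ ℝ ∘L .snd ℝ ℝ ℝ - ContinuousLinearMap.inr ℝ ℝ ℝ ∘L .fst ℝ ℝ ℝ +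
    (2 * z) • ContinuousLinearMap.inr ℝ ℝ ℝ ∘L .snd ℝ ℝ ℝ

theorem linATCLM_apply (z : ℝ) (ψ : ℝ × ℝ) : linATCLM z ψ = linAT z ψ := by
  ext <;> simp [linATCLM, linAT]

/-- The adjoint equation along a layer orbit, solved backwards from the return time. -/
theorem exists_adjoint_solution {z : ℝ → ℝ} (hz : Continuous z) {T : ℝ} (hT : 0 < T) :
    ∃ ψ : ℝ → ℝ × ℝ, ψ T = (1, 0) ∧
      ∀ t ∈ Icc 0 T, HasDerivWithinAt ψ (-linAT (z t) (ψ t)) (Icc 0 T) t := by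
  -- In the reversed time `s = (T - t) / T` this is an initial value problem.
  have hc : Continuous fun k : UI => T • linATCLM (z (T - T * k)) := by
    unfold linATCLM
    fun_prop
  let B : C(UI, ℝ × ℝ →L[ℝ] ℝ × ℝ) := ⟨_, hc⟩
  obtain ⟨η, hη⟩ := exists_eq_add_volOp B (ContinuousMap.const UI ((1, 0) : ℝ × ℝ))
  obtain ⟨h0, h1⟩ := eq_const_add_volterra_iff.1 hη
  refine ⟨fun t => ext01 η ((T - t) / T), by simpa using h0, fun t ht => ?_⟩
  have hmem : ∀ t ∈ Icc 0 T, (T - t) / T ∈ Icc (0 : ℝ) 1 := fun t ht =>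
    div_mem_unit hT ⟨by linarith [ht.2], by linarith [ht.1]⟩
  have h2 := (h1 _ (hmem t ht)).scomp t
    (((hasDerivAt_id t).const_sub T).div_const T).hasDerivWithinAt (t' := Icc 0 1) (s := Icc 0 T)
    hmem
  refine h2.congr_deriv ?_
  rw [ext01_of_mem _ (hmem t ht)]
  have h3 : T - T * ((T - t) / T) = t := by field_simp; ring
  have h4 : η ⟨(T - t) / T, hmem t ht⟩ = ext01 η ((T - t) / T) := (ext01_of_mem _ _).symm
  change (-1 / T) • (T • linATCLM (z (T - T * ((T - t) / T)))) (η ⟨(T - t) / T, hmem t ht⟩) = _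
  rw [h3, h4, smul_apply, linATCLM_apply, smul_smul, neg_div, neg_mul,
    one_div_mul_cancel hT.ne', neg_one_smul]

/-- Variation of constants: if `w' = A w + g`, `w 0 = 0`, and `ψ` solves the adjoint equation, then
`(ψ · w)' = ψ · g`. -/
theorem integral_adjoint {z : ℝ → ℝ} {T : ℝ} (hT : 0 < T) {w ψ g : ℝ → ℝ × ℝ} (hw0 : w 0 = 0)
    (hw : ∀ t ∈ Icc 0 T, HasDerivWithinAt w (linA (z t) (w t) + g t) (Icc 0 T) t)
    (hψT : ψ T = (1, 0))
    (hψ : ∀ t ∈ Icc 0 T, HasDerivWithinAt ψ (-linAT (z t) (ψ t)) (Icc 0 T) t)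
    (hg : ContinuousOn g (Icc 0 T)) :
    ∫ t in (0 : ℝ)..T, ((ψ t).1 * (g t).1 + (ψ t).2 * (g t).2) = (w T).1 := by
  have hd : ∀ t ∈ Icc 0 T, HasDerivWithinAt (fun t => (ψ t).1 * (w t).1 + (ψ t).2 * (w t).2)
      ((ψ t).1 * (g t).1 + (ψ t).2 * (g t).2) (Icc 0 T) t := by
    intro t ht
    obtain ⟨a1, a2⟩ := hasDerivWithinAt_fst_snd (hψ t ht)
    obtain ⟨b1, b2⟩ := hasDerivWithinAt_fst_snd (hw t ht)
    refine ((a1.mul b1).add (a2.mul b2)).congr_deriv ?_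
    simp only [linA, linAT, Prod.fst_add, Prod.snd_add, Prod.fst_neg, Prod.snd_neg]
    ring
  have hψc : ContinuousOn ψ (Icc 0 T) := fun t ht => (hψ t ht).continuousWithinAt
  have hcont : ContinuousOn (fun t => (ψ t).1 * (g t).1 + (ψ t).2 * (g t).2) (Icc 0 T) :=
    (hψc.fst.mul hg.fst).add (hψc.snd.mul hg.snd)
  rw [intervalIntegral.integral_eq_sub_of_hasDerivAt_of_le hT.le
    (fun t ht => (hd t ht).continuousWithinAt)
    (fun t ht => (hd t (Ioo_subset_Icc_self ht)).hasDerivAt (Icc_mem_nhds ht.1 ht.2))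
    (hcont.intervalIntegrable_of_Icc hT.le)]
  simp [hw0, hψT]

variable {F G H : ℝ → ℝ → ℝ → ℝ → ℝ → ℝ} {m : ℝ → ℝ → ℝ → ℝ × ℝ} {ε : ℝ}
  {D : Set (ℝ × ((ℝ × ℝ) × ℝ × ℝ × ℝ))} {W : ℝ × ((ℝ × ℝ) × ℝ × ℝ × ℝ) → ℝ × ℝ}

/-- The Melnikov functions are the displacement at the first return. -/
theorem IsScaledSystem.isMelnikovValue (hS : IsScaledSystem F G H m ε D W) {h y r μ₂ T : ℝ}
    (hh : 0 < h) {γ : C(UI, State)}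
    (hγ : IsStateReturn W (scaledRate G m) D (h, y, r, μ₂) γ T) :
    IsMelnikovValue F G H ε m h y r μ₂ T (h * ((γ 1).1.1 + 1)) (γ 1).2.1 := by
  obtain ⟨-, v₀, -, hv₀, hv₀0, -⟩ := exists_layer_orbit hh.le
  have hT := hγ.pos
  set v : ℝ → ℝ × ℝ := fun t => (ext01 γ (t / T)).1 with hv
  set Y : ℝ → ℝ := fun t => y + r * (ext01 γ (t / T)).2.1 with hY
  have hstate := fun t (ht : t ∈ Icc 0 T) => hγ.hasDerivWithinAt_state ht
  have hγ0 : ext01 γ (0 / T) = startState := by rw [zero_div]; exact hγ.init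
  have hγ1 : ext01 γ (T / T) = γ 1 := by rw [div_self hT.ne']; exact ext01_coe γ 1
  have hvc : ContinuousOn v (Icc 0 T) := fun t ht => (hstate t ht).2.1.continuousWithinAt
  have hqc : ContinuousOn (fun t => (ext01 γ (t / T)).2.1) (Icc 0 T) := fun t ht =>
    (hstate t ht).2.2.continuousWithinAt
  have hpc : ContinuousOn (fun t => (h, (v t, Y t, r, μ₂))) (Icc 0 T) :=
    continuousOn_const.prodMk (hvc.prodMk ((continuousOn_const.add (continuousOn_const.mul hqc)).prodMk
      continuousOn_const))
  have hpD : MapsTo (fun t => (h, (v t, Y t, r, μ₂))) (Icc 0 T) D := fun t ht => (hstate t ht).1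
  set φ : ℝ → ℝ × ℝ := fun t => h • v₀ t with hφ
  have hφd : ∀ t, HasDerivAt φ (layerField (φ t)) t := fun t => by
    refine ((hv₀ t).const_smul h).congr_deriv ?_
    ext <;> simp [hφ, scaledLayer, layerField]
    ring
  have hφc : Continuous φ := continuous_iff_continuousAt.2 fun t => (hφd t).continuousAt
  set w : ℝ → ℝ × ℝ := fun t => h • v t - φ t with hw
  have hφw : ∀ t, φ t + w t = h • v t := fun t => add_sub_cancel _ _
  have hstraight : ∀ t ∈ Icc 0 T, straightField F G H m r μ₂ (φ t + w t) (Y t) =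
      h • W (h, (v t, Y t, r, μ₂)) := fun t ht => by
    rw [hφw, hS.eq_straightField _ _ _ _ _ (hstate t ht).1]
  have hg : ContinuousOn (fun t => remainder F G H m r μ₂ (φ t) (w t) (Y t)) (Icc 0 T) := by
    have h1 : ContinuousOn (fun t => h • W (h, (v t, Y t, r, μ₂))) (Icc 0 T) :=
      (hS.smooth_W.continuousOn.comp hpc hpD).const_smul h
    have h2 : ContinuousOn (fun t => h • W (h, (v t, Y t, r, μ₂)) - layerField (φ t) -
        linA (φ t).2 (w t)) (Icc 0 T) := by
      unfold linA layerField
      fun_prop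
    refine h2.congr fun t ht => ?_
    simp only [remainder]
    rw [hstraight t ht]
  have hwd : ∀ t ∈ Icc 0 T, HasDerivWithinAt w
      (linA (φ t).2 (w t) + remainder F G H m r μ₂ (φ t) (w t) (Y t)) (Icc 0 T) t := by
    intro t ht
    refine (((hstate t ht).2.1.const_smul h).sub (hφd t).hasDerivWithinAt).congr_deriv ?_
    rw [remainder, hstraight t ht]
    abel
  have hw0 : w 0 = 0 := by
    simp only [hw, hv, hφ, hγ0, hv₀0, startState, sub_self]
  obtain ⟨ψ, hψT, hψ⟩ := exists_adjoint_solution hφc.snd hT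
  have hend1 : (v T).2 = 0 := by
    simp only [hv, div_self hT.ne']
    exact hγ.final
  have hend2 : (v T).1 < 0 := by
    simp only [hv, div_self hT.ne']
    exact hγ.neg
  refine ⟨φ, w, ψ, Y, ⟨?_, hφd, hw0, hwd, ?_, fun t ht => ?_, fun t ht => ?_, hT, ⟨?_, ?_⟩,
    fun t ht => ?_, hψT, hψ⟩, ?_, ?_⟩
  · simp [hφ, hv₀0]
  · simp only [hY, hγ0, startState, mul_zero, add_zero]
  · rw [hφw]
    exact ((hstate t ht).2.2.const_mul r).const_add y
  · exact abs_lt.1 (hS.bound _ _ _ _ _ (hstate t ht).1).1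
  · rw [hφw]
    simp [hend1]
  · rw [hφw]
    exact mul_neg_of_pos_of_neg hh hend2
  · rw [hφw]
    rintro ⟨h1, h2⟩
    have h3 : (v t).2 = 0 := (mul_eq_zero.1 h1).resolve_left hh.ne'
    have h4 := hγ.between (t / T) ⟨div_pos ht.1 hT, (div_lt_one hT).2 ht.2⟩ h3
    exact absurd h2 (mul_pos hh h4).le.not_gt
  · rw [integral_adjoint hT hw0 hwd hψT hψ hg]
    simp only [hw, hv, hγ1, Prod.fst_sub, Prod.smul_fst, smul_eq_mul]
    ring
  · have h1 : ∀ t ∈ Icc 0 T, HasDerivWithinAt (fun t => (ext01 γ (t / T)).2.1)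
        (straightRate G m r μ₂ (φ t + w t) (Y t)) (Icc 0 T) t := fun t ht => by
      rw [hφw]
      exact (hstate t ht).2.2
    have h2 : ContinuousOn (fun t => straightRate G m r μ₂ (φ t + w t) (Y t)) (Icc 0 T) :=
      (hS.smooth_rate.continuousOn.comp hpc hpD).congr fun t ht => by
        rw [hφw]
        rfl
    rw [intervalIntegral.integral_eq_sub_of_hasDerivAt_of_le hT.le
      (fun t ht => (h1 t ht).continuousWithinAt)
      (fun t ht => (h1 t (Ioo_subset_Icc_self ht)).hasDerivAt (Icc_mem_nhds ht.1 ht.2))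
      (h2.intervalIntegrable_of_Icc hT.le), hγ1, hγ0]
    simp [startState]

end MelnikovValue

end

section

set_option maxSynthPendingDepth 5

/-! ### Periodic orbits and equilibria -/

section PeriodicOrbits

variable {F G H : ℝ → ℝ → ℝ → ℝ → ℝ → ℝ} {m : ℝ → ℝ → ℝ → ℝ × ℝ} {ε : ℝ}
  {D : Set (ℝ × ((ℝ × ℝ) × ℝ × ℝ × ℝ))} {W : ℝ × ((ℝ × ℝ) × ℝ × ℝ × ℝ) → ℝ × ℝ}

/-- A zero of the displacement with `h > 0` is a periodic orbit. -/
theorem IsScaledSystem.exists_periodicOrbit (hS : IsScaledSystem F G H m ε D W) (hG : OrderG G)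
    {h y r μ₂ T : ℝ} (hh : 0 < h) {γ : C(UI, State)}
    (hγ : IsStateReturn W (scaledRate G m) D (h, y, r, μ₂) γ T) (hv1 : (γ 1).1.1 = -1)
    (hq1 : (γ 1).2.1 = 0) :
    ∃ γ : ℝ → ℝ × ℝ × ℝ, IsPeriodicOrbit F G H r (r * μ₂) T γ ∧
      γ 0 = ((m y r μ₂).1 - h, y, (m y r μ₂).2) ∧ ∀ t, (γ t).2.1 ∈ Ioo (-ε) ε := by
  have hT := hγ.pos
  set v : ℝ → ℝ × ℝ := fun t => (ext01 γ (t / T)).1 with hv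
  set Y : ℝ → ℝ := fun t => y + r * (ext01 γ (t / T)).2.1 with hY
  set z : ℝ → ℝ × ℝ × ℝ := fun t =>
    ((m (Y t) r μ₂ + h • v t).1, Y t, (m (Y t) r μ₂ + h • v t).2) with hz
  have hstate := fun t (ht : t ∈ Icc 0 T) => hγ.hasDerivWithinAt_state ht
  have hb := fun t (ht : t ∈ Icc 0 T) => hS.bound _ _ _ _ _ (hstate t ht).1
  have hzd : ∀ t ∈ Icc 0 (0 + T), HasDerivWithinAt z
      (chartField F G H r (r * μ₂) (z t).1 (z t).2.1 (z t).2.2) (Icc 0 (0 + T)) t := by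
    rw [zero_add]
    intro t ht
    refine hS.hasDerivWithinAt_chart hG (u := fun t => h • v t) (hb t ht) ?_
      (((hstate t ht).2.2.const_mul r).const_add y)
    rw [← hS.eq_straightField _ _ _ _ _ (hstate t ht).1]
    exact (hstate t ht).2.1.const_smul h
  have hγ0 : ext01 γ (0 / T) = startState := by rw [zero_div]; exact hγ.init
  have hγ1 : ext01 γ (T / T) = γ 1 := by rw [div_self hT.ne']; exact ext01_coe γ 1
  have hv2 : (γ 1).1.2 = 0 := by
    have h1 := hγ.final
    rwa [show ext01 γ 1 = γ 1 from ext01_coe γ 1] at h1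
  have hz0 : z 0 = ((m y r μ₂).1 - h, y, (m y r μ₂).2) := by
    simp only [hz, hY, hv, hγ0, startState, mul_zero, add_zero]
    ext <;> simp
    ring
  have hzT : z (0 + T) = z 0 := by
    rw [hz0, zero_add]
    simp only [hz, hY, hv, hγ1, hq1, mul_zero, add_zero]
    ext <;> simp [hv1, hv2]
    ring
  obtain ⟨Γ, h1, h2, h3, h4⟩ := exists_periodic_extension
    (X := fun p : ℝ × ℝ × ℝ => chartField F G H r (r * μ₂) p.1 p.2.1 p.2.2) hT hzd hzT
  rw [zero_add] at h3 h4
  have h0 : Γ 0 = z 0 := h3 ⟨le_rfl, hT.le⟩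
  refine ⟨Γ, ⟨h1, hT, h2, fun t ht heq => ?_⟩, h0.trans hz0, fun t => ?_⟩
  · rw [h0, h3 (Ioo_subset_Icc_self ht), hz0] at heq
    simp only [hz, Prod.mk.injEq] at heq
    obtain ⟨e1, e2, e3⟩ := heq
    rw [e2] at e1 e3
    simp only [Prod.fst_add, Prod.snd_add, Prod.smul_fst, Prod.smul_snd, smul_eq_mul] at e1 e3
    have e4 : (v t).2 = 0 := (mul_eq_zero.1 (add_eq_left.1 e3)).resolve_left hh.ne'
    have e5 : 0 < (v t).1 :=
      hγ.between (t / T) ⟨div_pos ht.1 hT, (div_lt_one hT).2 ht.2⟩ e4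
    linarith [mul_pos hh e5]
  · obtain ⟨s, hs, e⟩ := h4 t
    rw [e]
    exact abs_lt.1 (hb s hs).1

/-- A zero of the displacement with `h = 0` is an equilibrium: the slow variable satisfies a scalar
autonomous equation, and a solution of it that returns to its initial value is constant. -/
theorem IsScaledSystem.chartField_eq_zero (hS : IsScaledSystem F G H m ε D W) (hG : OrderG G)
    {y r μ₂ T : ℝ} {γ : C(UI, State)}
    (hγ : IsStateReturn W (scaledRate G m) D (0, y, r, μ₂) γ T) (hq1 : (γ 1).2.1 = 0) :
    chartField F G H r (r * μ₂) (m y r μ₂).1 y (m y r μ₂).2 = 0 := by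
  have hT := hγ.pos
  have hstate := fun t (ht : t ∈ Icc 0 T) => hγ.hasDerivWithinAt_state ht
  set q : ℝ → ℝ := fun t => (ext01 γ (t / T)).2.1 with hq
  let P : ℝ → ℝ × ((ℝ × ℝ) × ℝ × ℝ × ℝ) := fun x => (0, (0, y + r * x, r, μ₂))
  have hPs : ContDiff ℝ ∞ P := by
    simp only [P]
    fun_prop
  have hO : IsOpen (P ⁻¹' D) := hS.isOpen.preimage hPs.continuous
  have hX : ContDiffOn ℝ ∞ (scaledRate G m ∘ P) (P ⁻¹' D) :=
    hS.smooth_rate.comp hPs.contDiffOn fun _ h => h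
  have hqO : ∀ t ∈ Icc 0 T, q t ∈ P ⁻¹' D := fun t ht => hS.origin _ _ _ _ _ (hstate t ht).1
  have hqd : ∀ t ∈ Icc 0 T, HasDerivWithinAt q ((scaledRate G m ∘ P) (q t)) (Icc 0 T) t := by
    intro t ht
    refine (hstate t ht).2.2.congr_deriv ?_
    simp only [scaledRate, zero_smul, P, Function.comp, hq]
  have hq0 : q 0 = 0 := by
    simp only [hq, zero_div, hγ.init, startState]
  have hqT : q T = 0 := by
    simp only [hq, div_self hT.ne']
    rw [show ext01 γ 1 = γ 1 from ext01_coe γ 1, hq1]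
  obtain ⟨t, ht, hzero⟩ := exists_hasDerivAt_eq_zero (f := q) hT
    (fun t ht => (hqd t ht).continuousWithinAt) (hq0.trans hqT.symm)
    (fun t ht => (hqd t (Ioo_subset_Icc_self ht)).hasDerivAt (Icc_mem_nhds ht.1 ht.2))
  have ht' := Ioo_subset_Icc_self ht
  have heq := ode_eqOn hO hX ht' hqd hqO (w := fun _ => q t)
    (fun s _ => by rw [hzero]; exact hasDerivWithinAt_const _ _ _) (fun _ _ => hqO t ht') rfl
    (⟨le_rfl, hT.le⟩ : (0 : ℝ) ∈ Icc 0 T)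
  rw [← show q 0 = q t from heq, hq0] at hzero
  have hrate : slowRate G r μ₂ (m y r μ₂).1 y (m y r μ₂).2 = 0 := by
    simpa [scaledRate, straightRate, P] using hzero
  have hb := hS.bound _ _ _ _ _ (hqO 0 ⟨le_rfl, hT.le⟩)
  rw [hq0, mul_zero, add_zero] at hb
  have hinv := hS.invariant y r μ₂ hb.1 hb.2.1 hb.2.2
  have h2 := chartField_snd_fst (F := F) (H := H) hG r μ₂ (m y r μ₂).1 y (m y r μ₂).2
  rw [hrate, mul_zero] at h2
  rw [h2, zero_smul, Prod.mk_eq_zero] at hinv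
  exact Prod.ext hinv.1 (Prod.ext h2 hinv.2)

end PeriodicOrbits

end

section

set_option maxSynthPendingDepth 5

/-! ### The family of periodic orbits -/

section Family

variable {F G H : ℝ → ℝ → ℝ → ℝ → ℝ → ℝ} {m : ℝ → ℝ → ℝ → ℝ × ℝ} {ε : ℝ}
  {D : Set (ℝ × ((ℝ × ℝ) × ℝ × ℝ × ℝ))} {W : ℝ × ((ℝ × ℝ) × ℝ × ℝ × ℝ) → ℝ × ℝ}

/-- The return map on a box around the layer orbits, together with the curve of its fixed points. -/
theorem IsScaledSystem.exists_fixed_curve (hS : IsScaledSystem F G H m ε D W)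
    {h₁ K ϱ δ R a : ℝ} (hϱ : 0 < ϱ) (hδ : 0 < δ) (hδε : δ < ε) (hR : 0 < R)
    (hK : 1 + Real.exp h₁ < K) (hD : D = scaledDom (h₁ + 1) K ε ϱ)
    (hW0 : ∀ (h Y μ₂ : ℝ) (v : ℝ × ℝ), (h, (v, Y, 0, μ₂)) ∈ D →
      W (h, (v, Y, 0, μ₂)) = (-v.2, v.1 + 2 * Y * v.2 + h * v.2 ^ 2))
    (hQ0 : ∀ (h μ₂ : ℝ) (v : ℝ × ℝ), (h, (v, 0, 0, μ₂)) ∈ D →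
      scaledRate G m (h, (v, 0, 0, μ₂)) = μ₂ / 2 + a * (h * v.2)) :
    ∃ (η r₀ : ℝ) (Ψ : Param → C(UI, State) × ℝ) (Φ : ℝ × ℝ → ℝ × ℝ), 0 < η ∧ 0 < r₀ ∧ r₀ ≤ R ∧
      ContDiffOn ℝ ∞ Ψ (box h₁ η r₀ δ) ∧
      (∀ π ∈ box h₁ η r₀ δ, IsStateReturn W (scaledRate G m) D π (Ψ π).1 (Ψ π).2) ∧
      ContDiffOn ℝ ∞ Φ (Icc 0 h₁ ×ˢ Icc 0 r₀) ∧ (∀ h ∈ Icc 0 h₁, Φ (h, 0) = 0) ∧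
      ∀ h ∈ Icc 0 h₁, ∀ r ∈ Icc 0 r₀, (h, (Φ (h, r)).1, r, (Φ (h, r)).2) ∈ box h₁ η r₀ δ ∧
        displacement Ψ (h, (Φ (h, r)).1, r, (Φ (h, r)).2) = 0 := by
  have hε : 0 < ε := hδ.trans hδε
  set K₀ : Set Param := Icc 0 h₁ ×ˢ {0} ×ˢ {0} ×ˢ Icc (-δ) δ with hK₀
  have hX := contDiffOn_stateField hS.smooth_W hS.smooth_rate
  have hO : IsOpen (toScaled ⁻¹' D) := hS.isOpen.preimage contDiff_toScaled.continuous
  have hbase : ∀ h ∈ Icc 0 h₁, ∀ μ₂ ∈ Icc (-δ) δ, _ := fun h hh μ₂ hμ =>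
    exists_base_return hε hϱ hK hD hW0 hQ0 hh ((abs_le.2 hμ).trans_lt hδε)
  obtain ⟨Ψ, N, hN, hKN, hΨ, hret⟩ := exists_smooth_firstReturn_nhds (ρ := fstCoord)
    (z₀ := startState) (ℓ := sndCoord) hO hX (K := K₀) rfl (by
      rintro ⟨h, y, r, μ₂⟩ ⟨hh, hy, hr, hμ⟩
      simp only [mem_singleton_iff] at hh hy hr hμ
      subst hy hr
      obtain ⟨h1, γ, T, h2, h3, -⟩ := hbase h hh μ₂ hμ
      exact ⟨h1, γ, T, h2, h3⟩)
  have hmemK : ∀ h ∈ Icc 0 h₁, ∀ μ₂ ∈ Icc (-δ) δ, ((h, 0, 0, μ₂) : Param) ∈ N :=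
    fun h hh μ₂ hμ => hKN ⟨hh, rfl, rfl, hμ⟩
  -- On the layer orbits the displacement is known explicitly, by uniqueness of the first return.
  have hdisp : ∀ h ∈ Icc 0 h₁, ∀ μ₂ ∈ Icc (-δ) δ,
      displacement Ψ (h, 0, 0, μ₂) = (0, μ₂ * (Ψ (h, 0, 0, μ₂)).2 / 2) ∧
      0 < ((Ψ (h, 0, 0, μ₂)).1 1).2.2 := by
    intro h hh μ₂ hμ
    obtain ⟨-, γ, T, h2, -, h4, h5, h6⟩ := hbase h hh μ₂ hμ
    have h7 : Ψ (h, 0, 0, μ₂) = (γ, T) :=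
      IsFirstReturn.unique hO hX (hret _ (hmemK h hh μ₂ hμ)) (ψ' := (γ, T)) h2
    rw [displacement, h7]
    simp only [h4, h5]
    exact ⟨by norm_num, h6⟩
  obtain ⟨c, hc, hbox⟩ : ∃ c > 0, ∀ h ∈ Icc 0 h₁, ∀ μ₂ ∈ Icc (-δ) δ, ∀ y r : ℝ, |y| < c →
      |r| < c → ((h, y, r, μ₂) : Param) ∈ N := by
    have h1 : ∀ᶠ w : ℝ × ℝ in 𝓝 0, ∀ k ∈ Icc 0 h₁ ×ˢ Icc (-δ) δ,
        ((k.1, w.1, w.2, k.2) : Param) ∈ N := by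
      refine (isCompact_Icc.prod isCompact_Icc).eventually_forall_of_forall_eventually
        fun k hk => ?_
      have c1 : ContinuousAt (fun z : (ℝ × ℝ) × (ℝ × ℝ) => ((z.2.1, z.1.1, z.1.2, z.2.2) : Param))
        (0, k) := by fun_prop
      exact c1.preimage_mem_nhds (hN.mem_nhds (hmemK k.1 hk.1 k.2 hk.2))
    obtain ⟨c, hc, h2⟩ := Metric.eventually_nhds_iff_ball.1 h1
    refine ⟨c, hc, fun h hh μ₂ hμ y r hy hr => h2 (y, r) ?_ (h, μ₂) ⟨hh, hμ⟩⟩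
    simpa [Prod.norm_def] using ⟨hy, hr⟩
  have h0δ : (0 : ℝ) ∈ Icc (-δ) δ := ⟨by linarith, hδ.le⟩
  have hder := fun h (hh : h ∈ Icc 0 h₁) => displacement_derivatives hN hΨ hret hW0 hδ
    (fun μ₂ hμ => ⟨hmemK h hh μ₂ (abs_le.1 hμ), (hdisp h hh μ₂ (abs_le.1 hμ)).1⟩)
    (hdisp h hh 0 h0δ).2
  have hη : 0 < c / 2 := half_pos hc
  obtain ⟨r₁, hr₁, Φ, hΦs, hΦ0, hΦ⟩ := exists_zero_curve hN (contDiffOn_displacement hΨ)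
    (fun h hh => hmemK h hh 0 h0δ)
    (fun h hh => by rw [(hdisp h hh 0 h0δ).1, zero_mul, zero_div]; rfl)
    (fun h hh => (hder h hh).1) (fun h hh => (hder h hh).2.1) (fun h hh => (hder h hh).2.2)
    (lt_min hη hδ)
  set r₀ := min (min (c / 2) r₁) R with hr₀
  have hr₀1 : r₀ ≤ r₁ := (min_le_left _ _).trans (min_le_right _ _)
  have hr₀c : r₀ ≤ c / 2 := (min_le_left _ _).trans (min_le_left _ _)
  have hsub : Icc 0 h₁ ×ˢ Icc 0 r₀ ⊆ Icc 0 h₁ ×ˢ Icc 0 r₁ :=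
    prod_mono_right (Icc_subset_Icc_right hr₀1)
  have hboxN : box h₁ (c / 2) r₀ δ ⊆ N := by
    rintro ⟨h, y, r, μ₂⟩ ⟨hh, hy, hr, hμ⟩
    refine hbox h hh μ₂ hμ y r ((abs_le.2 hy).trans_lt (by linarith)) ?_
    change r ∈ Icc 0 r₀ at hr
    rw [abs_of_nonneg hr.1]
    linarith [hr.2]
  refine ⟨c / 2, r₀, Ψ, Φ, hη, lt_min (lt_min hη hr₁) hR, min_le_right _ _, hΨ.mono hboxN,
    fun π hπ => hret π (hboxN hπ), hΦs.mono hsub, hΦ0, fun h hh r hr => ?_⟩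
  obtain ⟨h1, h2⟩ := hΦ (h, r) (hsub ⟨hh, hr⟩)
  rw [Prod.norm_def, max_lt_iff] at h1
  exact ⟨⟨hh, abs_le.1 (h1.1.le.trans (min_le_left _ _)), hr,
    abs_le.1 (h1.2.le.trans (min_le_right _ _))⟩, h2⟩

/-- The assertions about the Melnikov functions and the periodic orbits, for a fixed `h₁`. -/
theorem IsScaledSystem.exists_melnikov (hS : IsScaledSystem F G H m ε D W) (hG : OrderG G)
    {h₁ K ϱ δ R a : ℝ} (hϱ : 0 < ϱ) (hδ : 0 < δ) (hδε : δ < ε) (hR : 0 < R)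
    (hK : 1 + Real.exp h₁ < K) (hD : D = scaledDom (h₁ + 1) K ε ϱ)
    (hW0 : ∀ (h Y μ₂ : ℝ) (v : ℝ × ℝ), (h, (v, Y, 0, μ₂)) ∈ D →
      W (h, (v, Y, 0, μ₂)) = (-v.2, v.1 + 2 * Y * v.2 + h * v.2 ^ 2))
    (hQ0 : ∀ (h μ₂ : ℝ) (v : ℝ × ℝ), (h, (v, 0, 0, μ₂)) ∈ D →
      scaledRate G m (h, (v, 0, 0, μ₂)) = μ₂ / 2 + a * (h * v.2)) :
    ∃ (η r₀ : ℝ) (T : ℝ × ℝ × ℝ × ℝ → ℝ) (D : ℝ × ℝ × ℝ × ℝ → ℝ × ℝ),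
      0 < η ∧ 0 < r₀ ∧ r₀ ≤ R ∧ IsRescaledMelnikov F G H ε m h₁ η r₀ δ T D ∧
      ∃ ybar mubar : ℝ × ℝ → ℝ,
        ContDiffOn ℝ ∞ ybar (Icc 0 h₁ ×ˢ Icc 0 r₀) ∧
        ContDiffOn ℝ ∞ mubar (Icc 0 h₁ ×ˢ Icc 0 r₀) ∧
        (∀ h ∈ Icc 0 h₁, ybar (h, 0) = 0 ∧ mubar (h, 0) = 0) ∧
        ∀ h ∈ Icc 0 h₁, ∀ r ∈ Icc 0 r₀,
          (h, ybar (h, r), r, mubar (h, r)) ∈ box h₁ η r₀ δ ∧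
          D (h, ybar (h, r), r, mubar (h, r)) = 0 ∧
          (0 < h →
            ∃ γ : ℝ → ℝ × ℝ × ℝ,
              IsPeriodicOrbit F G H r (r * mubar (h, r))
                (T (h, ybar (h, r), r, mubar (h, r))) γ ∧
              γ 0 = ((m (ybar (h, r)) r (mubar (h, r))).1 - h, ybar (h, r),
                (m (ybar (h, r)) r (mubar (h, r))).2) ∧
              ∀ t, (γ t).2.1 ∈ Ioo (-ε) ε) ∧
          (h = 0 →
            chartField F G H r (r * mubar (h, r))
              (m (ybar (h, r)) r (mubar (h, r))).1 (ybar (h, r))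
              (m (ybar (h, r)) r (mubar (h, r))).2 = 0) := by
  obtain ⟨η, r₀, Ψ, Φ, hη, hr₀, hr₀R, hΨ, hret, hΦs, hΦ0, hΦ⟩ :=
    hS.exists_fixed_curve hϱ hδ hδε hR hK hD hW0 hQ0
  refine ⟨η, r₀, fun π => (Ψ π).2, displacement Ψ, hη, hr₀, hr₀R,
    ⟨hΨ.snd, contDiffOn_displacement hΨ, fun h y r μ₂ hπ hh => ⟨_, _,
      hS.isMelnikovValue hh (hret _ hπ), ?_⟩⟩,
    fun x => (Φ x).1, fun x => (Φ x).2, hΦs.fst, hΦs.snd, fun h hh => ?_, fun h hh r hr => ?_⟩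
  · rw [inv_mul_cancel_left₀ hh.ne', displacement]
  · simp [hΦ0 h hh]
  · obtain ⟨h1, h2⟩ := hΦ h hh r hr
    have hq := congrArg Prod.snd h2
    have hv := congrArg Prod.fst h2
    simp only [displacement, Prod.fst_zero, Prod.snd_zero] at hq hv
    refine ⟨h1, h2, fun hpos => ?_, fun hzero => ?_⟩
    · exact hS.exists_periodicOrbit hG hpos (hret _ h1) (by linarith) hq
    · subst hzero
      exact hS.chartField_eq_zero hG (hret _ h1) hq

end Family

end

end FoldedSaddleNode

end

theorem mainTheorem3 (F G H : ℝ → ℝ → ℝ → ℝ → ℝ → ℝ)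
    (hF : FoldedSaddleNode.AnalyticInSpace F) (hG : FoldedSaddleNode.AnalyticInSpace G)
    (hH : FoldedSaddleNode.AnalyticInSpace H)
    (hF' : FoldedSaddleNode.OrderF F) (hG' : FoldedSaddleNode.OrderG G)
    (hH' : FoldedSaddleNode.OrderH H)
    (hlam : FoldedSaddleNode.a₁ G + FoldedSaddleNode.a₂ G ≠ 0) :
    ∃ (ν δ R : ℝ) (m : ℝ → ℝ → ℝ → ℝ × ℝ), 0 < ν ∧ 0 < δ ∧ 0 < R ∧
      FoldedSaddleNode.IsSlowManifold F G H ν δ R m ∧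
      ∀ h₁ : ℝ, 0 < h₁ →
        ∃ (η r₀ : ℝ) (T : ℝ × ℝ × ℝ × ℝ → ℝ) (D : ℝ × ℝ × ℝ × ℝ → ℝ × ℝ),
          0 < η ∧ 0 < r₀ ∧ r₀ ≤ R ∧
          FoldedSaddleNode.IsRescaledMelnikov F G H ν m h₁ η r₀ δ T D ∧
          ∃ ybar mubar : ℝ × ℝ → ℝ,
            ContDiffOn ℝ ∞ ybar (Set.Icc 0 h₁ ×ˢ Set.Icc 0 r₀) ∧
            ContDiffOn ℝ ∞ mubar (Set.Icc 0 h₁ ×ˢ Set.Icc 0 r₀) ∧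
            (∀ h ∈ Set.Icc 0 h₁, ybar (h, 0) = 0 ∧ mubar (h, 0) = 0) ∧
            ∀ h ∈ Set.Icc 0 h₁, ∀ r ∈ Set.Icc 0 r₀,
              (h, ybar (h, r), r, mubar (h, r)) ∈ FoldedSaddleNode.box h₁ η r₀ δ ∧
              D (h, ybar (h, r), r, mubar (h, r)) = 0 ∧
              (0 < h →
                ∃ γ : ℝ → ℝ × ℝ × ℝ,
                  FoldedSaddleNode.IsPeriodicOrbit F G H r (r * mubar (h, r))
                    (T (h, ybar (h, r), r, mubar (h, r))) γ ∧
                  γ 0 = ((m (ybar (h, r)) r (mubar (h, r))).1 - h, ybar (h, r),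
                    (m (ybar (h, r)) r (mubar (h, r))).2) ∧
                  ∀ t, (γ t).2.1 ∈ Set.Ioo (-ν) ν) ∧
              (h = 0 →
                FoldedSaddleNode.chartField F G H r (r * mubar (h, r))
                  (m (ybar (h, r)) r (mubar (h, r))).1 (ybar (h, r))
                  (m (ybar (h, r)) r (mubar (h, r))).2 = 0) := by
  obtain ⟨ε, m, hε, hε1, hsm, hms, hm⟩ :=
    FoldedSaddleNode.exists_slowManifold hF hG hH hF' hG' hH' hlam
  have hle : ε / 2 ≤ ε := by linarith
  have hδ : Set.Icc (-(ε / 4)) (ε / 4) ⊆ Set.Icc (-(ε / 2)) (ε / 2) :=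
    Set.Icc_subset_Icc (by linarith) (by linarith)
  -- The bound on `μ₂` is halved once more, so that the box of parameters lies inside an open set on
  -- which the slow manifolds and the scaled system are defined.
  refine ⟨ε / 2, ε / 4, ε / 2, m, by positivity, by positivity, by positivity,
    ⟨?_, fun r hr μ₂ hμ => hsm.invariant r hr μ₂ (hδ hμ), fun μ₂ hμ => hsm.critical μ₂ (hδ hμ)⟩,
    fun h₁ hh₁ => ?_⟩
  · obtain ⟨c, hc, hsum⟩ := hsm.analytic
    exact ⟨c, hc.mono (Set.prod_mono_right hδ), fun r hr μ₂ hμ => hsum r hr μ₂ (hδ hμ)⟩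
  have hexp := Real.exp_pos h₁
  have hms' := hms.mono (Metric.ball_subset_ball hle)
  have hm' := fun (y r μ₂ : ℝ) (hy : |y| < ε / 2) (hr : |r| < ε / 2) (hμ : |μ₂| < ε / 2) =>
    hm y r μ₂ (hy.trans_le hle) (hr.trans_le hle) (hμ.trans_le hle)
  obtain ⟨ϱ, W, hϱ, hϱε, hW, hQ, heq⟩ := FoldedSaddleNode.exists_scaledField hF hG hH hF' hG' hH'
    (half_pos hε) (hle.trans hε1) hms' hm' (by linarith : 0 < h₁ + 1)
    (by linarith : 0 < 2 + Real.exp h₁)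
  have hS : FoldedSaddleNode.IsScaledSystem F G H m (ε / 2)
      (FoldedSaddleNode.scaledDom (h₁ + 1) (2 + Real.exp h₁) (ε / 2) ϱ) W := by
    refine ⟨hms', fun y r μ₂ hy hr hμ => (hm' y r μ₂ hy hr hμ).2.2,
      FoldedSaddleNode.isOpen_scaledDom _ _ _ _, fun h Y r μ₂ v hmem => ?_,
      fun h Y r μ₂ v hmem => ?_, hW, hQ, fun h Y r μ₂ v hmem => (heq h Y r μ₂ v hmem).1⟩
    · obtain ⟨-, -, h3, h4, h5⟩ := FoldedSaddleNode.mem_scaledDom.1 hmem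
      exact ⟨h3, h4.trans_le hϱε, h5⟩
    · obtain ⟨-, -, h3, h4, h5⟩ := FoldedSaddleNode.mem_scaledDom.1 hmem
      exact FoldedSaddleNode.mem_scaledDom.2
        ⟨by rw [abs_zero]; linarith, by rw [norm_zero]; linarith, h3, h4, h5⟩
  refine hS.exists_melnikov hG' hϱ (by positivity) (by linarith) (by positivity)
    (K := 2 + Real.exp h₁) (by linarith) rfl (fun h Y μ₂ v hmem => (heq h Y 0 μ₂ v hmem).2 rfl)
    (a := FoldedSaddleNode.a₂ G) fun h μ₂ v hmem => ?_
  have h0 : |(0 : ℝ)| < ε / 2 := by rw [abs_zero]; positivity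
  have hm0 := (hm' 0 0 μ₂ h0 h0 (FoldedSaddleNode.mem_scaledDom.1 hmem).2.2.2.2).2.1
  simp only [FoldedSaddleNode.scaledRate, FoldedSaddleNode.straightRate,
    FoldedSaddleNode.slowRate_zero, hm0]
  simp
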